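/- Let $n\ge 1$, $\mu\ge 2$ and $w(x)=(1+|x|^2)^{\mu}$ on $\mathbb R^n$. For an open set $\Omega\subset\mathbb R^n$ with smooth boundary, lying locally on one side of its boundary (bounded or unbounded), let $N$ be the exterior unit normal to $\partial\Omega$, let $\theta=\Pi\nabla N$ be the second fundamental form of $\partial\Omega$, and let $l_0\in[0,\infty]$ be the largest number such that $(\bar x,t)\mapsto \bar x+tN(\bar x)$ is injective on $\partial\Omega\times(-l_0,l_0)$. For a $(0,s)$-tensor $\alpha$ put $|\alpha|^2=\sum_{i_1,\dots,i_s}\alpha_{i_1\cdots i_s}^2$, and on $\partial\Omega$ let $(\Pi\alpha)_{i_1\cdots i_s}=\gamma_{i_1}^{j_1}\cdots\gamma_{i_s}^{j_s}\alpha_{j_1\cdots j_s}$ with $\gamma_i^j=\delta_i^j-N_iN^j$. Let $\|\alpha\|_{L^2_w(\Omega)}=(\int_\Omega|\alpha|^2w\,dx)^{1/2}$ and $\|\alpha\|_{L^2_w(\partial\Omega)}=(\int_{\partial\Omega}|\alpha|^2w\,dS)^{1/2}$, with values in $[0,\infty]$. Let $r\ge 2$ be an integer and $K\ge 0$. (i)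 There is a constant $C=C(K)$, depending only on $K$, $r$, $n$ and $\mu$, such that for every such $\Omega$ with $|\theta|+\frac1{l_0}\le K$ on $\partial\Omega$ and every function $q:\overline\Omega\to\mathbb R$ of class $C^{r+1}$ up to the boundary (in particular for every smooth $q$), $$\|\nabla^r q\|_{L^2_w(\partial\Omega)}+\|\nabla^r q\|_{L^2_w(\Omega)}\le C\Big(\sum_{s=0}^{r}\|\Pi\nabla^s q\|_{L^2_w(\partial\Omega)}+\sum_{s=0}^{r-1}\|\nabla^s\Delta q\|_{L^2_w(\Omega)}+\|\nabla q\|_{L^2_w(\Omega)}\Big).$$ (ii) For every $\delta>0$ there is a constant $C=C(\delta^{-1},K)$, depending only on $\delta$, $K$, $r$, $n$ and $\mu$, such that for all $\Omega$ and $q$ as in (i), $$\|\nabla^{r-1} q\|_{L^2_w(\partial\Omega)}+\|\nabla^r q\|_{L^2_w(\Omega)}\le \delta\sum_{s=0}^{r}\|\Pi\nabla^s q\|_{L^2_w(\partial\Omega)}+C\Big(\sum_{s=0}^{r-2}\|\nabla^s\Delta q\|_{L^2_w(\Omega)}+\|\nabla q\|_{L^2_w(\Omega)}\Big).$$ -/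

import Mathlib

open Set Filter Topology MeasureTheory
open scoped NNReal ENNReal ContDiff

noncomputable section

namespace WeightedElliptic

/-- Euclidean space `ℝⁿ`. -/
abbrev Eu (n : ℕ) : Type := EuclideanSpace ℝ (Fin n)

/-! ### Domains with smooth boundary -/

/-- `ρ` is a smooth function with `∇ρ(p) ≠ 0` such that, near `p`, the set `Ω` is `{ρ < 0}`. -/
def IsLocalDefiningFunction {n : ℕ} (Ω : Set (Eu n)) (p : Eu n) (ρ : Eu n → ℝ) : Prop :=
  ContDiff ℝ ∞ ρ ∧ gradient ρ p ≠ 0 ∧ ∀ᶠ x in 𝓝 p, (x ∈ Ω ↔ ρ x < 0)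

/-- `Ω` is an open set with smooth boundary, lying locally on one side of its boundary.
Neither boundedness nor connectedness is required. -/
def HasSmoothBoundary {n : ℕ} (Ω : Set (Eu n)) : Prop :=
  IsOpen Ω ∧ ∀ p ∈ frontier Ω, ∃ ρ, IsLocalDefiningFunction Ω p ρ

open Classical in
/-- A local defining function of `Ω` near the boundary point `p`. What is built from it below
(the normal at `p` and the second fundamental form at `p`) does not depend on the choice. -/
def localDefiningFunction {n : ℕ} (Ω : Set (Eu n)) (p : Eu n) : Eu n → ℝ :=
  if h : ∃ ρ, IsLocalDefiningFunction Ω p ρ then h.choose else 0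

/-- A smooth vector field near the boundary point `p` which on the boundary is the exterior unit
normal: the normalised gradient of a local defining function. -/
def normalField {n : ℕ} (Ω : Set (Eu n)) (p : Eu n) (x : Eu n) : Eu n :=
  ‖gradient (localDefiningFunction Ω p) x‖⁻¹ • gradient (localDefiningFunction Ω p) x

/-- The exterior unit normal `N(p)` at the boundary point `p`. -/
def outerNormal {n : ℕ} (Ω : Set (Eu n)) (p : Eu n) : Eu n :=
  normalField Ω p p

/-- The orthogonal projection `γ = id - N ⊗ N` onto the tangent space of the boundary at `p`. -/
def tangentProj {n : ℕ} (Ω : Set (Eu n)) (p : Eu n) : Eu n →L[ℝ] Eu n :=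
  ContinuousLinearMap.id ℝ (Eu n) -
    (innerSL ℝ (outerNormal Ω p)).smulRight (outerNormal Ω p)

/-- The second fundamental form `θ = Π ∇N` of the boundary at `p`. Only derivatives of the normal
in tangential directions enter, so it does not depend on how the normal is extended. -/
def secondFundamentalForm {n : ℕ} (Ω : Set (Eu n)) (p : Eu n) (X Y : Eu n) : ℝ :=
  inner ℝ (fderiv ℝ (normalField Ω p) p (tangentProj Ω p X)) (tangentProj Ω p Y)

/-- The pointwise norm `|θ|`, where `|θ|² = ∑ θ_{ij}²`. -/
def secondFundamentalFormNorm {n : ℕ} (Ω : Set (Eu n)) (p : Eu n) : ℝ :=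
  √(∑ i : Fin n, ∑ j : Fin n, secondFundamentalForm Ω p
    (EuclideanSpace.basisFun (Fin n) ℝ i) (EuclideanSpace.basisFun (Fin n) ℝ j) ^ 2)

/-- The injectivity radius `l₀ ∈ [0, ∞]` of the normal exponential map: the largest `l` such that
`(x̄, t) ↦ x̄ + t N(x̄)` is injective on `∂Ω × (-l, l)`. -/
def injectivityRadius {n : ℕ} (Ω : Set (Eu n)) : ℝ≥0∞ :=
  sSup {l : ℝ≥0∞ | InjOn (fun z : Eu n × ℝ => z.1 + z.2 • outerNormal Ω z.1)
    {z : Eu n × ℝ | z.1 ∈ frontier Ω ∧ ENNReal.ofReal |z.2| < l}}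

/-- The condition `|θ| + 1 / l₀ ≤ K` on `∂Ω` (with `1 / ∞ = 0` and `1 / 0 = ∞`). -/
def GeometryBound {n : ℕ} (Ω : Set (Eu n)) (K : ℝ≥0) : Prop :=
  ∀ p ∈ frontier Ω,
    ENNReal.ofReal (secondFundamentalFormNorm Ω p) + (injectivityRadius Ω)⁻¹ ≤ (K : ℝ≥0∞)

/-! ### Tensors and weighted norms -/

/-- `(0, s)`-tensors at a point of `ℝⁿ`. -/
abbrev Tensor (n s : ℕ) : Type := ContinuousMultilinearMap ℝ (fun _ : Fin s => Eu n) ℝ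

/-- The squared pointwise norm `|α|² = ∑_I α_I²` of a `(0, s)`-tensor. -/
def tensorNormSq {n s : ℕ} (α : Tensor n s) : ℝ :=
  ∑ I : Fin s → Fin n, (α fun j => EuclideanSpace.basisFun (Fin n) ℝ (I j)) ^ 2

/-- The projection `Π α` of a tensor to the boundary at `p`: every slot is projected. -/
def tensorProj {n s : ℕ} (Ω : Set (Eu n)) (p : Eu n) (α : Tensor n s) : Tensor n s :=
  α.compContinuousLinearMap fun _ => tangentProj Ω p

/-- `∇ˢ q`, up to the boundary of `Ω`. -/
def covDeriv {n : ℕ} (Ω : Set (Eu n)) (s : ℕ) (q : Eu n → ℝ) (x : Eu n) : Tensor n s :=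
  iteratedFDerivWithin ℝ s q (closure Ω) x

/-- `Δ q`, up to the boundary of `Ω`. -/
def lap {n : ℕ} (Ω : Set (Eu n)) (q : Eu n → ℝ) : Eu n → ℝ :=
  InnerProductSpace.laplacianWithin q (closure Ω)

/-- The weight `w(x) = (1 + |x|²)^μ`. -/
def weight {n : ℕ} (μ : ℝ) (x : Eu n) : ℝ := (1 + ‖x‖ ^ 2) ^ μ

/-- The norm of `L²_w(Ω)` of a tensor field, with values in `[0, ∞]`. -/
def normInterior {n s : ℕ} (μ : ℝ) (Ω : Set (Eu n)) (α : Eu n → Tensor n s) : ℝ≥0∞ :=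
  (∫⁻ x in Ω, ENNReal.ofReal (tensorNormSq (α x) * weight μ x)) ^ (1 / 2 : ℝ)

/-- The norm of `L²_w(∂Ω)` of a tensor field, with values in `[0, ∞]`; the surface measure is the
`(n - 1)`-dimensional Hausdorff measure, normalised to be Lebesgue measure on hyperplanes. -/
def normBoundary {n s : ℕ} (μ : ℝ) (Ω : Set (Eu n)) (α : Eu n → Tensor n s) : ℝ≥0∞ :=
  (∫⁻ x in frontier Ω, ENNReal.ofReal (tensorNormSq (α x) * weight μ x)
    ∂(Measure.euclideanHausdorffMeasure (n - 1))) ^ (1 / 2 : ℝ)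

/-- `‖Π ∇ˢ q‖` in `L²_w(∂Ω)`. -/
def normProj {n : ℕ} (μ : ℝ) (Ω : Set (Eu n)) (s : ℕ) (q : Eu n → ℝ) : ℝ≥0∞ :=
  normBoundary μ Ω fun x => tensorProj Ω x (covDeriv Ω s q x)

end WeightedElliptic

end

noncomputable section

namespace WeightedElliptic

/-! ### Local defining functions -/

section DefiningFunctions

variable {n : ℕ} {Ω : Set (Eu n)} {p : Eu n} {ρ ρ₁ ρ₂ : Eu n → ℝ}

/-! The estimates come from integrating by parts with vector fields that are almost gradients. Let X
be a smooth extension of the exterior normal, P = id - X ⊗ X, and a_i = ∇^{k+1}q(e_i, Pe_{C 1}, …,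
Pe_{C k}) (`projField`). The derivatives of a are components of ∇^{k+2}q up to terms in which P is
differentiated, and these are bounded by |∇^{k+1}q| (`TubeBound.abs_projError_le`). So the curl of a
is of lower order and its divergence is ∇^k Δq, on projected slots, up to lower order.

For (ii) take r = k + 2. `TubeBound.divCurl_estimate` bounds ∫|∂a|² by the divergence, the curl and
a boundary term. Subtracting tangential derivatives, which integrate to zero over ∂Ω, reduces the
top-order part of the boundary term to -2 (X·a) times the tangential divergence of a, and the latter
is a trace of Π∇^r q up to lower order. Young's inequality leaves a small multiple of |Π∇^r q|² and
a large multiple of |∇^{r-1}q|² on ∂Ω; the trace inequality `TubeBound.trace_covDeriv` exchanges the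
second for a small multiple of |∇^r q|² and a large one of |∇^{r-1}q|² inside Ω. Conversely |∂a|²
controls |∇^r q|²: a symmetric tensor is determined by its trace and its components with all slots
but one projected, since a pair of normal slots can be exchanged for the trace and terms with fewer
free slots (`IsSymmTensor.tensorNormSq_le`), and the trace of ∇^r q is ∇^{r-2}Δq
(`HasSmoothBoundary.covDeriv_lap`). Now the small term is absorbed (`exists_interior_step`), and
induction on the order replaces ∇^{r-1}q by ∇q (`exists_interior_norm_bound`).

For (i) take r = k + 1. The divergence of X|a|² - 2(X·a)a has normal component |a|² - 2(X·a)², so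
that on ∂Ω the whole of a is bounded by its tangential part, which is Π∇^r q, and by interior terms
(`TubeBound.rellich_estimate`). This uses ∇^{r-1}Δq in Ω, as does the recovery of ∇^r q on ∂Ω, which
needs the trace of ∇^{r-2}Δq; hence the additional derivative of Δq in (i).

The constants depend on the domain only through the sizes of X and ∂X. In the tube of radius ℓ =
1/(2 max(K,1)) normal segments do not meet and |tθ| ≤ 1/2, so foot point and height are smooth
functions and the normal, cut off in the tube, has derivative at most C/ℓ + 2K
(`TubeBound.norm_fderiv_normalExt_le`). The weight is harmless because |∂w| ≤ μw. Since Ω may be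
unbounded and the norms infinite, all absorptions are made with weights φ ≤ ψ ≤ η of bounded
support, where ψ² ≤ φη; then the supports exhaust the space.

The divergence theorem for Hausdorff surface measure (`TubeBound.integral_fderivWithin`) is obtained
by testing with cutoffs that vanish near ∂Ω. Their gradient is -kX, with k a kernel living in a thin
collar, and charts with Lipschitz constants arbitrarily close to 1 show that collar integrals
converge to the surface integral (`TubeBound.tendsto_collar`). -/

lemma contDiff_gradient (hρ : ContDiff ℝ ∞ ρ) : ContDiff ℝ ∞ (gradient ρ) := by
  have h : ContDiff ℝ ∞ (fderiv ℝ ρ) := hρ.fderiv_right (by simp)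
  exact (InnerProductSpace.toDual ℝ (Eu n)).symm.contDiff.comp h

lemma IsLocalDefiningFunction.eventually (h : IsLocalDefiningFunction Ω p ρ) :
    ∀ᶠ y in 𝓝 p, IsLocalDefiningFunction Ω y ρ := by
  have h1 : ∀ᶠ y in 𝓝 p, gradient ρ y ≠ 0 :=
    (contDiff_gradient h.1).continuous.continuousAt.eventually_ne h.2.1
  filter_upwards [h1, h.2.2.eventually_nhds] with y hy1 hy2
  exact ⟨h.1, hy1, hy2⟩

lemma IsLocalDefiningFunction.hasDerivAt_line (h : IsLocalDefiningFunction Ω p ρ) (v : Eu n) :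
    HasDerivAt (fun s : ℝ => ρ (p + s • v)) (inner ℝ (gradient ρ p) v) 0 := by
  have h1 : HasFDerivAt ρ (fderiv ℝ ρ p) (p + (0 : ℝ) • v) := by
    simpa using (h.1.differentiable (by simp) p).hasFDerivAt
  have h2 : HasDerivAt (fun s : ℝ => p + s • v) v 0 := by
    simpa using ((hasDerivAt_id (0 : ℝ)).smul_const v).const_add p
  rw [inner_gradient_left]
  exact h1.comp_hasDerivAt (0 : ℝ) h2

lemma tendsto_line (p v : Eu n) : Tendsto (fun s : ℝ => p + s • v) (𝓝[>] 0) (𝓝 p) := by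
  have : ContinuousAt (fun s : ℝ => p + s • v) 0 := by fun_prop
  simpa using this.tendsto.mono_left nhdsWithin_le_nhds

lemma eventually_neg_of_hasDerivAt {f : ℝ → ℝ} {c : ℝ} (hf : HasDerivAt f c 0) (h0 : f 0 = 0)
    (hc : c < 0) : ∀ᶠ s in 𝓝[>] (0 : ℝ), f s < 0 := by
  have h1 := (hasDerivAt_iff_tendsto_slope.1 hf).mono_left
    (nhdsWithin_mono (0 : ℝ) (fun x (hx : 0 < x) => hx.ne'))
  filter_upwards [h1.eventually_lt_const hc, self_mem_nhdsWithin] with s hs hs0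
  rw [slope_def_field, h0, sub_zero, sub_zero, div_neg_iff] at hs
  have : (0 : ℝ) < s := hs0
  rcases hs with hs | hs
  · linarith [hs.2]
  · exact hs.1

lemma IsLocalDefiningFunction.eventually_mem (h : IsLocalDefiningFunction Ω p ρ) (h0 : ρ p = 0)
    {v : Eu n} (hv : inner ℝ (gradient ρ p) v < 0) : ∀ᶠ s in 𝓝[>] (0 : ℝ), p + s • v ∈ Ω := by
  filter_upwards [eventually_neg_of_hasDerivAt (h.hasDerivAt_line v) (by simpa using h0) hv,
    (tendsto_line p v).eventually h.2.2] with s hs1 hs2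
  exact hs2.2 hs1

lemma IsLocalDefiningFunction.eventually_notMem (h : IsLocalDefiningFunction Ω p ρ) (h0 : ρ p = 0)
    {v : Eu n} (hv : 0 < inner ℝ (gradient ρ p) v) : ∀ᶠ s in 𝓝[>] (0 : ℝ), p + s • v ∉ Ω := by
  filter_upwards [eventually_neg_of_hasDerivAt (h.hasDerivAt_line v).neg (by simpa using h0)
    (by linarith), (tendsto_line p v).eventually h.2.2] with s hs1 hs2
  rw [hs2]
  simp only [Pi.neg_apply] at hs1
  linarith

lemma IsLocalDefiningFunction.eq_zero (h : IsLocalDefiningFunction Ω p ρ) (hΩ : IsOpen Ω)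
    (hp : p ∈ frontier Ω) : ρ p = 0 := by
  rw [hΩ.frontier_eq] at hp
  have h1 : ¬ ρ p < 0 := fun hh => hp.2 (h.2.2.self_of_nhds.2 hh)
  by_contra h2
  have h3 : 0 < ρ p := lt_of_le_of_ne (not_lt.1 h1) (Ne.symm h2)
  have h4 : ∀ᶠ x in 𝓝 p, x ∉ Ω := by
    filter_upwards [h.1.continuous.continuousAt.eventually_const_lt h3, h.2.2] with x hx1 hx2
    rw [hx2]
    linarith
  exact (mem_closure_iff_frequently.1 hp.1) h4

lemma IsLocalDefiningFunction.mem_frontier (h : IsLocalDefiningFunction Ω p ρ) (h0 : ρ p = 0) :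
    p ∈ frontier Ω := by
  have h1 : p ∉ Ω := fun hh => by
    have := h.2.2.self_of_nhds.1 hh
    linarith
  refine ⟨?_, fun hh => h1 (interior_subset hh)⟩
  have h2 : inner ℝ (gradient ρ p) (-gradient ρ p) < 0 := by
    rw [inner_neg_right, real_inner_self_eq_norm_sq]
    have := norm_pos_iff.2 h.2.1
    nlinarith
  exact mem_closure_of_tendsto (tendsto_line p _) (h.eventually_mem h0 h2)

lemma IsLocalDefiningFunction.eventually_mem_frontier_iff (h : IsLocalDefiningFunction Ω p ρ)
    (hΩ : IsOpen Ω) : ∀ᶠ y in 𝓝 p, (y ∈ frontier Ω ↔ ρ y = 0) := by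
  filter_upwards [h.eventually] with y hy
  exact ⟨hy.eq_zero hΩ, hy.mem_frontier⟩

/-- If one open half-space lies in another closed one, their normals are positively parallel:
otherwise some vector makes an obtuse angle with `a` and an acute one with `b`. What remains is the
equality case of Cauchy–Schwarz. -/
lemma normalize_eq_of_inner_nonpos {a b : Eu n} (ha : a ≠ 0) (hb : b ≠ 0)
    (h : ∀ v, inner ℝ a v < 0 → inner ℝ b v ≤ 0) : ‖a‖⁻¹ • a = ‖b‖⁻¹ • b := by
  have ha' : 0 < ‖a‖ := norm_pos_iff.2 ha
  have hb' : 0 < ‖b‖ := norm_pos_iff.2 hb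
  have key : ‖a‖ * ‖b‖ ≤ inner ℝ a b := by
    refine le_of_forall_pos_lt_add fun ε hε => ?_
    by_contra hcon
    push Not at hcon
    -- Shortening the coefficient ‖b‖ of `a` by ε/(2‖a‖) uses only half of the assumed gap ε in
    -- Cauchy–Schwarz, so the product with `a` stays negative while the product with `b` is
    -- positive.
    have h1 : inner ℝ a (‖a‖ • b - (‖b‖ - ε / (2 * ‖a‖)) • a) < 0 := by
      rw [inner_sub_right, inner_smul_right, inner_smul_right, real_inner_self_eq_norm_sq]
      have : ε / (2 * ‖a‖) * ‖a‖ ^ 2 = ε / 2 * ‖a‖ := by field_simp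
      nlinarith
    have h2 := h _ h1
    rw [inner_sub_right, inner_smul_right, inner_smul_right, real_inner_self_eq_norm_sq,
      real_inner_comm] at h2
    have h3 : |inner ℝ a b| ≤ ‖a‖ * ‖b‖ := abs_real_inner_le_norm a b
    have h4 : -(‖a‖ * ‖b‖) ≤ inner ℝ a b := (abs_le.1 h3).1
    have h5 : 0 < ε / (2 * ‖a‖) := by positivity
    have h6 : ε / (2 * ‖a‖) * ‖a‖ = ε / 2 := by field_simp
    have h7 : 0 ≤ (‖b‖ - ε / (2 * ‖a‖)) := by
      rw [sub_nonneg, div_le_iff₀ (by positivity)]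
      nlinarith
    have h8 : (‖b‖ - ε / (2 * ‖a‖)) * inner ℝ a b ≤ (‖b‖ - ε / (2 * ‖a‖)) * (‖a‖ * ‖b‖ - ε) :=
      mul_le_mul_of_nonneg_left (by linarith) h7
    have h9 : 0 < ε / (2 * ‖a‖) * ε := by positivity
    have h10 : ε / (2 * ‖a‖) * (‖a‖ * ‖b‖) = ε / 2 * ‖b‖ := by field_simp
    have h11 : (ε / (2 * ‖a‖)) ≤ ‖b‖ := by linarith
    nlinarith
  have h1 : inner ℝ a b = ‖a‖ * ‖b‖ := le_antisymm (real_inner_le_norm a b) key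
  have h2 := inner_eq_norm_mul_iff_real.1 h1
  have h3 : b = (‖a‖⁻¹ * ‖b‖) • a := by
    rw [mul_smul, h2, smul_smul, inv_mul_cancel₀ ha'.ne', one_smul]
  nth_rw 2 [h3]
  rw [smul_smul]
  congr 1
  field_simp

/-- This makes the normal independent of the defining function: a direction that decreases `ρ₁`
enters `Ω`, hence cannot increase `ρ₂` to first order. -/
lemma IsLocalDefiningFunction.normalize_gradient_eq (h₁ : IsLocalDefiningFunction Ω p ρ₁)
    (h₂ : IsLocalDefiningFunction Ω p ρ₂) (hΩ : IsOpen Ω) (hp : p ∈ frontier Ω) :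
    ‖gradient ρ₁ p‖⁻¹ • gradient ρ₁ p = ‖gradient ρ₂ p‖⁻¹ • gradient ρ₂ p := by
  refine normalize_eq_of_inner_nonpos h₁.2.1 h₂.2.1 fun v hv => ?_
  by_contra hcon
  push Not at hcon
  obtain ⟨s, hs1, hs2⟩ := ((h₁.eventually_mem (h₁.eq_zero hΩ hp) hv).and
    (h₂.eventually_notMem (h₂.eq_zero hΩ hp) hcon)).exists
  exact hs2 hs1

lemma HasSmoothBoundary.isLocalDefiningFunction (hΩ : HasSmoothBoundary Ω) (hp : p ∈ frontier Ω) :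
    IsLocalDefiningFunction Ω p (localDefiningFunction Ω p) := by
  rw [localDefiningFunction, dif_pos (hΩ.2 p hp)]
  exact (hΩ.2 p hp).choose_spec

/-- The normal is defined by a separate choice at each boundary point. A defining function at `p`
also serves at nearby points, so near `p` all these choices agree with a single smooth field. -/
lemma HasSmoothBoundary.eventually_outerNormal_eq (hΩ : HasSmoothBoundary Ω)
    (hp : p ∈ frontier Ω) :
    ∀ᶠ y in 𝓝 p, y ∈ frontier Ω → outerNormal Ω y = normalField Ω p y := by
  filter_upwards [(hΩ.isLocalDefiningFunction hp).eventually] with y hy hyf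
  exact (hΩ.isLocalDefiningFunction hyf).normalize_gradient_eq hy hΩ.1 hyf

lemma HasSmoothBoundary.eventually_norm_normalField (hΩ : HasSmoothBoundary Ω)
    (hp : p ∈ frontier Ω) : ∀ᶠ y in 𝓝 p, ‖normalField Ω p y‖ = 1 := by
  filter_upwards [(hΩ.isLocalDefiningFunction hp).eventually] with y hy
  rw [normalField, norm_smul, norm_inv, norm_norm,
    inv_mul_cancel₀ (norm_ne_zero_iff.2 hy.2.1)]

lemma HasSmoothBoundary.norm_outerNormal (hΩ : HasSmoothBoundary Ω)
    (hp : p ∈ frontier Ω) : ‖outerNormal Ω p‖ = 1 :=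
  (hΩ.eventually_norm_normalField hp).self_of_nhds

lemma HasSmoothBoundary.contDiffAt_normalField (hΩ : HasSmoothBoundary Ω)
    (hp : p ∈ frontier Ω) : ContDiffAt ℝ ∞ (normalField Ω p) p := by
  have h := hΩ.isLocalDefiningFunction hp
  have hg := (contDiff_gradient h.1).contDiffAt (x := p)
  exact ((hg.norm ℝ h.2.1).inv (norm_ne_zero_iff.2 h.2.1)).smul hg

lemma HasSmoothBoundary.gradient_eq (hΩ : HasSmoothBoundary Ω) (hp : p ∈ frontier Ω) :
    gradient (localDefiningFunction Ω p) p
      = ‖gradient (localDefiningFunction Ω p) p‖ • outerNormal Ω p := by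
  have h := norm_ne_zero_iff.2 (hΩ.isLocalDefiningFunction hp).2.1
  rw [outerNormal, normalField, smul_smul, mul_inv_cancel₀ h, one_smul]

lemma HasSmoothBoundary.continuousOn_outerNormal (hΩ : HasSmoothBoundary Ω) :
    ContinuousOn (outerNormal Ω) (frontier Ω) := by
  intro p hp
  have h1 := (hΩ.contDiffAt_normalField hp).continuousAt.continuousWithinAt (s := frontier Ω)
  refine h1.congr_of_eventuallyEq ?_ rfl
  filter_upwards [nhdsWithin_le_nhds (hΩ.eventually_outerNormal_eq hp), self_mem_nhdsWithin]
    with y h2 h3 using h2 h3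

/-- At a boundary point the tangent cone of the closure contains the open half-space on which the
gradient of the defining function is negative, and a half-space spans. This makes derivatives up to
the boundary well defined and lets them obey the usual calculus. -/
lemma HasSmoothBoundary.uniqueDiffOn_closure (hΩ : HasSmoothBoundary Ω) :
    UniqueDiffOn ℝ (closure Ω) := by
  intro p hp
  by_cases hpΩ : p ∈ Ω
  · exact (hΩ.1.uniqueDiffWithinAt hpΩ).mono subset_closure
  have hpf : p ∈ frontier Ω := by rw [hΩ.1.frontier_eq]; exact ⟨hp, hpΩ⟩
  have h := hΩ.isLocalDefiningFunction hpf
  set g := gradient (localDefiningFunction Ω p) p with hg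
  have hgp : 0 < ‖g‖ := norm_pos_iff.2 h.2.1
  have hcone : ∀ v, inner ℝ g v < 0 → v ∈ tangentConeAt ℝ (closure Ω) p := by
    intro v hv
    refine mem_tangentConeAt_of_add_smul_mem (l := 𝓝[>] (0 : ℝ)) (c := fun s => s)
      (tendsto_id.mono_right (nhdsWithin_mono _ fun x (hx : 0 < x) => hx.ne')) ?_
    filter_upwards [h.eventually_mem (h.eq_zero hΩ.1 hpf) hv] with s hs
    exact subset_closure hs
  refine ⟨?_, subset_closure hp⟩
  have : Submodule.span ℝ (tangentConeAt ℝ (closure Ω) p) = ⊤ := by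
    rw [eq_top_iff]
    intro v _
    have h1 : -g ∈ tangentConeAt ℝ (closure Ω) p := hcone _ (by
      rw [inner_neg_right, real_inner_self_eq_norm_sq]; nlinarith)
    -- `c` is large enough to push `v - c • g` into the half-space; `v` is then a combination of two
    -- vectors of the cone.
    set c := (|inner ℝ g v| + 1) / ‖g‖ ^ 2 with hc
    have h2 : v - c • g ∈ tangentConeAt ℝ (closure Ω) p := hcone _ (by
      rw [inner_sub_right, inner_smul_right, real_inner_self_eq_norm_sq, hc,
        div_mul_cancel₀ _ (by positivity)]
      linarith [le_abs_self (inner ℝ g v)])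
    have h3 : v = (v - c • g) - c • (-g) := by simp
    rw [h3]
    exact Submodule.sub_mem _ (Submodule.subset_span h2)
      (Submodule.smul_mem _ _ (Submodule.subset_span h1))
  rw [this]
  simp

end DefiningFunctions

/-! ### The normal tube around the boundary -/

/-- The standing assumptions for the normal tube of radius `ℓ`. -/
structure TubeBound {n : ℕ} (Ω : Set (Eu n)) (K ℓ : ℝ) : Prop where
  smooth : HasSmoothBoundary Ω
  pos : 0 < ℓ
  injOn : InjOn (fun z : Eu n × ℝ => z.1 + z.2 • outerNormal Ω z.1)
    {z : Eu n × ℝ | z.1 ∈ frontier Ω ∧ |z.2| < ℓ}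
  curvature : ∀ p ∈ frontier Ω, secondFundamentalFormNorm Ω p ≤ K
  nonneg : 0 ≤ K
  mul_le : K * ℓ ≤ 1 / 2

/-- The set of all points `y + t N(y)` with `y ∈ ∂Ω` and `|t| < ℓ`. -/
def tube {n : ℕ} (Ω : Set (Eu n)) (ℓ : ℝ) : Set (Eu n) :=
  {x | ∃ z : Eu n × ℝ, (z.1 ∈ frontier Ω ∧ |z.2| < ℓ) ∧ z.1 + z.2 • outerNormal Ω z.1 = x}

open Classical in
/-- The coordinates `(y, t)` of a point `y + t N(y)` of the tube. -/
def tubeCoord {n : ℕ} (Ω : Set (Eu n)) (ℓ : ℝ) (x : Eu n) : Eu n × ℝ :=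
  if h : x ∈ tube Ω ℓ then h.choose else 0

/-! ### The second fundamental form as the tangential derivative of the normal -/

section Curvature

variable {n : ℕ} {Ω : Set (Eu n)} {p : Eu n}

lemma tangentProj_apply (Ω : Set (Eu n)) (p v : Eu n) :
    tangentProj Ω p v = v - inner ℝ (outerNormal Ω p) v • outerNormal Ω p := by
  simp [tangentProj]

/-- Differentiate |N|² = 1, which holds in a full neighbourhood of `p`. -/
lemma HasSmoothBoundary.inner_fderiv_normalField (hΩ : HasSmoothBoundary Ω)
    (hp : p ∈ frontier Ω) (v : Eu n) :
    inner ℝ (outerNormal Ω p) (fderiv ℝ (normalField Ω p) p v) = 0 := by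
  have hd : HasFDerivAt (normalField Ω p) (fderiv ℝ (normalField Ω p) p) p :=
    ((hΩ.contDiffAt_normalField hp).differentiableAt (by simp)).hasFDerivAt
  have h1 := (hd.inner ℝ hd)
  have h2 : HasFDerivAt (fun y => inner ℝ (normalField Ω p y) (normalField Ω p y))
      (0 : Eu n →L[ℝ] ℝ) p := by
    refine (hasFDerivAt_const (1 : ℝ) p).congr_of_eventuallyEq ?_
    filter_upwards [hΩ.eventually_norm_normalField hp] with y hy
    rw [real_inner_self_eq_norm_sq, hy, one_pow]
  have h3 := congrArg (fun L => L v) (h1.unique h2)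
  simp only [ContinuousLinearMap.comp_apply, ContinuousLinearMap.prod_apply,
    fderivInnerCLM_apply, zero_apply] at h3
  rw [real_inner_comm] at h3
  have : outerNormal Ω p = normalField Ω p p := rfl
  rw [this, real_inner_comm]
  linarith

/-- For tangential `ξ` neither projection in θ loses anything: `ξ` is fixed by one, and DN ξ is
orthogonal to N, so the components of DN ξ are θ(ξ, e_j). The rest is Cauchy–Schwarz for the
Hilbert–Schmidt norm. -/
lemma HasSmoothBoundary.norm_fderiv_normalField_le (hΩ : HasSmoothBoundary Ω)
    (hp : p ∈ frontier Ω) {ξ : Eu n} (hξ : inner ℝ (outerNormal Ω p) ξ = 0) :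
    ‖fderiv ℝ (normalField Ω p) p ξ‖ ≤ secondFundamentalFormNorm Ω p * ‖ξ‖ := by
  set b := EuclideanSpace.basisFun (Fin n) ℝ with hb
  set D := fderiv ℝ (normalField Ω p) p with hD
  have hDN : ∀ v, inner ℝ (D v) (outerNormal Ω p) = 0 := fun v => by
    rw [real_inner_comm]; exact hΩ.inner_fderiv_normalField hp v
  have hP : tangentProj Ω p ξ = ξ := by rw [tangentProj_apply, hξ, zero_smul, sub_zero]
  have hcomp : ∀ j, inner ℝ (D ξ) (b j)
      = ∑ i, ξ i * secondFundamentalForm Ω p (b i) (b j) := by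
    intro j
    have h1 : inner ℝ (D ξ) (b j) = secondFundamentalForm Ω p ξ (b j) := by
      rw [secondFundamentalForm, hP, tangentProj_apply, inner_sub_right, inner_smul_right, hDN,
        mul_zero, sub_zero]
    rw [h1]
    have h2 : ξ = ∑ i, ξ i • b i := by
      have := (b.sum_repr ξ).symm
      simpa [hb] using this
    conv_lhs => rw [h2]
    simp only [secondFundamentalForm, map_sum, map_smul, sum_inner, inner_smul_left]
    simp
  have hsq : ‖D ξ‖ ^ 2 ≤ (secondFundamentalFormNorm Ω p * ‖ξ‖) ^ 2 := by
    rw [mul_pow, secondFundamentalFormNorm, Real.sq_sqrt (by positivity),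
      EuclideanSpace.real_norm_sq_eq ξ, ← b.sum_sq_norm_inner_left (D ξ)]
    calc ∑ j, ‖inner ℝ (D ξ) (b j)‖ ^ 2
        = ∑ j, (∑ i, ξ i * secondFundamentalForm Ω p (b i) (b j)) ^ 2 := by
          refine Finset.sum_congr rfl fun j _ => ?_
          rw [Real.norm_eq_abs, sq_abs, hcomp]
      _ ≤ ∑ j, (∑ i, ξ i ^ 2) * ∑ i, secondFundamentalForm Ω p (b i) (b j) ^ 2 :=
          Finset.sum_le_sum fun j _ => Finset.sum_mul_sq_le_sq_mul_sq _ _ _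
      _ = _ := by rw [← Finset.mul_sum, Finset.sum_comm, mul_comm]
  exact (le_abs_self _).trans
    (abs_le_of_sq_le_sq hsq (mul_nonneg (Real.sqrt_nonneg _) (norm_nonneg _)))

end Curvature

/-! ### Smoothness of the tube coordinates, and the side of the boundary on which a point lies -/

namespace TubeBound

variable {n : ℕ} {Ω : Set (Eu n)} {K ℓ : ℝ}

lemma tubeCoord_spec {x : Eu n} (hx : x ∈ tube Ω ℓ) :
    ((tubeCoord Ω ℓ x).1 ∈ frontier Ω ∧ |(tubeCoord Ω ℓ x).2| < ℓ) ∧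
      (tubeCoord Ω ℓ x).1 + (tubeCoord Ω ℓ x).2 • outerNormal Ω (tubeCoord Ω ℓ x).1 = x := by
  rw [tubeCoord, dif_pos hx]
  exact hx.choose_spec

lemma mem_tube {y : Eu n} {t : ℝ} (hy : y ∈ frontier Ω) (ht : |t| < ℓ) :
    y + t • outerNormal Ω y ∈ tube Ω ℓ := ⟨(y, t), ⟨hy, ht⟩, rfl⟩

lemma tubeCoord_eq (h : TubeBound Ω K ℓ) {y : Eu n} {t : ℝ} (hy : y ∈ frontier Ω)
    (ht : |t| < ℓ) : tubeCoord Ω ℓ (y + t • outerNormal Ω y) = (y, t) := by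
  have h1 := tubeCoord_spec (mem_tube hy ht)
  exact h.injOn h1.1 (show (y, t).1 ∈ frontier Ω ∧ |(y, t).2| < ℓ from ⟨hy, ht⟩) h1.2

/-- Kℓ ≤ 1/2 keeps the tube away from the focal set: id + t DN is invertible on tangent vectors,
with inverse of norm at most 2. -/
lemma abs_mul_lt (h : TubeBound Ω K ℓ) {y : Eu n} {t : ℝ} (hy : y ∈ frontier Ω) (ht : |t| < ℓ)
    {ξ : Eu n} (hξ : inner ℝ (outerNormal Ω y) ξ = 0) :
    ‖t • fderiv ℝ (normalField Ω y) y ξ‖ ≤ 1 / 2 * ‖ξ‖ := by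
  have h1 := h.smooth.norm_fderiv_normalField_le hy hξ
  have h2 := h.curvature y hy
  rw [norm_smul, Real.norm_eq_abs]
  calc |t| * ‖fderiv ℝ (normalField Ω y) y ξ‖ ≤ ℓ * (K * ‖ξ‖) := by
        refine mul_le_mul ht.le (h1.trans ?_) (norm_nonneg _) h.pos.le
        exact mul_le_mul_of_nonneg_right h2 (norm_nonneg _)
    _ = (K * ℓ) * ‖ξ‖ := by ring
    _ ≤ _ := mul_le_mul_of_nonneg_right h.mul_le (norm_nonneg _)

/-- The linearised tube coordinates: the normal component is split off. -/
lemma split (h : TubeBound Ω K ℓ) {y : Eu n} {t s : ℝ} (hy : y ∈ frontier Ω) (ht : |t| < ℓ)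
    {ξ v : Eu n} (hξ : inner ℝ (outerNormal Ω y) ξ = 0)
    (hv : ξ + (t • fderiv ℝ (normalField Ω y) y ξ + s • outerNormal Ω y) = v) :
    s = inner ℝ (outerNormal Ω y) v ∧ ‖ξ‖ ≤ 2 * ‖v‖ := by
  have hN := h.smooth.norm_outerNormal hy
  have hs : s = inner ℝ (outerNormal Ω y) v := by
    rw [← hv, inner_add_right, inner_add_right, hξ, inner_smul_right, inner_smul_right,
      h.smooth.inner_fderiv_normalField hy, real_inner_self_eq_norm_sq, hN]
    ring
  refine ⟨hs, ?_⟩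
  set η := ξ + t • fderiv ℝ (normalField Ω y) y ξ with hη
  have h1 : inner ℝ (outerNormal Ω y) η = 0 := by
    rw [hη, inner_add_right, hξ, inner_smul_right, h.smooth.inner_fderiv_normalField hy]
    ring
  have h2 : ‖v‖ ^ 2 = ‖η‖ ^ 2 + s ^ 2 := by
    rw [← hv, ← add_assoc, ← hη, norm_add_sq_real, inner_smul_right, real_inner_comm, h1,
      norm_smul, hN]
    simp
  have h3 : ‖η‖ ≤ ‖v‖ := by
    refine abs_le_of_sq_le_sq' ?_ (norm_nonneg _) |>.2
    nlinarith [sq_nonneg s]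
  have h4 : ‖ξ‖ ≤ ‖η‖ + 1 / 2 * ‖ξ‖ := by
    have h5 : ξ = η - t • fderiv ℝ (normalField Ω y) y ξ := by rw [hη]; abel
    calc ‖ξ‖ = ‖η - t • fderiv ℝ (normalField Ω y) y ξ‖ := by rw [← h5]
      _ ≤ ‖η‖ + ‖t • fderiv ℝ (normalField Ω y) y ξ‖ := norm_sub_le _ _
      _ ≤ _ := by gcongr; exact h.abs_mul_lt hy ht hξ
  linarith

lemma inner_outerNormal_eq_zero_iff (h : TubeBound Ω K ℓ) {y : Eu n} (hy : y ∈ frontier Ω)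
    (ξ : Eu n) : fderiv ℝ (localDefiningFunction Ω y) y ξ = 0 ↔
      inner ℝ (outerNormal Ω y) ξ = 0 := by
  have h1 := norm_ne_zero_iff.2 (h.smooth.isLocalDefiningFunction hy).2.1
  rw [← inner_gradient_left, h.smooth.gradient_eq hy, inner_smul_left]
  simp [h1]

/-- Near a point of the tube, the tube coordinates are smooth. -/
lemma exists_contDiffAt (h : TubeBound Ω K ℓ) {x : Eu n} (hx : x ∈ tube Ω ℓ) :
    ContDiffAt ℝ ∞ (tubeCoord Ω ℓ) x ∧ ∀ᶠ x' in 𝓝 x, x' ∈ tube Ω ℓ := by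
  obtain ⟨⟨y, t⟩, ⟨hy, ht⟩, rfl⟩ := hx
  simp only at hy ht ⊢
  set N := normalField Ω y with hN
  set ρ := localDefiningFunction Ω y with hρ
  have hNN : N y = outerNormal Ω y := rfl
  have hdef := h.smooth.isLocalDefiningFunction hy
  have hρ0 : ρ y = 0 := hdef.eq_zero h.smooth.1 hy
  -- Adjoining the equation ρ = 0 gives a map between spaces of equal dimension, so the inverse
  -- function theorem applies without parametrising the boundary. The tube coordinates are the local
  -- inverse restricted to second component 0.
  let F : Eu n × ℝ → Eu n × ℝ := fun z => (z.1 + z.2 • N z.1, ρ z.1)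
  have hNsm : ContDiffAt ℝ ∞ N y := h.smooth.contDiffAt_normalField hy
  have hFsm : ContDiffAt ℝ ∞ F (y, t) := by
    have h1 : ContDiffAt ℝ ∞ (fun z : Eu n × ℝ => N z.1) (y, t) :=
      ContDiffAt.comp (g := N) (f := Prod.fst) (y, t) hNsm contDiffAt_fst
    exact (contDiffAt_fst.add (contDiffAt_snd.smul h1)).prodMk
      ((hdef.1.contDiffAt (x := y)).comp (y, t) contDiffAt_fst)
  have hNd : HasFDerivAt N (fderiv ℝ N y) (y, t).1 :=
    (hNsm.differentiableAt (by simp)).hasFDerivAt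
  have hρd : HasFDerivAt ρ (fderiv ℝ ρ y) (y, t).1 :=
    (hdef.1.differentiable (by simp) y).hasFDerivAt
  obtain ⟨A, hA, hAv⟩ : ∃ A : Eu n × ℝ →L[ℝ] Eu n × ℝ, HasFDerivAt F A (y, t) ∧
      ∀ z, A z = (z.1 + (t • fderiv ℝ N y z.1 + z.2 • N y), fderiv ℝ ρ y z.1) := by
    have h1 := (hasFDerivAt_fst (𝕜 := ℝ) (p := ((y, t) : Eu n × ℝ))).add
      ((hasFDerivAt_snd (𝕜 := ℝ) (p := ((y, t) : Eu n × ℝ))).smul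
        (hNd.comp (y, t) hasFDerivAt_fst))
    have h2 := h1.prodMk (hρd.comp (y, t) hasFDerivAt_fst)
    exact ⟨_, h2, fun z => by simp⟩
  have hAinj : Function.Injective A := by
    rw [injective_iff_map_eq_zero]
    intro z hz
    rw [hAv, Prod.mk_eq_zero, h.inner_outerNormal_eq_zero_iff hy] at hz
    have h1 := h.split hy ht hz.2 (s := z.2) (v := 0) hz.1
    have h2 : z.1 = 0 := by simpa using h1.2
    have h3 : z.2 = 0 := by simpa using h1.1
    exact Prod.ext h2 h3
  let A' : (Eu n × ℝ) ≃L[ℝ] (Eu n × ℝ) :=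
    (LinearEquiv.ofInjectiveEndo (A : Eu n × ℝ →ₗ[ℝ] Eu n × ℝ) hAinj).toContinuousLinearEquiv
  have hA' : HasFDerivAt F (A' : Eu n × ℝ →L[ℝ] Eu n × ℝ) (y, t) := by
    have : (A' : Eu n × ℝ →L[ℝ] Eu n × ℝ) = A := by ext z <;> rfl
    rw [this]; exact hA
  have hn : (∞ : WithTop ℕ∞) ≠ 0 := by simp
  let G := hFsm.localInverse hA' hn
  have hGsm : ContDiffAt ℝ ∞ G (F (y, t)) := hFsm.to_localInverse hA' hn
  have hGF : G (F (y, t)) = (y, t) := hFsm.localInverse_apply_image hA' hn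
  have hFy : F (y, t) = (y + t • outerNormal Ω y, 0) := by
    simp only [F, hρ0, hNN]
  have hFG : ∀ᶠ w in 𝓝 (F (y, t)), F (G w) = w :=
    (hFsm.hasStrictFDerivAt' hA' hn).eventually_right_inverse
  let g : Eu n → Eu n × ℝ := fun x' => G (x', 0)
  have hgsm : ContDiffAt ℝ ∞ g (y + t • outerNormal Ω y) := by
    rw [hFy] at hGsm
    exact hGsm.comp (y + t • outerNormal Ω y) (contDiffAt_id.prodMk contDiffAt_const)
  have hg0 : g (y + t • outerNormal Ω y) = (y, t) := by
    simp only [g]; rw [← hFy, hGF]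
  have hgt : Tendsto g (𝓝 (y + t • outerNormal Ω y)) (𝓝 (y, t)) := by
    have := hgsm.continuousAt.tendsto
    rwa [hg0] at this
  have hFg : ∀ᶠ x' in 𝓝 (y + t • outerNormal Ω y), F (g x') = (x', 0) := by
    have hc : Tendsto (fun x' : Eu n => (x', (0 : ℝ))) (𝓝 (y + t • outerNormal Ω y))
        (𝓝 (F (y, t))) := by
      rw [hFy]
      exact Continuous.tendsto' (by fun_prop) _ _ rfl
    exact hc.eventually hFG
  have h1 : Tendsto (fun x' => (g x').1) (𝓝 (y + t • outerNormal Ω y)) (𝓝 y) :=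
    (continuous_fst.tendsto (y, t)).comp hgt
  have h2 : Tendsto (fun x' => |(g x').2|) (𝓝 (y + t • outerNormal Ω y)) (𝓝 |t|) :=
    ((continuous_snd.tendsto (y, t)).comp hgt).abs
  -- The local inverse lands on the boundary with height below ℓ, and injectivity in the tube forces
  -- it to coincide with the globally chosen coordinates.
  have key : ∀ᶠ x' in 𝓝 (y + t • outerNormal Ω y), x' ∈ tube Ω ℓ ∧ tubeCoord Ω ℓ x' = g x' := by
    filter_upwards [hFg, h1.eventually (hdef.eventually_mem_frontier_iff h.smooth.1),
      h1.eventually (h.smooth.eventually_outerNormal_eq hy), h2.eventually_lt_const ht]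
      with x' hx1 hx2 hx3 hx4
    have hx5 : x' = (g x').1 + (g x').2 • N (g x').1 := (congrArg Prod.fst hx1).symm
    have hx6 : ρ (g x').1 = 0 := congrArg Prod.snd hx1
    have hx7 := hx2.2 hx6
    rw [show N (g x').1 = outerNormal Ω (g x').1 from (hx3 hx7).symm] at hx5
    refine ⟨hx5 ▸ mem_tube hx7 hx4, ?_⟩
    conv_lhs => rw [hx5]
    exact h.tubeCoord_eq hx7 hx4
  exact ⟨hgsm.congr_of_eventuallyEq (key.mono fun _ hx => hx.2), key.mono fun _ hx => hx.1⟩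

/-- The normal vector at the foot point. -/
def _root_.WeightedElliptic.tubeNormal (Ω : Set (Eu n)) (ℓ : ℝ) (x : Eu n) : Eu n :=
  outerNormal Ω (tubeCoord Ω ℓ x).1

lemma isOpen_tube (h : TubeBound Ω K ℓ) : IsOpen (tube Ω ℓ) :=
  isOpen_iff_mem_nhds.2 fun _ hx => (h.exists_contDiffAt hx).2

lemma frontier_subset_tube (h : TubeBound Ω K ℓ) : frontier Ω ⊆ tube Ω ℓ := fun y hy => by
  have := mem_tube (ℓ := ℓ) (t := 0) hy (by simpa using h.pos)
  simpa using this

lemma tubeCoord_frontier (h : TubeBound Ω K ℓ) {y : Eu n} (hy : y ∈ frontier Ω) :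
    tubeCoord Ω ℓ y = (y, 0) := by
  have := h.tubeCoord_eq (t := 0) hy (by simpa using h.pos)
  simpa using this

lemma norm_tubeNormal (h : TubeBound Ω K ℓ) {x : Eu n} (hx : x ∈ tube Ω ℓ) :
    ‖tubeNormal Ω ℓ x‖ = 1 := h.smooth.norm_outerNormal (tubeCoord_spec hx).1.1

lemma contDiffAt_height (h : TubeBound Ω K ℓ) {x : Eu n} (hx : x ∈ tube Ω ℓ) :
    ContDiffAt ℝ ∞ (fun x => (tubeCoord Ω ℓ x).2) x := (h.exists_contDiffAt hx).1.snd

lemma eventually_tubeNormal_eq (h : TubeBound Ω K ℓ) {x : Eu n} (hx : x ∈ tube Ω ℓ) :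
    ∀ᶠ x' in 𝓝 x, tubeNormal Ω ℓ x'
      = normalField Ω (tubeCoord Ω ℓ x).1 (tubeCoord Ω ℓ x').1 := by
  have h1 : Tendsto (fun x' => (tubeCoord Ω ℓ x').1) (𝓝 x) (𝓝 (tubeCoord Ω ℓ x).1) :=
    (h.exists_contDiffAt hx).1.fst.continuousAt
  filter_upwards [h1.eventually (h.smooth.eventually_outerNormal_eq (tubeCoord_spec hx).1.1),
    (h.exists_contDiffAt hx).2] with x' h2 h3
  exact h2 (tubeCoord_spec h3).1.1

lemma contDiffAt_tubeNormal (h : TubeBound Ω K ℓ) {x : Eu n} (hx : x ∈ tube Ω ℓ) :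
    ContDiffAt ℝ ∞ (tubeNormal Ω ℓ) x := by
  have h1 := (h.smooth.contDiffAt_normalField (tubeCoord_spec hx).1.1).comp x
    (h.exists_contDiffAt hx).1.fst
  exact h1.congr_of_eventuallyEq (h.eventually_tubeNormal_eq hx)

/-- The gradient of the height is the normal, and the normal has bounded derivative. -/
lemma fderiv_tube (h : TubeBound Ω K ℓ) {x : Eu n} (hx : x ∈ tube Ω ℓ) (v : Eu n) :
    fderiv ℝ (fun x => (tubeCoord Ω ℓ x).2) x v = inner ℝ (tubeNormal Ω ℓ x) v ∧
      ‖fderiv ℝ (tubeNormal Ω ℓ) x v‖ ≤ 2 * K * ‖v‖ := by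
  obtain ⟨⟨hy, ht⟩, hxe⟩ := tubeCoord_spec hx
  set y := (tubeCoord Ω ℓ x).1 with hydef
  set t := (tubeCoord Ω ℓ x).2 with htdef
  have hsm := (h.exists_contDiffAt hx).1
  have hf : HasFDerivAt (fun x => (tubeCoord Ω ℓ x).1)
      (fderiv ℝ (fun x => (tubeCoord Ω ℓ x).1) x) x :=
    (hsm.fst.differentiableAt (by simp)).hasFDerivAt
  have hg : HasFDerivAt (fun x => (tubeCoord Ω ℓ x).2)
      (fderiv ℝ (fun x => (tubeCoord Ω ℓ x).2) x) x :=
    (hsm.snd.differentiableAt (by simp)).hasFDerivAt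
  have hdef := h.smooth.isLocalDefiningFunction hy
  have hN : HasFDerivAt (normalField Ω y) (fderiv ℝ (normalField Ω y) y) y :=
    ((h.smooth.contDiffAt_normalField hy).differentiableAt (by simp)).hasFDerivAt
  have hρ : HasFDerivAt (localDefiningFunction Ω y) (fderiv ℝ (localDefiningFunction Ω y) y) y :=
    (hdef.1.differentiable (by simp) y).hasFDerivAt
  have hNc := hN.comp x hf
  have hρc := hρ.comp x hf
  -- Two identities are differentiated: x = y(x) + t(x) N(y(x)) and ρ(y(x)) = 0. The second says
  -- that dy is tangential; `split` then reads off dt and bounds dy from the first.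
  have hev1 : (fun x' : Eu n => x') =ᶠ[𝓝 x] fun x' => (tubeCoord Ω ℓ x').1
      + (tubeCoord Ω ℓ x').2 • normalField Ω y (tubeCoord Ω ℓ x').1 := by
    filter_upwards [h.eventually_tubeNormal_eq hx, (h.exists_contDiffAt hx).2] with x' h2 h3
    have h4 := (tubeCoord_spec h3).2
    rw [tubeNormal] at h2
    rw [h2] at h4
    exact h4.symm
  have hev2 : (fun _ : Eu n => (0 : ℝ)) =ᶠ[𝓝 x]
      fun x' => localDefiningFunction Ω y (tubeCoord Ω ℓ x').1 := by
    have h3 : Tendsto (fun x' => (tubeCoord Ω ℓ x').1) (𝓝 x) (𝓝 y) := hsm.fst.continuousAt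
    filter_upwards [h3.eventually (hdef.eventually_mem_frontier_iff h.smooth.1),
      (h.exists_contDiffAt hx).2] with x' h4 h5
    exact (h4.1 (tubeCoord_spec h5).1.1).symm
  have h1 := (hf.add (hg.smul hNc)).congr_of_eventuallyEq hev1
  have h2 := hρc.congr_of_eventuallyEq hev2
  have e1 := congrArg (fun L => L v) (h1.unique (hasFDerivAt_id x))
  have e2 := congrArg (fun L => L v) (h2.unique (hasFDerivAt_const (0 : ℝ) x))
  simp only [add_apply, smul_apply,
    ContinuousLinearMap.comp_apply, ContinuousLinearMap.smulRight_apply,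
    ContinuousLinearMap.id_apply, zero_apply, Function.comp_apply] at e1 e2
  rw [h.inner_outerNormal_eq_zero_iff hy] at e2
  have hs := h.split hy ht e2 (s := fderiv ℝ (fun x => (tubeCoord Ω ℓ x).2) x v) (v := v) e1
  refine ⟨hs.1, ?_⟩
  have h3 := hNc.congr_of_eventuallyEq (h.eventually_tubeNormal_eq hx)
  rw [h3.fderiv, ContinuousLinearMap.comp_apply]
  calc _ ≤ secondFundamentalFormNorm Ω y * _ := h.smooth.norm_fderiv_normalField_le hy e2
    _ ≤ K * (2 * ‖v‖) := mul_le_mul (h.curvature y hy) hs.2 (norm_nonneg _) h.nonneg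
    _ = _ := by ring

/-- Compactness: the foot points of a convergent sequence are bounded because the heights are, a
subsequence converges, and the normal is continuous along it. Closedness is what makes cut-off
functions of the height smooth across the edge of the tube. -/
lemma isClosed_closedTube (h : TubeBound Ω K ℓ) {s : ℝ} (hs : s < ℓ) :
    IsClosed {x | x ∈ tube Ω ℓ ∧ |(tubeCoord Ω ℓ x).2| ≤ s} := by
  refine isClosed_of_closure_subset fun x hx => ?_
  obtain ⟨u, hu, hux⟩ := mem_closure_iff_seq_limit.1 hx
  have hcl : IsClosed (frontier Ω ×ˢ Icc (-s) s) := isClosed_frontier.prod isClosed_Icc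
  obtain ⟨R, hR⟩ := (Metric.isBounded_range_of_tendsto u hux).exists_norm_le
  have hmem : ∀ k, tubeCoord Ω ℓ (u k) ∈ frontier Ω ×ˢ Icc (-s) s :=
    fun k => ⟨(tubeCoord_spec (hu k).1).1.1, abs_le.1 (hu k).2⟩
  have hbd : Bornology.IsBounded ((frontier Ω ×ˢ Icc (-s) s) ∩ Metric.closedBall 0 (R + s)) :=
    Metric.isBounded_closedBall.subset inter_subset_right
  have hmem2 : ∀ k, tubeCoord Ω ℓ (u k) ∈
      (frontier Ω ×ˢ Icc (-s) s) ∩ Metric.closedBall 0 (R + s) := by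
    intro k
    refine ⟨hmem k, ?_⟩
    have h1 := tubeCoord_spec (hu k).1
    have h2 : ‖u k‖ ≤ R := hR _ (mem_range_self k)
    have h0 : 0 ≤ R := (norm_nonneg _).trans h2
    rw [mem_closedBall_zero_iff, Prod.norm_def, max_le_iff]
    have h3 : ‖(tubeCoord Ω ℓ (u k)).2 • outerNormal Ω (tubeCoord Ω ℓ (u k)).1‖ ≤ s := by
      rw [norm_smul, h.smooth.norm_outerNormal h1.1.1, mul_one]; exact (hu k).2
    constructor
    · rw [eq_sub_of_add_eq h1.2]
      exact (norm_sub_le _ _).trans (add_le_add h2 h3)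
    · exact (hu k).2.trans (by linarith)
  obtain ⟨a, ha, φ, hφ, hlim⟩ := tendsto_subseq_of_bounded hbd hmem2
  have ha' : a ∈ frontier Ω ×ˢ Icc (-s) s :=
    (hcl.inter Metric.isClosed_closedBall).closure_eq ▸ ha |>.1
  have hN : Tendsto (fun k => outerNormal Ω (tubeCoord Ω ℓ (u (φ k))).1) atTop
      (𝓝 (outerNormal Ω a.1)) := by
    refine ((h.smooth.continuousOn_outerNormal a.1 ha'.1).tendsto).comp
      (tendsto_nhdsWithin_iff.2 ⟨(continuous_fst.tendsto a).comp hlim, ?_⟩)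
    exact Eventually.of_forall fun k => (hmem (φ k)).1
  have hsum : Tendsto (fun k => u (φ k)) atTop (𝓝 (a.1 + a.2 • outerNormal Ω a.1)) := by
    have := ((continuous_fst.tendsto a).comp hlim).add
      (((continuous_snd.tendsto a).comp hlim).smul hN)
    refine this.congr fun k => ?_
    exact (tubeCoord_spec (hu (φ k)).1).2
  have hxa : x = a.1 + a.2 • outerNormal Ω a.1 :=
    tendsto_nhds_unique (hux.comp hφ.tendsto_atTop) hsum
  have ha2 : |a.2| ≤ s := abs_le.2 ha'.2
  rw [hxa]
  refine ⟨mem_tube ha'.1 (ha2.trans_lt hs), ?_⟩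
  rw [h.tubeCoord_eq ha'.1 (ha2.trans_lt hs)]
  exact ha2

lemma notMem_frontier (h : TubeBound Ω K ℓ) {y : Eu n} {t : ℝ} (hy : y ∈ frontier Ω)
    (ht : |t| < ℓ) (ht0 : t ≠ 0) : y + t • outerNormal Ω y ∉ frontier Ω := by
  intro hcon
  have h1 := h.tubeCoord_frontier hcon
  rw [h.tubeCoord_eq hy ht] at h1
  exact ht0 (congrArg Prod.snd h1)

lemma mem_frontier_iff (h : TubeBound Ω K ℓ) {x : Eu n} (hx : x ∈ tube Ω ℓ) :
    x ∈ frontier Ω ↔ (tubeCoord Ω ℓ x).2 = 0 := by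
  have h1 := tubeCoord_spec hx
  constructor
  · intro hxf
    rw [h.tubeCoord_frontier hxf]
  · intro h0
    rw [h0, zero_smul, add_zero] at h1
    exact h1.2 ▸ h1.1.1

/-- By injectivity a normal segment without its foot point never returns to the boundary. Being
connected, it lies in `Ω` as soon as one of its points does. -/
lemma segment_subset (h : TubeBound Ω K ℓ) {y : Eu n} {t σ : ℝ} (hy : y ∈ frontier Ω)
    (ht : t < ℓ) (hσ : |σ| = 1)
    (hex : ∃ s ∈ Ioc 0 t, y + s • (σ • outerNormal Ω y) ∈ Ω) :
    ∀ s ∈ Ioc 0 t, y + s • (σ • outerNormal Ω y) ∈ Ω := by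
  have hpre : IsPreconnected ((fun s : ℝ => y + s • (σ • outerNormal Ω y)) '' Ioc 0 t) :=
    isPreconnected_Ioc.image _ (by fun_prop)
  have hsub := hpre.subset_left_of_subset_union h.smooth.1 isClosed_closure.isOpen_compl
    (disjoint_compl_right.mono_left subset_closure) ?_ ?_
  · exact fun s hs => hsub (mem_image_of_mem _ hs)
  · rintro _ ⟨s, hs, rfl⟩
    by_contra hcon
    rw [mem_union, not_or, mem_compl_iff, not_not] at hcon
    have h1 : y + s • (σ • outerNormal Ω y) ∈ frontier Ω := by
      rw [h.smooth.1.frontier_eq]; exact ⟨hcon.2, hcon.1⟩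
    rw [smul_smul] at h1
    have hab : |s * σ| = s := by rw [abs_mul, hσ, mul_one, abs_of_pos hs.1]
    refine h.notMem_frontier hy ?_ ?_ h1
    · rw [hab]; exact hs.2.trans_lt ht
    · rw [← abs_pos, hab]; exact hs.1
  · obtain ⟨s, hs, hs2⟩ := hex
    exact ⟨_, mem_image_of_mem _ hs, hs2⟩

/-- Near the foot point the side is decided by the first-order behaviour of the defining function,
and `segment_subset` carries the answer along the normal. -/
lemma mem_iff (h : TubeBound Ω K ℓ) {x : Eu n} (hx : x ∈ tube Ω ℓ) :
    x ∈ Ω ↔ (tubeCoord Ω ℓ x).2 < 0 := by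
  obtain ⟨⟨hy, ht⟩, hxe⟩ := tubeCoord_spec hx
  set y := (tubeCoord Ω ℓ x).1 with hydef
  set t := (tubeCoord Ω ℓ x).2 with htdef
  have hdef := h.smooth.isLocalDefiningFunction hy
  have h0 := hdef.eq_zero h.smooth.1 hy
  have hpos := norm_pos_iff.2 hdef.2.1
  have hN := h.smooth.norm_outerNormal hy
  have hin : ∀ σ : ℝ, inner ℝ (gradient (localDefiningFunction Ω y) y) (σ • outerNormal Ω y)
      = σ * ‖gradient (localDefiningFunction Ω y) y‖ := by
    intro σ
    conv_lhs => rw [h.smooth.gradient_eq hy]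
    rw [inner_smul_left, inner_smul_right, real_inner_self_eq_norm_sq, hN]
    simp [mul_comm]
  constructor
  · intro hxΩ
    by_contra hcon
    push Not at hcon
    have hne : t ≠ 0 := by
      intro h1
      have := (h.mem_frontier_iff hx).2 h1
      rw [h.smooth.1.frontier_eq] at this
      exact this.2 hxΩ
    have htp : 0 < t := lt_of_le_of_ne hcon (Ne.symm hne)
    have hall := h.segment_subset hy (abs_lt.1 ht).2 (σ := 1) (by simp)
      ⟨t, ⟨htp, le_rfl⟩, by rw [one_smul, hxe]; exact hxΩ⟩
    have hev := hdef.eventually_notMem h0 (v := (1 : ℝ) • outerNormal Ω y) (by rw [hin]; linarith)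
    obtain ⟨s, hs1, hs2⟩ := (hev.and (Ioc_mem_nhdsGT htp)).exists
    exact hs1 (hall s hs2)
  · intro htn
    have hev := hdef.eventually_mem h0 (v := (-1 : ℝ) • outerNormal Ω y) (by rw [hin]; linarith)
    obtain ⟨s, hs1, hs2⟩ := (hev.and (Ioc_mem_nhdsGT (neg_pos.2 htn))).exists
    have hall := h.segment_subset hy (t := -t) (by linarith [(abs_lt.1 ht).1]) (σ := -1) (by simp)
      ⟨s, hs2, hs1⟩
    have := hall (-t) ⟨neg_pos.2 htn, le_rfl⟩
    rw [smul_smul, neg_mul_neg, mul_one, hxe] at this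
    exact this

end TubeBound

/-! ### The extended normal field and the collar cutoffs -/

/-- The cutoff used to extend the normal field into the tube. -/
def normalBump : ContDiffBump (0 : ℝ) := ⟨1 / 4, 1 / 2, by norm_num, by norm_num⟩

lemma exists_deriv_normalBump_bound : ∃ B : ℝ, 0 ≤ B ∧ ∀ s, |deriv normalBump s| ≤ B := by
  have h1 : HasCompactSupport (deriv normalBump) := normalBump.hasCompactSupport.deriv
  have h2 : Continuous (deriv normalBump) :=
    (normalBump.contDiff (n := (⊤ : ℕ∞))).continuous_deriv (by simp)
  obtain ⟨B, hB⟩ := h1.exists_bound_of_continuous h2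
  exact ⟨B, (norm_nonneg _).trans (hB 0), hB⟩

/-- A bound for the derivative of `normalBump`. -/
def normalBumpBound : ℝ := exists_deriv_normalBump_bound.choose

lemma normalBumpBound_nonneg : 0 ≤ normalBumpBound := exists_deriv_normalBump_bound.choose_spec.1

lemma abs_deriv_normalBump_le (s : ℝ) : |deriv normalBump s| ≤ normalBumpBound :=
  exists_deriv_normalBump_bound.choose_spec.2 s

open Classical in
/-- A smooth vector field on the whole space which is the exterior normal on the boundary. -/
def normalExt {n : ℕ} (Ω : Set (Eu n)) (ℓ : ℝ) (x : Eu n) : Eu n :=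
  if x ∈ tube Ω ℓ then normalBump ((tubeCoord Ω ℓ x).2 / ℓ) • tubeNormal Ω ℓ x else 0

namespace TubeBound

variable {n : ℕ} {Ω : Set (Eu n)} {K ℓ : ℝ}

lemma eventually_normalExt_eq (h : TubeBound Ω K ℓ) {x : Eu n} (hx : x ∈ tube Ω ℓ) :
    normalExt Ω ℓ =ᶠ[𝓝 x]
      fun x => normalBump ((tubeCoord Ω ℓ x).2 / ℓ) • tubeNormal Ω ℓ x := by
  filter_upwards [(h.exists_contDiffAt hx).2] with x' hx'
  rw [normalExt, if_pos hx']

/-- A point outside the tube has a neighbourhood missing the closed half tube. A function of the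
height that is constant beyond ℓ/2 therefore extends smoothly by that constant. -/
lemma eventually_half_lt (h : TubeBound Ω K ℓ) {x : Eu n} (hx : x ∉ tube Ω ℓ) :
    ∀ᶠ x' in 𝓝 x, x' ∈ tube Ω ℓ → ℓ / 2 < |(tubeCoord Ω ℓ x').2| := by
  have h1 := h.isClosed_closedTube (s := ℓ / 2) (by linarith [h.pos])
  filter_upwards [h1.isOpen_compl.mem_nhds (fun hh => hx hh.1)] with x' hx' hx''
  by_contra hcon
  exact hx' ⟨hx'', not_lt.1 hcon⟩

lemma eventually_normalExt_eq_zero (h : TubeBound Ω K ℓ) {x : Eu n} (hx : x ∉ tube Ω ℓ) :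
    normalExt Ω ℓ =ᶠ[𝓝 x] fun _ => 0 := by
  filter_upwards [h.eventually_half_lt hx] with x' hx'
  rw [normalExt]
  split_ifs with hh
  · rw [normalBump.zero_of_le_dist, zero_smul]
    have := hx' hh
    rw [dist_zero_right, Real.norm_eq_abs, abs_div, abs_of_pos h.pos, le_div_iff₀ h.pos]
    simp only [normalBump]
    linarith
  · rfl

lemma contDiff_normalExt (h : TubeBound Ω K ℓ) : ContDiff ℝ ∞ (normalExt Ω ℓ) := by
  rw [contDiff_iff_contDiffAt]
  intro x
  by_cases hx : x ∈ tube Ω ℓ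
  · refine ContDiffAt.congr_of_eventuallyEq ?_ (h.eventually_normalExt_eq hx)
    have h1 : ContDiffAt ℝ ∞ (fun x => normalBump ((tubeCoord Ω ℓ x).2 / ℓ)) x :=
      (normalBump.contDiff (n := (⊤ : ℕ∞))).contDiffAt.comp x
        ((h.contDiffAt_height hx).div_const ℓ)
    exact h1.smul (h.contDiffAt_tubeNormal hx)
  · exact contDiffAt_const.congr_of_eventuallyEq (h.eventually_normalExt_eq_zero hx)

lemma norm_normalExt_le (h : TubeBound Ω K ℓ) (x : Eu n) : ‖normalExt Ω ℓ x‖ ≤ 1 := by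
  rw [normalExt]
  split_ifs with hx
  · rw [norm_smul, h.norm_tubeNormal hx, mul_one, Real.norm_eq_abs,
      abs_of_nonneg normalBump.nonneg]
    exact normalBump.le_one
  · simp

lemma normalExt_eq_tubeNormal (h : TubeBound Ω K ℓ) {x : Eu n} (hx : x ∈ tube Ω ℓ)
    (ht : |(tubeCoord Ω ℓ x).2| ≤ ℓ / 4) : normalExt Ω ℓ x = tubeNormal Ω ℓ x := by
  rw [normalExt, if_pos hx, normalBump.one_of_mem_closedBall, one_smul]
  rw [mem_closedBall_zero_iff, Real.norm_eq_abs, abs_div, abs_of_pos h.pos, div_le_iff₀ h.pos]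
  simp only [normalBump]
  linarith

lemma normalExt_frontier (h : TubeBound Ω K ℓ) {x : Eu n} (hx : x ∈ frontier Ω) :
    normalExt Ω ℓ x = outerNormal Ω x := by
  rw [h.normalExt_eq_tubeNormal (h.frontier_subset_tube hx), tubeNormal, h.tubeCoord_frontier hx]
  rw [h.tubeCoord_frontier hx]
  simpa using div_nonneg h.pos.le (by norm_num : (0 : ℝ) ≤ 4)

/-- The bump contributes its derivative over ℓ, in the normal direction since dt = N, and the normal
itself contributes 2K. The right side does not involve `Ω`; with |X| ≤ 1, this is how the geometry
enters the later constants. -/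
lemma norm_fderiv_normalExt_le (h : TubeBound Ω K ℓ) (x v : Eu n) :
    ‖fderiv ℝ (normalExt Ω ℓ) x v‖ ≤ (normalBumpBound / ℓ + 2 * K) * ‖v‖ := by
  have hc : 0 ≤ normalBumpBound / ℓ + 2 * K :=
    add_nonneg (div_nonneg normalBumpBound_nonneg h.pos.le) (by linarith [h.nonneg])
  by_cases hx : x ∈ tube Ω ℓ
  · rw [(h.eventually_normalExt_eq hx).fderiv_eq]
    have h1 : HasFDerivAt (fun x => (tubeCoord Ω ℓ x).2 / ℓ) _ x :=
      ((h.contDiffAt_height hx).differentiableAt (by simp)).hasFDerivAt.mul_const ℓ⁻¹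
    have h2 : HasDerivAt normalBump (deriv normalBump ((tubeCoord Ω ℓ x).2 / ℓ))
        ((tubeCoord Ω ℓ x).2 / ℓ) :=
      ((normalBump.contDiff (n := (⊤ : ℕ∞))).differentiable (by simp) _).hasDerivAt
    have h3 := h2.comp_hasFDerivAt x h1
    have h4 := h3.smul ((h.contDiffAt_tubeNormal hx).differentiableAt (by simp)).hasFDerivAt
    have h5 := h.fderiv_tube hx v
    have h6 : fderiv ℝ (fun x => normalBump ((tubeCoord Ω ℓ x).2 / ℓ) • tubeNormal Ω ℓ x) x v
        = normalBump ((tubeCoord Ω ℓ x).2 / ℓ) • fderiv ℝ (tubeNormal Ω ℓ) x v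
          + (deriv normalBump ((tubeCoord Ω ℓ x).2 / ℓ) * (ℓ⁻¹ * inner ℝ (tubeNormal Ω ℓ x) v)) •
            tubeNormal Ω ℓ x := by
      rw [show (fun x => normalBump ((tubeCoord Ω ℓ x).2 / ℓ) • tubeNormal Ω ℓ x)
        = (normalBump ∘ fun x => (tubeCoord Ω ℓ x).2 / ℓ) • tubeNormal Ω ℓ from rfl, h4.fderiv]
      simp [h5.1]
    rw [h6]
    refine (norm_add_le _ _).trans ?_
    rw [norm_smul, norm_smul, h.norm_tubeNormal hx, mul_one, norm_mul, norm_mul, norm_inv,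
      Real.norm_eq_abs, Real.norm_eq_abs, Real.norm_eq_abs, abs_of_nonneg normalBump.nonneg,
      abs_of_pos h.pos]
    have h7 : normalBump ((tubeCoord Ω ℓ x).2 / ℓ) * ‖fderiv ℝ (tubeNormal Ω ℓ) x v‖
        ≤ 1 * (2 * K * ‖v‖) :=
      mul_le_mul normalBump.le_one h5.2 (norm_nonneg _) zero_le_one
    have h8 : ‖inner ℝ (tubeNormal Ω ℓ x) v‖ ≤ ‖v‖ := by
      refine (norm_inner_le_norm _ _).trans ?_
      rw [h.norm_tubeNormal hx, one_mul]
    have h9 : |deriv normalBump ((tubeCoord Ω ℓ x).2 / ℓ)| * (ℓ⁻¹ * ‖inner ℝ (tubeNormal Ω ℓ x) v‖)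
        ≤ normalBumpBound * (ℓ⁻¹ * ‖v‖) := by
      refine mul_le_mul (abs_deriv_normalBump_le _) ?_
        (mul_nonneg (inv_nonneg.2 h.pos.le) (norm_nonneg _)) normalBumpBound_nonneg
      exact mul_le_mul_of_nonneg_left h8 (inv_nonneg.2 h.pos.le)
    rw [div_eq_mul_inv normalBumpBound]
    linarith
  · rw [(h.eventually_normalExt_eq_zero hx).fderiv_eq, fderiv_const_apply]
    simpa using mul_nonneg hc (norm_nonneg v)

end TubeBound

/-! ### Collar cutoffs and integration by parts against them -/

/-- The kernel `k_ε` on the line: a probability density supported in `[-2ε, -ε]`. -/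
def lineKernel (ε t : ℝ) : ℝ := ε⁻¹ * deriv Real.smoothTransition (-t / ε - 1)

lemma continuous_deriv_smoothTransition : Continuous (deriv Real.smoothTransition) :=
  (Real.smoothTransition.contDiff (n := (⊤ : ℕ∞))).continuous_deriv (by simp)

lemma deriv_smoothTransition_of_lt {s : ℝ} (hs : s < 0) : deriv Real.smoothTransition s = 0 := by
  have : Real.smoothTransition =ᶠ[𝓝 s] fun _ => 0 := by
    filter_upwards [gt_mem_nhds hs] with x hx using Real.smoothTransition.zero_of_nonpos hx.le
  rw [this.deriv_eq, deriv_const]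

lemma deriv_smoothTransition_of_gt {s : ℝ} (hs : 1 < s) : deriv Real.smoothTransition s = 0 := by
  have : Real.smoothTransition =ᶠ[𝓝 s] fun _ => 1 := by
    filter_upwards [lt_mem_nhds hs] with x hx using Real.smoothTransition.one_of_one_le hx.le
  rw [this.deriv_eq, deriv_const]

lemma exists_abs_deriv_smoothTransition_le :
    ∃ M : ℝ, 0 ≤ M ∧ ∀ s, |deriv Real.smoothTransition s| ≤ M := by
  have h1 : HasCompactSupport (deriv Real.smoothTransition) :=
    HasCompactSupport.intro (isCompact_Icc (a := (0 : ℝ)) (b := 1)) fun s hs => by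
      rw [Set.mem_Icc, not_and_or, not_le, not_le] at hs
      rcases hs with hs | hs
      · exact deriv_smoothTransition_of_lt hs
      · exact deriv_smoothTransition_of_gt hs
  obtain ⟨M, hM⟩ := h1.exists_bound_of_continuous continuous_deriv_smoothTransition
  exact ⟨M, (norm_nonneg _).trans (hM 0), hM⟩

lemma deriv_smoothTransition_nonneg (s : ℝ) : 0 ≤ deriv Real.smoothTransition s :=
  Real.smoothTransition.monotone.deriv_nonneg

lemma lineKernel_nonneg {ε : ℝ} (hε : 0 < ε) (t : ℝ) : 0 ≤ lineKernel ε t :=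
  mul_nonneg (inv_nonneg.2 hε.le) (deriv_smoothTransition_nonneg _)

lemma continuous_lineKernel (ε : ℝ) : Continuous (lineKernel ε) :=
  continuous_const.mul (continuous_deriv_smoothTransition.comp (by fun_prop))

lemma lineKernel_eq_zero {ε t : ℝ} (hε : 0 < ε) (ht : t ∉ Icc (-(2 * ε)) (-ε)) :
    lineKernel ε t = 0 := by
  rw [lineKernel]
  rw [mem_Icc, not_and_or, not_le, not_le] at ht
  rcases ht with ht | ht
  · rw [deriv_smoothTransition_of_gt, mul_zero]
    rw [lt_sub_iff_add_lt, lt_div_iff₀ hε]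
    linarith
  · rw [deriv_smoothTransition_of_lt, mul_zero]
    rw [sub_lt_zero, div_lt_one hε]
    linarith

lemma hasDerivAt_line {ε : ℝ} (t : ℝ) :
    HasDerivAt (fun t => Real.smoothTransition (-t / ε - 1)) (-lineKernel ε t) t := by
  have h1 : HasDerivAt (fun t : ℝ => -t / ε - 1) (-1 / ε) t :=
    ((hasDerivAt_id t).neg.div_const ε).sub_const 1
  have h2 : HasDerivAt Real.smoothTransition (deriv Real.smoothTransition (-t / ε - 1))
      (-t / ε - 1) :=
    ((Real.smoothTransition.contDiff (n := (⊤ : ℕ∞))).differentiable (by simp) _).hasDerivAt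
  convert! h2.comp t h1 using 1
  rw [lineKernel]
  ring

lemma integral_lineKernel {ε : ℝ} (hε : 0 < ε) : ∫ t, lineKernel ε t = 1 := by
  have h1 : ∫ t in (-(2 * ε))..(-ε), -lineKernel ε t = -1 := by
    rw [intervalIntegral.integral_eq_sub_of_hasDerivAt (fun t _ => hasDerivAt_line t)
      ((continuous_lineKernel ε).neg.intervalIntegrable _ _)]
    rw [Real.smoothTransition.zero_of_nonpos, Real.smoothTransition.one_of_one_le]
    · norm_num
    · rw [neg_neg, le_sub_iff_add_le, le_div_iff₀ hε]; linarith
    · rw [neg_neg, div_self hε.ne', sub_self]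
  rw [intervalIntegral.integral_neg, neg_inj, intervalIntegral.integral_of_le (by linarith),
    ← integral_Icc_eq_integral_Ioc] at h1
  rw [← h1, setIntegral_eq_integral_of_forall_compl_eq_zero]
  exact fun t ht => lineKernel_eq_zero hε ht

open Classical in
/-- The cutoff vanishing near the boundary, as a function on `Ω`. -/
def collarCutoff {n : ℕ} (Ω : Set (Eu n)) (ℓ ε : ℝ) (x : Eu n) : ℝ :=
  if x ∈ tube Ω ℓ then Real.smoothTransition (-(tubeCoord Ω ℓ x).2 / ε - 1) else 1

open Classical in
/-- The collar kernel: minus the normal derivative of the cutoff. -/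
def collarKernel {n : ℕ} (Ω : Set (Eu n)) (ℓ ε : ℝ) (x : Eu n) : ℝ :=
  if x ∈ tube Ω ℓ then lineKernel ε (tubeCoord Ω ℓ x).2 else 0

section BoundedSupport

variable {n : ℕ} {Ω : Set (Eu n)} {R : ℝ}

lemma integrableOn_of_continuousOn_closure {f : Eu n → ℝ} (hf : ContinuousOn f (closure Ω))
    (hR : ∀ x, R < ‖x‖ → f x = 0) : IntegrableOn f (closure Ω) := by
  have hc : IsCompact (closure Ω ∩ Metric.closedBall 0 R) :=
    (isCompact_closedBall _ _).inter_left isClosed_closure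
  have h1 : IntegrableOn f (closure Ω ∩ Metric.closedBall 0 R) :=
    (hf.mono inter_subset_left).integrableOn_compact hc
  refine h1.of_forall_sdiff_eq_zero isClosed_closure.measurableSet fun x hx => hR x ?_
  have : x ∉ Metric.closedBall 0 R := fun hh => hx.2 ⟨hx.1, hh⟩
  simpa using this

lemma fderivWithin_eq_zero_of_lt {g : Eu n → ℝ} {s : Set (Eu n)} (hR : ∀ x, R < ‖x‖ → g x = 0)
    {x : Eu n} (hx : R < ‖x‖) : fderivWithin ℝ g s x = 0 := by
  have h1 : g =ᶠ[𝓝 x] fun _ => 0 := by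
    filter_upwards [continuous_norm.continuousAt.eventually_const_lt hx] with y hy using hR y hy
  rw [(h1.filter_mono nhdsWithin_le_nhds).fderivWithin_eq h1.self_of_nhds]
  simp

lemma continuousOn_fderivWithin_apply {g : Eu n → ℝ} {s : Set (Eu n)} (hs : UniqueDiffOn ℝ s)
    (hg : ContDiffOn ℝ 1 g s) (v : Eu n) : ContinuousOn (fun x => fderivWithin ℝ g s x v) s :=
  (hg.continuousOn_fderivWithin hs (by simp)).clm_apply continuousOn_const

end BoundedSupport

namespace TubeBound

variable {n : ℕ} {Ω : Set (Eu n)} {K ℓ ε : ℝ}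

lemma eventually_collarCutoff_eq_one (h : TubeBound Ω K ℓ) (hε : 0 < ε) (hεℓ : 8 * ε < ℓ)
    {x : Eu n} (hxΩ : x ∈ Ω) (hx : x ∉ tube Ω ℓ) :
    collarCutoff Ω ℓ ε =ᶠ[𝓝 x] fun _ => 1 := by
  filter_upwards [h.eventually_half_lt hx, h.smooth.1.mem_nhds hxΩ] with x' h1 h2
  rw [collarCutoff]
  split_ifs with hh
  · have h3 := (h.mem_iff hh).1 h2
    have h4 := h1 hh
    rw [abs_of_neg h3] at h4
    refine Real.smoothTransition.one_of_one_le ?_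
    rw [le_sub_iff_add_le, le_div_iff₀ hε]
    linarith
  · rfl

lemma contDiffAt_collarCutoff (h : TubeBound Ω K ℓ) (hε : 0 < ε) (hεℓ : 8 * ε < ℓ) {x : Eu n}
    (hxΩ : x ∈ Ω) : ContDiffAt ℝ ∞ (collarCutoff Ω ℓ ε) x := by
  by_cases hx : x ∈ tube Ω ℓ
  · have h1 : ContDiffAt ℝ ∞
        (fun x => Real.smoothTransition (-(tubeCoord Ω ℓ x).2 / ε - 1)) x :=
      (Real.smoothTransition.contDiff (n := (⊤ : ℕ∞))).contDiffAt.comp x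
        (((h.contDiffAt_height hx).neg.div_const ε).sub contDiffAt_const)
    refine h1.congr_of_eventuallyEq ?_
    filter_upwards [(h.exists_contDiffAt hx).2] with x' hx'
    rw [collarCutoff, if_pos hx']
  · exact contDiffAt_const.congr_of_eventuallyEq (h.eventually_collarCutoff_eq_one hε hεℓ hxΩ hx)

/-- The kernel is supported at heights between -2ε and -ε. Since 8ε < ℓ, the extended normal there
is still the gradient of the height, the bump being 1 up to ℓ/4. -/
lemma fderiv_collarCutoff (h : TubeBound Ω K ℓ) (hε : 0 < ε) (hεℓ : 8 * ε < ℓ) {x : Eu n}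
    (hxΩ : x ∈ Ω) (v : Eu n) : fderiv ℝ (collarCutoff Ω ℓ ε) x v
      = -(collarKernel Ω ℓ ε x * inner ℝ (normalExt Ω ℓ x) v) := by
  by_cases hx : x ∈ tube Ω ℓ
  · have h1 : collarCutoff Ω ℓ ε =ᶠ[𝓝 x]
        (fun t => Real.smoothTransition (-t / ε - 1)) ∘ fun x => (tubeCoord Ω ℓ x).2 := by
      filter_upwards [(h.exists_contDiffAt hx).2] with x' hx'
      rw [collarCutoff, if_pos hx', Function.comp_apply]
    have h2 := (hasDerivAt_line (ε := ε) (tubeCoord Ω ℓ x).2).comp_hasFDerivAt x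
      ((h.contDiffAt_height hx).differentiableAt (by simp)).hasFDerivAt
    rw [h1.fderiv_eq, h2.fderiv, smul_apply, (h.fderiv_tube hx v).1, collarKernel, if_pos hx,
      smul_eq_mul, neg_mul]
    by_cases ht : (tubeCoord Ω ℓ x).2 ∈ Icc (-(2 * ε)) (-ε)
    · rw [h.normalExt_eq_tubeNormal hx]
      rw [abs_le]
      constructor <;> linarith [ht.1, ht.2]
    · rw [lineKernel_eq_zero hε ht]
      simp
  · rw [(h.eventually_collarCutoff_eq_one hε hεℓ hxΩ hx).fderiv_eq, collarKernel, if_neg hx]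
    simp

lemma eventually_collarCutoff_eq_zero (h : TubeBound Ω K ℓ) (hε : 0 < ε) {x : Eu n}
    (hx : x ∈ frontier Ω) : ∀ᶠ x' in 𝓝 x, collarCutoff Ω ℓ ε x' = 0 := by
  have hxt := h.frontier_subset_tube hx
  have h1 : Tendsto (fun x' => |(tubeCoord Ω ℓ x').2|) (𝓝 x) (𝓝 |(tubeCoord Ω ℓ x).2|) :=
    (h.contDiffAt_height hxt).continuousAt.tendsto.abs
  rw [h.tubeCoord_frontier hx, abs_zero] at h1
  filter_upwards [h1.eventually_lt_const hε, (h.exists_contDiffAt hxt).2] with x' h2 h3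
  rw [collarCutoff, if_pos h3]
  refine Real.smoothTransition.zero_of_nonpos ?_
  rw [sub_nonpos, div_le_one hε]
  linarith [(abs_lt.1 h2).1]

/-- The cutoff vanishes in a full neighbourhood of each boundary point, so nothing about `g` at the
boundary matters and extension by zero is C¹ on the whole space. -/
lemma contDiff_indicator (h : TubeBound Ω K ℓ) (hε : 0 < ε) (hεℓ : 8 * ε < ℓ) {g : Eu n → ℝ}
    (hg : ContDiffOn ℝ 1 g (closure Ω)) :
    ContDiff ℝ 1 (Ω.indicator fun x => collarCutoff Ω ℓ ε x * g x) ∧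
    ∀ x ∉ Ω, (Ω.indicator fun x => collarCutoff Ω ℓ ε x * g x) =ᶠ[𝓝 x] fun _ => 0 := by
  have h2 : ∀ x ∉ Ω, (Ω.indicator fun x => collarCutoff Ω ℓ ε x * g x) =ᶠ[𝓝 x] fun _ => 0 := by
    intro x hx
    by_cases hxc : x ∈ closure Ω
    · have hxf : x ∈ frontier Ω := by rw [h.smooth.1.frontier_eq]; exact ⟨hxc, hx⟩
      filter_upwards [h.eventually_collarCutoff_eq_zero hε hxf] with x' hx'
      simp [indicator, hx']
    · filter_upwards [isClosed_closure.isOpen_compl.mem_nhds hxc] with x' hx'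
      exact indicator_of_notMem (fun hh => hx' (subset_closure hh)) _
  refine ⟨?_, h2⟩
  rw [contDiff_iff_contDiffAt]
  intro x
  by_cases hx : x ∈ Ω
  · have h1 : ContDiffAt ℝ 1 (fun x => collarCutoff Ω ℓ ε x * g x) x :=
      ((h.contDiffAt_collarCutoff hε hεℓ hx).of_le (by simp)).mul
        (hg.contDiffAt (mem_of_superset (h.smooth.1.mem_nhds hx) subset_closure))
    refine h1.congr_of_eventuallyEq ?_
    filter_upwards [h.smooth.1.mem_nhds hx] with x' hx'
    exact indicator_of_mem hx' _
  · exact contDiffAt_const.congr_of_eventuallyEq (h2 x hx)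

lemma collarCutoff_mem (x : Eu n) : collarCutoff Ω ℓ ε x ∈ Icc 0 1 := by
  rw [collarCutoff]
  split_ifs
  · exact ⟨Real.smoothTransition.nonneg _, Real.smoothTransition.le_one _⟩
  · simp

lemma continuousOn_collarKernel (h : TubeBound Ω K ℓ) (hε : 0 < ε) (hεℓ : 8 * ε < ℓ) :
    ContinuousOn (collarKernel Ω ℓ ε) Ω := by
  intro x hxΩ
  refine ContinuousAt.continuousWithinAt ?_
  by_cases hx : x ∈ tube Ω ℓ
  · have h1 : ContinuousAt (fun x => lineKernel ε (tubeCoord Ω ℓ x).2) x :=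
      ContinuousAt.comp (g := lineKernel ε) (continuous_lineKernel ε).continuousAt
        (h.contDiffAt_height hx).continuousAt
    refine h1.congr ?_
    filter_upwards [(h.exists_contDiffAt hx).2] with x' hx'
    rw [collarKernel, if_pos hx']
  · have h1 : (fun _ => 0) =ᶠ[𝓝 x] collarKernel Ω ℓ ε := by
      filter_upwards [h.eventually_half_lt hx] with x' h1
      rw [collarKernel]
      split_ifs with hh
      · rw [lineKernel_eq_zero hε]
        intro hcon
        have h3 := h1 hh
        rw [abs_of_neg (by linarith [hcon.2])] at h3
        linarith [hcon.1]
      · rfl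
    exact continuousAt_const.congr h1

/-- Integration by parts against the collar cutoff. -/
lemma integral_collarCutoff (h : TubeBound Ω K ℓ) (hε : 0 < ε) (hεℓ : 8 * ε < ℓ) {g : Eu n → ℝ}
    (hg : ContDiffOn ℝ 1 g (closure Ω)) {R : ℝ} (hR : ∀ x, R < ‖x‖ → g x = 0) (v : Eu n) :
    ∫ x in Ω, collarCutoff Ω ℓ ε x * fderivWithin ℝ g (closure Ω) x v
      = ∫ x in Ω, collarKernel Ω ℓ ε x * (inner ℝ (normalExt Ω ℓ x) v * g x) := by
  obtain ⟨hG, hG0⟩ := h.contDiff_indicator hε hεℓ hg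
  set G := Ω.indicator fun x => collarCutoff Ω ℓ ε x * g x with hGdef
  have hu := h.smooth.uniqueDiffOn_closure
  have hGR : ∀ x, R < ‖x‖ → G x = 0 := fun x hx => by
    rw [hGdef, indicator]; split_ifs <;> simp [hR x hx]
  have hGs : HasCompactSupport G := HasCompactSupport.intro (isCompact_closedBall 0 R)
    fun x hx => hGR x (by simpa using hx)
  have hG' : HasCompactSupport fun x => fderiv ℝ G x v := hGs.fderiv_apply ℝ v
  have hG'c : Continuous fun x => fderiv ℝ G x v :=
    (hG.continuous_fderiv (by simp)).clm_apply continuous_const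
  -- The derivative of a compactly supported C¹ function has integral zero: integration by parts
  -- against the constant 1.
  have h0 : ∫ x, fderiv ℝ G x v = 0 := by
    have := integral_mul_fderiv_eq_neg_fderiv_mul_of_integrable (μ := (volume : Measure (Eu n)))
      (f := fun _ => (1 : ℝ)) (g := G) (v := v) (by simp)
      (by simpa using hG'c.integrable_of_hasCompactSupport hG')
      (by simpa using hG.continuous.integrable_of_hasCompactSupport hGs)
      (fun _ _ => differentiableAt_const _)
      (fun x _ => hG.differentiable (by simp) x)
    simpa using this
  have h1 : ∫ x in Ω, fderiv ℝ G x v = 0 := by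
    rw [setIntegral_eq_integral_of_forall_compl_eq_zero, h0]
    intro x hx
    rw [(hG0 x hx).fderiv_eq]
    simp
  have h2 : ∀ x ∈ Ω, fderiv ℝ G x v = collarCutoff Ω ℓ ε x * fderivWithin ℝ g (closure Ω) x v
      - collarKernel Ω ℓ ε x * (inner ℝ (normalExt Ω ℓ x) v * g x) := by
    intro x hx
    have hnc : closure Ω ∈ 𝓝 x := mem_of_superset (h.smooth.1.mem_nhds hx) subset_closure
    have e1 : G =ᶠ[𝓝 x] fun x => collarCutoff Ω ℓ ε x * g x := by
      filter_upwards [h.smooth.1.mem_nhds hx] with x' hx'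
      exact indicator_of_mem hx' _
    have e2 := ((h.contDiffAt_collarCutoff hε hεℓ hx).differentiableAt (by simp)).hasFDerivAt
    have e3 := ((hg.contDiffAt hnc).differentiableAt (by simp)).hasFDerivAt
    rw [e1.fderiv_eq, (e2.fun_mul e3).fderiv, fderivWithin_of_mem_nhds hnc]
    simp only [add_apply, smul_apply, smul_eq_mul, h.fderiv_collarCutoff hε hεℓ hx]
    ring
  rw [setIntegral_congr_fun h.smooth.1.measurableSet h2, integral_sub] at h1
  · linarith
  · refine Integrable.bdd_mul (c := 1)
      ((integrableOn_of_continuousOn_closure (R := R)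
        (continuousOn_fderivWithin_apply hu hg v) ?_).mono_set subset_closure) ?_ ?_
    · intro x hx
      rw [fderivWithin_eq_zero_of_lt hR hx, zero_apply]
    · exact (show ContinuousOn (collarCutoff Ω ℓ ε) Ω from fun x hx =>
        (h.contDiffAt_collarCutoff hε hεℓ hx).continuousAt.continuousWithinAt).aestronglyMeasurable
          h.smooth.1.measurableSet
    · refine Eventually.of_forall fun x => ?_
      rw [Real.norm_eq_abs, abs_of_nonneg (collarCutoff_mem x).1]
      exact (collarCutoff_mem x).2
  · have hgc : ContinuousOn (fun x => inner ℝ (normalExt Ω ℓ x) v * g x) (closure Ω) :=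
      ((h.contDiff_normalExt.continuous.inner continuous_const).continuousOn).mul hg.continuousOn
    obtain ⟨B, hB0, hB⟩ := exists_abs_deriv_smoothTransition_le
    refine Integrable.bdd_mul (c := ε⁻¹ * B)
      ((integrableOn_of_continuousOn_closure (R := R) hgc ?_).mono_set subset_closure) ?_ ?_
    · intro x hx
      rw [hR x hx, mul_zero]
    · exact (h.continuousOn_collarKernel hε hεℓ).aestronglyMeasurable h.smooth.1.measurableSet
    · refine Eventually.of_forall fun x => ?_
      rw [collarKernel]
      split_ifs
      · rw [lineKernel, norm_mul, norm_inv, Real.norm_eq_abs ε, abs_of_pos hε]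
        exact mul_le_mul_of_nonneg_left (hB _) (inv_nonneg.2 hε.le)
      · rw [norm_zero]
        positivity

lemma tendsto_collarCutoff (h : TubeBound Ω K ℓ) {x : Eu n} (hx : x ∈ Ω) :
    Tendsto (fun ε => collarCutoff Ω ℓ ε x) (𝓝[>] 0) (𝓝 1) := by
  refine tendsto_const_nhds.congr' ?_
  by_cases hxt : x ∈ tube Ω ℓ
  · have h1 := (h.mem_iff hxt).1 hx
    have h2 : (0 : ℝ) < -(tubeCoord Ω ℓ x).2 / 2 := by linarith
    filter_upwards [Ioo_mem_nhdsGT h2] with ε hε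
    rw [collarCutoff, if_pos hxt, Real.smoothTransition.one_of_one_le]
    rw [le_sub_iff_add_le, le_div_iff₀ hε.1]
    linarith [hε.2]
  · exact Eventually.of_forall fun ε => by simp [collarCutoff, hxt]

lemma tendsto_integral_collarCutoff (h : TubeBound Ω K ℓ) {f : Eu n → ℝ}
    (hf : IntegrableOn f Ω) :
    Tendsto (fun ε => ∫ x in Ω, collarCutoff Ω ℓ ε x * f x) (𝓝[>] 0) (𝓝 (∫ x in Ω, f x)) := by
  refine tendsto_integral_filter_of_dominated_convergence (fun x => ‖f x‖) ?_ ?_ hf.norm ?_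
  · filter_upwards [Ioo_mem_nhdsGT (show (0 : ℝ) < ℓ / 8 by linarith [h.pos])] with ε hε
    refine AEStronglyMeasurable.mul ?_ hf.aestronglyMeasurable
    exact (show ContinuousOn (collarCutoff Ω ℓ ε) Ω from fun x hx =>
      (h.contDiffAt_collarCutoff hε.1 (by linarith [hε.2]) hx).continuousAt.continuousWithinAt)
        |>.aestronglyMeasurable h.smooth.1.measurableSet
  · refine Eventually.of_forall fun ε => Eventually.of_forall fun x => ?_
    rw [norm_mul, Real.norm_eq_abs, abs_of_nonneg (collarCutoff_mem x).1]
    exact mul_le_of_le_one_left (norm_nonneg _) (collarCutoff_mem x).2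
  · filter_upwards [self_mem_ae_restrict h.smooth.1.measurableSet] with x hx
    simpa using (h.tendsto_collarCutoff hx).mul_const (f x)

end TubeBound

/-! ### Comparison of Hausdorff measures under Lipschitz maps -/

section LipschitzMeasure

variable {X Y : Type*} [EMetricSpace X] [MeasurableSpace X] [BorelSpace X]
  [EMetricSpace Y] [MeasurableSpace Y] [BorelSpace Y]

/-- A Lipschitz image enlarges d-dimensional Hausdorff measure by at most c^d, so the measure on the
image is dominated by a multiple of the pushed-forward measure. Applied to a chart and to its
inverse, this replaces a change of variables formula. -/
lemma lintegral_image_le {Φ : X → Y} {s : Set X} {c : ℝ≥0} (hΦ : LipschitzOnWith c Φ s)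
    (hs : MeasurableSet s) (d : ℕ) {f : Y → ℝ≥0∞} (hf : Measurable f) :
    ∫⁻ y in Φ '' s, f y ∂(Measure.euclideanHausdorffMeasure d)
      ≤ (c : ℝ≥0∞) ^ d * ∫⁻ x in s, f (Φ x) ∂(Measure.euclideanHausdorffMeasure d) := by
  have hm : AEMeasurable Φ ((Measure.euclideanHausdorffMeasure d).restrict s) :=
    hΦ.continuousOn.aemeasurable hs
  have key : (Measure.euclideanHausdorffMeasure d : Measure Y).restrict (Φ '' s)
      ≤ ((c : ℝ≥0∞) ^ d) • (Measure.map Φ ((Measure.euclideanHausdorffMeasure d).restrict s)) := by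
    refine Measure.le_intro fun A hA _ => ?_
    rw [Measure.restrict_apply hA, Measure.smul_apply, smul_eq_mul,
      Measure.map_apply_of_aemeasurable hm hA, Measure.restrict_apply' hs]
    have h1 : A ∩ Φ '' s = Φ '' (Φ ⁻¹' A ∩ s) := by
      rw [inter_comm (Φ ⁻¹' A), image_inter_preimage, inter_comm]
    have h2 := (hΦ.mono inter_subset_right : LipschitzOnWith c Φ (Φ ⁻¹' A ∩ s))
      |>.hausdorffMeasure_image_le (d := (d : ℝ)) (Nat.cast_nonneg d)
    rw [ENNReal.rpow_natCast] at h2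
    rw [h1, Measure.euclideanHausdorffMeasure_def, Measure.euclideanHausdorffMeasure_def,
      Measure.smul_apply, Measure.smul_apply, ENNReal.smul_def, ENNReal.smul_def, smul_eq_mul,
      smul_eq_mul, mul_left_comm]
    gcongr
  calc _ ≤ ∫⁻ y, f y ∂(((c : ℝ≥0∞) ^ d) •
        (Measure.map Φ ((Measure.euclideanHausdorffMeasure d).restrict s))) :=
        lintegral_mono' key le_rfl
    _ = _ := by rw [lintegral_smul_measure, lintegral_map' hf.aemeasurable hm, smul_eq_mul]

end LipschitzMeasure

/-! ### Splitting off a coordinate -/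

/-- The point of `ℝ^(m+1)` with first coordinate `z` and remaining coordinates `v`. -/
def consPoint {m : ℕ} (z : ℝ) (v : Eu m) : Eu (m + 1) := WithLp.toLp 2 (Fin.cons z v.ofLp)

/-- Forget the first coordinate. -/
def tailPoint {m : ℕ} (y : Eu (m + 1)) : Eu m := WithLp.toLp 2 (Fin.tail y.ofLp)

section ConsPoint

variable {m : ℕ}

lemma consPoint_zero (z : ℝ) (v : Eu m) : consPoint z v 0 = z := rfl

lemma consPoint_tailPoint (y : Eu (m + 1)) : consPoint (y 0) (tailPoint y) = y := by
  apply WithLp.ofLp_injective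
  exact Fin.cons_self_tail _

lemma tailPoint_consPoint (z : ℝ) (v : Eu m) : tailPoint (consPoint z v) = v := by
  apply WithLp.ofLp_injective
  exact Fin.tail_cons (α := fun _ => ℝ) z v.ofLp

lemma norm_sq_eq_add_tailPoint (y : Eu (m + 1)) : ‖y‖ ^ 2 = y 0 ^ 2 + ‖tailPoint y‖ ^ 2 := by
  rw [EuclideanSpace.real_norm_sq_eq, EuclideanSpace.real_norm_sq_eq, Fin.sum_univ_succ]
  rfl

lemma tailPoint_sub (y y' : Eu (m + 1)) : tailPoint (y - y') = tailPoint y - tailPoint y' := rfl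

lemma consPoint_sub (z : ℝ) (v v' : Eu m) :
    consPoint z v - consPoint z v' = consPoint 0 (v - v') := by
  apply WithLp.ofLp_injective
  funext i
  refine Fin.cases ?_ (fun i => ?_) i
  · show z - z = 0
    ring
  · rfl

lemma norm_tailPoint_le (y : Eu (m + 1)) : ‖tailPoint y‖ ≤ ‖y‖ := by
  refine abs_le_of_sq_le_sq' ?_ (norm_nonneg _) |>.2
  rw [norm_sq_eq_add_tailPoint y]
  nlinarith [sq_nonneg (y 0)]

lemma lipschitzWith_tailPoint : LipschitzWith 1 (tailPoint (m := m)) :=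
  LipschitzWith.of_dist_le_mul fun y y' => by
    rw [dist_eq_norm, dist_eq_norm, ← tailPoint_sub, NNReal.coe_one, one_mul]
    exact norm_tailPoint_le _

lemma norm_consPoint_zero (v : Eu m) : ‖consPoint 0 v‖ = ‖v‖ := by
  have h := norm_sq_eq_add_tailPoint (consPoint 0 v)
  rw [tailPoint_consPoint, consPoint_zero] at h
  refine (sq_eq_sq₀ (norm_nonneg _) (norm_nonneg _)).1 ?_
  rw [h]; ring

lemma isometry_consPoint (z : ℝ) : Isometry (consPoint (m := m) z) :=
  Isometry.of_dist_eq fun v v' => by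
    rw [dist_eq_norm, dist_eq_norm, consPoint_sub, norm_consPoint_zero]

lemma continuous_consPoint : Continuous fun q : ℝ × Eu m => consPoint q.1 q.2 := by
  refine (PiLp.continuous_toLp 2 _).comp ?_
  refine continuous_pi fun i => ?_
  refine Fin.cases ?_ (fun i => ?_) i
  · exact continuous_fst
  · simp only [Fin.cons_succ]
    fun_prop

lemma lintegral_consPoint {F : Eu (m + 1) → ℝ≥0∞} (hF : Measurable F) :
    ∫⁻ y, F y = ∫⁻ z : ℝ, ∫⁻ v : Eu m, F (consPoint z v) := by
  have h1 : ∫⁻ y, F y = ∫⁻ w : Fin (m + 1) → ℝ, F (WithLp.toLp 2 w) :=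
    ((PiLp.volume_preserving_toLp (Fin (m + 1))).lintegral_comp hF).symm
  have h2 : ∫⁻ w : Fin (m + 1) → ℝ, F (WithLp.toLp 2 w)
      = ∫⁻ q : ℝ × (Fin m → ℝ), F (WithLp.toLp 2 (Fin.cons q.1 q.2)) := by
    rw [← ((volume_preserving_piFinSuccAbove (fun _ : Fin (m + 1) => ℝ) 0).symm).lintegral_comp_emb
      (MeasurableEquiv.measurableEmbedding _)]
    refine lintegral_congr fun q => ?_
    congr 2
    exact Fin.insertNth_zero (α := fun _ => ℝ) q.1 q.2
  have hm : Measurable fun q : ℝ × (Fin m → ℝ) => F (WithLp.toLp 2 (Fin.cons q.1 q.2)) := by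
    have : Continuous fun q : ℝ × (Fin m → ℝ) => consPoint q.1 (WithLp.toLp 2 q.2) :=
      continuous_consPoint.comp
        (continuous_fst.prodMk ((PiLp.continuous_toLp 2 _).comp continuous_snd))
    exact hF.comp this.measurable
  rw [h1, h2, Measure.volume_eq_prod, lintegral_prod _ hm.aemeasurable]
  refine lintegral_congr fun z => ?_
  have hm2 : Measurable fun v : Eu m => F (consPoint z v) :=
    hF.comp (isometry_consPoint z).continuous.measurable
  exact (PiLp.volume_preserving_toLp (Fin m)).lintegral_comp hm2

end ConsPoint

/-! ### Averages against the line kernel -/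

lemma lintegral_lineKernel {ε : ℝ} (hε : 0 < ε) : ∫⁻ z, ENNReal.ofReal (lineKernel ε z) = 1 := by
  have hc : HasCompactSupport (lineKernel ε) :=
    HasCompactSupport.intro isCompact_Icc fun t ht => lineKernel_eq_zero hε ht
  rw [← ofReal_integral_eq_lintegral_ofReal
    ((continuous_lineKernel ε).integrable_of_hasCompactSupport hc)
    (Eventually.of_forall (lineKernel_nonneg hε)), integral_lineKernel hε, ENNReal.ofReal_one]

/-- The kernel is a probability density supported within distance 2ε of the origin, so its averages
of a continuous function tend to the value there. The two one-sided bounds avoid subtraction in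
[0,∞]. -/
lemma lineKernel_average {ψ : ℝ → ℝ≥0∞} (hψ : ContinuousAt ψ 0) (hfin : ψ 0 ≠ ⊤) {δ : ℝ≥0∞}
    (hδ : 0 < δ) : ∀ᶠ ε in 𝓝[>] (0 : ℝ),
      ∫⁻ z, ENNReal.ofReal (lineKernel ε z) * ψ z ≤ ψ 0 + δ ∧
      ψ 0 ≤ (∫⁻ z, ENNReal.ofReal (lineKernel ε z) * ψ z) + δ := by
  have hnear : ∀ᶠ z in 𝓝 (0 : ℝ), ψ z ∈ Icc (ψ 0 - δ) (ψ 0 + δ) :=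
    hψ.eventually (ENNReal.Icc_mem_nhds hfin hδ.ne')
  obtain ⟨r, hr, hball⟩ := Metric.eventually_nhds_iff.1 hnear
  filter_upwards [Ioo_mem_nhdsGT (show (0 : ℝ) < r / 2 by linarith)] with ε hε
  have hz : ∀ z, z ∈ Icc (-(2 * ε)) (-ε) → ψ z ∈ Icc (ψ 0 - δ) (ψ 0 + δ) := fun z hz => by
    refine hball ?_
    rw [dist_zero_right, Real.norm_eq_abs, abs_lt]
    constructor <;> linarith [hz.1, hz.2, hε.1, hε.2]
  have hmeas : Measurable fun z => ENNReal.ofReal (lineKernel ε z) :=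
    (continuous_lineKernel ε).measurable.ennreal_ofReal
  constructor
  · calc _ ≤ ∫⁻ z, ENNReal.ofReal (lineKernel ε z) * (ψ 0 + δ) := by
          refine lintegral_mono fun z => ?_
          by_cases h : z ∈ Icc (-(2 * ε)) (-ε)
          · exact mul_le_mul_right (hz z h).2 _
          · simp [lineKernel_eq_zero hε.1 h]
      _ = _ := by rw [lintegral_mul_const _ hmeas, lintegral_lineKernel hε.1, one_mul]
  · calc ψ 0 = ∫⁻ z, ENNReal.ofReal (lineKernel ε z) * ψ 0 := by
          rw [lintegral_mul_const _ hmeas, lintegral_lineKernel hε.1, one_mul]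
      _ ≤ ∫⁻ z, (ENNReal.ofReal (lineKernel ε z) * ψ z + ENNReal.ofReal (lineKernel ε z) * δ) := by
          refine lintegral_mono fun z => ?_
          by_cases h : z ∈ Icc (-(2 * ε)) (-ε)
          · rw [← mul_add]
            exact mul_le_mul_right (tsub_le_iff_right.1 (hz z h).1) _
          · simp [lineKernel_eq_zero hε.1 h]
      _ = _ := by
          rw [lintegral_add_right _ (hmeas.mul_const δ), lintegral_mul_const _ hmeas,
            lintegral_lineKernel hε.1, one_mul]

lemma continuous_lintegral_consPoint {m : ℕ} {F : Eu (m + 1) → ℝ} (hF : Continuous F)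
    (hc : HasCompactSupport F) (h0 : ∀ y, 0 ≤ F y) :
    Continuous (fun z => ∫⁻ v : Eu m, ENNReal.ofReal (F (consPoint z v))) ∧
    ∀ z, ∫⁻ v : Eu m, ENNReal.ofReal (F (consPoint z v)) ≠ ⊤ := by
  obtain ⟨R, hR⟩ := hc.isCompact.isBounded.exists_norm_le
  have hzero : ∀ z (v : Eu m), v ∉ Metric.closedBall (0 : Eu m) R → F (consPoint z v) = 0 := by
    intro z v hv
    by_contra hne
    refine hv ?_
    rw [mem_closedBall_zero_iff]
    calc ‖v‖ = ‖tailPoint (consPoint z v)‖ := by rw [tailPoint_consPoint]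
      _ ≤ ‖consPoint z v‖ := norm_tailPoint_le _
      _ ≤ R := hR _ (subset_tsupport _ hne)
  have hcont : Continuous fun z => ∫ v in Metric.closedBall (0 : Eu m) R, F (consPoint z v) :=
    continuous_parametric_integral_of_continuous (f := fun z (v : Eu m) => F (consPoint z v))
      (hF.comp continuous_consPoint) (isCompact_closedBall _ _)
  have heq : ∀ z, ∫⁻ v : Eu m, ENNReal.ofReal (F (consPoint z v))
      = ENNReal.ofReal (∫ v in Metric.closedBall (0 : Eu m) R, F (consPoint z v)) := by
    intro z
    rw [setIntegral_eq_integral_of_forall_compl_eq_zero (hzero z),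
      ofReal_integral_eq_lintegral_ofReal]
    · exact (hF.comp (isometry_consPoint z).continuous).integrable_of_hasCompactSupport
        (HasCompactSupport.intro (isCompact_closedBall _ _) (hzero z))
    · exact Eventually.of_forall fun v => h0 _
  constructor
  · simp_rw [heq]
    exact ENNReal.continuous_ofReal.comp hcont
  · intro z
    rw [heq]
    exact ENNReal.ofReal_ne_top

/-! ### Boundary charts and the collar limit -/

/-- A chart near a boundary point, bi-Lipschitz with constant `a`, whose first coordinate is the
height over the boundary. -/
structure BoundaryChart {m : ℕ} (Ω : Set (Eu (m + 1))) (ℓ : ℝ) (a : ℝ≥0) where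
  U : Set (Eu (m + 1))
  V : Set (Eu (m + 1))
  G : Eu (m + 1) → Eu (m + 1)
  Φ : Eu (m + 1) → Eu (m + 1)
  isOpen_U : IsOpen U
  isOpen_V : IsOpen V
  mapsTo_G : MapsTo G U V
  mapsTo_Φ : MapsTo Φ V U
  left_inv : ∀ x ∈ U, Φ (G x) = x
  right_inv : ∀ y ∈ V, G (Φ y) = y
  lipschitz_G : LipschitzOnWith a G U
  lipschitz_Φ : LipschitzOnWith a Φ V
  subset_tube : U ⊆ tube Ω ℓ
  height : ∀ x ∈ U, G x 0 = (tubeCoord Ω ℓ x).2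

/-- The chart exchanges the component of x - p along N for the height over the boundary and then
turns N into the first basis vector. The gradient of the height at `p` is N, so the derivative at
`p` is an isometry; by continuity the chart and its inverse are Lipschitz near `p` with any
prescribed constant above 1. -/
lemma TubeBound.exists_boundaryChart {m : ℕ} {Ω : Set (Eu (m + 1))} {K ℓ : ℝ}
    (h : TubeBound Ω K ℓ) {a : ℝ≥0} (ha : 1 < a) {p : Eu (m + 1)} (hp : p ∈ frontier Ω) :
    ∃ χ : BoundaryChart Ω ℓ a, p ∈ χ.U := by
  have hpt := h.frontier_subset_tube hp
  set N := outerNormal Ω p with hN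
  have hN1 : ‖N‖ = 1 := h.smooth.norm_outerNormal hp
  set e₀ : Eu (m + 1) := EuclideanSpace.single 0 1 with he₀
  have he1 : ‖N‖ = ‖e₀‖ := by rw [hN1, he₀]; simp
  -- The reflection in the hyperplane orthogonal to N - e₀ exchanges these two unit vectors.
  set S : Eu (m + 1) ≃ₗᵢ[ℝ] Eu (m + 1) := (Submodule.span ℝ {N - e₀})ᗮ.reflection with hS
  have hSN : S N = e₀ := Submodule.reflection_sub he1
  let G : Eu (m + 1) → Eu (m + 1) := fun x =>
    S ((x - p) - inner ℝ N (x - p) • N + (tubeCoord Ω ℓ x).2 • N)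
  have hG0 : ∀ x, G x 0 = (tubeCoord Ω ℓ x).2 := by
    intro x
    have h1 : G x 0 = inner ℝ e₀ (G x) := by
      rw [he₀, EuclideanSpace.inner_single_left]; simp
    rw [h1, ← hSN]
    simp only [G]
    rw [S.inner_map_map, inner_add_right, inner_sub_right, inner_smul_right, inner_smul_right,
      real_inner_self_eq_norm_sq, hN1]
    ring
  have hGsm : ContDiffAt ℝ ∞ G p := by
    have h1 := h.contDiffAt_height hpt
    have h2 : ContDiffAt ℝ ∞ (fun x => (x - p) - inner ℝ N (x - p) • N) p :=
      (contDiffAt_id.sub contDiffAt_const).sub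
        ((contDiffAt_const.inner ℝ (contDiffAt_id.sub contDiffAt_const)).smul contDiffAt_const)
    have h3 : ContDiffAt ℝ ∞ (fun x => (tubeCoord Ω ℓ x).2 • N) p := h1.smul contDiffAt_const
    exact S.contDiff.contDiffAt.comp p (h2.add h3)
  have hνp : tubeNormal Ω ℓ p = N := by rw [tubeNormal, h.tubeCoord_frontier hp]
  let S' : Eu (m + 1) ≃L[ℝ] Eu (m + 1) := S.toContinuousLinearEquiv
  have hGd : HasFDerivAt G (S' : Eu (m + 1) →L[ℝ] Eu (m + 1)) p := by
    have h1 : HasFDerivAt (fun x => (tubeCoord Ω ℓ x).2)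
        (fderiv ℝ (fun x => (tubeCoord Ω ℓ x).2) p) p :=
      ((h.contDiffAt_height hpt).differentiableAt (by simp)).hasFDerivAt
    have h2 : HasFDerivAt (fun x : Eu (m + 1) => x - p) (ContinuousLinearMap.id ℝ _) p :=
      (hasFDerivAt_id p).sub_const p
    have h3 : HasFDerivAt (fun x : Eu (m + 1) => inner ℝ N (x - p)) (innerSL ℝ N) p := by
      have h5 := (innerSL ℝ N).hasFDerivAt.comp p h2
      rw [ContinuousLinearMap.comp_id] at h5
      exact h5
    have h4 := (S' : Eu (m + 1) →L[ℝ] Eu (m + 1)).hasFDerivAt.comp p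
      ((h2.sub (h3.smul_const N)).add (h1.smul_const N))
    convert! h4 using 1
    ext1 v
    simp [(h.fderiv_tube hpt v).1, hνp]
  have hn : (∞ : WithTop ℕ∞) ≠ 0 := by simp
  let e := hGsm.toOpenPartialHomeomorph G hGd hn
  have hpe : p ∈ e.source := hGsm.mem_toOpenPartialHomeomorph_source hGd hn
  have heG : ∀ x, e x = G x := fun x => by
    rw [hGsm.toOpenPartialHomeomorph_coe hGd hn]
  have hstr : HasStrictFDerivAt G (S' : Eu (m + 1) →L[ℝ] Eu (m + 1)) p :=
    hGsm.hasStrictFDerivAt' hGd hn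
  have hstr' : HasStrictFDerivAt e.symm (S'.symm : Eu (m + 1) →L[ℝ] Eu (m + 1)) (G p) :=
    hstr.to_localInverse
  have hnS : ‖(S' : Eu (m + 1) →L[ℝ] Eu (m + 1))‖₊ < a := by
    refine lt_of_le_of_lt ?_ ha
    refine ContinuousLinearMap.opNorm_le_bound _ zero_le_one fun v => ?_
    simp [S']
  have hnS' : ‖(S'.symm : Eu (m + 1) →L[ℝ] Eu (m + 1))‖₊ < a := by
    refine lt_of_le_of_lt ?_ ha
    refine ContinuousLinearMap.opNorm_le_bound _ zero_le_one fun v => ?_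
    simp [S']
  obtain ⟨s₁, hs₁, hL₁⟩ := hstr.exists_lipschitzOnWith_of_nnnorm_lt a hnS
  obtain ⟨s₂, hs₂, hL₂⟩ := hstr'.exists_lipschitzOnWith_of_nnnorm_lt a hnS'
  have hGc : ContinuousAt G p := hGsm.continuousAt
  obtain ⟨U₁, hU₁, hU₁o, hpU₁⟩ := mem_nhds_iff.1
    (inter_mem (inter_mem (e.open_source.mem_nhds hpe) hs₁)
      (inter_mem (hGc.preimage_mem_nhds hs₂) (h.isOpen_tube.mem_nhds hpt)))
  refine ⟨⟨U₁, e '' U₁, G, e.symm, hU₁o, ?_, ?_, ?_, ?_, ?_, ?_, ?_, ?_, ?_⟩, hpU₁⟩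
  · exact e.isOpen_image_of_subset_source hU₁o fun x hx => (hU₁ hx).1.1
  · intro x hx
    rw [← heG]
    exact mem_image_of_mem _ hx
  · rintro _ ⟨x, hx, rfl⟩
    rw [e.left_inv (hU₁ hx).1.1]
    exact hx
  · intro x hx
    rw [← heG]
    exact e.left_inv (hU₁ hx).1.1
  · rintro _ ⟨x, hx, rfl⟩
    rw [e.left_inv (hU₁ hx).1.1, heG]
  · exact hL₁.mono fun x hx => (hU₁ hx).1.2
  · refine hL₂.mono ?_
    rintro _ ⟨x, hx, rfl⟩
    rw [heG]
    exact (hU₁ hx).2.1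
  · exact fun x hx => (hU₁ hx).2.2
  · exact fun x _ => hG0 x

/-- The integral of `f` over the collar of width `ε`. -/
def collarLIntegral {n : ℕ} (Ω : Set (Eu n)) (ℓ ε : ℝ) (f : Eu n → ℝ) : ℝ≥0∞ :=
  ∫⁻ x in Ω, ENNReal.ofReal (collarKernel Ω ℓ ε x * f x)

/-- The boundary integral of `f`. -/
def bdryLIntegral {n : ℕ} (Ω : Set (Eu n)) (f : Eu n → ℝ) : ℝ≥0∞ :=
  ∫⁻ x in frontier Ω, ENNReal.ofReal (f x) ∂(Measure.euclideanHausdorffMeasure (n - 1))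

/-- Collar integrals and the boundary integral agree in the limit up to the factor `c`. -/
def CollarComparable {n : ℕ} (Ω : Set (Eu n)) (ℓ : ℝ) (c : ℝ≥0∞) (f : Eu n → ℝ) : Prop :=
  ∀ δ : ℝ≥0∞, 0 < δ → ∀ᶠ ε in 𝓝[>] (0 : ℝ),
    collarLIntegral Ω ℓ ε f ≤ c * bdryLIntegral Ω f + δ ∧
    bdryLIntegral Ω f ≤ c * collarLIntegral Ω ℓ ε f + δ

namespace BoundaryChart

variable {m : ℕ} {Ω : Set (Eu (m + 1))} {K ℓ : ℝ} {a : ℝ≥0} (χ : BoundaryChart Ω ℓ a)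

lemma image_G : χ.G '' χ.U = χ.V :=
  Subset.antisymm (image_subset_iff.2 χ.mapsTo_G)
    fun y hy => ⟨χ.Φ y, χ.mapsTo_Φ hy, χ.right_inv y hy⟩

lemma image_Φ : χ.Φ '' χ.V = χ.U :=
  Subset.antisymm (image_subset_iff.2 χ.mapsTo_Φ)
    fun x hx => ⟨χ.G x, χ.mapsTo_G hx, χ.left_inv x hx⟩

open Classical in
/-- The function `f` in the chart, extended by zero. -/
def pull (f : Eu (m + 1) → ℝ) (y : Eu (m + 1)) : ℝ := if y ∈ χ.V then f (χ.Φ y) else 0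

lemma pull_of_mem (f : Eu (m + 1) → ℝ) {y : Eu (m + 1)} (hy : y ∈ χ.V) :
    χ.pull f y = f (χ.Φ y) := if_pos hy

lemma pull_of_notMem (f : Eu (m + 1) → ℝ) {y : Eu (m + 1)} (hy : y ∉ χ.V) :
    χ.pull f y = 0 := if_neg hy

variable {f : Eu (m + 1) → ℝ}

lemma isCompact_image (hc : HasCompactSupport f) (hU : tsupport f ⊆ χ.U) :
    IsCompact (χ.G '' tsupport f) :=
  hc.isCompact.image_of_continuousOn (χ.lipschitz_G.continuousOn.mono hU)

lemma pull_eq_zero {y : Eu (m + 1)} (hy : y ∉ χ.G '' tsupport f) :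
    χ.pull f y = 0 := by
  by_cases hyV : y ∈ χ.V
  · rw [χ.pull_of_mem f hyV]
    by_contra hne
    exact hy ⟨χ.Φ y, subset_tsupport _ hne, χ.right_inv y hyV⟩
  · exact χ.pull_of_notMem f hyV

lemma hasCompactSupport_pull (hc : HasCompactSupport f) (hU : tsupport f ⊆ χ.U) :
    HasCompactSupport (χ.pull f) :=
  HasCompactSupport.intro (χ.isCompact_image hc hU) fun _ hy => χ.pull_eq_zero hy

lemma continuous_pull (hf : Continuous f) (hc : HasCompactSupport f) (hU : tsupport f ⊆ χ.U) :
    Continuous (χ.pull f) := by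
  rw [continuous_iff_continuousAt]
  intro y
  by_cases hyV : y ∈ χ.V
  · have h1 : ContinuousAt (fun y => f (χ.Φ y)) y :=
      hf.continuousAt.comp (χ.lipschitz_Φ.continuousOn.continuousAt (χ.isOpen_V.mem_nhds hyV))
    refine h1.congr ?_
    filter_upwards [χ.isOpen_V.mem_nhds hyV] with y' hy'
    rw [χ.pull_of_mem f hy']
  · have hy : y ∉ χ.G '' tsupport f := by
      rintro ⟨x, hx, rfl⟩
      exact hyV (χ.mapsTo_G (hU hx))
    refine (continuousAt_const (y := (0 : ℝ))).congr ?_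
    filter_upwards [(χ.isCompact_image hc hU).isClosed.isOpen_compl.mem_nhds hy] with y' hy'
    rw [χ.pull_eq_zero hy']

lemma pull_nonneg (h0 : ∀ x, 0 ≤ f x) (y : Eu (m + 1)) : 0 ≤ χ.pull f y := by
  rw [pull]; split_ifs
  · exact h0 _
  · exact le_rfl

/-- In the chart the collar kernel depends on the first coordinate alone. Membership in `Ω` is
automatic on its support, where the height is negative. The two Lipschitz maps compare the volumes
in both directions. -/
lemma collar_compare (h : TubeBound Ω K ℓ) (hf : Continuous f) (hc : HasCompactSupport f)
    (hU : tsupport f ⊆ χ.U) {ε : ℝ} (hε : 0 < ε) (hεℓ : 8 * ε < ℓ) :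
    collarLIntegral Ω ℓ ε f
      ≤ (a : ℝ≥0∞) ^ (m + 1) * ∫⁻ y, ENNReal.ofReal (lineKernel ε (y 0) * χ.pull f y) ∧
    ∫⁻ y, ENNReal.ofReal (lineKernel ε (y 0) * χ.pull f y)
      ≤ (a : ℝ≥0∞) ^ (m + 1) * collarLIntegral Ω ℓ ε f := by
  have hvol : (volume : Measure (Eu (m + 1))) = Measure.euclideanHausdorffMeasure (m + 1) :=
    (EuclideanSpace.euclideanHausdorffMeasure_eq_volume (m + 1)).symm
  set F : Eu (m + 1) → ℝ≥0∞ := Ω.indicator fun x => ENNReal.ofReal (collarKernel Ω ℓ ε x * f x)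
    with hF
  set H : Eu (m + 1) → ℝ≥0∞ := fun y => ENNReal.ofReal (lineKernel ε (y 0) * χ.pull f y) with hH
  have hFm : Measurable F := by
    have h1 : ContinuousOn (fun x => collarKernel Ω ℓ ε x * f x) Ω :=
      (h.continuousOn_collarKernel hε hεℓ).mul hf.continuousOn
    have h2 : Measurable (Ω.indicator fun x => collarKernel Ω ℓ ε x * f x) := by
      classical
      have := h1.measurable_piecewise (g := 0) continuous_zero.continuousOn
        h.smooth.1.measurableSet
      rwa [piecewise_eq_indicator] at this
    have h3 : F = fun x => ENNReal.ofReal ((Ω.indicator fun x => collarKernel Ω ℓ ε x * f x) x) := by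
      funext x
      simp only [F, indicator]
      split_ifs <;> simp
    rw [h3]
    exact h2.ennreal_ofReal
  have hHm : Measurable H := by
    have h1 : Continuous fun y : Eu (m + 1) => lineKernel ε (y 0) :=
      (continuous_lineKernel ε).comp (by fun_prop)
    exact (h1.mul (χ.continuous_pull hf hc hU)).measurable.ennreal_ofReal
  have hFH : ∀ x ∈ χ.U, F x = H (χ.G x) := by
    intro x hx
    have hxt := χ.subset_tube hx
    simp only [hF, hH]
    rw [χ.pull_of_mem f (χ.mapsTo_G hx), χ.left_inv x hx, χ.height x hx]
    by_cases hxΩ : x ∈ Ω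
    · rw [indicator_of_mem hxΩ, collarKernel, if_pos hxt]
    · rw [indicator_of_notMem hxΩ, lineKernel_eq_zero hε, zero_mul, ENNReal.ofReal_zero]
      intro hcon
      exact hxΩ ((h.mem_iff hxt).2 (by linarith [hcon.2]))
  have hFU : ∀ x ∉ χ.U, F x = 0 := by
    intro x hx
    simp only [hF, indicator]
    split_ifs
    · rw [image_eq_zero_of_notMem_tsupport (fun hh => hx (hU hh))]
      simp
    · rfl
  have hHV : ∀ y ∉ χ.V, H y = 0 := by
    intro y hy
    simp only [hH]
    rw [χ.pull_of_notMem f hy]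
    simp
  have e1 : collarLIntegral Ω ℓ ε f = ∫⁻ x in χ.U, F x := by
    rw [collarLIntegral, ← lintegral_indicator h.smooth.1.measurableSet]
    exact (setLIntegral_eq_of_support_subset fun x hx => by
      by_contra hcon
      exact hx (hFU x hcon)).symm
  have e2 : ∫⁻ y, H y = ∫⁻ y in χ.V, H y :=
    (setLIntegral_eq_of_support_subset fun x hx => by
      by_contra hcon
      exact hx (hHV x hcon)).symm
  rw [e1, e2, hvol]
  constructor
  · conv_lhs => rw [← χ.image_Φ]
    refine (lintegral_image_le χ.lipschitz_Φ χ.isOpen_V.measurableSet _ hFm).trans_eq ?_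
    congr 1
    refine setLIntegral_congr_fun χ.isOpen_V.measurableSet fun y hy => ?_
    rw [hFH _ (χ.mapsTo_Φ hy), χ.right_inv y hy]
  · conv_lhs => rw [← χ.image_G]
    refine (lintegral_image_le χ.lipschitz_G χ.isOpen_U.measurableSet _ hHm).trans_eq ?_
    congr 1
    refine setLIntegral_congr_fun χ.isOpen_U.measurableSet fun x hx => ?_
    rw [hFH _ hx]

/-- The same comparison one dimension lower: inside the chart the boundary corresponds to the slice
where the first coordinate vanishes. -/
lemma bdry_compare (h : TubeBound Ω K ℓ) (hf : Continuous f) (hc : HasCompactSupport f)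
    (hU : tsupport f ⊆ χ.U) :
    bdryLIntegral Ω f
      ≤ (a : ℝ≥0∞) ^ m * ∫⁻ v : Eu m, ENNReal.ofReal (χ.pull f (consPoint 0 v)) ∧
    ∫⁻ v : Eu m, ENNReal.ofReal (χ.pull f (consPoint 0 v))
      ≤ (a : ℝ≥0∞) ^ m * bdryLIntegral Ω f := by
  have hvol : (volume : Measure (Eu m)) = Measure.euclideanHausdorffMeasure m :=
    (EuclideanSpace.euclideanHausdorffMeasure_eq_volume m).symm
  set W : Set (Eu m) := consPoint 0 ⁻¹' χ.V with hW
  have hWo : IsOpen W := χ.isOpen_V.preimage (isometry_consPoint 0).continuous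
  set H : Eu m → ℝ≥0∞ := fun v => ENNReal.ofReal (χ.pull f (consPoint 0 v)) with hH
  have hHm : Measurable H := ((χ.continuous_pull hf hc hU).comp
    (isometry_consPoint 0).continuous).measurable.ennreal_ofReal
  have hfm : Measurable fun x => ENNReal.ofReal (f x) := hf.measurable.ennreal_ofReal
  have hmem : ∀ x ∈ χ.U, (x ∈ frontier Ω ↔ χ.G x 0 = 0) := fun x hx => by
    rw [χ.height x hx]
    exact h.mem_frontier_iff (χ.subset_tube hx)
  have hL1 : LipschitzOnWith a (fun v => χ.Φ (consPoint 0 v)) W := by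
    have := χ.lipschitz_Φ.comp ((isometry_consPoint (m := m) 0).lipschitz.lipschitzOnWith (s := W))
      (fun v hv => hv)
    rwa [mul_one] at this
  have hL2 : LipschitzOnWith a (fun x => tailPoint (χ.G x)) (frontier Ω ∩ χ.U) := by
    have := lipschitzWith_tailPoint.lipschitzOnWith (s := univ) |>.comp
      (χ.lipschitz_G.mono (inter_subset_right (s := frontier Ω))) (fun _ _ => mem_univ _)
    rwa [one_mul] at this
  have hmeas : MeasurableSet (frontier Ω ∩ χ.U) :=
    isClosed_frontier.measurableSet.inter χ.isOpen_U.measurableSet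
  have hcons : ∀ x ∈ frontier Ω ∩ χ.U, consPoint 0 (tailPoint (χ.G x)) = χ.G x := by
    intro x hx
    conv_rhs => rw [← consPoint_tailPoint (χ.G x)]
    rw [(hmem x hx.2).1 hx.1]
  have hi1 : (fun v => χ.Φ (consPoint 0 v)) '' W = frontier Ω ∩ χ.U := by
    refine Subset.antisymm ?_ fun x hx => ?_
    · rintro _ ⟨v, hv, rfl⟩
      have hv' : consPoint 0 v ∈ χ.V := hv
      refine ⟨(hmem _ (χ.mapsTo_Φ hv')).2 ?_, χ.mapsTo_Φ hv'⟩
      rw [χ.right_inv _ hv', consPoint_zero]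
    · refine ⟨tailPoint (χ.G x), ?_, ?_⟩
      · rw [hW, mem_preimage, hcons x hx]
        exact χ.mapsTo_G hx.2
      · simp only
        rw [hcons x hx, χ.left_inv x hx.2]
  have hi2 : (fun x => tailPoint (χ.G x)) '' (frontier Ω ∩ χ.U) = W := by
    refine Subset.antisymm ?_ fun v hv => ?_
    · rintro _ ⟨x, hx, rfl⟩
      rw [hW, mem_preimage, hcons x hx]
      exact χ.mapsTo_G hx.2
    · have hv' : consPoint 0 v ∈ χ.V := hv
      refine ⟨χ.Φ (consPoint 0 v), hi1 ▸ mem_image_of_mem _ hv, ?_⟩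
      simp only
      rw [χ.right_inv _ hv', tailPoint_consPoint]
  have e1 : bdryLIntegral Ω f = ∫⁻ x in frontier Ω ∩ χ.U, ENNReal.ofReal (f x)
      ∂(Measure.euclideanHausdorffMeasure m) := by
    rw [bdryLIntegral, Nat.add_sub_cancel, inter_comm, ← setLIntegral_indicator
      χ.isOpen_U.measurableSet]
    refine lintegral_congr fun x => ?_
    rw [indicator]
    split_ifs with hx
    · rfl
    · rw [image_eq_zero_of_notMem_tsupport (fun hh => hx (hU hh)), ENNReal.ofReal_zero]
  have e2 : ∫⁻ v, H v = ∫⁻ v in W, H v :=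
    (setLIntegral_eq_of_support_subset fun v hv => by
      by_contra hcon
      refine hv ?_
      simp only [hH]
      rw [χ.pull_of_notMem f hcon, ENNReal.ofReal_zero]).symm
  have hfH : ∀ v ∈ W, ENNReal.ofReal (f (χ.Φ (consPoint 0 v))) = H v := fun v hv => by
    simp only [hH]
    rw [χ.pull_of_mem f hv]
  rw [e1, e2, hvol]
  constructor
  · rw [← hi1]
    refine (lintegral_image_le hL1 hWo.measurableSet _ hfm).trans_eq ?_
    congr 1
    exact setLIntegral_congr_fun hWo.measurableSet hfH
  · conv_lhs => rw [← hi2]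
    refine (lintegral_image_le hL2 hmeas _ hHm).trans_eq ?_
    congr 1
    refine setLIntegral_congr_fun hmeas fun x hx => ?_
    simp only [hH]
    rw [hcons x hx, χ.pull_of_mem f (χ.mapsTo_G hx.2), χ.left_inv x hx.2]

/-- By Fubini the collar integral becomes an average against the kernel of the slice integrals,
which depend continuously on the slice; the slice at 0 is the boundary integral. The comparisons
cost a^(m+1) in the collar and a^m ≤ a^(m+1) on the boundary. -/
lemma collarComparable (h : TubeBound Ω K ℓ) (ha : 1 < a) (hf : Continuous f)
    (hc : HasCompactSupport f) (h0 : ∀ x, 0 ≤ f x) (hU : tsupport f ⊆ χ.U) :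
    CollarComparable Ω ℓ ((a : ℝ≥0∞) ^ (2 * (m + 1))) f := by
  intro δ hδ
  set A : ℝ≥0∞ := (a : ℝ≥0∞) ^ (m + 1) with hA
  have ha1 : (1 : ℝ≥0∞) ≤ a := by exact_mod_cast ha.le
  have hA0 : A ≠ 0 := by
    rw [hA]; exact pow_ne_zero _ (by positivity)
  have hAt : A ≠ ⊤ := by rw [hA]; exact ENNReal.pow_ne_top ENNReal.coe_ne_top
  have hAm : (a : ℝ≥0∞) ^ m ≤ A := pow_le_pow_right₀ ha1 (Nat.le_succ m)
  have hA2 : (a : ℝ≥0∞) ^ (2 * (m + 1)) = A * A := by rw [hA, ← pow_add]; congr 1; ring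
  -- The averaging error is subsequently multiplied by one factor A.
  set δ' := δ / A with hδ'
  have hδ'0 : 0 < δ' := ENNReal.div_pos hδ.ne' hAt
  have hAδ : A * δ' = δ := ENNReal.mul_div_cancel hA0 hAt
  obtain ⟨hψc, hψfin⟩ := continuous_lintegral_consPoint (χ.continuous_pull hf hc hU)
    (χ.hasCompactSupport_pull hc hU) (χ.pull_nonneg h0)
  set ψ : ℝ → ℝ≥0∞ := fun z => ∫⁻ v : Eu m, ENNReal.ofReal (χ.pull f (consPoint z v)) with hψ
  have hb := χ.bdry_compare h hf hc hU
  filter_upwards [lineKernel_average hψc.continuousAt (hψfin 0) hδ'0,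
    Ioo_mem_nhdsGT (show (0 : ℝ) < ℓ / 8 by linarith [h.pos])] with ε hav hε
  have hcol := χ.collar_compare h hf hc hU hε.1 (by linarith [hε.2])
  have hfub : ∫⁻ y, ENNReal.ofReal (lineKernel ε (y 0) * χ.pull f y)
      = ∫⁻ z, ENNReal.ofReal (lineKernel ε z) * ψ z := by
    have hm : Measurable fun y : Eu (m + 1) => ENNReal.ofReal (lineKernel ε (y 0) * χ.pull f y) := by
      have h1 : Continuous fun y : Eu (m + 1) => lineKernel ε (y 0) :=
        (continuous_lineKernel ε).comp (by fun_prop)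
      exact (h1.mul (χ.continuous_pull hf hc hU)).measurable.ennreal_ofReal
    rw [lintegral_consPoint hm]
    refine lintegral_congr fun z => ?_
    rw [hψ, ← lintegral_const_mul']
    · refine lintegral_congr fun v => ?_
      rw [consPoint_zero, ENNReal.ofReal_mul (lineKernel_nonneg hε.1 z)]
    · exact ENNReal.ofReal_ne_top
  rw [hfub] at hcol
  have hb1 : bdryLIntegral Ω f ≤ A * ψ 0 := hb.1.trans (mul_le_mul_left hAm _)
  have hb2 : ψ 0 ≤ A * bdryLIntegral Ω f := hb.2.trans (mul_le_mul_left hAm _)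
  constructor
  · calc _ ≤ A * (ψ 0 + δ') := hcol.1.trans (mul_le_mul_right hav.1 _)
      _ ≤ A * (A * bdryLIntegral Ω f + δ') := by gcongr
      _ = _ := by rw [mul_add, hAδ, hA2, mul_assoc]
  · calc _ ≤ A * ψ 0 := hb1
      _ ≤ A * (A * collarLIntegral Ω ℓ ε f + δ') := by
          gcongr
          exact hav.2.trans (by gcongr; exact hcol.2)
      _ = _ := by rw [mul_add, hAδ, hA2, mul_assoc]

end BoundaryChart

/-! ### The divergence theorem -/

namespace TubeBound

variable {n : ℕ} {Ω : Set (Eu n)} {K ℓ : ℝ} {f : Eu n → ℝ}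

/-- The boundary integral vanishes, and so does the collar integral for small ε: collar points lie
within 2ε of the boundary, and the compact support keeps a positive distance from it. -/
lemma collarComparable_of_disjoint (h : TubeBound Ω K ℓ) (hc : HasCompactSupport f)
    (hd : tsupport f ⊆ (frontier Ω)ᶜ) (c : ℝ≥0∞) : CollarComparable Ω ℓ c f := by
  intro δ _
  have hI : bdryLIntegral Ω f = 0 := by
    rw [bdryLIntegral]
    refine setLIntegral_eq_zero isClosed_frontier.measurableSet fun x hx => ?_
    rw [image_eq_zero_of_notMem_tsupport (fun hh => hd hh hx)]
    simp
  obtain ⟨r, hr, hsub⟩ := hc.isCompact.exists_thickening_subset_open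
    isClosed_frontier.isOpen_compl hd
  filter_upwards [Ioo_mem_nhdsGT (show (0 : ℝ) < r / 2 by linarith)] with ε hε
  have hB : collarLIntegral Ω ℓ ε f = 0 := by
    rw [collarLIntegral]
    refine setLIntegral_eq_zero h.smooth.1.measurableSet fun x hx => ?_
    by_cases hxf : x ∈ tsupport f
    · simp only [Pi.zero_apply]
      rw [collarKernel]
      split_ifs with hxt
      · rw [lineKernel_eq_zero hε.1, zero_mul, ENNReal.ofReal_zero]
        intro hcon
        have hs := tubeCoord_spec hxt
        refine hsub (Metric.mem_thickening_iff.2 ⟨x, hxf, ?_⟩) hs.1.1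
        have h1 : dist (tubeCoord Ω ℓ x).1 x
            = ‖(tubeCoord Ω ℓ x).2 • outerNormal Ω (tubeCoord Ω ℓ x).1‖ := by
          rw [dist_eq_norm, norm_sub_rev, sub_eq_of_eq_add' hs.2.symm]
        rw [h1, norm_smul, h.smooth.norm_outerNormal hs.1.1, mul_one, Real.norm_eq_abs, abs_lt]
        constructor <;> linarith [hcon.1, hcon.2, hε.1, hε.2]
      · simp
    · rw [image_eq_zero_of_notMem_tsupport hxf]
      simp
  rw [hI, hB]
  simp

/-- Both integrals are additive in nonnegative functions, so a partition of unity reduces to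
functions supported in one chart or away from the boundary. -/
lemma collarComparable (h : TubeBound Ω K ℓ) {a : ℝ≥0} (ha : 1 < a) (hf : Continuous f)
    (hc : HasCompactSupport f) (h0 : ∀ x, 0 ≤ f x) :
    CollarComparable Ω ℓ ((a : ℝ≥0∞) ^ (2 * n)) f := by
  have hloc : ∀ x : Eu n, ∃ U : Set (Eu n), IsOpen U ∧ x ∈ U ∧ ∀ g : Eu n → ℝ, Continuous g →
      HasCompactSupport g → (∀ x, 0 ≤ g x) → tsupport g ⊆ U →
      CollarComparable Ω ℓ ((a : ℝ≥0∞) ^ (2 * n)) g := by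
    intro x
    by_cases hx : x ∈ frontier Ω
    · cases n with
      | zero =>
        have h1 := h.smooth.norm_outerNormal hx
        rw [Subsingleton.elim (outerNormal Ω x) 0, norm_zero] at h1
        exact absurd h1 zero_ne_one
      | succ m =>
        obtain ⟨χ, hχ⟩ := h.exists_boundaryChart ha hx
        exact ⟨χ.U, χ.isOpen_U, hχ, fun g hg hgc hg0 hgU =>
          χ.collarComparable h ha hg hgc hg0 hgU⟩
    · exact ⟨(frontier Ω)ᶜ, isClosed_frontier.isOpen_compl, hx, fun g _ hgc _ hgU =>
        h.collarComparable_of_disjoint hgc hgU _⟩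
  choose U hUo hxU hU using hloc
  obtain ⟨t, -, ht⟩ := hc.isCompact.elim_nhds_subcover U fun x _ => (hUo x).mem_nhds (hxU x)
  obtain ⟨φ, hφs, hφ1, hφ01, hφc⟩ := exists_continuous_sum_one_of_isOpen_isCompact
    (s := fun i => U (t.equivFin.symm i)) (fun i => hUo _) hc.isCompact (by
      intro x hx
      obtain ⟨y, hy, hxy⟩ := mem_iUnion₂.1 (ht hx)
      exact mem_iUnion.2 ⟨t.equivFin ⟨y, hy⟩, by simpa using hxy⟩)
  have hfs : ∀ x, f x = ∑ i, φ i x * f x := by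
    intro x
    by_cases hx : x ∈ tsupport f
    · have h1 := hφ1 hx
      simp only [Finset.sum_apply, Pi.one_apply] at h1
      rw [← Finset.sum_mul, h1, one_mul]
    · rw [image_eq_zero_of_notMem_tsupport hx]
      simp
  have hgood : ∀ i, CollarComparable Ω ℓ ((a : ℝ≥0∞) ^ (2 * n)) fun x => φ i x * f x := by
    intro i
    refine hU (t.equivFin.symm i) _ ((φ i).continuous.mul hf) ((hφc i).mul_right) (fun x =>
      mul_nonneg (hφ01 i x).1 (h0 x)) ?_
    exact (tsupport_mul_subset_left).trans (hφs i)
  have hbd : bdryLIntegral Ω f = ∑ i, bdryLIntegral Ω fun x => φ i x * f x := by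
    simp only [bdryLIntegral]
    rw [← lintegral_finsetSum]
    · refine lintegral_congr fun x => ?_
      rw [← ENNReal.ofReal_sum_of_nonneg fun i _ => mul_nonneg (hφ01 i x).1 (h0 x), ← hfs x]
    · exact fun i _ => ((φ i).continuous.mul hf).measurable.ennreal_ofReal
  intro δ hδ
  -- The error is shared among the pieces; the additional 1 covers an empty cover.
  set k : ℝ≥0∞ := (t.card : ℝ≥0∞) + 1 with hk
  have hk0 : k ≠ 0 := by rw [hk]; simp
  have hkt : k ≠ ⊤ := by rw [hk]; simp
  have hδ' : 0 < δ / k := ENNReal.div_pos hδ.ne' hkt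
  have hδk : (t.card : ℝ≥0∞) * (δ / k) ≤ δ := by
    calc (t.card : ℝ≥0∞) * (δ / k) ≤ k * (δ / k) := by gcongr; rw [hk]; exact le_self_add
      _ = δ := ENNReal.mul_div_cancel hk0 hkt
  filter_upwards [eventually_all.2 fun i => hgood i _ hδ',
    Ioo_mem_nhdsGT (show (0 : ℝ) < ℓ / 8 by linarith [h.pos])] with ε hev hε
  have hcol : collarLIntegral Ω ℓ ε f = ∑ i, collarLIntegral Ω ℓ ε fun x => φ i x * f x := by
    simp only [collarLIntegral]
    rw [← lintegral_finsetSum']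
    · refine lintegral_congr fun x => ?_
      have hκ : 0 ≤ collarKernel Ω ℓ ε x := by
        rw [collarKernel]; split_ifs
        · exact lineKernel_nonneg hε.1 _
        · exact le_rfl
      rw [← ENNReal.ofReal_sum_of_nonneg fun i _ =>
        mul_nonneg hκ (mul_nonneg (hφ01 i x).1 (h0 x)), ← Finset.mul_sum, ← hfs x]
    · exact fun i _ => (((h.continuousOn_collarKernel hε.1 (by linarith [hε.2])).mul
        ((φ i).continuous.mul hf).continuousOn).aemeasurable
          h.smooth.1.measurableSet).ennreal_ofReal
  rw [hbd, hcol]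
  constructor
  · calc _ ≤ ∑ i, ((a : ℝ≥0∞) ^ (2 * n) * bdryLIntegral Ω (fun x => φ i x * f x) + δ / k) :=
          Finset.sum_le_sum fun i _ => (hev i).1
      _ ≤ _ := by
        rw [Finset.sum_add_distrib, ← Finset.mul_sum]
        gcongr
        simpa using hδk
  · calc _ ≤ ∑ i, ((a : ℝ≥0∞) ^ (2 * n) * collarLIntegral Ω ℓ ε (fun x => φ i x * f x) + δ / k) :=
          Finset.sum_le_sum fun i _ => (hev i).2
      _ ≤ _ := by
        rw [Finset.sum_add_distrib, ← Finset.mul_sum]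
        gcongr
        simpa using hδk

lemma collarKernel_nonneg {ε : ℝ} (hε : 0 < ε) (x : Eu n) : 0 ≤ collarKernel Ω ℓ ε x := by
  rw [collarKernel]; split_ifs
  · exact lineKernel_nonneg hε _
  · exact le_rfl

lemma integrableOn_collarKernel_mul (h : TubeBound Ω K ℓ) (hf : Continuous f)
    (hc : HasCompactSupport f) {ε : ℝ} (hε : 0 < ε) (hεℓ : 8 * ε < ℓ) :
    IntegrableOn (fun x => collarKernel Ω ℓ ε x * f x) Ω := by
  obtain ⟨B, hB⟩ : ∃ B, ∀ s, ‖lineKernel ε s‖ ≤ B :=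
    (HasCompactSupport.intro isCompact_Icc fun t ht => lineKernel_eq_zero hε ht
      ).exists_bound_of_continuous (continuous_lineKernel ε)
  refine Integrable.bdd_mul (c := B) (hf.integrable_of_hasCompactSupport hc).integrableOn ?_ ?_
  · exact (h.continuousOn_collarKernel hε hεℓ).aestronglyMeasurable h.smooth.1.measurableSet
  · refine Eventually.of_forall fun x => ?_
    rw [collarKernel]
    split_ifs
    · exact hB _
    · rw [norm_zero]; exact (norm_nonneg _).trans (hB 0)

lemma collarLIntegral_eq (h : TubeBound Ω K ℓ) (hf : Continuous f)
    (hc : HasCompactSupport f) (h0 : ∀ x, 0 ≤ f x) {ε : ℝ} (hε : 0 < ε) (hεℓ : 8 * ε < ℓ) :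
    collarLIntegral Ω ℓ ε f = ENNReal.ofReal (∫ x in Ω, collarKernel Ω ℓ ε x * f x) := by
  rw [collarLIntegral, ofReal_integral_eq_lintegral_ofReal
    (h.integrableOn_collarKernel_mul hf hc hε hεℓ)]
  exact Eventually.of_forall fun x => mul_nonneg (collarKernel_nonneg hε x) (h0 x)

/-- Local finiteness of the surface measure is a by-product of comparability: a collar integral at a
single width is finite, and it bounds the boundary integral up to a factor and an error. -/
lemma bdryLIntegral_ne_top (h : TubeBound Ω K ℓ) (hf : Continuous f)
    (hc : HasCompactSupport f) (h0 : ∀ x, 0 ≤ f x) : bdryLIntegral Ω f ≠ ⊤ := by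
  obtain ⟨ε, h1, hε⟩ := ((h.collarComparable (a := 2) (by norm_num) hf hc h0 1 one_pos).and
    (Ioo_mem_nhdsGT (show (0 : ℝ) < ℓ / 8 by linarith [h.pos]))).exists
  refine ne_top_of_le_ne_top ?_ h1.2
  rw [h.collarLIntegral_eq hf hc h0 hε.1 (by linarith [hε.2])]
  exact ENNReal.add_ne_top.2 ⟨ENNReal.mul_ne_top (ENNReal.pow_ne_top ENNReal.coe_ne_top)
    ENNReal.ofReal_ne_top, ENNReal.one_ne_top⟩

lemma integrableOn_frontier_of_continuous (h : TubeBound Ω K ℓ) (hf : Continuous f)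
    (hc : HasCompactSupport f) :
    IntegrableOn f (frontier Ω) (Measure.euclideanHausdorffMeasure (n - 1)) := by
  refine ⟨hf.aestronglyMeasurable, ?_⟩
  have h1 := h.bdryLIntegral_ne_top hf.norm hc.norm fun x => norm_nonneg _
  rw [bdryLIntegral] at h1
  rw [hasFiniteIntegral_iff_norm]
  exact h1.lt_top

lemma tendsto_collar_of_nonneg (h : TubeBound Ω K ℓ) (hf : Continuous f)
    (hc : HasCompactSupport f) (h0 : ∀ x, 0 ≤ f x) :
    Tendsto (fun ε => ∫ x in Ω, collarKernel Ω ℓ ε x * f x) (𝓝[>] 0)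
      (𝓝 (∫ x in frontier Ω, f x ∂(Measure.euclideanHausdorffMeasure (n - 1)))) := by
  set i := ∫ x in frontier Ω, f x ∂(Measure.euclideanHausdorffMeasure (n - 1)) with hi
  have hi0 : 0 ≤ i := integral_nonneg h0
  have hI : bdryLIntegral Ω f = ENNReal.ofReal i := by
    rw [bdryLIntegral, hi, ofReal_integral_eq_lintegral_ofReal
      (h.integrableOn_frontier_of_continuous hf hc) (Eventually.of_forall h0)]
  rw [Metric.tendsto_nhds]
  intro η hη
  -- With comparison factor below 1 + θ and error θ, the collar integral exceeds i by at most θ(i +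
  -- 1), and i exceeds it by at most θ(2i + 2); both are below η for this θ.
  set θ : ℝ := min 1 (η / (4 * (i + 1))) with hθ
  have hθ0 : 0 < θ := by positivity
  have hθ1 : θ ≤ 1 := min_le_left _ _
  have hθη : θ * (4 * (i + 1)) ≤ η := by
    rw [← le_div_iff₀ (by positivity)]
    exact min_le_right _ _
  obtain ⟨a, ha1, ha⟩ : ∃ a : ℝ≥0, 1 < a ∧ (a : ℝ) ^ (2 * n) < 1 + θ := by
    have hcont : Tendsto (fun a : ℝ≥0 => (a : ℝ) ^ (2 * n)) (𝓝[>] 1) (𝓝 1) := by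
      have : Continuous fun a : ℝ≥0 => (a : ℝ) ^ (2 * n) := by fun_prop
      simpa using (this.tendsto 1).mono_left nhdsWithin_le_nhds
    obtain ⟨a, h1, h2⟩ := ((hcont.eventually_lt_const (show (1 : ℝ) < 1 + θ by linarith)).and
      self_mem_nhdsWithin).exists
    exact ⟨a, h2, h1⟩
  filter_upwards [h.collarComparable ha1 hf hc h0 (ENNReal.ofReal θ) (ENNReal.ofReal_pos.2 hθ0),
    Ioo_mem_nhdsGT (show (0 : ℝ) < ℓ / 8 by linarith [h.pos])] with ε hev hε
  set b := ∫ x in Ω, collarKernel Ω ℓ ε x * f x with hb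
  have hb0 : 0 ≤ b := integral_nonneg fun x => mul_nonneg (collarKernel_nonneg hε.1 x) (h0 x)
  rw [hI, h.collarLIntegral_eq hf hc h0 hε.1 (by linarith [hε.2]), ← hb] at hev
  have hc' : ((a : ℝ≥0∞) ^ (2 * n)) = ENNReal.ofReal ((a : ℝ) ^ (2 * n)) := by
    rw [ENNReal.ofReal_pow a.coe_nonneg, ENNReal.ofReal_coe_nnreal]
  have hap : 0 ≤ (a : ℝ) ^ (2 * n) := by positivity
  rw [hc', ← ENNReal.ofReal_mul hap, ← ENNReal.ofReal_mul hap,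
    ← ENNReal.ofReal_add (by positivity) hθ0.le, ← ENNReal.ofReal_add (by positivity) hθ0.le,
    ENNReal.ofReal_le_ofReal_iff (by positivity), ENNReal.ofReal_le_ofReal_iff (by positivity)]
    at hev
  have e1 : b ≤ (1 + θ) * i + θ := hev.1.trans (by gcongr)
  have e2 : i ≤ (1 + θ) * b + θ := hev.2.trans (by gcongr)
  have e3 : θ * b ≤ θ * (2 * i + 1) := by
    refine mul_le_mul_of_nonneg_left ?_ hθ0.le
    nlinarith
  rw [Real.dist_eq, abs_lt]
  constructor <;> nlinarith

lemma tendsto_collar (h : TubeBound Ω K ℓ) (hf : Continuous f) (hc : HasCompactSupport f) :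
    Tendsto (fun ε => ∫ x in Ω, collarKernel Ω ℓ ε x * f x) (𝓝[>] 0)
      (𝓝 (∫ x in frontier Ω, f x ∂(Measure.euclideanHausdorffMeasure (n - 1)))) := by
  have hcp : Continuous fun x => max (f x) 0 := hf.max continuous_const
  have hcm : Continuous fun x => max (-f x) 0 := hf.neg.max continuous_const
  have hsp : HasCompactSupport fun x => max (f x) 0 :=
    HasCompactSupport.intro hc.isCompact fun x hx => by
      simp [image_eq_zero_of_notMem_tsupport hx]
  have hsm : HasCompactSupport fun x => max (-f x) 0 :=
    HasCompactSupport.intro hc.isCompact fun x hx => by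
      simp [image_eq_zero_of_notMem_tsupport hx]
  have hsplit : ∀ x, f x = max (f x) 0 - max (-f x) 0 := fun x => by
    rcases le_total 0 (f x) with hx | hx
    · rw [max_eq_left hx, max_eq_right (by linarith), sub_zero]
    · rw [max_eq_right hx, max_eq_left (by linarith)]; ring
  have hlim := (h.tendsto_collar_of_nonneg hcp hsp fun x => le_max_right _ _).sub
    (h.tendsto_collar_of_nonneg hcm hsm fun x => le_max_right _ _)
  rw [← integral_sub (h.integrableOn_frontier_of_continuous hcp hsp)
    (h.integrableOn_frontier_of_continuous hcm hsm)] at hlim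
  simp_rw [← hsplit] at hlim
  refine hlim.congr' ?_
  filter_upwards [Ioo_mem_nhdsGT (show (0 : ℝ) < ℓ / 8 by linarith [h.pos])] with ε hε
  rw [← integral_sub (h.integrableOn_collarKernel_mul hcp hsp hε.1 (by linarith [hε.2]))
    (h.integrableOn_collarKernel_mul hcm hsm hε.1 (by linarith [hε.2]))]
  simp_rw [← mul_sub, ← hsplit]

lemma exists_extension {R : ℝ} (hf : ContinuousOn f (closure Ω))
    (hR : ∀ x, R < ‖x‖ → f x = 0) :
    ∃ F : Eu n → ℝ, Continuous F ∧ HasCompactSupport F ∧ EqOn F f (closure Ω) := by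
  -- Tietze's theorem is applied on the closure together with the exterior of a ball, where the
  -- function is zero; the second set forces the extension to have compact support.
  set T : Set (Eu n) := closure Ω ∪ {x | R + 1 ≤ ‖x‖} with hT
  have hcl : IsClosed {x : Eu n | R + 1 ≤ ‖x‖} := isClosed_le continuous_const continuous_norm
  have hTc : IsClosed T := isClosed_closure.union hcl
  have hzero : ContinuousOn f {x : Eu n | R + 1 ≤ ‖x‖} :=
    (continuousOn_const (c := (0 : ℝ))).congr fun x hx => hR x (by
      have : R + 1 ≤ ‖x‖ := hx
      linarith)
  have hfT : ContinuousOn f T := hf.union_of_isClosed hzero isClosed_closure hcl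
  obtain ⟨F, hF⟩ := ContinuousMap.exists_restrict_eq hTc ⟨T.domRestrict f, hfT.domRestrict⟩
  have hFe : EqOn F f T := fun x hx => by
    have := congrArg (fun g => g ⟨x, hx⟩) hF
    exact this
  refine ⟨F, F.continuous, ?_, hFe.mono subset_union_left⟩
  refine HasCompactSupport.intro (isCompact_closedBall (0 : Eu n) (R + 1)) fun x hx => ?_
  have hx' : R + 1 < ‖x‖ := by simpa using hx
  rw [hFe (Or.inr hx'.le)]
  exact hR x (by linarith)

lemma integrableOn_frontier (h : TubeBound Ω K ℓ) {R : ℝ} (hf : ContinuousOn f (closure Ω))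
    (hR : ∀ x, R < ‖x‖ → f x = 0) :
    IntegrableOn f (frontier Ω) (Measure.euclideanHausdorffMeasure (n - 1)) := by
  obtain ⟨F, hFc, hFs, hFe⟩ := exists_extension hf hR
  exact (h.integrableOn_frontier_of_continuous hFc hFs).congr_fun
    (hFe.mono frontier_subset_closure) isClosed_frontier.measurableSet

/-- The divergence theorem, in one direction at a time. -/
theorem integral_fderivWithin (h : TubeBound Ω K ℓ) {R : ℝ} (hf : ContDiffOn ℝ 1 f (closure Ω))
    (hR : ∀ x, R < ‖x‖ → f x = 0) (v : Eu n) :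
    ∫ x in Ω, fderivWithin ℝ f (closure Ω) x v
      = ∫ x in frontier Ω, inner ℝ (normalExt Ω ℓ x) v * f x
        ∂(Measure.euclideanHausdorffMeasure (n - 1)) := by
  have hInt : IntegrableOn (fun x => fderivWithin ℝ f (closure Ω) x v) Ω :=
    (integrableOn_of_continuousOn_closure (R := R)
      (continuousOn_fderivWithin_apply h.smooth.uniqueDiffOn_closure hf v) fun x hx => by
        rw [fderivWithin_eq_zero_of_lt hR hx, zero_apply]).mono_set subset_closure
  have hgc : ContinuousOn (fun x => inner ℝ (normalExt Ω ℓ x) v * f x) (closure Ω) :=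
    ((h.contDiff_normalExt.continuous.inner continuous_const).continuousOn).mul hf.continuousOn
  obtain ⟨F, hFc, hFs, hFe⟩ := exists_extension hgc (R := R) fun x hx => by rw [hR x hx, mul_zero]
  have h1 := h.tendsto_collar hFc hFs
  rw [setIntegral_congr_fun isClosed_frontier.measurableSet
    (hFe.mono frontier_subset_closure)] at h1
  -- The two sides of the cutoff identity agree for every small ε. One tends to the interior
  -- integral because the cutoff tends to 1, the other to the boundary integral by the collar limit.
  refine tendsto_nhds_unique (h.tendsto_integral_collarCutoff hInt) (h1.congr' ?_)
  filter_upwards [Ioo_mem_nhdsGT (show (0 : ℝ) < ℓ / 8 by linarith [h.pos])] with ε hε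
  rw [h.integral_collarCutoff hε.1 (by linarith [hε.2]) hf hR]
  refine setIntegral_congr_fun h.smooth.1.measurableSet fun x hx => ?_
  rw [hFe (subset_closure hx)]

end TubeBound

/-! ### Algebra of symmetric tensors -/

/-- The standard basis vectors. -/
abbrev eb {n : ℕ} (i : Fin n) : Eu n := EuclideanSpace.basisFun (Fin n) ℝ i

/-- The map `v ↦ v - ⟨X, v⟩ X`. -/
def normalProj {n : ℕ} (X : Eu n) : Eu n →L[ℝ] Eu n :=
  ContinuousLinearMap.id ℝ (Eu n) - (innerSL ℝ X).smulRight X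

section TensorAlgebra

variable {n s : ℕ}

lemma normalProj_apply (X v : Eu n) : normalProj X v = v - inner ℝ X v • X := by
  simp [normalProj]

lemma norm_eb (i : Fin n) : ‖eb i‖ = 1 := (EuclideanSpace.basisFun (Fin n) ℝ).norm_eq_one i

lemma inner_eb (X : Eu n) (i : Fin n) : inner ℝ X (eb i) = X i := by
  rw [eb, EuclideanSpace.basisFun_apply, EuclideanSpace.inner_single_right]
  simp

lemma sum_eb (v : Eu n) : v = ∑ i, v i • eb i := by
  have := ((EuclideanSpace.basisFun (Fin n) ℝ).sum_repr v).symm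
  simpa using this

lemma abs_coord_le (v : Eu n) (i : Fin n) : |v i| ≤ ‖v‖ := by
  simpa using PiLp.norm_apply_le v i

lemma norm_normalProj_le {X : Eu n} (hX : ‖X‖ ≤ 1) (v : Eu n) : ‖normalProj X v‖ ≤ ‖v‖ := by
  refine abs_le_of_sq_le_sq' ?_ (norm_nonneg _) |>.2
  rw [normalProj_apply, norm_sub_sq_real, inner_smul_right, norm_smul, mul_pow, Real.norm_eq_abs,
    sq_abs, real_inner_comm X v]
  have h1 : ‖X‖ ^ 2 ≤ 1 := pow_le_one₀ (norm_nonneg _) hX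
  nlinarith [sq_nonneg (inner ℝ v X)]

lemma tensor_expand (α : Tensor n s) (v : Fin s → Eu n) :
    α v = ∑ I : Fin s → Fin n, (∏ k, v k (I k)) * α fun k => eb (I k) := by
  have h1 : v = fun k => ∑ i, v k i • eb i := funext fun k => sum_eb (v k)
  conv_lhs => rw [h1]
  rw [← ContinuousMultilinearMap.coe_coe, MultilinearMap.map_sum]
  refine Finset.sum_congr rfl fun I _ => ?_
  exact MultilinearMap.map_smul_univ _ (fun k => v k (I k)) _

lemma tensorNormSq_nonneg (α : Tensor n s) : 0 ≤ tensorNormSq α :=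
  Finset.sum_nonneg fun _ _ => sq_nonneg _

lemma abs_basis_le_sqrt (α : Tensor n s) (I : Fin s → Fin n) :
    |α fun k => eb (I k)| ≤ √(tensorNormSq α) := by
  refine Real.abs_le_sqrt ?_
  exact Finset.single_le_sum (f := fun I : Fin s → Fin n => (α fun k => eb (I k)) ^ 2)
    (fun _ _ => sq_nonneg _) (Finset.mem_univ I)

lemma abs_tensor_le_of_basis (α : Tensor n s) {M : ℝ}
    (hM : ∀ I : Fin s → Fin n, |α fun k => eb (I k)| ≤ M) {v : Fin s → Eu n}
    (hv : ∀ k, ‖v k‖ ≤ 1) : |α v| ≤ (n : ℝ) ^ s * M := by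
  rw [tensor_expand]
  refine (Finset.abs_sum_le_sum_abs _ _).trans ?_
  calc ∑ I : Fin s → Fin n, |(∏ k, v k (I k)) * α fun k => eb (I k)|
      ≤ ∑ _I : Fin s → Fin n, M := by
        refine Finset.sum_le_sum fun I _ => ?_
        rw [abs_mul, Finset.abs_prod]
        have h1 : ∏ k, |v k (I k)| ≤ 1 := Finset.prod_le_one (fun k _ => abs_nonneg _)
          fun k _ => (abs_coord_le _ _).trans (hv k)
        calc _ ≤ 1 * M := mul_le_mul h1 (hM I) (abs_nonneg _) zero_le_one
          _ = M := one_mul M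
    _ = _ := by simp

lemma abs_tensor_le (α : Tensor n s) {v : Fin s → Eu n} (hv : ∀ k, ‖v k‖ ≤ 1) :
    |α v| ≤ (n : ℝ) ^ s * √(tensorNormSq α) :=
  abs_tensor_le_of_basis α (abs_basis_le_sqrt α) hv

lemma tensorNormSq_le_of_basis (α : Tensor n s) {M : ℝ}
    (hM : ∀ I : Fin s → Fin n, |α fun k => eb (I k)| ≤ M) :
    tensorNormSq α ≤ (n : ℝ) ^ s * M ^ 2 := by
  rw [tensorNormSq]
  calc _ ≤ ∑ _I : Fin s → Fin n, M ^ 2 := Finset.sum_le_sum fun I _ =>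
        sq_le_sq' (abs_le.1 (hM I)).1 (abs_le.1 (hM I)).2
    _ = _ := by simp

lemma tensor_update_sum_smul (α : Tensor n s) (u : Fin s → Eu n) (j : Fin s) (c : Fin n → ℝ)
    (w : Fin n → Eu n) :
    α (Function.update u j (∑ l, c l • w l)) = ∑ l, c l * α (Function.update u j (w l)) := by
  rw [← ContinuousMultilinearMap.coe_coe, MultilinearMap.map_update_sum]
  refine Finset.sum_congr rfl fun l _ => ?_
  rw [MultilinearMap.map_update_smul, smul_eq_mul]

lemma tensor_update_split (α : Tensor n s) (X : Eu n) (u : Fin s → Eu n) (j : Fin s) (a : Eu n) :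
    α (Function.update u j a) = α (Function.update u j (normalProj X a))
      + inner ℝ X a * α (Function.update u j X) := by
  have h1 : a = normalProj X a + inner ℝ X a • X := by rw [normalProj_apply]; abel
  conv_lhs => rw [h1]
  rw [ContinuousMultilinearMap.map_update_add, ContinuousMultilinearMap.map_update_smul,
    smul_eq_mul]

/-- Since e_l - Pe_l = X_l X, summing α(e_l - Pe_l, e_l) over l produces α(X, X), whatever the
length of X. Two normal slots are thus exchanged for a trace and for terms with one slot projected;
this is how Δq determines the normal derivatives. -/
lemma tensor_double_normal (α : Tensor n s) (X : Eu n) (u : Fin s → Eu n) {i j : Fin s}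
    (hij : i ≠ j) :
    α (Function.update (Function.update u i X) j X)
      = (∑ l, α (Function.update (Function.update u i (eb l)) j (eb l)))
        - ∑ l, α (Function.update (Function.update u i (normalProj X (eb l))) j (eb l)) := by
  rw [← Finset.sum_sub_distrib]
  have h1 : ∀ l, α (Function.update (Function.update u i (eb l)) j (eb l))
      - α (Function.update (Function.update u i (normalProj X (eb l))) j (eb l))
      = X l * α (Function.update (Function.update u i X) j (eb l)) := by
    intro l
    rw [Function.update_comm hij, tensor_update_split α X, Function.update_comm hij.symm,
      Function.update_comm hij.symm, inner_eb]
    ring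
  rw [Finset.sum_congr rfl fun l _ => h1 l, ← tensor_update_sum_smul, ← sum_eb]

open Classical in
/-- The arguments `v` with the slots in `S` projected. -/
def projOn (X : Eu n) (S : Finset (Fin s)) (v : Fin s → Eu n) : Fin s → Eu n :=
  fun k => if k ∈ S then normalProj X (v k) else v k

lemma projOn_insert (X : Eu n) (S : Finset (Fin s)) (v : Fin s → Eu n) {i : Fin s} (hi : i ∉ S)
    (a : Eu n) : projOn X (insert i S) (Function.update v i a)
      = Function.update (projOn X S v) i (normalProj X a) := by
  funext k
  by_cases hk : k = i
  · subst hk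
    simp [projOn]
  · simp [projOn, hk, Function.update_of_ne]

lemma projOn_update (X : Eu n) (S : Finset (Fin s)) (v : Fin s → Eu n) {i : Fin s} (hi : i ∉ S)
    (a : Eu n) : projOn X S (Function.update v i a) = Function.update (projOn X S v) i a := by
  funext k
  by_cases hk : k = i
  · subst hk
    simp [projOn, hi]
  · simp [projOn, hk, Function.update_of_ne]

lemma norm_projOn_le {X : Eu n} (hX : ‖X‖ ≤ 1) (S : Finset (Fin s)) {v : Fin s → Eu n}
    (hv : ∀ k, ‖v k‖ ≤ 1) (k : Fin s) : ‖projOn X S v k‖ ≤ 1 := by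
  rw [projOn]
  split_ifs
  · exact (norm_normalProj_le hX _).trans (hv k)
  · exact hv k

lemma norm_update_le {v : Fin s → Eu n} (hv : ∀ k, ‖v k‖ ≤ 1) (i : Fin s) {a : Eu n}
    (ha : ‖a‖ ≤ 1) (k : Fin s) : ‖Function.update v i a k‖ ≤ 1 := by
  by_cases hk : k = i
  · subst hk; simpa using ha
  · simpa [Function.update_of_ne hk] using hv k

/-- The constants in the recovery of a tensor from its projections and traces. -/
def recoveryConst (n : ℕ) : ℕ → ℝ
  | 0 => 1
  | k + 1 => (n + 2) * recoveryConst n k + 1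

lemma one_le_recoveryConst (n k : ℕ) : 1 ≤ recoveryConst n k := by
  induction k with
  | zero => exact le_rfl
  | succ k ih =>
    rw [recoveryConst]
    have : (0 : ℝ) ≤ n := Nat.cast_nonneg n
    nlinarith

/-- Induction on the number of unprojected slots, at most k + 1 at stage k. When two are left, each
is split into its projected and normal parts; a term with a projected part has fewer free slots, and
the doubly normal term is treated by `tensor_double_normal`. This accounts for the recursion c ↦ (n
+ 2)c + 1 of the constants. -/
lemma abs_tensor_projOn_le [NeZero s] (α : Tensor n s) {X : Eu n} (hX : ‖X‖ ≤ 1) {M : ℝ}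
    (hM : 0 ≤ M)
    (hbase : ∀ (i : Fin s) (v : Fin s → Eu n) (w : Eu n), (∀ k, ‖v k‖ ≤ 1) → ‖w‖ ≤ 1 →
      |α (Function.update (fun k => normalProj X (v k)) i w)| ≤ M)
    (htr : ∀ (i j : Fin s) (v : Fin s → Eu n), i ≠ j → (∀ k, ‖v k‖ ≤ 1) →
      |∑ l, α (Function.update (Function.update v i (eb l)) j (eb l))| ≤ M) (k : ℕ) :
    ∀ (S : Finset (Fin s)) (v : Fin s → Eu n), (Sᶜ).card ≤ k + 1 → (∀ k, ‖v k‖ ≤ 1) →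
      |α (projOn X S v)| ≤ recoveryConst n k * M := by
  induction k with
  | zero =>
    intro S v hS hv
    obtain ⟨i, hi⟩ : ∃ i : Fin s, Sᶜ ⊆ {i} := by
      rcases Finset.card_le_one_iff_subset_singleton.1 hS with ⟨i, hi⟩
      exact ⟨i, hi⟩
    have h1 : projOn X S v = Function.update (fun k => normalProj X (v k)) i (projOn X S v i) := by
      funext k
      by_cases hk : k = i
      · subst hk; simp
      · have : k ∈ S := by
          by_contra hcon
          exact hk (Finset.mem_singleton.1 (hi (Finset.mem_compl.2 hcon)))
        simp [projOn, this, Function.update_of_ne hk]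
    rw [h1, recoveryConst, one_mul]
    exact hbase i v _ hv (norm_projOn_le hX S hv i)
  | succ k ih =>
    intro S v hS hv
    have hrc := one_le_recoveryConst n k
    by_cases hS' : (Sᶜ).card ≤ k + 1
    · refine (ih S v hS' hv).trans ?_
      rw [recoveryConst]
      have : (0 : ℝ) ≤ n := Nat.cast_nonneg n
      gcongr
      nlinarith
    -- Only the case of exactly k + 2 ≥ 2 free slots is new.
    obtain ⟨i, hi, j, hj, hij⟩ := Finset.one_lt_card.1 (show 1 < (Sᶜ).card by omega)
    rw [Finset.mem_compl] at hi hj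
    have hins : ∀ i : Fin s, i ∉ S → ((insert i S)ᶜ).card ≤ k + 1 := by
      intro i hi
      rw [Finset.compl_insert, Finset.card_erase_of_mem (Finset.mem_compl.2 hi)]
      omega
    set u := projOn X S v with hu
    have hu1 : ∀ k, ‖u k‖ ≤ 1 := norm_projOn_le hX S hv
    have hui : u = Function.update u i (v i) := by
      funext k
      by_cases hk : k = i
      · subst hk; simp [hu, projOn, hi]
      · simp [Function.update_of_ne hk]
    have huj : u = Function.update u j (v j) := by
      funext k
      by_cases hk : k = j
      · subst hk; simp [hu, projOn, hj]
      · simp [Function.update_of_ne hk]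
    have e1 : α u = α (Function.update u i (normalProj X (v i)))
        + inner ℝ X (v i) * α (Function.update u i X) := by
      conv_lhs => rw [hui]
      exact tensor_update_split α X u i (v i)
    have e2 : α (Function.update u i X)
        = α (Function.update (Function.update u i X) j (normalProj X (v j)))
          + inner ℝ X (v j) * α (Function.update (Function.update u i X) j X) := by
      have : Function.update u i X = Function.update (Function.update u i X) j (v j) := by
        conv_lhs => rw [huj, Function.update_comm hij.symm]
      conv_lhs => rw [this]
      exact tensor_update_split α X _ j (v j)
    have e3 := tensor_double_normal α X u hij
    have hXv : ∀ k, |inner ℝ X (v k)| ≤ 1 := fun k =>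
      (abs_real_inner_le_norm X (v k)).trans (mul_le_one₀ hX (norm_nonneg _) (hv k))
    have b1 : |α (Function.update u i (normalProj X (v i)))| ≤ recoveryConst n k * M := by
      rw [hu, ← projOn_insert X S v hi]
      exact ih _ _ (hins i hi) (norm_update_le hv i (hv i))
    have b2 : |α (Function.update (Function.update u i X) j (normalProj X (v j)))|
        ≤ recoveryConst n k * M := by
      rw [hu, ← projOn_update X S v hi, ← projOn_insert X S _ hj]
      exact ih _ _ (hins j hj) (norm_update_le (norm_update_le hv i hX) j (hv j))
    have b3 : |∑ l, α (Function.update (Function.update u i (eb l)) j (eb l))| ≤ M :=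
      htr i j u hij hu1
    have b4 : |∑ l, α (Function.update (Function.update u i (normalProj X (eb l))) j (eb l))|
        ≤ n * (recoveryConst n k * M) := by
      refine (Finset.abs_sum_le_sum_abs _ _).trans ?_
      calc _ ≤ ∑ _l : Fin n, recoveryConst n k * M := by
            refine Finset.sum_le_sum fun l _ => ?_
            have hj' : j ∉ insert i S := by
              rw [Finset.mem_insert, not_or]; exact ⟨hij.symm, hj⟩
            rw [hu, ← projOn_insert X S v hi, ← projOn_update X _ _ hj']
            exact ih _ _ (hins i hi)
              (norm_update_le (norm_update_le hv i (norm_eb l).le) j (norm_eb l).le)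
        _ = _ := by simp
    have b5 : |α (Function.update (Function.update u i X) j X)|
        ≤ M + n * (recoveryConst n k * M) := by
      rw [e3]
      exact (abs_sub _ _).trans (add_le_add b3 b4)
    have b6 : |α (Function.update u i X)|
        ≤ recoveryConst n k * M + (M + n * (recoveryConst n k * M)) := by
      rw [e2]
      refine (abs_add_le _ _).trans (add_le_add b2 ?_)
      rw [abs_mul]
      exact (mul_le_of_le_one_left (abs_nonneg _) (hXv j)).trans b5
    calc |α u| ≤ recoveryConst n k * M
          + (recoveryConst n k * M + (M + n * (recoveryConst n k * M))) := by
          rw [e1]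
          refine (abs_add_le _ _).trans (add_le_add b1 ?_)
          rw [abs_mul]
          exact (mul_le_of_le_one_left (abs_nonneg _) (hXv i)).trans b6
      _ = _ := by rw [recoveryConst]; ring

/-- A tensor is symmetric if it is invariant under permutations of its arguments. -/
def IsSymmTensor (α : Tensor n s) : Prop :=
  ∀ (σ : Equiv.Perm (Fin s)) (v : Fin s → Eu n), α (v ∘ σ) = α v

end TensorAlgebra

/-! ### Recovery of a symmetric tensor from its trace and its projected components -/

section SymmetricRecovery

variable {n m : ℕ}

/-- The trace of a tensor over its first two slots. -/
def tensorTrace (α : Tensor n (m + 2)) (A : Fin m → Fin n) : ℝ :=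
  ∑ l, α (Matrix.vecCons (eb l) (Matrix.vecCons (eb l) fun k => eb (A k)))

lemma abs_vecCons_le (α : Tensor n (m + 1)) (P : Eu n →L[ℝ] Eu n) {M : ℝ}
    (hM : ∀ (i : Fin n) (C : Fin m → Fin n),
      |α (Matrix.vecCons (eb i) fun k => P (eb (C k)))| ≤ M)
    {w : Eu n} {v : Fin m → Eu n} (hw : ‖w‖ ≤ 1) (hv : ∀ k, ‖v k‖ ≤ 1) :
    |α (Matrix.vecCons w fun k => P (v k))| ≤ (n : ℝ) ^ (m + 1) * M := by
  let Q : Fin (m + 1) → Eu n →L[ℝ] Eu n :=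
    Matrix.vecCons (ContinuousLinearMap.id ℝ (Eu n)) fun _ => P
  have hQ : ∀ (w : Eu n) (v : Fin m → Eu n),
      (fun k => Q k (Matrix.vecCons w v k)) = Matrix.vecCons w fun k => P (v k) := by
    intro w v
    funext k
    refine Fin.cases ?_ (fun k => ?_) k <;> simp [Q]
  have h1 := abs_tensor_le_of_basis (α.compContinuousLinearMap Q) (M := M)
    (v := Matrix.vecCons w v) ?_ ?_
  · rw [ContinuousMultilinearMap.compContinuousLinearMap_apply, hQ] at h1
    exact h1
  · intro I
    have h2 : (fun k => Q k (eb (I k)))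
        = Matrix.vecCons (eb (I 0)) fun k => P (eb (I k.succ)) := by
      funext k
      refine Fin.cases ?_ (fun k => ?_) k <;> simp [Q]
    rw [ContinuousMultilinearMap.compContinuousLinearMap_apply, h2]
    exact hM _ _
  · intro k
    refine Fin.cases ?_ (fun k => ?_) k
    · simpa using hw
    · simpa using hv k

lemma abs_trace_le (α : Tensor n (m + 2)) {M : ℝ} (hM : ∀ A, |tensorTrace α A| ≤ M)
    {v : Fin m → Eu n} (hv : ∀ k, ‖v k‖ ≤ 1) :
    |∑ l, α (Matrix.vecCons (eb l) (Matrix.vecCons (eb l) v))| ≤ (n : ℝ) ^ m * M := by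
  let β : Tensor n m := ∑ l, (α.curryLeft (eb l)).curryLeft (eb l)
  have hβ : ∀ v, β v = ∑ l, α (Matrix.vecCons (eb l) (Matrix.vecCons (eb l) v)) := by
    intro v
    simp only [β, sum_apply, ContinuousMultilinearMap.curryLeft_apply]
    rfl
  rw [← hβ]
  refine abs_tensor_le_of_basis β (fun I => ?_) hv
  rw [hβ]
  exact hM I

lemma IsSymmTensor.update_eq {α : Tensor n (m + 1)} (hα : IsSymmTensor α) (P : Eu n → Eu n)
    (v : Fin (m + 1) → Eu n) (i : Fin (m + 1)) (w : Eu n) :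
    α (Function.update (fun k => P (v k)) i w)
      = α (Matrix.vecCons w fun k => P (v (Equiv.swap 0 i k.succ))) := by
  rw [← hα (Equiv.swap 0 i)]
  congr 1
  funext k
  refine Fin.cases ?_ (fun k => ?_) k
  · simp
  · have h1 : Equiv.swap 0 i k.succ ≠ i := by
      intro hcon
      have := (Equiv.swap 0 i).injective (hcon.trans (Equiv.swap_apply_left 0 i).symm)
      exact Fin.succ_ne_zero k this
    simp [Function.update_of_ne h1]

lemma IsSymmTensor.update_update_eq {α : Tensor n (m + 2)} (hα : IsSymmTensor α)
    {i j : Fin (m + 2)} (hij : i ≠ j) (v : Fin (m + 2) → Eu n) :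
    ∃ σ : Equiv.Perm (Fin (m + 2)), ∀ a b,
      α (Function.update (Function.update v i a) j b)
        = α (Matrix.vecCons a (Matrix.vecCons b fun k => v (σ k.succ.succ))) := by
  set j' := Equiv.swap 0 i j with hj'
  have hj0 : j' ≠ 0 := by
    intro hcon
    have : Equiv.swap 0 i j = Equiv.swap 0 i i := by rw [← hj', hcon, Equiv.swap_apply_right]
    exact hij ((Equiv.swap 0 i).injective this).symm
  set σ : Equiv.Perm (Fin (m + 2)) := (Equiv.swap 1 j').trans (Equiv.swap 0 i) with hσ
  have hσ0 : σ 0 = i := by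
    rw [hσ, Equiv.trans_apply, Equiv.swap_apply_of_ne_of_ne (by simp) hj0.symm,
      Equiv.swap_apply_left]
  have hσ1 : σ 1 = j := by
    rw [hσ, Equiv.trans_apply, Equiv.swap_apply_left, hj', Equiv.swap_apply_self]
  refine ⟨σ, fun a b => ?_⟩
  rw [← hα σ]
  congr 1
  funext k
  refine Fin.cases ?_ (fun k => ?_) k
  · simp [hσ0, Function.update_of_ne hij]
  · refine Fin.cases ?_ (fun k => ?_) k
    · simp only [Function.comp_apply, Fin.succ_zero_eq_one, hσ1]
      simp
    · have h1 : σ k.succ.succ ≠ i := by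
        rw [← hσ0]; exact fun hcon => Fin.succ_ne_zero _ (σ.injective hcon)
      have h2 : σ k.succ.succ ≠ j := by
        rw [← hσ1]
        intro hcon
        have := σ.injective hcon
        rw [← Fin.succ_zero_eq_one] at this
        exact Fin.succ_ne_zero _ (Fin.succ_injective _ this)
      simp [Function.update_of_ne h1, Function.update_of_ne h2]

/-- A symmetric tensor is controlled by its components with all but one slot projected, together
with its trace. -/
lemma IsSymmTensor.tensorNormSq_le {α : Tensor n (m + 2)} (hα : IsSymmTensor α) {X : Eu n}
    (hX : ‖X‖ ≤ 1) {M : ℝ} (hM : 0 ≤ M)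
    (hb : ∀ (i : Fin n) (C : Fin (m + 1) → Fin n),
      |α (Matrix.vecCons (eb i) fun k => normalProj X (eb (C k)))| ≤ M)
    (ht : ∀ A, |tensorTrace α A| ≤ M) :
    tensorNormSq α
      ≤ (n : ℝ) ^ (m + 2) * (recoveryConst n (m + 1) * (((n : ℝ) + 1) ^ (m + 2) * M)) ^ 2 := by
  have hn1 : (1 : ℝ) ≤ n + 1 := by
    have : (0 : ℝ) ≤ n := Nat.cast_nonneg n
    linarith
  have hpow : ∀ k ≤ m + 2, (n : ℝ) ^ k * M ≤ ((n : ℝ) + 1) ^ (m + 2) * M := fun k hk => by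
    refine mul_le_mul_of_nonneg_right ?_ hM
    calc (n : ℝ) ^ k ≤ ((n : ℝ) + 1) ^ k := by gcongr; linarith
      _ ≤ _ := pow_le_pow_right₀ hn1 hk
  have hM' : 0 ≤ ((n : ℝ) + 1) ^ (m + 2) * M := by positivity
  refine tensorNormSq_le_of_basis α fun I => ?_
  have h1 : (fun k => eb (I k)) = projOn X ∅ fun k => eb (I k) := by
    funext k; simp [projOn]
  rw [h1]
  refine abs_tensor_projOn_le α hX hM' ?_ ?_ (m + 1) ∅ _ (by simp) fun k => (norm_eb _).le
  · intro i v w hv hw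
    rw [hα.update_eq]
    exact (abs_vecCons_le α _ hb hw fun k => hv _).trans (hpow _ le_rfl)
  · intro i j v hij hv
    obtain ⟨σ, hσ⟩ := hα.update_update_eq hij v
    simp_rw [hσ]
    exact (abs_trace_le α ht fun k => hv _).trans (hpow _ (by omega))

end SymmetricRecovery

/-! ### Partial derivatives up to the boundary and integral identities -/

/-- The partial derivative `∂_i g`, up to the boundary of `Ω`. -/
def pd {n : ℕ} (Ω : Set (Eu n)) (i : Fin n) (g : Eu n → ℝ) (x : Eu n) : ℝ :=
  fderivWithin ℝ g (closure Ω) x (eb i)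

/-- The surface measure of the boundary of `Ω`. -/
def bdryMeasure {n : ℕ} (Ω : Set (Eu n)) : Measure (Eu n) :=
  (Measure.euclideanHausdorffMeasure (n - 1)).restrict (frontier Ω)

section PartialDerivatives

variable {n : ℕ} {Ω : Set (Eu n)} {f g : Eu n → ℝ} {x : Eu n} {i j : Fin n}

lemma pd_mul (hu : UniqueDiffOn ℝ (closure Ω)) (hx : x ∈ closure Ω)
    (hf : ContDiffOn ℝ 1 f (closure Ω)) (hg : ContDiffOn ℝ 1 g (closure Ω)) :
    pd Ω i (fun x => f x * g x) x = f x * pd Ω i g x + g x * pd Ω i f x := by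
  rw [pd, fderivWithin_fun_mul (hu x hx) (hf.differentiableOn (by simp) x hx)
    (hg.differentiableOn (by simp) x hx)]
  simp [pd]

lemma pd_sum {ι : Type*} {s : Finset ι} {F : ι → Eu n → ℝ} (hu : UniqueDiffOn ℝ (closure Ω))
    (hx : x ∈ closure Ω) (hF : ∀ k ∈ s, ContDiffOn ℝ 1 (F k) (closure Ω)) :
    pd Ω i (fun x => ∑ k ∈ s, F k x) x = ∑ k ∈ s, pd Ω i (F k) x := by
  rw [pd, fderivWithin_fun_sum (hu x hx) fun k hk => (hF k hk).differentiableOn (by simp) x hx]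
  simp [pd]

lemma ContDiffOn.pd' {k : ℕ} (hu : UniqueDiffOn ℝ (closure Ω))
    (hg : ContDiffOn ℝ (k + 1 : ℕ) g (closure Ω)) : ContDiffOn ℝ k (pd Ω i g) (closure Ω) :=
  (hg.fderivWithin hu (by norm_cast)).clm_apply contDiffOn_const

lemma continuousOn_pd (hu : UniqueDiffOn ℝ (closure Ω)) (hg : ContDiffOn ℝ 1 g (closure Ω)) :
    ContinuousOn (pd Ω i g) (closure Ω) := continuousOn_fderivWithin_apply hu hg _

lemma pd_eq_zero_of_lt {R : ℝ} (hR : ∀ x, R < ‖x‖ → g x = 0) (hx : R < ‖x‖) :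
    pd Ω i g x = 0 := by
  rw [pd, fderivWithin_eq_zero_of_lt hR hx, zero_apply]

lemma pd_comm (hΩ : IsOpen Ω) (hg : ContDiffOn ℝ 2 g (closure Ω)) (hx : x ∈ Ω) :
    pd Ω i (pd Ω j g) x = pd Ω j (pd Ω i g) x := by
  have hnc : ∀ y ∈ Ω, closure Ω ∈ 𝓝 y := fun y hy =>
    mem_of_superset (hΩ.mem_nhds hy) subset_closure
  have hgx : ContDiffAt ℝ 2 g x := hg.contDiffAt (hnc x hx)
  have hsymm : IsSymmSndFDerivAt ℝ g x := hgx.isSymmSndFDerivAt (by simp)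
  have h1 : ∀ k l : Fin n, pd Ω k (pd Ω l g) x = fderiv ℝ (fderiv ℝ g) x (eb k) (eb l) := by
    intro k l
    have e1 : pd Ω l g =ᶠ[𝓝 x] fun y => fderiv ℝ g y (eb l) := by
      filter_upwards [hΩ.mem_nhds hx] with y hy
      rw [pd, fderivWithin_of_mem_nhds (hnc y hy)]
    rw [pd, fderivWithin_of_mem_nhds (hnc x hx), e1.fderiv_eq]
    have h2 : DifferentiableAt ℝ (fderiv ℝ g) x :=
      (hgx.fderiv_right (m := 1) (by norm_num)).differentiableAt (by simp)
    have h3 := h2.hasFDerivAt.clm_apply (hasFDerivAt_const (eb l) x)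
    rw [h3.fderiv]
    simp
  rw [h1, h1, hsymm]

end PartialDerivatives

namespace TubeBound

variable {n : ℕ} {Ω : Set (Eu n)} {K ℓ R : ℝ}

/-- The coordinates of the extended normal field. -/
def _root_.WeightedElliptic.nc (Ω : Set (Eu n)) (ℓ : ℝ) (i : Fin n) (x : Eu n) : ℝ :=
  normalExt Ω ℓ x i

lemma contDiff_nc (h : TubeBound Ω K ℓ) (i : Fin n) : ContDiff ℝ ∞ (nc Ω ℓ i) :=
  (contDiff_piLp_apply (p := 2) (i := i)).comp h.contDiff_normalExt

lemma abs_nc_le (h : TubeBound Ω K ℓ) (i : Fin n) (x : Eu n) : |nc Ω ℓ i x| ≤ 1 :=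
  (abs_coord_le _ i).trans (h.norm_normalExt_le x)

lemma abs_pd_nc_le (h : TubeBound Ω K ℓ) (i j : Fin n) {x : Eu n} (hx : x ∈ closure Ω) :
    |pd Ω i (nc Ω ℓ j) x| ≤ normalBumpBound / ℓ + 2 * K := by
  have h1 : HasFDerivAt (nc Ω ℓ j)
      ((EuclideanSpace.proj j : Eu n →L[ℝ] ℝ).comp (fderiv ℝ (normalExt Ω ℓ) x)) x :=
    (EuclideanSpace.proj j : Eu n →L[ℝ] ℝ).hasFDerivAt.comp x
      (h.contDiff_normalExt.differentiable (by simp) x).hasFDerivAt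
  rw [pd, h1.hasFDerivWithinAt.fderivWithin (h.smooth.uniqueDiffOn_closure x hx)]
  have h2 := h.norm_fderiv_normalExt_le x (eb i)
  rw [norm_eb, mul_one] at h2
  exact (abs_coord_le _ j).trans h2

lemma sum_nc_sq (h : TubeBound Ω K ℓ) {x : Eu n} (hx : x ∈ frontier Ω) :
    ∑ i, nc Ω ℓ i x * nc Ω ℓ i x = 1 := by
  have h1 : ‖normalExt Ω ℓ x‖ ^ 2 = 1 := by
    rw [h.normalExt_frontier hx, h.smooth.norm_outerNormal hx, one_pow]
  rw [EuclideanSpace.real_norm_sq_eq] at h1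
  rw [← h1]
  exact Finset.sum_congr rfl fun i _ => (sq _).symm

lemma integrable_bdry (h : TubeBound Ω K ℓ) {f : Eu n → ℝ} (hf : ContinuousOn f (closure Ω))
    (hR : ∀ x, R < ‖x‖ → f x = 0) : Integrable f (bdryMeasure Ω) :=
  h.integrableOn_frontier hf hR

lemma integrableOn (_h : TubeBound Ω K ℓ) {f : Eu n → ℝ} (hf : ContinuousOn f (closure Ω))
    (hR : ∀ x, R < ‖x‖ → f x = 0) : IntegrableOn f Ω :=
  (integrableOn_of_continuousOn_closure hf hR).mono_set subset_closure

lemma integral_pd (h : TubeBound Ω K ℓ) {g : Eu n → ℝ} (hg : ContDiffOn ℝ 1 g (closure Ω))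
    (hR : ∀ x, R < ‖x‖ → g x = 0) (i : Fin n) :
    ∫ x in Ω, pd Ω i g x = ∫ x, nc Ω ℓ i x * g x ∂(bdryMeasure Ω) := by
  have := h.integral_fderivWithin hg hR (eb i)
  simp_rw [inner_eb] at this
  exact this

lemma contDiffOn_nc (h : TubeBound Ω K ℓ) {k : ℕ} (i : Fin n) :
    ContDiffOn ℝ k (nc Ω ℓ i) (closure Ω) :=
  ((h.contDiff_nc i).of_le (by exact_mod_cast le_top)).contDiffOn

lemma integrable_nc_mul (h : TubeBound Ω K ℓ) {g : Eu n → ℝ} (hg : ContinuousOn g (closure Ω))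
    (hR : ∀ x, R < ‖x‖ → g x = 0) (i : Fin n) :
    Integrable (fun x => nc Ω ℓ i x * g x) (bdryMeasure Ω) :=
  h.integrable_bdry (R := R) ((h.contDiff_nc i).continuous.continuousOn.mul hg)
    fun x hx => by rw [hR x hx, mul_zero]

/-- The divergence theorem for a finite family of one-directional fields. -/
lemma integral_sum_pd (h : TubeBound Ω K ℓ) {ι : Type*} (s : Finset ι) (d : ι → Fin n)
    {g : ι → Eu n → ℝ} (hg : ∀ k, ContDiffOn ℝ 1 (g k) (closure Ω))
    (hR : ∀ k x, R < ‖x‖ → g k x = 0) :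
    ∫ x in Ω, ∑ k ∈ s, pd Ω (d k) (g k) x
      = ∫ x, ∑ k ∈ s, nc Ω ℓ (d k) x * g k x ∂(bdryMeasure Ω) := by
  have hu := h.smooth.uniqueDiffOn_closure
  rw [integral_finsetSum, integral_finsetSum]
  · exact Finset.sum_congr rfl fun k _ => h.integral_pd (hg k) (hR k) (d k)
  · exact fun k _ => h.integrable_nc_mul (hg k).continuousOn (hR k) _
  · exact fun k _ => h.integrableOn (continuousOn_pd hu (hg k)) fun x hx =>
      pd_eq_zero_of_lt (hR k) hx

/-- Tangential derivatives of a function integrate to zero over the boundary. -/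
lemma integral_tangential (h : TubeBound Ω K ℓ) {S : Eu n → ℝ} (hS : ContDiffOn ℝ 2 S (closure Ω))
    (hR : ∀ x, R < ‖x‖ → S x = 0) (i j : Fin n) :
    ∫ x, (nc Ω ℓ i x * pd Ω j S x - nc Ω ℓ j x * pd Ω i S x) ∂(bdryMeasure Ω) = 0 := by
  have hu := h.smooth.uniqueDiffOn_closure
  have h1 : ∀ k, ContDiffOn ℝ 1 (pd Ω k S) (closure Ω) := fun k =>
    ContDiffOn.pd' (k := 1) hu (by simpa using hS)
  have h2 : ∀ k x, R < ‖x‖ → pd Ω k S x = 0 := fun k x hx => pd_eq_zero_of_lt hR hx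
  -- By the divergence theorem the boundary integral equals ∫_Ω (∂_i ∂_j S - ∂_j ∂_i S), which
  -- vanishes.
  rw [integral_sub (h.integrable_nc_mul (h1 j).continuousOn (h2 j) i)
    (h.integrable_nc_mul (h1 i).continuousOn (h2 i) j),
    ← h.integral_pd (h1 j) (h2 j), ← h.integral_pd (h1 i) (h2 i), sub_eq_zero]
  exact setIntegral_congr_fun h.smooth.1.measurableSet fun x hx => pd_comm h.smooth.1 hS hx

/-- Integration by parts for a pair of directions; second derivatives cancel. -/
lemma integral_pair (h : TubeBound Ω K ℓ) {g v : Eu n → ℝ} (hg : ContDiffOn ℝ 1 g (closure Ω))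
    (hv : ContDiffOn ℝ 2 v (closure Ω)) (hR : ∀ x, R < ‖x‖ → g x = 0) (i j : Fin n) :
    ∫ x in Ω, (pd Ω i g x * pd Ω j v x - pd Ω j g x * pd Ω i v x)
      = ∫ x, g x * (nc Ω ℓ i x * pd Ω j v x - nc Ω ℓ j x * pd Ω i v x) ∂(bdryMeasure Ω) := by
  have hu := h.smooth.uniqueDiffOn_closure
  have h1 : ∀ k, ContDiffOn ℝ 1 (pd Ω k v) (closure Ω) := fun k =>
    ContDiffOn.pd' (k := 1) hu (by simpa using hv)
  have h2 : ∀ k, ContDiffOn ℝ 1 (fun x => g x * pd Ω k v x) (closure Ω) := fun k => hg.mul (h1 k)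
  have h3 : ∀ k x, R < ‖x‖ → g x * pd Ω k v x = 0 := fun k x hx => by rw [hR x hx, zero_mul]
  have e1 : ∫ x in Ω, (pd Ω i g x * pd Ω j v x - pd Ω j g x * pd Ω i v x)
      = ∫ x in Ω, (pd Ω i (fun x => g x * pd Ω j v x) x - pd Ω j (fun x => g x * pd Ω i v x) x) := by
    refine setIntegral_congr_fun h.smooth.1.measurableSet fun x hx => ?_
    rw [pd_mul hu (subset_closure hx) hg (h1 j), pd_mul hu (subset_closure hx) hg (h1 i),
      pd_comm h.smooth.1 hv hx]
    ring
  rw [e1, integral_sub, h.integral_pd (h2 j) (h3 j), h.integral_pd (h2 i) (h3 i), ← integral_sub]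
  · refine integral_congr_ae (Eventually.of_forall fun x => ?_)
    simp only
    ring
  · exact h.integrable_nc_mul (h2 j).continuousOn (h3 j) i
  · exact h.integrable_nc_mul (h2 i).continuousOn (h3 i) j
  · exact h.integrableOn (continuousOn_pd hu (h2 j)) fun x hx => pd_eq_zero_of_lt (h3 j) hx
  · exact h.integrableOn (continuousOn_pd hu (h2 i)) fun x hx => pd_eq_zero_of_lt (h3 i) hx

end TubeBound

/-! ### Weighted energy inequalities for vector fields -/

/-- Three nested weights of bounded support, each of the first two with its gradient controlled by
the next one. -/
structure CutoffTriple {n : ℕ} (φ ψ η : Eu n → ℝ) (B R : ℝ) : Prop where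
  contDiff_fst : ContDiff ℝ ∞ φ
  contDiff_snd : ContDiff ℝ ∞ ψ
  continuous_trd : Continuous η
  nonneg : ∀ x, 0 ≤ φ x
  fst_le : ∀ x, φ x ≤ ψ x
  snd_le : ∀ x, ψ x ≤ η x
  sq_le : ∀ x, ψ x ^ 2 ≤ φ x * η x
  deriv_fst : ∀ x i, |fderiv ℝ φ x (eb i)| ≤ B * ψ x
  deriv_snd : ∀ x i, |fderiv ℝ ψ x (eb i)| ≤ B * η x
  bound_nonneg : 0 ≤ B
  support : ∀ x, R < ‖x‖ → η x = 0

namespace CutoffTriple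

variable {n : ℕ} {φ ψ η : Eu n → ℝ} {B R : ℝ}

lemma snd_nonneg (h : CutoffTriple φ ψ η B R) (x : Eu n) : 0 ≤ ψ x := (h.nonneg x).trans (h.fst_le x)

lemma trd_nonneg (h : CutoffTriple φ ψ η B R) (x : Eu n) : 0 ≤ η x :=
  (h.snd_nonneg x).trans (h.snd_le x)

lemma support_snd (h : CutoffTriple φ ψ η B R) (x : Eu n) (hx : R < ‖x‖) : ψ x = 0 :=
  le_antisymm ((h.snd_le x).trans (h.support x hx).le) (h.snd_nonneg x)

lemma support_fst (h : CutoffTriple φ ψ η B R) (x : Eu n) (hx : R < ‖x‖) : φ x = 0 :=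
  le_antisymm ((h.fst_le x).trans (h.support_snd x hx).le) (h.nonneg x)

end CutoffTriple

/-! ### Pointwise algebra behind the div-curl estimate -/

section PointwiseInequalities

variable {n : ℕ}

/-- Young's inequality across three weights: from s² ≤ p o, a cross term with the middle weight
splits into one term with the small weight, to be absorbed, and one with the large weight. -/
lemma mul_abs_mul_abs_le {p s o u v ε : ℝ} (hp : 0 ≤ p) (ho : 0 ≤ o)
    (h : s ^ 2 ≤ p * o) (hε : 0 < ε) :
    s * |u| * |v| ≤ ε * (p * v ^ 2) + 1 / (4 * ε) * (o * u ^ 2) := by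
  have h1 : (s * |u| * |v|) ^ 2 ≤ (ε * (p * v ^ 2) + 1 / (4 * ε) * (o * u ^ 2)) ^ 2 := by
    have e1 : (s * |u| * |v|) ^ 2 = s ^ 2 * (u ^ 2 * v ^ 2) := by
      rw [mul_pow, mul_pow, sq_abs, sq_abs]; ring
    have e2 : 4 * (ε * (p * v ^ 2)) * (1 / (4 * ε) * (o * u ^ 2)) = p * o * (u ^ 2 * v ^ 2) := by
      field_simp
    have h2 : s ^ 2 * (u ^ 2 * v ^ 2) ≤ p * o * (u ^ 2 * v ^ 2) :=
      mul_le_mul_of_nonneg_right h (by positivity)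
    rw [e1]
    nlinarith [sq_nonneg (ε * (p * v ^ 2) - 1 / (4 * ε) * (o * u ^ 2))]
  exact (abs_le_of_sq_le_sq' h1 (by positivity)).2

/-- The interior integrand of the div-curl identity dominates the full gradient. -/
lemma divCurl_interior {A : Fin n → Fin n → ℝ} {a dφ : Fin n → ℝ} {p s o B N F : ℝ}
    (hp : 0 ≤ p) (hs : p ≤ s) (ho : s ≤ o) (h : s ^ 2 ≤ p * o)
    (hd : ∀ i, |dφ i| ≤ B * s) (ha : ∀ i, a i ^ 2 ≤ N)
    (hA : ∀ i j, (A i j - A j i) ^ 2 ≤ N) (hF : (∑ i, A i i) ^ 2 ≤ F) :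
    1 / 2 * (p * ∑ i, ∑ j, A i j ^ 2)
      ≤ (∑ i, ∑ j, ((p * A i j + a j * dφ i) * A j i - (p * A j j + a j * dφ j) * A i i))
        + p * F + (n ^ 2 * (1 + 2 * (n + 1) * B ^ 2)) * (o * N) := by
  have hs0 := hp.trans hs
  have ho0 := hs0.trans ho
  -- Summed over i and j, the cross terms cost ε(1 + n) = 1/4 of p|A|², which leaves more than the
  -- required half.
  set ε : ℝ := 1 / (4 * (n + 1)) with hε
  have hε0 : 0 < ε := by positivity
  have hε4 : 1 / (4 * ε) = n + 1 := by rw [hε]; field_simp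
  set Q := ∑ i, ∑ j, A i j ^ 2 with hQ
  have cross : ∀ i j k l : Fin n, |a j * dφ i * A k l|
      ≤ ε * (p * A k l ^ 2) + (n + 1) * B ^ 2 * (o * N) := by
    intro i j k l
    have hN : 0 ≤ N := (sq_nonneg _).trans (ha j)
    have h1 := mul_abs_mul_abs_le (u := B * a j) (v := A k l) hp ho0 h hε0
    rw [hε4] at h1
    have h2 : |a j * dφ i * A k l| ≤ s * |B * a j| * |A k l| := by
      rw [abs_mul, abs_mul, abs_mul]
      refine mul_le_mul_of_nonneg_right ?_ (abs_nonneg _)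
      have h3 : |dφ i| ≤ |B| * s := (hd i).trans (mul_le_mul_of_nonneg_right (le_abs_self B) hs0)
      calc |a j| * |dφ i| ≤ |a j| * (|B| * s) := mul_le_mul_of_nonneg_left h3 (abs_nonneg _)
        _ = _ := by ring
    refine h2.trans (h1.trans ?_)
    have h4 : o * (B * a j) ^ 2 ≤ B ^ 2 * (o * N) := by
      rw [mul_pow]
      have := mul_le_mul_of_nonneg_left (ha j) (mul_nonneg ho0 (sq_nonneg B))
      linarith
    have h5 : (0 : ℝ) ≤ n + 1 := by positivity
    have := mul_le_mul_of_nonneg_left h4 h5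
    linarith
  -- A_ij A_ji = (A_ij² + A_ji²)/2 - (A_ij - A_ji)²/2: the product yields the full gradient up to
  -- the curl, while A_ii A_jj sums to the square of the divergence.
  have key : ∀ i j : Fin n, (p * A i j + a j * dφ i) * A j i - (p * A j j + a j * dφ j) * A i i
      ≥ p * ((A i j ^ 2 + A j i ^ 2) / 2) - 1 / 2 * (o * N) - p * (A i i * A j j)
        - ε * p * (A j i ^ 2 + A i i ^ 2) - 2 * ((n + 1) * B ^ 2 * (o * N)) := by
    intro i j
    have hN : 0 ≤ N := (sq_nonneg _).trans (ha j)
    have h1 := (abs_le.1 (cross i j j i)).1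
    have h2 := (abs_le.1 (cross j j i i)).2
    have h3 := mul_le_mul_of_nonneg_left (hA i j) hp
    have h4 : p * N ≤ o * N := mul_le_mul_of_nonneg_right (hs.trans ho) hN
    nlinarith
  have hsum := Finset.sum_le_sum fun i (_ : i ∈ Finset.univ) =>
    Finset.sum_le_sum fun j (_ : j ∈ Finset.univ) => key i j
  have e1 : ∑ i : Fin n, ∑ j : Fin n, A j i ^ 2 = Q := Finset.sum_comm
  have e3 : ∑ i : Fin n, ∑ _j : Fin n, A i i ^ 2 ≤ n * Q := by
    simp only [Finset.sum_const, Finset.card_univ, Fintype.card_fin, nsmul_eq_mul]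
    rw [← Finset.mul_sum]
    refine mul_le_mul_of_nonneg_left (Finset.sum_le_sum fun i _ => ?_) (Nat.cast_nonneg n)
    exact Finset.single_le_sum (f := fun j => A i j ^ 2) (fun _ _ => sq_nonneg _)
      (Finset.mem_univ i)
  have e4 : ∑ i : Fin n, ∑ j : Fin n, (p * ((A i j ^ 2 + A j i ^ 2) / 2) - 1 / 2 * (o * N)
      - p * (A i i * A j j) - ε * p * (A j i ^ 2 + A i i ^ 2) - 2 * ((n + 1) * B ^ 2 * (o * N)))
      = p * ((Q + Q) / 2) - n ^ 2 * (1 / 2 * (o * N)) - p * (∑ i, A i i) ^ 2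
        - ε * p * (Q + ∑ i : Fin n, ∑ _j : Fin n, A i i ^ 2)
        - n ^ 2 * (2 * ((n + 1) * B ^ 2 * (o * N))) := by
    simp only [Finset.sum_sub_distrib, ← Finset.mul_sum, ← Finset.sum_div, Finset.sum_add_distrib,
      e1, ← hQ, ← Finset.sum_mul, Finset.sum_const, Finset.card_univ, Fintype.card_fin, nsmul_eq_mul]
    ring
  rw [e4] at hsum
  have e5 : ε * p * (Q + ∑ i : Fin n, ∑ _j : Fin n, A i i ^ 2) ≤ 1 / 4 * (p * Q) := by
    calc _ ≤ ε * p * (Q + n * Q) :=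
          mul_le_mul_of_nonneg_left (add_le_add le_rfl e3) (by positivity)
      _ = _ := by rw [hε]; field_simp; ring
  have e6 := mul_le_mul_of_nonneg_left hF hp
  have hQ0 : 0 ≤ p * Q := mul_nonneg hp (by positivity)
  -- That N ≥ 0 is read off from a component of `a`, which exists only for n > 0; for n = 0 the sums
  -- are empty.
  rcases Nat.eq_zero_or_pos n with hn | hn
  · subst hn
    simp at hsum e6 ⊢
    simp [hQ]
    linarith
  have hN : 0 ≤ N := (sq_nonneg _).trans (ha ⟨0, hn⟩)
  have hoN : 0 ≤ (n : ℝ) ^ 2 * (o * N) := by positivity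
  nlinarith

/-- The boundary integrand of the div-curl identity, after subtraction of tangential
divergences. -/
lemma divCurl_boundary_identity {A : Fin n → Fin n → ℝ} {a X : Fin n → ℝ} {p b : ℝ}
    (hX : ∑ i, X i * X i = 1) (hb : b = ∑ i, X i * a i) {S : Fin n → Fin n → Fin n → ℝ}
    {L : Fin n → Fin n → Fin n → ℝ}
    (hS : ∀ k i j, S k i j
      = L k i j + p * X i * A k j * b + p * X i * a j * ∑ l, X l * A k l) :
    ∑ i, ∑ j, (p * a j * (X i * A j i - X j * A i i) - (X i * S j i j - X j * S i i j))
      = -2 * (p * b * ((∑ i, A i i) - ∑ i, X i * ∑ l, X l * A i l))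
        - ∑ i, ∑ j, (X i * L j i j - X j * L i i j) := by
  -- c k is the derivative in direction k of X·a with X frozen. The uncontrolled term Σ a_j c_j
  -- occurs in `h1` and in `h4` with opposite signs, and cancelling it is the purpose of subtracting
  -- the tangential derivatives of S.
  set c : Fin n → ℝ := fun k => ∑ l, X l * A k l with hc
  set d := ∑ i, A i i with hd
  have h1 : ∑ i, ∑ j, p * (a j * (X i * A j i)) = p * ∑ j, a j * c j := by
    rw [Finset.sum_comm]
    simp only [hc, Finset.mul_sum]
  have h2 : ∑ i, ∑ j, p * (A i i * (X j * a j)) = p * (d * b) := by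
    simp only [← Finset.mul_sum]
    rw [← Finset.sum_mul, hb]
  have h3 : ∑ i, ∑ j, p * b * ((X i * X i) * A j j) = p * (b * d) := by
    simp only [← Finset.mul_sum]
    rw [← Finset.sum_mul, hX]; ring
  have h4 : ∑ i, ∑ j, p * ((X i * X i) * (a j * c j)) = p * ∑ j, a j * c j := by
    simp only [← Finset.mul_sum]
    rw [← Finset.sum_mul, hX]; ring
  have h5 : ∑ i, ∑ j, p * b * (X i * (X j * A i j)) = p * b * ∑ i, X i * c i := by
    simp only [← Finset.mul_sum, hc]
  have h6 : ∑ i, ∑ j, p * ((X i * c i) * (X j * a j)) = p * b * ∑ i, X i * c i := by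
    simp only [← Finset.mul_sum]
    rw [← Finset.sum_mul, hb]; ring
  have e : ∀ i j, p * a j * (X i * A j i - X j * A i i) - (X i * S j i j - X j * S i i j)
      = p * (a j * (X i * A j i)) - p * (A i i * (X j * a j)) - p * b * ((X i * X i) * A j j)
        - p * ((X i * X i) * (a j * c j)) + p * b * (X i * (X j * A i j))
        + p * ((X i * c i) * (X j * a j)) - (X i * L j i j - X j * L i i j) := by
    intro i j
    rw [hS, hS]
    simp only [hc]
    ring
  simp only [e, Finset.sum_sub_distrib, Finset.sum_add_distrib, h1, h2, h3, h4, h5, h6]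
  ring

lemma abs_sum_mul_le {X a : Fin n → ℝ} {c α : ℝ} (hX : ∀ i, |X i| ≤ c) (hc : 0 ≤ c)
    (ha : ∀ i, |a i| ≤ α) : |∑ i, X i * a i| ≤ n * (c * α) := by
  refine (Finset.abs_sum_le_sum_abs _ _).trans ?_
  calc _ ≤ ∑ _i : Fin n, c * α := Finset.sum_le_sum fun i _ => by
        rw [abs_mul]; exact mul_le_mul (hX i) (ha i) (abs_nonneg _) hc
    _ = _ := by simp

/-- These are the terms in which the derivative of φ X_i a_j (X·a) falls on the weight or on the
normal; they are quadratic in `a` and contain none of its derivatives. -/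
lemma divCurl_boundary_lower {X a dφ : Fin n → ℝ} {Y : Fin n → Fin n → ℝ} {p s B κ N b : ℝ}
    (hn : 0 < n) (hp : 0 ≤ p) (hs : p ≤ s) (hκ : 0 ≤ κ)
    (hX : ∀ i, |X i| ≤ 1) (hY : ∀ i j, |Y i j| ≤ κ) (hB : 0 ≤ B) (hd : ∀ i, |dφ i| ≤ B * s)
    (ha : ∀ i, a i ^ 2 ≤ N) (hb : b = ∑ i, X i * a i) (k i j : Fin n) :
    |dφ k * X i * a j * b + p * Y k i * a j * b + p * X i * a j * ∑ l, Y k l * a l|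
      ≤ n * (B + 2 * κ) * (s * N) := by
  have hN : 0 ≤ N := (sq_nonneg _).trans (ha ⟨0, hn⟩)
  have hs0 := hp.trans hs
  set α := √N with hα
  have hα0 : 0 ≤ α := Real.sqrt_nonneg _
  have hαα : α * α = N := Real.mul_self_sqrt hN
  have ha' : ∀ i, |a i| ≤ α := fun i => Real.abs_le_sqrt (ha i)
  have hb' : |b| ≤ n * (1 * α) := hb ▸ abs_sum_mul_le hX zero_le_one ha'
  have hc' : |∑ l, Y k l * a l| ≤ n * (κ * α) := abs_sum_mul_le (hY k) hκ ha'
  have h1 : |dφ k * X i * a j * b| ≤ B * s * 1 * α * (n * (1 * α)) := by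
    rw [abs_mul, abs_mul, abs_mul]
    have := hd k; have := hX i; have := ha' j
    gcongr
  have h2 : |p * Y k i * a j * b| ≤ s * κ * α * (n * (1 * α)) := by
    rw [abs_mul, abs_mul, abs_mul, abs_of_nonneg hp]
    have := hY k i; have := ha' j
    gcongr
  have h3 : |p * X i * a j * ∑ l, Y k l * a l| ≤ s * 1 * α * (n * (κ * α)) := by
    rw [abs_mul, abs_mul, abs_mul, abs_of_nonneg hp]
    have := hX i; have := ha' j
    gcongr
  refine (abs_add_three _ _ _).trans ((add_le_add_three h1 h2 h3).trans (le_of_eq ?_))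
  rw [← hαα]
  ring

end PointwiseInequalities
/-! ### Integral inequalities for vector fields -/

section MonotoneCombination

variable {E : Type*} [MeasurableSpace E] {μ : Measure E} {s : Set E} {f g₁ g₂ g₃ : E → ℝ}

lemma setIntegral_le_three (hs : MeasurableSet s) (hf : IntegrableOn f s μ)
    (h₁ : IntegrableOn g₁ s μ) (h₂ : IntegrableOn g₂ s μ) (h₃ : IntegrableOn g₃ s μ) (c₁ c₂ c₃ : ℝ)
    (hle : ∀ x ∈ s, f x ≤ c₁ * g₁ x + c₂ * g₂ x + c₃ * g₃ x) :
    ∫ x in s, f x ∂μ ≤ c₁ * ∫ x in s, g₁ x ∂μ + c₂ * ∫ x in s, g₂ x ∂μ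
      + c₃ * ∫ x in s, g₃ x ∂μ := by
  have e1 : ∫ x in s, (c₁ * g₁ x + c₂ * g₂ x + c₃ * g₃ x) ∂μ = c₁ * (∫ x in s, g₁ x ∂μ)
      + c₂ * (∫ x in s, g₂ x ∂μ) + c₃ * ∫ x in s, g₃ x ∂μ := by
    rw [integral_add (f := fun x => c₁ * g₁ x + c₂ * g₂ x)
      ((h₁.const_mul c₁).add (h₂.const_mul c₂)) (h₃.const_mul c₃),
      integral_add (h₁.const_mul c₁) (h₂.const_mul c₂), integral_const_mul, integral_const_mul,
      integral_const_mul]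
  rw [← e1]
  exact setIntegral_mono_on hf (((h₁.const_mul c₁).add (h₂.const_mul c₂)).add (h₃.const_mul c₃))
    hs hle

lemma setIntegral_le_two (hs : MeasurableSet s) (hf : IntegrableOn f s μ)
    (h₁ : IntegrableOn g₁ s μ) (h₂ : IntegrableOn g₂ s μ) (c₁ c₂ : ℝ)
    (hle : ∀ x ∈ s, f x ≤ c₁ * g₁ x + c₂ * g₂ x) :
    ∫ x in s, f x ∂μ ≤ c₁ * ∫ x in s, g₁ x ∂μ + c₂ * ∫ x in s, g₂ x ∂μ := by
  have := setIntegral_le_three hs hf h₁ h₂ h₂ c₁ c₂ 0 fun x hx => by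
    rw [zero_mul, add_zero]; exact hle x hx
  simpa using this

end MonotoneCombination

namespace TubeBound

variable {n : ℕ} {Ω : Set (Eu n)} {K ℓ B R : ℝ} {φ ψ η : Eu n → ℝ}

lemma integrableOn_mul (h : TubeBound Ω K ℓ) {c f : Eu n → ℝ} (hc : Continuous c)
    (hR : ∀ x, R < ‖x‖ → c x = 0) (hf : ContinuousOn f (closure Ω)) :
    IntegrableOn (fun x => c x * f x) Ω :=
  h.integrableOn (hc.continuousOn.mul hf) fun x hx => by rw [hR x hx, zero_mul]

lemma integrable_bdry_mul (h : TubeBound Ω K ℓ) {c f : Eu n → ℝ} (hc : Continuous c)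
    (hR : ∀ x, R < ‖x‖ → c x = 0) (hf : ContinuousOn f (closure Ω)) :
    Integrable (fun x => c x * f x) (bdryMeasure Ω) :=
  h.integrable_bdry (hc.continuousOn.mul hf) fun x hx => by rw [hR x hx, zero_mul]

/-- A bound for the derivative of the extended normal field. -/
def _root_.WeightedElliptic.normalDerivBound (K ℓ : ℝ) : ℝ := normalBumpBound / ℓ + 2 * K

lemma normalDerivBound_nonneg (h : TubeBound Ω K ℓ) : 0 ≤ normalDerivBound K ℓ := by
  have h1 := normalBumpBound_nonneg
  have h2 := h.nonneg
  have h3 := h.pos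
  rw [normalDerivBound]
  positivity

lemma abs_pd_nc_le' (h : TubeBound Ω K ℓ) (i j : Fin n) {x : Eu n} (hx : x ∈ closure Ω) :
    |pd Ω i (nc Ω ℓ j) x| ≤ normalDerivBound K ℓ := h.abs_pd_nc_le i j hx

lemma pd_eq_fderiv (h : TubeBound Ω K ℓ) {g : Eu n → ℝ} (hg : ContDiff ℝ ∞ g) {x : Eu n}
    (hx : x ∈ closure Ω) (i : Fin n) : pd Ω i g x = fderiv ℝ g x (eb i) := by
  rw [pd, fderivWithin_eq_fderiv (h.smooth.uniqueDiffOn_closure x hx)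
    (hg.differentiable (by simp) x)]

lemma contDiffOn_of_contDiff (_h : TubeBound Ω K ℓ) {g : Eu n → ℝ} (hg : ContDiff ℝ ∞ g) (k : ℕ) :
    ContDiffOn ℝ k g (closure Ω) := (hg.of_le (by exact_mod_cast le_top)).contDiffOn

lemma integral_sum_sum {μ : Measure (Eu n)} {f : Fin n → Fin n → Eu n → ℝ}
    (hf : ∀ i j, Integrable (f i j) μ) :
    ∫ x, ∑ i, ∑ j, f i j x ∂μ = ∑ i, ∑ j, ∫ x, f i j x ∂μ := by
  rw [integral_finsetSum _ fun i _ => integrable_finsetSum _ fun j _ => hf i j]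
  exact Finset.sum_congr rfl fun i _ => integral_finsetSum _ fun j _ => hf i j

/-- The derivative of the product `φ X_i a_j (X · a)` with the top-order part separated. -/
lemma pd_normal_product (h : TubeBound Ω K ℓ) (hφ : ContDiff ℝ ∞ φ) {a : Fin n → Eu n → ℝ}
    (ha : ∀ i, ContDiffOn ℝ 1 (a i) (closure Ω)) {x : Eu n} (hx : x ∈ closure Ω)
    (k i j : Fin n) :
    pd Ω k (fun x => φ x * (nc Ω ℓ i x * (a j x * ∑ l, nc Ω ℓ l x * a l x))) x
      = (fderiv ℝ φ x (eb k) * nc Ω ℓ i x * a j x * ∑ l, nc Ω ℓ l x * a l x)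
        + φ x * pd Ω k (nc Ω ℓ i) x * a j x * (∑ l, nc Ω ℓ l x * a l x)
        + φ x * nc Ω ℓ i x * a j x * (∑ l, pd Ω k (nc Ω ℓ l) x * a l x)
        + φ x * nc Ω ℓ i x * pd Ω k (a j) x * (∑ l, nc Ω ℓ l x * a l x)
        + φ x * nc Ω ℓ i x * a j x * ∑ l, nc Ω ℓ l x * pd Ω k (a l) x := by
  have hu := h.smooth.uniqueDiffOn_closure
  have hφ1 := h.contDiffOn_of_contDiff hφ 1
  have hX : ∀ l, ContDiffOn ℝ 1 (nc Ω ℓ l) (closure Ω) := fun l => h.contDiffOn_nc (k := 1) l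
  have hb : ContDiffOn ℝ 1 (fun x => ∑ l, nc Ω ℓ l x * a l x) (closure Ω) :=
    ContDiffOn.sum fun l _ => (hX l).mul (ha l)
  have e : pd Ω k (fun x => ∑ l, nc Ω ℓ l x * a l x) x
      = (∑ l, nc Ω ℓ l x * pd Ω k (a l) x) + ∑ l, pd Ω k (nc Ω ℓ l) x * a l x := by
    rw [pd_sum hu hx fun l _ => (hX l).mul (ha l), ← Finset.sum_add_distrib]
    refine Finset.sum_congr rfl fun l _ => ?_
    rw [pd_mul hu hx (hX l) (ha l), mul_comm (a l x)]
  rw [pd_mul hu hx (by exact_mod_cast hφ1) ((hX i).mul ((ha j).mul hb)),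
    pd_mul hu hx (hX i) ((ha j).mul hb), pd_mul hu hx (ha j) hb, e, h.pd_eq_fderiv hφ hx]
  ring

/-- The boundary integrand of the div-curl identity. -/
def _root_.WeightedElliptic.divCurlFlux (Ω : Set (Eu n)) (ℓ : ℝ) (φ : Eu n → ℝ)
    (a : Fin n → Eu n → ℝ) (i j : Fin n) (x : Eu n) : ℝ :=
  φ x * a j x * (nc Ω ℓ i x * pd Ω j (a i) x - nc Ω ℓ j x * pd Ω i (a i) x)
    - (nc Ω ℓ i x * pd Ω j (fun x => φ x * (nc Ω ℓ i x * (a j x * ∑ l, nc Ω ℓ l x * a l x))) x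
      - nc Ω ℓ j x * pd Ω i (fun x => φ x * (nc Ω ℓ i x * (a j x * ∑ l, nc Ω ℓ l x * a l x))) x)

/-- By the boundary identity the only top-order term is -2φ(X·a)D, where D is the tangential
divergence. Young's inequality puts δ on D², which is data, and 1/δ on (X·a)² ≤ n²N, which is of
lower order. -/
lemma divCurlFlux_le (h : TubeBound Ω K ℓ) (hn : 0 < n) (hc : CutoffTriple φ ψ η B R)
    {a : Fin n → Eu n → ℝ} (ha : ∀ i, ContDiffOn ℝ 1 (a i) (closure Ω)) {x : Eu n}
    (hx : x ∈ frontier Ω) {N T δ : ℝ} (haN : ∀ i, a i x ^ 2 ≤ N)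
    (hT : ((∑ i, pd Ω i (a i) x)
      - ∑ i, nc Ω ℓ i x * ∑ l, nc Ω ℓ l x * pd Ω i (a l) x) ^ 2 ≤ T) (hδ : 0 < δ) :
    ∑ i, ∑ j, divCurlFlux Ω ℓ φ a i j x
      ≤ δ * (φ x * T) + (2 * n ^ 3 * (B + 2 * normalDerivBound K ℓ) + n ^ 2 / δ) * (ψ x * N) := by
  have hxc := frontier_subset_closure hx
  set κ := normalDerivBound K ℓ with hκ
  set X := fun i => nc Ω ℓ i x with hX
  set b := ∑ l, nc Ω ℓ l x * a l x with hb
  set dφ := fun k => fderiv ℝ φ x (eb k) with hdφ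
  set L : Fin n → Fin n → Fin n → ℝ := fun k i j =>
    dφ k * X i * a j x * b + φ x * pd Ω k (nc Ω ℓ i) x * a j x * b
      + φ x * X i * a j x * ∑ l, pd Ω k (nc Ω ℓ l) x * a l x with hL
  have hXle : ∀ i, |X i| ≤ 1 := fun i => h.abs_nc_le i x
  have hN0 : 0 ≤ N := (sq_nonneg _).trans (haN ⟨0, hn⟩)
  have hLle : ∀ k i j, |L k i j| ≤ n * (B + 2 * κ) * (ψ x * N) := fun k i j =>
    divCurl_boundary_lower hn (hc.nonneg x) (hc.fst_le x) h.normalDerivBound_nonneg hXle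
      (fun i j => h.abs_pd_nc_le' i j hxc) hc.bound_nonneg (fun i => hc.deriv_fst x i) haN hb k i j
  have e : ∑ i, ∑ j, divCurlFlux Ω ℓ φ a i j x
      = -2 * (φ x * b * ((∑ i, pd Ω i (a i) x)
        - ∑ i, X i * ∑ l, X l * pd Ω i (a l) x))
        - ∑ i, ∑ j, (X i * L j i j - X j * L i i j) :=
    divCurl_boundary_identity (A := fun i j => pd Ω i (a j) x) (a := fun j => a j x) (p := φ x)
      (h.sum_nc_sq hx) hb (S := fun k i j =>
        pd Ω k (fun x => φ x * (nc Ω ℓ i x * (a j x * ∑ l, nc Ω ℓ l x * a l x))) x)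
      (fun k i j => h.pd_normal_product hc.contDiff_fst ha hxc k i j)
  rw [e]
  set D := (∑ i, pd Ω i (a i) x) - ∑ i, X i * ∑ l, X l * pd Ω i (a l) x with hD
  have hlow : -∑ i, ∑ j, (X i * L j i j - X j * L i i j)
      ≤ n ^ 2 * (2 * (n * (B + 2 * κ) * (ψ x * N))) := by
    refine (neg_le_abs _).trans ((Finset.abs_sum_le_sum_abs _ _).trans ?_)
    calc _ ≤ ∑ _i : Fin n, ∑ _j : Fin n, 2 * (n * (B + 2 * κ) * (ψ x * N)) := by
          refine Finset.sum_le_sum fun i _ => (Finset.abs_sum_le_sum_abs _ _).trans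
            (Finset.sum_le_sum fun j _ => ?_)
          refine (abs_sub _ _).trans ?_
          rw [abs_mul, abs_mul]
          have h1 := mul_le_mul (hXle i) (hLle j i j) (abs_nonneg _) zero_le_one
          have h2 := mul_le_mul (hXle j) (hLle i i j) (abs_nonneg _) zero_le_one
          linarith
      _ = _ := by simp; ring
  have hbN : b ^ 2 ≤ n ^ 2 * N := by
    have h1 : |b| ≤ n * (1 * √N) := abs_sum_mul_le hXle zero_le_one fun i => Real.abs_le_sqrt (haN i)
    have h2 := pow_le_pow_left₀ (abs_nonneg b) h1 2
    rw [sq_abs, one_mul, mul_pow, Real.sq_sqrt hN0] at h2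
    exact h2
  have hmain : -2 * (φ x * b * D) ≤ δ * (φ x * T) + n ^ 2 / δ * (ψ x * N) := by
    have h1 : -2 * (b * D) ≤ δ * D ^ 2 + b ^ 2 / δ := by
      have : δ * D ^ 2 + b ^ 2 / δ - -2 * (b * D) = (δ * D + b) ^ 2 / δ := by field_simp; ring
      have h2 : 0 ≤ (δ * D + b) ^ 2 / δ := by positivity
      linarith
    have h2 : δ * D ^ 2 + b ^ 2 / δ ≤ δ * T + n ^ 2 * N / δ := by gcongr
    have h3 := mul_le_mul_of_nonneg_left (h1.trans h2) (hc.nonneg x)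
    have h4 : φ x * (n ^ 2 * N / δ) ≤ ψ x * (n ^ 2 * N / δ) :=
      mul_le_mul_of_nonneg_right (hc.fst_le x) (by positivity)
    calc _ = φ x * (-2 * (b * D)) := by ring
      _ ≤ φ x * (δ * T + n ^ 2 * N / δ) := h3
      _ = δ * (φ x * T) + φ x * (n ^ 2 * N / δ) := by ring
      _ ≤ δ * (φ x * T) + ψ x * (n ^ 2 * N / δ) := by linarith
      _ = _ := by ring
  calc _ ≤ δ * (φ x * T) + n ^ 2 / δ * (ψ x * N) + n ^ 2 * (2 * (n * (B + 2 * κ) * (ψ x * N))) := by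
        linarith
    _ = _ := by ring

lemma continuousOn_divCurlFlux (h : TubeBound Ω K ℓ) (hφ : ContDiff ℝ ∞ φ)
    {a : Fin n → Eu n → ℝ} (ha : ∀ i, ContDiffOn ℝ 1 (a i) (closure Ω)) (i j : Fin n) :
    ContinuousOn (divCurlFlux Ω ℓ φ a i j) (closure Ω) := by
  have hu := h.smooth.uniqueDiffOn_closure
  have hX : ∀ l, ContDiffOn ℝ 1 (nc Ω ℓ l) (closure Ω) := fun l => h.contDiffOn_nc (k := 1) l
  have hS : ContDiffOn ℝ 1
      (fun x => φ x * (nc Ω ℓ i x * (a j x * ∑ l, nc Ω ℓ l x * a l x))) (closure Ω) :=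
    ContDiffOn.mul (by exact_mod_cast h.contDiffOn_of_contDiff hφ 1) ((hX i).mul
      ((ha j).mul (ContDiffOn.sum fun l _ => (hX l).mul (ha l))))
  have hXc := fun l => (hX l).continuousOn
  exact ((hφ.continuous.continuousOn.mul (ha j).continuousOn).mul
    (((hXc i).mul (continuousOn_pd hu (ha i))).sub ((hXc j).mul (continuousOn_pd hu (ha i))))).sub
    (((hXc i).mul (continuousOn_pd hu hS)).sub ((hXc j).mul (continuousOn_pd hu hS)))

lemma divCurlFlux_eq_zero {a : Fin n → Eu n → ℝ} (hR : ∀ x, R < ‖x‖ → φ x = 0) (i j : Fin n)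
    {x : Eu n} (hx : R < ‖x‖) : divCurlFlux Ω ℓ φ a i j x = 0 := by
  have hS : ∀ y, R < ‖y‖ →
      φ y * (nc Ω ℓ i y * (a j y * ∑ l, nc Ω ℓ l y * a l y)) = 0 := fun y hy => by
    rw [hR y hy, zero_mul]
  rw [divCurlFlux, hR x hx, pd_eq_zero_of_lt hS hx, pd_eq_zero_of_lt hS hx]
  ring

/-- Apply `integral_pair` to the functions φ a_j and a_i, and subtract the tangential derivatives of
φ X_i a_j (X·a), whose boundary integral is zero. The latter need two derivatives of `a`. -/
lemma integral_divCurl (h : TubeBound Ω K ℓ) (hφ : ContDiff ℝ ∞ φ)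
    (hR : ∀ x, R < ‖x‖ → φ x = 0) {a : Fin n → Eu n → ℝ}
    (ha : ∀ i, ContDiffOn ℝ 2 (a i) (closure Ω)) :
    ∫ x in Ω, ∑ i, ∑ j, (pd Ω i (fun x => φ x * a j x) x * pd Ω j (a i) x
        - pd Ω j (fun x => φ x * a j x) x * pd Ω i (a i) x)
      = ∫ x, ∑ i, ∑ j, divCurlFlux Ω ℓ φ a i j x ∂(bdryMeasure Ω) := by
  have hu := h.smooth.uniqueDiffOn_closure
  have ha1 : ∀ i, ContDiffOn ℝ 1 (a i) (closure Ω) := fun i => (ha i).of_le (by norm_num)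
  have hg : ∀ j, ContDiffOn ℝ 1 (fun x => φ x * a j x) (closure Ω) := fun j =>
    ContDiffOn.mul (by exact_mod_cast h.contDiffOn_of_contDiff hφ 1) (ha1 j)
  have hgR : ∀ j x, R < ‖x‖ → φ x * a j x = 0 := fun j x hx => by rw [hR x hx, zero_mul]
  have hX : ∀ l, ContDiffOn ℝ 2 (nc Ω ℓ l) (closure Ω) := fun l => h.contDiffOn_nc (k := 2) l
  have hS : ∀ i j, ContDiffOn ℝ 2
      (fun x => φ x * (nc Ω ℓ i x * (a j x * ∑ l, nc Ω ℓ l x * a l x))) (closure Ω) := fun i j =>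
    ContDiffOn.mul (by exact_mod_cast h.contDiffOn_of_contDiff hφ 2) ((hX i).mul
      ((ha j).mul (ContDiffOn.sum fun l _ => (hX l).mul (ha l))))
  have hSR : ∀ i j x, R < ‖x‖ →
      φ x * (nc Ω ℓ i x * (a j x * ∑ l, nc Ω ℓ l x * a l x)) = 0 := fun i j x hx => by
    rw [hR x hx, zero_mul]
  rw [integral_sum_sum, integral_sum_sum]
  · refine Finset.sum_congr rfl fun i _ => Finset.sum_congr rfl fun j _ => ?_
    rw [h.integral_pair (hg j) (ha i) (hgR j) i j]
    have htan := h.integral_tangential (hS i j) (hSR i j) i j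
    rw [← sub_zero (∫ x, φ x * a j x * _ ∂_), ← htan, ← integral_sub]
    · rfl
    · refine h.integrable_bdry (R := R) ((hg j).continuousOn.mul ?_) fun x hx => by
        rw [hgR j x hx, zero_mul]
      exact ((hX i).continuousOn.mul (continuousOn_pd hu (ha1 i))).sub
        ((hX j).continuousOn.mul (continuousOn_pd hu (ha1 i)))
    · have hS1 := (hS i j).of_le (show (1 : WithTop ℕ∞) ≤ 2 by norm_num)
      refine h.integrable_bdry (R := R) (((hX i).continuousOn.mul (continuousOn_pd hu hS1)).sub
        ((hX j).continuousOn.mul (continuousOn_pd hu hS1))) fun x hx => ?_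
      rw [pd_eq_zero_of_lt (hSR i j) hx, pd_eq_zero_of_lt (hSR i j) hx]
      ring
  · exact fun i j => h.integrable_bdry (h.continuousOn_divCurlFlux hφ ha1 i j) fun x hx =>
      divCurlFlux_eq_zero hR i j hx
  · refine fun i j => h.integrableOn (R := R)
      (((continuousOn_pd hu (hg j)).mul (continuousOn_pd hu (ha1 i))).sub
        ((continuousOn_pd hu (hg j)).mul (continuousOn_pd hu (ha1 i)))) fun x hx => ?_
    rw [pd_eq_zero_of_lt (hgR j) hx, pd_eq_zero_of_lt (hgR j) hx]
    ring

/-- The weighted div-curl estimate. -/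
lemma divCurl_estimate (h : TubeBound Ω K ℓ) (hn : 0 < n) (hc : CutoffTriple φ ψ η B R)
    {a : Fin n → Eu n → ℝ} (ha : ∀ i, ContDiffOn ℝ 2 (a i) (closure Ω)) {N F T : Eu n → ℝ}
    (hN : ContinuousOn N (closure Ω)) (hF : ContinuousOn F (closure Ω))
    (hT : ContinuousOn T (closure Ω)) (haN : ∀ x ∈ closure Ω, ∀ i, a i x ^ 2 ≤ N x)
    (hcurl : ∀ x ∈ closure Ω, ∀ i j, (pd Ω i (a j) x - pd Ω j (a i) x) ^ 2 ≤ N x)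
    (hdiv : ∀ x ∈ closure Ω, (∑ i, pd Ω i (a i) x) ^ 2 ≤ F x)
    (hbdry : ∀ x ∈ frontier Ω, ((∑ i, pd Ω i (a i) x)
      - ∑ i, nc Ω ℓ i x * ∑ l, nc Ω ℓ l x * pd Ω i (a l) x) ^ 2 ≤ T x) {δ : ℝ} (hδ : 0 < δ) :
    1 / 2 * ∫ x in Ω, φ x * ∑ i, ∑ j, pd Ω i (a j) x ^ 2
      ≤ (∫ x in Ω, φ x * F x) + (n ^ 2 * (1 + 2 * (n + 1) * B ^ 2)) * (∫ x in Ω, η x * N x)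
        + δ * (∫ x, φ x * T x ∂(bdryMeasure Ω))
        + (2 * n ^ 3 * (B + 2 * normalDerivBound K ℓ) + n ^ 2 / δ)
          * ∫ x, ψ x * N x ∂(bdryMeasure Ω) := by
  have hu := h.smooth.uniqueDiffOn_closure
  have ha1 : ∀ i, ContDiffOn ℝ 1 (a i) (closure Ω) := fun i => (ha i).of_le (by norm_num)
  have hφc := hc.contDiff_fst.continuous
  have hψc := hc.contDiff_snd.continuous
  have hg : ∀ j, ContDiffOn ℝ 1 (fun x => φ x * a j x) (closure Ω) := fun j =>
    ContDiffOn.mul (by exact_mod_cast h.contDiffOn_of_contDiff hc.contDiff_fst 1) (ha1 j)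
  have hgR : ∀ j x, R < ‖x‖ → φ x * a j x = 0 := fun j x hx => by
    rw [hc.support_fst x hx, zero_mul]
  have hcA : ∀ i j, ContinuousOn (pd Ω i (a j)) (closure Ω) := fun i j =>
    continuousOn_pd hu (ha1 j)
  have iH : IntegrableOn (fun x => ∑ i, ∑ j, (pd Ω i (fun x => φ x * a j x) x * pd Ω j (a i) x
        - pd Ω j (fun x => φ x * a j x) x * pd Ω i (a i) x)) Ω := by
    refine h.integrableOn (R := R) (continuousOn_finsetSum _ fun i _ =>
      continuousOn_finsetSum _ fun j _ => ((continuousOn_pd hu (hg j)).mul (hcA _ _)).sub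
        ((continuousOn_pd hu (hg j)).mul (hcA _ _))) fun x hx => ?_
    refine Finset.sum_eq_zero fun i _ => Finset.sum_eq_zero fun j _ => ?_
    rw [pd_eq_zero_of_lt (hgR j) hx, pd_eq_zero_of_lt (hgR j) hx]
    ring
  have iF := h.integrableOn_mul hφc hc.support_fst hF
  have iN := h.integrableOn_mul hc.continuous_trd hc.support hN
  have iQ : IntegrableOn (fun x => φ x * ∑ i, ∑ j, pd Ω i (a j) x ^ 2) Ω :=
    h.integrableOn_mul hφc hc.support_fst (continuousOn_finsetSum _ fun i _ =>
      continuousOn_finsetSum _ fun j _ => (hcA i j).pow 2)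
  have iT := h.integrable_bdry_mul hφc hc.support_fst hT
  have iN' := h.integrable_bdry_mul hψc hc.support_snd hN
  have s1 : 1 / 2 * ∫ x in Ω, φ x * ∑ i, ∑ j, pd Ω i (a j) x ^ 2
      ≤ (∫ x in Ω, ∑ i, ∑ j, (pd Ω i (fun x => φ x * a j x) x * pd Ω j (a i) x
        - pd Ω j (fun x => φ x * a j x) x * pd Ω i (a i) x)) + (∫ x in Ω, φ x * F x)
        + (n ^ 2 * (1 + 2 * (n + 1) * B ^ 2)) * ∫ x in Ω, η x * N x := by
    have h0 := setIntegral_le_three h.smooth.1.measurableSet (iQ.const_mul (1 / 2)) iH iF iN 1 1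
      (n ^ 2 * (1 + 2 * (n + 1) * B ^ 2)) fun x hx => ?_
    · rwa [integral_const_mul, one_mul, one_mul] at h0
    have hx' := subset_closure hx
    have h1 := divCurl_interior (A := fun i j => pd Ω i (a j) x) (a := fun j => a j x)
      (dφ := fun k => fderiv ℝ φ x (eb k)) (hc.nonneg x) (hc.fst_le x) (hc.snd_le x)
      (hc.sq_le x) (hc.deriv_fst x) (haN x hx') (hcurl x hx') (hdiv x hx')
    rw [one_mul, one_mul]
    refine h1.trans (le_of_eq ?_)
    congr 2
    refine Finset.sum_congr rfl fun i _ => Finset.sum_congr rfl fun j _ => ?_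
    have e : ∀ k, pd Ω k (fun x => φ x * a j x) x
        = φ x * pd Ω k (a j) x + a j x * fderiv ℝ φ x (eb k) := fun k => by
      rw [pd_mul hu hx' (by exact_mod_cast h.contDiffOn_of_contDiff hc.contDiff_fst 1) (ha1 j),
        h.pd_eq_fderiv hc.contDiff_fst hx']
    rw [e, e]
  have s2 : ∫ x, ∑ i, ∑ j, divCurlFlux Ω ℓ φ a i j x ∂(bdryMeasure Ω)
      ≤ δ * (∫ x, φ x * T x ∂(bdryMeasure Ω))
        + (2 * n ^ 3 * (B + 2 * normalDerivBound K ℓ) + n ^ 2 / δ)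
          * ∫ x, ψ x * N x ∂(bdryMeasure Ω) := by
    refine setIntegral_le_two isClosed_frontier.measurableSet ?_ iT iN' _ _ fun x hx => ?_
    · exact integrable_finsetSum _ fun i _ => integrable_finsetSum _ fun j _ =>
        h.integrable_bdry (h.continuousOn_divCurlFlux hc.contDiff_fst ha1 i j) fun x hx =>
          divCurlFlux_eq_zero hc.support_fst i j hx
    · exact h.divCurlFlux_le hn hc ha1 hx (haN x (frontier_subset_closure hx)) (hbdry x hx) hδ
  rw [h.integral_divCurl hc.contDiff_fst hc.support_fst ha] at s1
  linarith

end TubeBound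
-- Trace and Rellich estimates
namespace TubeBound

variable {n : ℕ} {Ω : Set (Eu n)} {K ℓ B R : ℝ} {φ ψ η : Eu n → ℝ}

/-- The weighted trace inequality. -/
lemma trace_estimate (h : TubeBound Ω K ℓ) (hc : CutoffTriple φ ψ η B R) {v : Eu n → ℝ}
    (hv : ContDiffOn ℝ 1 v (closure Ω)) {ε : ℝ} (hε : 0 < ε) :
    ∫ x, ψ x * v x ^ 2 ∂(bdryMeasure Ω)
      ≤ ε * (∫ x in Ω, φ x * ∑ i, pd Ω i v x ^ 2)
        + n * (B + normalDerivBound K ℓ + 1 / ε) * ∫ x in Ω, η x * v x ^ 2 := by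
  have hu := h.smooth.uniqueDiffOn_closure
  have hX : ∀ l, ContDiffOn ℝ 1 (nc Ω ℓ l) (closure Ω) := fun l => h.contDiffOn_nc (k := 1) l
  have hψ1 : ContDiffOn ℝ 1 ψ (closure Ω) := by
    exact_mod_cast h.contDiffOn_of_contDiff hc.contDiff_snd 1
  have hg : ∀ i, ContDiffOn ℝ 1 (fun x => ψ x * (nc Ω ℓ i x * (v x * v x))) (closure Ω) := fun i =>
    hψ1.mul ((hX i).mul (hv.mul hv))
  have hgR : ∀ (i : Fin n) x, R < ‖x‖ → ψ x * (nc Ω ℓ i x * (v x * v x)) = 0 := fun i x hx => by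
    rw [hc.support_snd x hx, zero_mul]
  -- The divergence theorem for the field ψv²X, whose normal component on the boundary is ψv².
  have h0 := h.integral_sum_pd Finset.univ id hg hgR
  have e1 : ∫ x, ψ x * v x ^ 2 ∂(bdryMeasure Ω)
      = ∫ x, ∑ k, nc Ω ℓ (id k) x * (ψ x * (nc Ω ℓ k x * (v x * v x))) ∂(bdryMeasure Ω) := by
    refine setIntegral_congr_fun isClosed_frontier.measurableSet fun x hx => ?_
    have : ∑ k, nc Ω ℓ (id k) x * (ψ x * (nc Ω ℓ k x * (v x * v x)))
        = (∑ k, nc Ω ℓ k x * nc Ω ℓ k x) * (ψ x * (v x * v x)) := by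
      rw [Finset.sum_mul]
      exact Finset.sum_congr rfl fun k _ => by rw [id]; ring
    rw [this, h.sum_nc_sq hx]
    ring
  rw [e1, ← h0]
  refine setIntegral_le_two h.smooth.1.measurableSet ?_ ?_ ?_ _ _ fun x hx => ?_
  · exact h.integrableOn (R := R) (continuousOn_finsetSum _ fun i _ => continuousOn_pd hu (hg i))
      fun x hx => Finset.sum_eq_zero fun i _ => pd_eq_zero_of_lt (hgR i) hx
  · exact h.integrableOn_mul hc.contDiff_fst.continuous hc.support_fst
      (continuousOn_finsetSum _ fun i _ => (continuousOn_pd hu hv).pow 2)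
  · exact h.integrableOn_mul hc.continuous_trd hc.support (hv.continuousOn.pow 2)
  have hx' := subset_closure hx
  have key : ∀ i, pd Ω i (fun x => ψ x * (nc Ω ℓ i x * (v x * v x))) x
      ≤ ε * (φ x * pd Ω i v x ^ 2) + (B + normalDerivBound K ℓ + 1 / ε) * (η x * v x ^ 2) := by
    intro i
    rw [pd_mul hu hx' hψ1 ((hX i).mul (hv.mul hv)), pd_mul hu hx' (hX i) (hv.mul hv),
      pd_mul hu hx' hv hv, h.pd_eq_fderiv hc.contDiff_snd hx']
    -- Differentiating v·v produces the cross term twice, so each copy may use ε/2 of the gradient.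
    have h1 := mul_abs_mul_abs_le (u := v x) (v := pd Ω i v x) (hc.nonneg x) (hc.trd_nonneg x)
      (hc.sq_le x) (half_pos hε)
    have h2 : 1 / (4 * (ε / 2)) = 1 / ε / 2 := by field_simp; norm_num
    rw [h2] at h1
    have hXi := h.abs_nc_le i x
    have b1 : ψ x * (nc Ω ℓ i x * (v x * pd Ω i v x)) ≤ ψ x * |v x| * |pd Ω i v x| := by
      refine (le_abs_self _).trans ?_
      rw [abs_mul, abs_mul, abs_mul, abs_of_nonneg (hc.snd_nonneg x), mul_assoc]
      refine mul_le_mul_of_nonneg_left ?_ (hc.snd_nonneg x)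
      exact mul_le_of_le_one_left (by positivity) hXi
    have b2 : ψ x * (v x * v x * pd Ω i (nc Ω ℓ i) x)
        ≤ normalDerivBound K ℓ * (η x * v x ^ 2) := by
      have hy := (le_abs_self _).trans (h.abs_pd_nc_le' i i hx')
      calc _ = ψ x * v x ^ 2 * pd Ω i (nc Ω ℓ i) x := by ring
        _ ≤ ψ x * v x ^ 2 * normalDerivBound K ℓ :=
          mul_le_mul_of_nonneg_left hy (mul_nonneg (hc.snd_nonneg x) (sq_nonneg _))
        _ ≤ η x * v x ^ 2 * normalDerivBound K ℓ :=
          mul_le_mul_of_nonneg_right (mul_le_mul_of_nonneg_right (hc.snd_le x) (sq_nonneg _))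
            h.normalDerivBound_nonneg
        _ = _ := by ring
    have b3 : nc Ω ℓ i x * (v x * v x) * fderiv ℝ ψ x (eb i) ≤ B * (η x * v x ^ 2) := by
      refine (le_abs_self _).trans ?_
      have e : |v x * v x| = v x ^ 2 := by rw [abs_mul_self, sq]
      rw [abs_mul, abs_mul, e]
      calc _ ≤ 1 * v x ^ 2 * (B * η x) :=
            mul_le_mul (mul_le_mul_of_nonneg_right hXi (sq_nonneg _)) (hc.deriv_snd x i)
              (abs_nonneg _) (by positivity)
        _ = _ := by ring
    linarith
  refine (Finset.sum_le_sum fun i _ => key i).trans (le_of_eq ?_)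
  rw [Finset.sum_add_distrib, ← Finset.mul_sum, ← Finset.mul_sum]
  simp
  ring

/-- The field whose divergence yields the Rellich identity. -/
def _root_.WeightedElliptic.rellichField (Ω : Set (Eu n)) (ℓ : ℝ) (φ : Eu n → ℝ)
    (a : Fin n → Eu n → ℝ) (i j : Fin n) (x : Eu n) : ℝ :=
  φ x * (nc Ω ℓ i x * (a j x * a j x) - 2 * (nc Ω ℓ j x * (a j x * a i x)))

lemma contDiffOn_rellichField (h : TubeBound Ω K ℓ) (hφ : ContDiff ℝ ∞ φ)
    {a : Fin n → Eu n → ℝ} (ha : ∀ i, ContDiffOn ℝ 1 (a i) (closure Ω)) (i j : Fin n) :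
    ContDiffOn ℝ 1 (rellichField Ω ℓ φ a i j) (closure Ω) := by
  have hX : ∀ l, ContDiffOn ℝ 1 (nc Ω ℓ l) (closure Ω) := fun l => h.contDiffOn_nc (k := 1) l
  refine ContDiffOn.mul (by exact_mod_cast h.contDiffOn_of_contDiff hφ 1) ?_
  exact ((hX i).mul ((ha j).mul (ha j))).sub
    (contDiffOn_const.mul ((hX j).mul ((ha j).mul (ha i))))

lemma pd_rellichField (h : TubeBound Ω K ℓ) (hφ : ContDiff ℝ ∞ φ)
    {a : Fin n → Eu n → ℝ} (ha : ∀ i, ContDiffOn ℝ 1 (a i) (closure Ω)) {x : Eu n}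
    (hx : x ∈ closure Ω) (i j : Fin n) :
    pd Ω i (rellichField Ω ℓ φ a i j) x
      = fderiv ℝ φ x (eb i) * (nc Ω ℓ i x * (a j x * a j x) - 2 * (nc Ω ℓ j x * (a j x * a i x)))
        + φ x * (pd Ω i (nc Ω ℓ i) x * (a j x * a j x)
          - 2 * (pd Ω i (nc Ω ℓ j) x * (a j x * a i x)))
        + 2 * (φ x * (nc Ω ℓ i x * a j x * pd Ω i (a j) x - nc Ω ℓ j x * a i x * pd Ω i (a j) x))
        - 2 * (φ x * (nc Ω ℓ j x * a j x * pd Ω i (a i) x)) := by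
  have hu := h.smooth.uniqueDiffOn_closure
  have hX : ∀ l, ContDiffOn ℝ 1 (nc Ω ℓ l) (closure Ω) := fun l => h.contDiffOn_nc (k := 1) l
  have hφ1 : ContDiffOn ℝ 1 φ (closure Ω) := by exact_mod_cast h.contDiffOn_of_contDiff hφ 1
  -- Writing the difference as a sum over `Bool` reduces the computation to the sum and product
  -- rules for `pd`.
  have e : rellichField Ω ℓ φ a i j = fun x => φ x * ∑ k : Bool, bif k
      then nc Ω ℓ i x * (a j x * a j x) else (-2 * nc Ω ℓ j x) * (a j x * a i x) := by
    funext x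
    simp only [rellichField, Fintype.sum_bool, cond_true, cond_false]
    ring
  have h2 : ContDiffOn ℝ 1 (fun x => -2 * nc Ω ℓ j x) (closure Ω) := contDiffOn_const.mul (hX j)
  have hterm : ∀ k : Bool, ContDiffOn ℝ 1 (fun x => bif k
      then nc Ω ℓ i x * (a j x * a j x) else (-2 * nc Ω ℓ j x) * (a j x * a i x))
      (closure Ω) := by
    intro k
    cases k
    · exact h2.mul ((ha j).mul (ha i))
    · exact (hX i).mul ((ha j).mul (ha j))
  have hconst : pd Ω i (fun _ => (-2 : ℝ)) x = 0 := by simp [pd]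
  rw [e, pd_mul hu hx hφ1 (ContDiffOn.sum fun k _ => hterm k), pd_sum hu hx fun k _ => hterm k,
    h.pd_eq_fderiv hφ hx]
  simp only [Fintype.sum_bool, cond_true, cond_false]
  rw [pd_mul hu hx (hX i) ((ha j).mul (ha j)), pd_mul hu hx (ha j) (ha j),
    pd_mul hu hx h2 ((ha j).mul (ha i)), pd_mul hu hx (ha j) (ha i),
    pd_mul hu hx contDiffOn_const (hX j), hconst]
  ring

/-- After i and j are interchanged in one of the sums, derivatives of `a` occur only through the
curl, in X_i a_j(∂_i a_j - ∂_j a_i), and through the divergence, in -2(X·a) div a. Everything else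
is quadratic in `a`, with a derivative on φ or X. -/
lemma neg_pd_rellichField_le (h : TubeBound Ω K ℓ) (hn : 0 < n) (hc : CutoffTriple φ ψ η B R)
    {a : Fin n → Eu n → ℝ} (ha : ∀ i, ContDiffOn ℝ 1 (a i) (closure Ω)) {x : Eu n}
    (hx : x ∈ closure Ω) {N F : ℝ} (haN : ∀ i, a i x ^ 2 ≤ N)
    (hcurl : ∀ i j, (pd Ω i (a j) x - pd Ω j (a i) x) ^ 2 ≤ N)
    (hdiv : (∑ i, pd Ω i (a i) x) ^ 2 ≤ F) :
    -∑ i, ∑ j, pd Ω i (rellichField Ω ℓ φ a i j) x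
      ≤ φ x * F + n ^ 2 * (3 * B + 3 * normalDerivBound K ℓ + 3) * (η x * N) := by
  set κ := normalDerivBound K ℓ with hκ
  have hκ0 : 0 ≤ κ := h.normalDerivBound_nonneg
  have hN0 : 0 ≤ N := (sq_nonneg _).trans (haN ⟨0, hn⟩)
  have hφ0 := hc.nonneg x
  have hφη : φ x ≤ η x := (hc.fst_le x).trans (hc.snd_le x)
  have hη0 := hc.trd_nonneg x
  have hX := fun i => h.abs_nc_le i x
  set b := ∑ l, nc Ω ℓ l x * a l x with hb
  set d := ∑ i, pd Ω i (a i) x with hd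
  have ha' : ∀ i, |a i x| ≤ √N := fun i => Real.abs_le_sqrt (haN i)
  have hNN : √N * √N = N := Real.mul_self_sqrt hN0
  have haa : ∀ i j, |a i x * a j x| ≤ N := fun i j => by
    rw [abs_mul, ← hNN]
    exact mul_le_mul (ha' i) (ha' j) (abs_nonneg _) (Real.sqrt_nonneg _)
  have hbN : b ^ 2 ≤ n ^ 2 * N := by
    have h1 : |b| ≤ n * (1 * √N) := abs_sum_mul_le hX zero_le_one ha'
    have h2 := pow_le_pow_left₀ (abs_nonneg b) h1 2
    rw [sq_abs, one_mul, mul_pow, Real.sq_sqrt hN0] at h2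
    exact h2
  set U : Fin n → Fin n → ℝ := fun i j =>
    fderiv ℝ φ x (eb i) * (nc Ω ℓ i x * (a j x * a j x) - 2 * (nc Ω ℓ j x * (a j x * a i x)))
        + φ x * (pd Ω i (nc Ω ℓ i) x * (a j x * a j x)
          - 2 * (pd Ω i (nc Ω ℓ j) x * (a j x * a i x)))
        + 2 * (φ x * (nc Ω ℓ i x * a j x * (pd Ω i (a j) x - pd Ω j (a i) x))) with hU
  have e1 : ∑ i, ∑ j, pd Ω i (rellichField Ω ℓ φ a i j) x
      = (∑ i, ∑ j, U i j) - 2 * (φ x * (b * d)) := by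
    have e2 : ∑ i, ∑ j, 2 * (φ x * (nc Ω ℓ j x * a j x * pd Ω i (a i) x)) = 2 * (φ x * (b * d)) := by
      simp only [← Finset.mul_sum, ← Finset.sum_mul, ← hb, ← hd]
    have e3 : ∑ i, ∑ j, 2 * (φ x * (nc Ω ℓ j x * a i x * pd Ω i (a j) x))
        = ∑ i, ∑ j, 2 * (φ x * (nc Ω ℓ i x * a j x * pd Ω j (a i) x)) := Finset.sum_comm
    rw [← e2, ← sub_eq_zero]
    have e4 := sub_eq_zero.2 e3
    rw [← Finset.sum_sub_distrib] at e4 ⊢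
    simp only [← Finset.sum_sub_distrib] at e4 ⊢
    rw [← neg_eq_zero, ← e4, ← Finset.sum_neg_distrib]
    refine Finset.sum_congr rfl fun i _ => ?_
    rw [← Finset.sum_neg_distrib]
    refine Finset.sum_congr rfl fun j _ => ?_
    rw [h.pd_rellichField hc.contDiff_fst ha hx]
    simp only [hU]
    ring
  have hUle : ∀ i j, |U i j| ≤ (3 * B + 3 * κ + 2) * (η x * N) := by
    intro i j
    have c1 : ∀ u₁ u₂ c : ℝ, |u₁| ≤ c → |u₂| ≤ c → 0 ≤ c →
        |u₁ * (a j x * a j x) - 2 * (u₂ * (a j x * a i x))| ≤ 3 * (c * N) := by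
      intro u₁ u₂ c h1 h2 h0
      refine (abs_sub _ _).trans ?_
      rw [abs_mul, abs_mul 2, abs_mul u₂, abs_two]
      have := mul_le_mul h1 (haa j j) (abs_nonneg _) h0
      have := mul_le_mul h2 (haa j i) (abs_nonneg _) h0
      linarith
    have h1 := c1 _ _ 1 (hX i) (hX j) zero_le_one
    have h2 := c1 _ _ κ (h.abs_pd_nc_le' i i hx) (h.abs_pd_nc_le' i j hx) hκ0
    have h3 : |nc Ω ℓ i x * a j x * (pd Ω i (a j) x - pd Ω j (a i) x)| ≤ N := by
      rw [abs_mul, abs_mul, ← hNN]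
      refine mul_le_mul ?_ (Real.abs_le_sqrt (hcurl i j)) (abs_nonneg _) (Real.sqrt_nonneg _)
      calc _ ≤ 1 * √N := mul_le_mul (hX i) (ha' j) (abs_nonneg _) zero_le_one
        _ = _ := one_mul _
    have hd' : |fderiv ℝ φ x (eb i)| ≤ B * η x :=
      (hc.deriv_fst x i).trans (mul_le_mul_of_nonneg_left (hc.snd_le x) hc.bound_nonneg)
    have h4 := mul_le_mul hd' h1 (abs_nonneg _) (mul_nonneg hc.bound_nonneg hη0)
    have h5 := mul_le_mul hφη h2 (abs_nonneg _) hη0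
    have h6 := mul_le_mul hφη h3 (abs_nonneg _) hη0
    refine (abs_add_three _ _ _).trans ?_
    rw [abs_mul, abs_mul (φ x), abs_mul 2, abs_mul (φ x), abs_of_nonneg hφ0, abs_two]
    linarith
  have hUsum : -∑ i, ∑ j, U i j ≤ n ^ 2 * ((3 * B + 3 * κ + 2) * (η x * N)) := by
    refine (neg_le_abs _).trans ((Finset.abs_sum_le_sum_abs _ _).trans ?_)
    calc _ ≤ ∑ _i : Fin n, ∑ _j : Fin n, (3 * B + 3 * κ + 2) * (η x * N) :=
          Finset.sum_le_sum fun i _ => (Finset.abs_sum_le_sum_abs _ _).trans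
            (Finset.sum_le_sum fun j _ => hUle i j)
      _ = _ := by simp; ring
  have hbd : 2 * (φ x * (b * d)) ≤ φ x * F + n ^ 2 * (η x * N) := by
    have h1 : 2 * (b * d) ≤ F + n ^ 2 * N := by nlinarith [sq_nonneg (b - d)]
    have h2 := mul_le_mul_of_nonneg_left h1 hφ0
    have h3 : φ x * (n ^ 2 * N) ≤ η x * (n ^ 2 * N) :=
      mul_le_mul_of_nonneg_right hφη (by positivity)
    linarith
  rw [e1]
  linarith

/-- The weighted Rellich estimate: on the boundary, the tangential part of an almost
divergence- and curl-free field controls the field. -/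
lemma rellich_estimate (h : TubeBound Ω K ℓ) (hn : 0 < n) (hc : CutoffTriple φ ψ η B R)
    {a : Fin n → Eu n → ℝ} (ha : ∀ i, ContDiffOn ℝ 1 (a i) (closure Ω)) {N F T : Eu n → ℝ}
    (hN : ContinuousOn N (closure Ω)) (hF : ContinuousOn F (closure Ω))
    (hT : ContinuousOn T (closure Ω)) (haN : ∀ x ∈ closure Ω, ∀ i, a i x ^ 2 ≤ N x)
    (hcurl : ∀ x ∈ closure Ω, ∀ i j, (pd Ω i (a j) x - pd Ω j (a i) x) ^ 2 ≤ N x)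
    (hdiv : ∀ x ∈ closure Ω, (∑ i, pd Ω i (a i) x) ^ 2 ≤ F x)
    (hbdry : ∀ x ∈ frontier Ω,
      (∑ i, a i x ^ 2) - (∑ i, nc Ω ℓ i x * a i x) ^ 2 ≤ T x) :
    ∫ x, φ x * ∑ i, a i x ^ 2 ∂(bdryMeasure Ω)
      ≤ 2 * (∫ x, φ x * T x ∂(bdryMeasure Ω)) + (∫ x in Ω, φ x * F x)
        + n ^ 2 * (3 * B + 3 * normalDerivBound K ℓ + 3) * ∫ x in Ω, η x * N x := by
  have hu := h.smooth.uniqueDiffOn_closure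
  have hφc := hc.contDiff_fst.continuous
  have hg := fun p : Fin n × Fin n => h.contDiffOn_rellichField hc.contDiff_fst ha p.1 p.2
  have hgR : ∀ (p : Fin n × Fin n) x, R < ‖x‖ → rellichField Ω ℓ φ a p.1 p.2 x = 0 :=
    fun p x hx => by rw [rellichField, hc.support_fst x hx, zero_mul]
  have h0 := h.integral_sum_pd Finset.univ Prod.fst hg hgR
  simp only [Fintype.sum_prod_type] at h0
  have iF := h.integrableOn_mul hφc hc.support_fst hF
  have iN := h.integrableOn_mul hc.continuous_trd hc.support hN
  have iT := h.integrable_bdry_mul hφc hc.support_fst hT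
  have ia : Integrable (fun x => φ x * ∑ i, a i x ^ 2) (bdryMeasure Ω) :=
    h.integrable_bdry_mul hφc hc.support_fst
      (continuousOn_finsetSum _ fun i _ => (ha i).continuousOn.pow 2)
  have iG : Integrable (fun x => ∑ i, ∑ j, nc Ω ℓ i x * rellichField Ω ℓ φ a i j x)
      (bdryMeasure Ω) := integrable_finsetSum _ fun i _ => integrable_finsetSum _ fun j _ =>
    h.integrable_nc_mul (hg (i, j)).continuousOn (hgR (i, j)) i
  have s1 := setIntegral_le_two (f := fun x => -∑ i, ∑ j, pd Ω i (rellichField Ω ℓ φ a i j) x)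
    h.smooth.1.measurableSet ?_ iF iN 1 (n ^ 2 * (3 * B + 3 * normalDerivBound K ℓ + 3))
    fun x hx => by
      rw [one_mul]
      have hx' := subset_closure hx
      exact h.neg_pd_rellichField_le hn hc ha hx' (haN x hx') (hcurl x hx') (hdiv x hx')
  · rw [integral_neg, h0, one_mul] at s1
    have s2 := setIntegral_le_two (f := fun x => φ x * ∑ i, a i x ^ 2)
      (μ := Measure.euclideanHausdorffMeasure (n - 1)) (s := frontier Ω)
      isClosed_frontier.measurableSet ia iT iG 2 (-1) fun x hx => ?_
    · change ∫ x, φ x * ∑ i, a i x ^ 2 ∂(bdryMeasure Ω)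
        ≤ 2 * (∫ x, φ x * T x ∂(bdryMeasure Ω)) + -1 * ∫ x,
          ∑ i, ∑ j, nc Ω ℓ i x * rellichField Ω ℓ φ a i j x ∂(bdryMeasure Ω) at s2
      linarith
    -- The flux through the boundary is φ(|a|² - 2(X·a)²), and |a|² = 2(|a|² - (X·a)²) - (|a|² -
    -- 2(X·a)²): twice the tangential part minus the flux.
    · have e1 : ∑ i, ∑ j, nc Ω ℓ i x * rellichField Ω ℓ φ a i j x
          = φ x * ((∑ i, a i x ^ 2) - 2 * (∑ i, nc Ω ℓ i x * a i x) ^ 2) := by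
        have e2 : ∑ i, ∑ j, φ x * ((nc Ω ℓ i x * nc Ω ℓ i x) * a j x ^ 2)
            = φ x * ∑ i, a i x ^ 2 := by
          simp only [← Finset.mul_sum, ← Finset.sum_mul]
          rw [h.sum_nc_sq hx, one_mul]
        have e3 : ∑ i, ∑ j, 2 * φ x * ((nc Ω ℓ i x * a i x) * (nc Ω ℓ j x * a j x))
            = φ x * (2 * (∑ i, nc Ω ℓ i x * a i x) ^ 2) := by
          simp only [← Finset.mul_sum, ← Finset.sum_mul]
          ring
        rw [mul_sub, ← e2, ← e3]
        simp only [← Finset.sum_sub_distrib]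
        refine Finset.sum_congr rfl fun i _ => Finset.sum_congr rfl fun j _ => ?_
        rw [rellichField]
        ring
      rw [e1]
      have := mul_le_mul_of_nonneg_left (hbdry x hx) (hc.nonneg x)
      linarith
  · refine (h.integrableOn (R := R) (continuousOn_finsetSum _ fun i _ =>
      continuousOn_finsetSum _ fun j _ => continuousOn_pd hu (hg (i, j))) fun x hx =>
      Finset.sum_eq_zero fun i _ => Finset.sum_eq_zero fun j _ =>
        pd_eq_zero_of_lt (hgR (i, j)) hx).neg

end TubeBound
/-! ### Iterated derivatives up to the boundary -/

section CovDeriv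

variable {n s k : ℕ} {Ω : Set (Eu n)} {q : Eu n → ℝ} {x : Eu n}

lemma HasSmoothBoundary.contDiffOn_covDeriv (hΩ : HasSmoothBoundary Ω)
    (hq : ContDiffOn ℝ (k + s : ℕ) q (closure Ω)) :
    ContDiffOn ℝ k (covDeriv Ω s q) (closure Ω) := fun x hx =>
  (hq x hx).iteratedFDerivWithin_right hΩ.uniqueDiffOn_closure (by norm_cast) hx

lemma HasSmoothBoundary.contDiffOn_covDeriv_apply (hΩ : HasSmoothBoundary Ω)
    (hq : ContDiffOn ℝ (k + s : ℕ) q (closure Ω)) (v : Fin s → Eu n) :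
    ContDiffOn ℝ k (fun y => covDeriv Ω s q y v) (closure Ω) :=
  (ContinuousMultilinearMap.apply ℝ (fun _ : Fin s => Eu n) ℝ v).contDiff.comp_contDiffOn
    (hΩ.contDiffOn_covDeriv hq)

lemma HasSmoothBoundary.fderivWithin_covDeriv_apply (hΩ : HasSmoothBoundary Ω)
    (hq : ContDiffOn ℝ (s + 1 : ℕ) q (closure Ω)) (hx : x ∈ closure Ω) (v : Fin s → Eu n)
    (w : Eu n) :
    fderivWithin ℝ (fun y => covDeriv Ω s q y v) (closure Ω) x w
      = covDeriv Ω (s + 1) q x (Matrix.vecCons w v) := by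
  have hD : ContDiffOn ℝ (1 : ℕ) (covDeriv Ω s q) (closure Ω) :=
    hΩ.contDiffOn_covDeriv (by rwa [add_comm])
  have h1 : DifferentiableWithinAt ℝ (covDeriv Ω s q) (closure Ω) x :=
    hD.differentiableOn (by simp) x hx
  have h2 := (ContinuousMultilinearMap.apply ℝ (fun _ : Fin s => Eu n) ℝ v).hasFDerivAt
    |>.comp_hasFDerivWithinAt x h1.hasFDerivWithinAt
  have h3 : fderivWithin ℝ (fun y => covDeriv Ω s q y v) (closure Ω) x = _ :=
    h2.fderivWithin (hΩ.uniqueDiffOn_closure x hx)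
  rw [h3]
  rfl

lemma HasSmoothBoundary.pd_covDeriv (hΩ : HasSmoothBoundary Ω)
    (hq : ContDiffOn ℝ (s + 1 : ℕ) q (closure Ω)) (hx : x ∈ closure Ω) (v : Fin s → Eu n)
    (i : Fin n) :
    pd Ω i (fun y => covDeriv Ω s q y v) x = covDeriv Ω (s + 1) q x (Matrix.vecCons (eb i) v) :=
  hΩ.fderivWithin_covDeriv_apply hq hx v _

/-- Both sides are second derivatives of the C² function y ↦ ∇ˢq(y)(v). Their symmetry holds up to
the boundary because each point of the closure is a limit of interior points. -/
lemma HasSmoothBoundary.covDeriv_swap (hΩ : HasSmoothBoundary Ω)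
    (hq : ContDiffOn ℝ (s + 2 : ℕ) q (closure Ω)) (hx : x ∈ closure Ω) (a b : Eu n)
    (v : Fin s → Eu n) :
    covDeriv Ω (s + 2) q x (Matrix.vecCons a (Matrix.vecCons b v))
      = covDeriv Ω (s + 2) q x (Matrix.vecCons b (Matrix.vecCons a v)) := by
  set g : Eu n → ℝ := fun y => covDeriv Ω s q y v with hg
  have hgc : ContDiffOn ℝ 2 g (closure Ω) := by
    have := hΩ.contDiffOn_covDeriv_apply (k := 2) (by rwa [add_comm]) v
    exact_mod_cast this
  have hu := hΩ.uniqueDiffOn_closure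
  have hsymm : IsSymmSndFDerivWithinAt ℝ g (closure Ω) x := by
    refine (hgc x hx).isSymmSndFDerivWithinAt (by simp) hu ?_ hx
    exact closure_mono (hΩ.1.subset_interior_iff.2 subset_closure) hx
  have hd : DifferentiableWithinAt ℝ (fderivWithin ℝ g (closure Ω)) (closure Ω) x :=
    (hgc.fderivWithin (m := 1) hu (by norm_num)).differentiableOn (by simp) x hx
  have key : ∀ a b : Eu n, covDeriv Ω (s + 2) q x (Matrix.vecCons a (Matrix.vecCons b v))
      = fderivWithin ℝ (fderivWithin ℝ g (closure Ω)) (closure Ω) x a b := by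
    intro a b
    rw [← hΩ.fderivWithin_covDeriv_apply (s := s + 1) (by exact_mod_cast hq) hx]
    have e : ∀ y ∈ closure Ω, covDeriv Ω (s + 1) q y (Matrix.vecCons b v)
        = fderivWithin ℝ g (closure Ω) y b := fun y hy =>
      (hΩ.fderivWithin_covDeriv_apply (hq.of_le (by norm_cast; omega)) hy v b).symm
    rw [fderivWithin_congr e (e x hx)]
    have h3 := hd.hasFDerivWithinAt.clm_apply (hasFDerivWithinAt_const b x (closure Ω))
    rw [h3.fderivWithin (hu x hx)]
    simp
  rw [key, key, hsymm]

lemma cons_comp_swap_succ (v : Fin (s + 1) → Eu n) (i j : Fin s) :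
    v ∘ Equiv.swap i.succ j.succ
      = Matrix.vecCons (v 0) ((fun k : Fin s => v k.succ) ∘ Equiv.swap i j) := by
  funext k
  refine Fin.cases ?_ (fun k => ?_) k
  · have : Equiv.swap i.succ j.succ 0 = 0 := Equiv.swap_apply_of_ne_of_ne
      (Fin.succ_ne_zero i).symm (Fin.succ_ne_zero j).symm
    simp [this]
  · have : Equiv.swap i.succ j.succ k.succ = (Equiv.swap i j k).succ := by
      rcases eq_or_ne k i with rfl | hi
      · simp
      rcases eq_or_ne k j with rfl | hj
      · simp
      rw [Equiv.swap_apply_of_ne_of_ne hi hj, Equiv.swap_apply_of_ne_of_ne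
        (fun h => hi (Fin.succ_injective _ h)) fun h => hj (Fin.succ_injective _ h)]
    simp [this]

lemma cons_comp_swap_zero (v : Fin (s + 2) → Eu n) :
    v ∘ Equiv.swap 0 1
      = Matrix.vecCons (v 1) (Matrix.vecCons (v 0) fun k : Fin s => v k.succ.succ) := by
  funext k
  refine Fin.cases (by simp) (fun k => ?_) k
  refine Fin.cases (by simp) (fun k => ?_) k
  have : Equiv.swap (0 : Fin (s + 2)) 1 k.succ.succ = k.succ.succ :=
    Equiv.swap_apply_of_ne_of_ne (Fin.succ_ne_zero _) fun h => by
      rw [← Fin.succ_zero_eq_one] at h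
      exact Fin.succ_ne_zero _ (Fin.succ_injective _ h)
  simp [this]

lemma vecCons_self (v : Fin (s + 1) → Eu n) :
    Matrix.vecCons (v 0) (fun k : Fin s => v k.succ) = v := by
  funext k
  refine Fin.cases (by simp) (fun k => by simp) k

/-- The first adjacent pair is exchanged by symmetry of second derivatives; for a later pair the
identity one order lower is differentiated. -/
lemma HasSmoothBoundary.covDeriv_swap_adjacent (hΩ : HasSmoothBoundary Ω) :
    ∀ (s : ℕ) {x : Eu n}, x ∈ closure Ω → ContDiffOn ℝ (s + 1 : ℕ) q (closure Ω) →
      ∀ (i : Fin s) (v : Fin (s + 1) → Eu n),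
        covDeriv Ω (s + 1) q x (v ∘ Equiv.swap i.castSucc i.succ) = covDeriv Ω (s + 1) q x v
  | 0, _, _, _, i, _ => i.elim0
  | s + 1, x, hx, hq, i, v => by
    refine Fin.cases ?_ (fun i => ?_) i
    · have e : Matrix.vecCons (v 0) (Matrix.vecCons (v 1) fun k : Fin s => v k.succ.succ) = v := by
        funext k
        refine Fin.cases (by simp) (fun k => ?_) k
        exact Fin.cases (by simp) (fun k => by simp) k
      rw [Fin.castSucc_zero, Fin.succ_zero_eq_one, cons_comp_swap_zero,
        hΩ.covDeriv_swap (by exact_mod_cast hq) hx, e]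
    · have hq1 : ContDiffOn ℝ (s + 1 : ℕ) q (closure Ω) := hq.of_le (by norm_cast; omega)
      rw [← Fin.succ_castSucc, cons_comp_swap_succ]
      conv_rhs => rw [← vecCons_self v]
      rw [← hΩ.fderivWithin_covDeriv_apply hq hx, ← hΩ.fderivWithin_covDeriv_apply hq hx]
      have e : ∀ y ∈ closure Ω, covDeriv Ω (s + 1) q y
          ((fun k => v k.succ) ∘ Equiv.swap i.castSucc i.succ)
          = covDeriv Ω (s + 1) q y fun k => v k.succ := fun y hy =>
        hΩ.covDeriv_swap_adjacent s hy hq1 i _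
      rw [fderivWithin_congr e (e x hx)]

/-- Iterated derivatives up to the boundary are symmetric tensors. -/
lemma HasSmoothBoundary.isSymmTensor_covDeriv (hΩ : HasSmoothBoundary Ω) (hx : x ∈ closure Ω)
    (hq : ContDiffOn ℝ (s + 1 : ℕ) q (closure Ω)) : IsSymmTensor (covDeriv Ω (s + 1) q x) := by
  intro σ
  -- Adjacent transpositions generate all permutations.
  have hσ : σ ∈ Submonoid.closure
      (Set.range fun i : Fin s => Equiv.swap i.castSucc i.succ) := by
    rw [Equiv.Perm.mclosure_swap_castSucc_succ]; trivial
  induction hσ using Submonoid.closure_induction with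
  | mem τ hτ =>
    obtain ⟨i, rfl⟩ := hτ
    exact fun v => hΩ.covDeriv_swap_adjacent s hx hq i v
  | one => exact fun v => rfl
  | mul σ τ _ _ h1 h2 =>
    intro v
    rw [Equiv.Perm.coe_mul, ← Function.comp_assoc, h2, h1]

lemma IsSymmTensor.rotate {m : ℕ} {α : Tensor n (m + 3)} (hα : IsSymmTensor α) (a b c : Eu n)
    (u : Fin m → Eu n) :
    α (Matrix.vecCons a (Matrix.vecCons b (Matrix.vecCons c u)))
      = α (Matrix.vecCons b (Matrix.vecCons c (Matrix.vecCons a u))) := by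
  rw [← hα (Equiv.swap 0 1), cons_comp_swap_zero, ← hα (Equiv.swap 1 2)]
  have e := cons_comp_swap_succ (Matrix.vecCons b (Matrix.vecCons a (Matrix.vecCons c u))) 0 1
  congr 1
  refine Eq.trans e ?_
  rw [cons_comp_swap_zero]
  rfl

lemma HasSmoothBoundary.lap_eq (hΩ : HasSmoothBoundary Ω) (hx : x ∈ closure Ω) :
    lap Ω q x = ∑ l, covDeriv Ω 2 q x (Matrix.vecCons (eb l) (Matrix.vecCons (eb l) ![])) :=
  InnerProductSpace.laplacianWithin_eq_iteratedFDerivWithin_orthonormalBasis q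
    hΩ.uniqueDiffOn_closure hx (EuclideanSpace.basisFun (Fin n) ℝ)

lemma HasSmoothBoundary.contDiffOn_lap (hΩ : HasSmoothBoundary Ω)
    (hq : ContDiffOn ℝ (k + 2 : ℕ) q (closure Ω)) : ContDiffOn ℝ k (lap Ω q) (closure Ω) :=
  (ContDiffOn.sum fun l _ => hΩ.contDiffOn_covDeriv_apply hq
    (Matrix.vecCons (eb l) (Matrix.vecCons (eb l) ![]))).congr fun _ hx => hΩ.lap_eq hx

/-- The derivatives of `Δ q` are traces of derivatives of `q`. -/
lemma HasSmoothBoundary.covDeriv_lap (hΩ : HasSmoothBoundary Ω) :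
    ∀ (m : ℕ) {x : Eu n}, x ∈ closure Ω → ContDiffOn ℝ (m + 2 : ℕ) q (closure Ω) →
      ∀ v : Fin m → Eu n, covDeriv Ω m (lap Ω q) x v
        = ∑ l, covDeriv Ω (m + 2) q x (Matrix.vecCons (eb l) (Matrix.vecCons (eb l) v))
  | 0, x, hx, _, v => by
    have hv : v = ![] := Subsingleton.elim _ _
    rw [hv, covDeriv, iteratedFDerivWithin_zero_apply, hΩ.lap_eq hx]
  | m + 1, x, hx, hq, v => by
    have hu := hΩ.uniqueDiffOn_closure
    have hq' : ContDiffOn ℝ (m + 2 + 1 : ℕ) q (closure Ω) := by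
      have e : m + 1 + 2 = m + 2 + 1 := by ring
      rwa [e] at hq
    have hq2 : ContDiffOn ℝ (m + 2 : ℕ) q (closure Ω) := hq.of_le (by norm_cast; omega)
    have hlap : ContDiffOn ℝ (m + 1 : ℕ) (lap Ω q) (closure Ω) := hΩ.contDiffOn_lap hq
    conv_lhs => rw [← vecCons_self v]
    rw [← hΩ.fderivWithin_covDeriv_apply hlap hx]
    have e : ∀ y ∈ closure Ω, covDeriv Ω m (lap Ω q) y (fun k => v k.succ)
        = ∑ l, covDeriv Ω (m + 2) q y
          (Matrix.vecCons (eb l) (Matrix.vecCons (eb l) fun k => v k.succ)) :=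
      fun y hy => hΩ.covDeriv_lap m hy hq2 _
    rw [fderivWithin_congr e (e x hx), fderivWithin_fun_sum (hu x hx)]
    · rw [sum_apply]
      -- The new derivative enters in the first slot; by symmetry it is moved behind the traced
      -- pair.
      refine Finset.sum_congr rfl fun l _ => ?_
      rw [hΩ.fderivWithin_covDeriv_apply hq' hx,
        (hΩ.isSymmTensor_covDeriv hx hq').rotate, vecCons_self]
    · intro l _
      refine (hΩ.contDiffOn_covDeriv_apply (k := 1) (s := m + 2) ?_ _).differentiableOn (by simp)
        x hx
      rwa [add_comm]

lemma HasSmoothBoundary.tensorTrace_covDeriv (hΩ : HasSmoothBoundary Ω) {m : ℕ}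
    (hx : x ∈ closure Ω) (hq : ContDiffOn ℝ (m + 2 : ℕ) q (closure Ω)) (A : Fin m → Fin n) :
    tensorTrace (covDeriv Ω (m + 2) q x) A = covDeriv Ω m (lap Ω q) x fun k => eb (A k) :=
  (hΩ.covDeriv_lap m hx hq _).symm

/-- Squared norms of derivatives are continuous up to the boundary. -/
lemma HasSmoothBoundary.continuousOn_tensorNormSq (hΩ : HasSmoothBoundary Ω)
    (hq : ContDiffOn ℝ s q (closure Ω)) :
    ContinuousOn (fun x => tensorNormSq (covDeriv Ω s q x)) (closure Ω) :=
  continuousOn_finsetSum _ fun _ _ => ((hΩ.contDiffOn_covDeriv_apply (k := 0)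
    (by rwa [zero_add]) _).continuousOn).pow 2

lemma tensorNormSq_succ (α : Tensor n (s + 1)) :
    tensorNormSq α = ∑ I : Fin s → Fin n, ∑ i, α (Matrix.vecCons (eb i) fun k => eb (I k)) ^ 2 := by
  rw [Finset.sum_comm, tensorNormSq, ← (Fin.consEquiv fun _ => Fin n).sum_comp,
    Fintype.sum_prod_type]
  refine Finset.sum_congr rfl fun i _ => Finset.sum_congr rfl fun I _ => ?_
  congr 2
  funext k
  refine Fin.cases (by simp [Fin.consEquiv]) (fun k => by simp [Fin.consEquiv]) k

end CovDeriv
/-! ### Derivatives with projected slots -/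

section ProjectedFields

variable {n m : ℕ} {Ω : Set (Eu n)} {K ℓ : ℝ} {q : Eu n → ℝ} {x : Eu n}

/-- The `A`-component of `P e_{C 1} ⊗ ⋯ ⊗ P e_{C m}`, where `P` projects along the extended
normal. -/
def projCoeff (Ω : Set (Eu n)) (ℓ : ℝ) (C A : Fin m → Fin n) (x : Eu n) : ℝ :=
  ∏ k, normalProj (normalExt Ω ℓ x) (eb (C k)) (A k)

/-- The vector field `i ↦ ∇^{m+1} q (e_i, P e_{C 1}, …, P e_{C m})`. -/
def projField (Ω : Set (Eu n)) (ℓ : ℝ) (q : Eu n → ℝ) (C : Fin m → Fin n) (i : Fin n)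
    (x : Eu n) : ℝ :=
  covDeriv Ω (m + 1) q x
    (Matrix.vecCons (eb i) fun k => normalProj (normalExt Ω ℓ x) (eb (C k)))

lemma tensor_cons_expand (α : Tensor n (m + 1)) (w : Eu n) (u : Fin m → Eu n) :
    α (Matrix.vecCons w u)
      = ∑ A : Fin m → Fin n, (∏ k, u k (A k)) * α (Matrix.vecCons w fun k => eb (A k)) :=
  tensor_expand (α.curryLeft w) u

lemma tensor_cons_cons_expand (α : Tensor n (m + 2)) (w w' : Eu n) (u : Fin m → Eu n) :
    α (Matrix.vecCons w (Matrix.vecCons w' u)) = ∑ A : Fin m → Fin n, (∏ k, u k (A k))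
      * α (Matrix.vecCons w (Matrix.vecCons w' fun k => eb (A k))) :=
  tensor_expand ((α.curryLeft w).curryLeft w') u

lemma tensor_cons_sum (α : Tensor n (m + 1)) (w : Eu n) (u : Fin m → Eu n) :
    α (Matrix.vecCons w u) = ∑ l, w l * α (Matrix.vecCons (eb l) u) := by
  have h1 : ∀ w, α (Matrix.vecCons w u) = α (Function.update (Matrix.vecCons w u) 0 w) := by
    intro w
    congr 1
    funext k
    refine Fin.cases (by simp) (fun k => by simp) k
  have h2 : ∀ w', Function.update (Matrix.vecCons w u) 0 w' = Matrix.vecCons w' u := by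
    intro w'
    funext k
    refine Fin.cases (by simp) (fun k => by simp) k
  rw [h1]
  conv_lhs => rw [sum_eb w]
  rw [tensor_update_sum_smul]
  refine Finset.sum_congr rfl fun l _ => ?_
  rw [← sum_eb w, h2]

lemma normalProj_coord (X : Eu n) (c a : Fin n) :
    normalProj X (eb c) a = eb c a - X c * X a := by
  rw [normalProj_apply, inner_eb]
  simp

lemma abs_pd_prod_le {ι : Type*} [DecidableEq ι] (hu : UniqueDiffOn ℝ (closure Ω))
    (hx : x ∈ closure Ω) {g : ι → Eu n → ℝ} {c : ℝ} (hg : ∀ k, ContDiffOn ℝ 1 (g k) (closure Ω))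
    (hg1 : ∀ k, |g k x| ≤ 1) {i : Fin n} (hgc : ∀ k, |pd Ω i (g k) x| ≤ c) (s : Finset ι) :
    |pd Ω i (fun x => ∏ k ∈ s, g k x) x| ≤ s.card * c := by
  induction s using Finset.induction_on with
  | empty => simp [pd]
  | insert a s ha ih =>
    have e : (fun x => ∏ k ∈ insert a s, g k x) = fun x => g a x * ∏ k ∈ s, g k x := by
      funext x
      rw [Finset.prod_insert ha]
    have hs : ContDiffOn ℝ 1 (fun x => ∏ k ∈ s, g k x) (closure Ω) :=
      contDiffOn_prod fun k _ => hg k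
    rw [e, pd_mul hu hx (hg a) hs, Finset.card_insert_of_notMem ha]
    have h1 : |∏ k ∈ s, g k x| ≤ 1 := by
      rw [Finset.abs_prod]
      exact Finset.prod_le_one (fun k _ => abs_nonneg _) fun k _ => hg1 k
    have h2 : |g a x * pd Ω i (fun x => ∏ k ∈ s, g k x) x| ≤ 1 * (s.card * c) := by
      rw [abs_mul]
      exact mul_le_mul (hg1 a) ih (abs_nonneg _) zero_le_one
    have h3 : |(∏ k ∈ s, g k x) * pd Ω i (g a) x| ≤ 1 * c := by
      rw [abs_mul]
      exact mul_le_mul h1 (hgc a) (abs_nonneg _) zero_le_one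
    push_cast
    calc _ ≤ 1 * (s.card * c) + 1 * c := (abs_add_le _ _).trans (add_le_add h2 h3)
      _ = _ := by ring

namespace TubeBound

lemma contDiff_projEntry (h : TubeBound Ω K ℓ) (c a : Fin n) :
    ContDiff ℝ ∞ fun x => normalProj (normalExt Ω ℓ x) (eb c) a := by
  simp_rw [normalProj_coord]
  exact contDiff_const.sub ((h.contDiff_nc c).mul (h.contDiff_nc a))

lemma abs_projEntry_le (h : TubeBound Ω K ℓ) (c a : Fin n) (x : Eu n) :
    |normalProj (normalExt Ω ℓ x) (eb c) a| ≤ 1 :=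
  (abs_coord_le _ _).trans ((norm_normalProj_le (h.norm_normalExt_le x) _).trans (norm_eb c).le)

lemma abs_pd_projEntry_le (h : TubeBound Ω K ℓ) (c a i : Fin n) (hx : x ∈ closure Ω) :
    |pd Ω i (fun x => normalProj (normalExt Ω ℓ x) (eb c) a) x| ≤ 2 * normalDerivBound K ℓ := by
  have hu := h.smooth.uniqueDiffOn_closure
  have e : (fun x => normalProj (normalExt Ω ℓ x) (eb c) a)
      = fun x => eb c a - nc Ω ℓ c x * nc Ω ℓ a x := by
    funext x
    rw [normalProj_coord]
    rfl
  have h1 : pd Ω i (fun x => eb c a - nc Ω ℓ c x * nc Ω ℓ a x) x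
      = -pd Ω i (fun x => nc Ω ℓ c x * nc Ω ℓ a x) x := by
    rw [pd, fderivWithin_const_sub (hu x hx)]
    rfl
  rw [e, h1, abs_neg, pd_mul hu hx (h.contDiffOn_nc (k := 1) c) (h.contDiffOn_nc (k := 1) a)]
  refine (abs_add_le _ _).trans ?_
  rw [abs_mul, abs_mul]
  have h2 := mul_le_mul (h.abs_nc_le c x) (h.abs_pd_nc_le' i a hx) (abs_nonneg _) zero_le_one
  have h3 := mul_le_mul (h.abs_nc_le a x) (h.abs_pd_nc_le' i c hx) (abs_nonneg _) zero_le_one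
  linarith

lemma contDiffOn_projCoeff (h : TubeBound Ω K ℓ) (C A : Fin m → Fin n) (k : ℕ) :
    ContDiffOn ℝ k (projCoeff Ω ℓ C A) (closure Ω) :=
  contDiffOn_prod fun l _ => h.contDiffOn_of_contDiff (h.contDiff_projEntry (C l) (A l)) k

lemma abs_pd_projCoeff_le (h : TubeBound Ω K ℓ) (C A : Fin m → Fin n) (i : Fin n)
    (hx : x ∈ closure Ω) :
    |pd Ω i (projCoeff Ω ℓ C A) x| ≤ m * (2 * normalDerivBound K ℓ) := by
  have := abs_pd_prod_le h.smooth.uniqueDiffOn_closure hx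
    (g := fun k x => normalProj (normalExt Ω ℓ x) (eb (C k)) (A k))
    (fun k => by
      exact_mod_cast h.contDiffOn_of_contDiff (h.contDiff_projEntry (C k) (A k)) 1)
    (fun k => h.abs_projEntry_le _ _ x) (fun k => h.abs_pd_projEntry_le _ _ i hx) Finset.univ
  rw [Finset.card_univ, Fintype.card_fin] at this
  exact this

lemma projField_eq (C : Fin m → Fin n) (i : Fin n) (x : Eu n) :
    projField Ω ℓ q C i x = ∑ A, projCoeff Ω ℓ C A x
      * covDeriv Ω (m + 1) q x (Matrix.vecCons (eb i) fun k => eb (A k)) :=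
  tensor_cons_expand _ _ _

lemma contDiffOn_projField (h : TubeBound Ω K ℓ) {k : ℕ}
    (hq : ContDiffOn ℝ (k + (m + 1) : ℕ) q (closure Ω)) (C : Fin m → Fin n) (i : Fin n) :
    ContDiffOn ℝ k (projField Ω ℓ q C i) (closure Ω) := by
  refine ContDiffOn.congr (f := fun x => ∑ A, projCoeff Ω ℓ C A x
      * covDeriv Ω (m + 1) q x (Matrix.vecCons (eb i) fun k => eb (A k))) ?_ fun x _ =>
    projField_eq C i x
  exact ContDiffOn.sum fun A _ => (h.contDiffOn_projCoeff C A k).mul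
    (h.smooth.contDiffOn_covDeriv_apply hq _)

/-- The error made in replacing derivatives of the projected field by projected derivatives. -/
def _root_.WeightedElliptic.projError (Ω : Set (Eu n)) (ℓ : ℝ) (q : Eu n → ℝ) (C : Fin m → Fin n)
    (j i : Fin n) (x : Eu n) : ℝ :=
  pd Ω j (projField Ω ℓ q C i) x - covDeriv Ω (m + 2) q x (Matrix.vecCons (eb j)
    (Matrix.vecCons (eb i) fun k => normalProj (normalExt Ω ℓ x) (eb (C k))))

/-- The constant in the bound for the error. -/
def _root_.WeightedElliptic.projErrorConst (n m : ℕ) (K ℓ : ℝ) : ℝ :=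
  n ^ m * (m * (2 * normalDerivBound K ℓ))

lemma projErrorConst_nonneg (h : TubeBound Ω K ℓ) : 0 ≤ projErrorConst n m K ℓ := by
  have := h.normalDerivBound_nonneg
  rw [projErrorConst]
  positivity

/-- Expand the projected slots in the standard basis. When ∂_j falls on ∇^{m+1}q it gives the
subtracted component; what is left has ∂_j on the coefficients of the projections, hence is of order
m + 1 in `q`. -/
lemma abs_projError_le (h : TubeBound Ω K ℓ) (hq : ContDiffOn ℝ (m + 2 : ℕ) q (closure Ω))
    (C : Fin m → Fin n) (j i : Fin n) (hx : x ∈ closure Ω) :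
    |projError Ω ℓ q C j i x|
      ≤ projErrorConst n m K ℓ * √(tensorNormSq (covDeriv Ω (m + 1) q x)) := by
  have hu := h.smooth.uniqueDiffOn_closure
  have hD : ∀ A : Fin m → Fin n, ContDiffOn ℝ 1 (fun x =>
      covDeriv Ω (m + 1) q x (Matrix.vecCons (eb i) fun k => eb (A k))) (closure Ω) := fun A => by
    have := h.smooth.contDiffOn_covDeriv_apply (k := 1) (s := m + 1) (q := q)
      (by rwa [add_comm]) (Matrix.vecCons (eb i) fun k => eb (A k))
    exact_mod_cast this
  have hcoe : ∀ A : Fin m → Fin n, ContDiffOn ℝ 1 (projCoeff Ω ℓ C A) (closure Ω) := fun A => by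
    exact_mod_cast h.contDiffOn_projCoeff C A 1
  have e0 : projField Ω ℓ q C i = fun x => ∑ A, projCoeff Ω ℓ C A x
      * covDeriv Ω (m + 1) q x (Matrix.vecCons (eb i) fun k => eb (A k)) :=
    funext (projField_eq C i)
  have e1 : projError Ω ℓ q C j i x = ∑ A,
      covDeriv Ω (m + 1) q x (Matrix.vecCons (eb i) fun k => eb (A k))
        * pd Ω j (projCoeff Ω ℓ C A) x := by
    rw [projError, e0, pd_sum hu hx fun A _ => (hcoe A).mul (hD A), tensor_cons_cons_expand,
      ← Finset.sum_sub_distrib]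
    refine Finset.sum_congr rfl fun A _ => ?_
    rw [pd_mul hu hx (hcoe A) (hD A), h.smooth.pd_covDeriv hq hx, projCoeff]
    ring
  rw [e1]
  refine (Finset.abs_sum_le_sum_abs _ _).trans ?_
  calc _ ≤ ∑ _A : Fin m → Fin n, √(tensorNormSq (covDeriv Ω (m + 1) q x))
        * (m * (2 * normalDerivBound K ℓ)) := by
        refine Finset.sum_le_sum fun A _ => ?_
        rw [abs_mul]
        refine mul_le_mul ?_ (h.abs_pd_projCoeff_le C A j hx) (abs_nonneg _) (Real.sqrt_nonneg _)
        have e2 : (Matrix.vecCons (eb i) fun k => eb (A k))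
            = fun k => eb ((Fin.cons i A : Fin (m + 1) → Fin n) k) := by
          funext k
          refine Fin.cases (by simp) (fun k => by simp) k
        rw [e2]
        exact abs_basis_le_sqrt _ _
    _ = _ := by simp [projErrorConst]; ring

end TubeBound

end ProjectedFields
/-! ### Pointwise bounds for the projected fields -/

section ProjectedBounds

variable {n m : ℕ} {Ω : Set (Eu n)} {K ℓ : ℝ} {q : Eu n → ℝ} {x : Eu n}

/-- The squared norm of `∇ˢ q` with every slot projected along the extended normal. -/
def projNormSq (Ω : Set (Eu n)) (ℓ : ℝ) (s : ℕ) (q : Eu n → ℝ) (x : Eu n) : ℝ :=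
  tensorNormSq ((covDeriv Ω s q x).compContinuousLinearMap
    fun _ => normalProj (normalExt Ω ℓ x))

lemma projNormSq_nonneg {s : ℕ} : 0 ≤ projNormSq Ω ℓ s q x := tensorNormSq_nonneg _

lemma abs_component_le_sqrt_projNormSq {s : ℕ} (I : Fin s → Fin n) :
    |covDeriv Ω s q x fun k => normalProj (normalExt Ω ℓ x) (eb (I k))|
      ≤ √(projNormSq Ω ℓ s q x) :=
  abs_basis_le_sqrt ((covDeriv Ω s q x).compContinuousLinearMap
    fun _ => normalProj (normalExt Ω ℓ x)) I

lemma tensor_cons_sub_smul (α : Tensor n (m + 1)) (a b : Eu n) (c : ℝ) (u : Fin m → Eu n) :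
    α (Matrix.vecCons (a - c • b) u) = α (Matrix.vecCons a u) - c * α (Matrix.vecCons b u) := by
  change α.curryLeft (a - c • b) u = α.curryLeft a u - c * α.curryLeft b u
  rw [map_sub, map_smul]
  rfl

/-- The trace over the projected directions. -/
lemma tensor_sum_normalProj (α : Tensor n (m + 2)) {X : Eu n} (hX : ∑ i, X i * X i = 1)
    (u : Fin m → Eu n) :
    ∑ i, α (Matrix.vecCons (normalProj X (eb i)) (Matrix.vecCons (normalProj X (eb i)) u))
      = (∑ i, α (Matrix.vecCons (eb i) (Matrix.vecCons (eb i) u)))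
        - ∑ i, X i * ∑ l, X l * α (Matrix.vecCons (eb i) (Matrix.vecCons (eb l) u)) := by
  have hsnd : ∀ w : Eu n, α (Matrix.vecCons w (Matrix.vecCons X u))
      = ∑ l, X l * α (Matrix.vecCons w (Matrix.vecCons (eb l) u)) := fun w =>
    tensor_cons_sum (α.curryLeft w) X u
  have hsnd' : ∀ (w a : Eu n) (c : ℝ), α (Matrix.vecCons w (Matrix.vecCons (a - c • X) u))
      = α (Matrix.vecCons w (Matrix.vecCons a u)) - c * α (Matrix.vecCons w (Matrix.vecCons X u)) :=
    fun w a c => tensor_cons_sub_smul (α.curryLeft w) a X c u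
  set Z := α (Matrix.vecCons X (Matrix.vecCons X u)) with hZ
  have e1 : ∑ i, X i * α (Matrix.vecCons (eb i) (Matrix.vecCons X u)) = Z :=
    (tensor_cons_sum α X _).symm
  have e2 : ∑ i, X i * α (Matrix.vecCons X (Matrix.vecCons (eb i) u)) = Z := (hsnd X).symm
  have e3 : ∀ i, α (Matrix.vecCons (normalProj X (eb i)) (Matrix.vecCons (normalProj X (eb i)) u))
      = α (Matrix.vecCons (eb i) (Matrix.vecCons (eb i) u))
        - X i * α (Matrix.vecCons X (Matrix.vecCons (eb i) u))
        - X i * α (Matrix.vecCons (eb i) (Matrix.vecCons X u)) + X i * X i * Z := by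
    intro i
    rw [normalProj_apply, inner_eb, hsnd', tensor_cons_sub_smul, tensor_cons_sub_smul]
    ring
  simp only [← hsnd]
  rw [e1, Finset.sum_congr rfl fun i _ => e3 i, Finset.sum_add_distrib, Finset.sum_sub_distrib,
    Finset.sum_sub_distrib, e1, e2, ← Finset.sum_mul, hX]
  ring

lemma sq_le_of_abs_le {t y c d u v : ℝ} (h : |t| ≤ c * √u + d * √v) (hu : 0 ≤ u) (hv : 0 ≤ v)
    (hy : y = 2 * c ^ 2 * u + 2 * d ^ 2 * v) : t ^ 2 ≤ y := by
  have h1 := pow_le_pow_left₀ (abs_nonneg t) h 2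
  rw [sq_abs] at h1
  have hu' := Real.sq_sqrt hu
  have hv' := Real.sq_sqrt hv
  rw [hy]
  nlinarith [sq_nonneg (c * √u - d * √v)]

lemma sum_le_natCast_mul {f : Fin n → ℝ} {c : ℝ} (h : ∀ i, f i ≤ c) : ∑ i, f i ≤ n * c :=
  (Finset.sum_le_sum fun i _ => h i).trans (by simp)

namespace TubeBound

lemma projNormSq_frontier (h : TubeBound Ω K ℓ) {s : ℕ} (hx : x ∈ frontier Ω) :
    projNormSq Ω ℓ s q x = tensorNormSq (tensorProj Ω x (covDeriv Ω s q x)) := by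
  rw [projNormSq, h.normalExt_frontier hx]
  rfl

lemma continuousOn_projNormSq (h : TubeBound Ω K ℓ) {s : ℕ}
    (hq : ContDiffOn ℝ s q (closure Ω)) : ContinuousOn (projNormSq Ω ℓ s q) (closure Ω) := by
  refine continuousOn_finsetSum _ fun I _ => ContinuousOn.pow ?_ 2
  simp only [ContinuousMultilinearMap.compContinuousLinearMap_apply]
  have e : (fun x => covDeriv Ω s q x fun k => normalProj (normalExt Ω ℓ x) (eb (I k)))
      = fun x => ∑ A, projCoeff Ω ℓ I A x * covDeriv Ω s q x fun k => eb (A k) :=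
    funext fun x => tensor_expand _ _
  rw [e]
  exact continuousOn_finsetSum _ fun A _ => (h.contDiffOn_projCoeff I A 0).continuousOn.mul
    (h.smooth.contDiffOn_covDeriv_apply (k := 0) (by rwa [zero_add]) _).continuousOn

lemma norm_projVec_le (h : TubeBound Ω K ℓ) (c : Fin n) (x : Eu n) :
    ‖normalProj (normalExt Ω ℓ x) (eb c)‖ ≤ 1 :=
  (norm_normalProj_le (h.norm_normalExt_le x) _).trans (norm_eb c).le

lemma projField_sq_le (h : TubeBound Ω K ℓ) (C : Fin m → Fin n) (i : Fin n) (x : Eu n) :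
    projField Ω ℓ q C i x ^ 2
      ≤ ((n : ℝ) ^ (m + 1)) ^ 2 * tensorNormSq (covDeriv Ω (m + 1) q x) := by
  have h1 : |projField Ω ℓ q C i x|
      ≤ (n : ℝ) ^ (m + 1) * √(tensorNormSq (covDeriv Ω (m + 1) q x)) := by
    refine abs_tensor_le _ fun k => ?_
    refine Fin.cases (by simp) (fun k => ?_) k
    simpa using h.norm_projVec_le (C k) x
  have h2 := pow_le_pow_left₀ (abs_nonneg _) h1 2
  rwa [sq_abs, mul_pow, Real.sq_sqrt (tensorNormSq_nonneg _)] at h2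

/-- The leading part ∇^{m+2}q(e_i, e_j, …) is symmetric in i and j, so only the projection errors
survive. -/
lemma projField_curl_sq_le (h : TubeBound Ω K ℓ) (hq : ContDiffOn ℝ (m + 2 : ℕ) q (closure Ω))
    (C : Fin m → Fin n) (i j : Fin n) (hx : x ∈ closure Ω) :
    (pd Ω i (projField Ω ℓ q C j) x - pd Ω j (projField Ω ℓ q C i) x) ^ 2
      ≤ (2 * projErrorConst n m K ℓ) ^ 2 * tensorNormSq (covDeriv Ω (m + 1) q x) := by
  have e : pd Ω i (projField Ω ℓ q C j) x - pd Ω j (projField Ω ℓ q C i) x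
      = projError Ω ℓ q C i j x - projError Ω ℓ q C j i x := by
    rw [projError, projError, h.smooth.covDeriv_swap hq hx]
    ring
  have h1 := h.abs_projError_le hq C i j hx
  have h2 := h.abs_projError_le hq C j i hx
  have h3 : |pd Ω i (projField Ω ℓ q C j) x - pd Ω j (projField Ω ℓ q C i) x|
      ≤ 2 * projErrorConst n m K ℓ * √(tensorNormSq (covDeriv Ω (m + 1) q x)) := by
    rw [e]
    refine (abs_sub _ _).trans ?_
    linarith
  have h4 := pow_le_pow_left₀ (abs_nonneg _) h3 2
  rwa [sq_abs, mul_pow, Real.sq_sqrt (tensorNormSq_nonneg _)] at h4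

lemma abs_sum_projError_le (h : TubeBound Ω K ℓ) (hq : ContDiffOn ℝ (m + 2 : ℕ) q (closure Ω))
    (C : Fin m → Fin n) (hx : x ∈ closure Ω) :
    |∑ i, projError Ω ℓ q C i i x|
      ≤ n * projErrorConst n m K ℓ * √(tensorNormSq (covDeriv Ω (m + 1) q x)) := by
  refine (Finset.abs_sum_le_sum_abs _ _).trans ?_
  refine (Finset.sum_le_sum fun i _ => h.abs_projError_le hq C i i hx).trans (le_of_eq ?_)
  simp
  ring

/-- The leading part is a trace of ∇^{m+2}q, that is ∇^m Δq evaluated on projected basis vectors. -/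
lemma projField_div_sq_le (h : TubeBound Ω K ℓ) (hq : ContDiffOn ℝ (m + 2 : ℕ) q (closure Ω))
    (C : Fin m → Fin n) (hx : x ∈ closure Ω) :
    (∑ i, pd Ω i (projField Ω ℓ q C i) x) ^ 2
      ≤ 2 * ((n : ℝ) ^ m) ^ 2 * tensorNormSq (covDeriv Ω m (lap Ω q) x)
        + 2 * (n * projErrorConst n m K ℓ) ^ 2 * tensorNormSq (covDeriv Ω (m + 1) q x) := by
  have e : ∑ i, pd Ω i (projField Ω ℓ q C i) x
      = covDeriv Ω m (lap Ω q) x (fun k => normalProj (normalExt Ω ℓ x) (eb (C k)))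
        + ∑ i, projError Ω ℓ q C i i x := by
    rw [h.smooth.covDeriv_lap m hx hq, ← Finset.sum_add_distrib]
    refine Finset.sum_congr rfl fun i _ => ?_
    rw [projError]
    ring
  refine sq_le_of_abs_le ?_ (tensorNormSq_nonneg _) (tensorNormSq_nonneg _) rfl
  rw [e]
  exact (abs_add_le _ _).trans (add_le_add
    (abs_tensor_le _ fun k => h.norm_projVec_le (C k) x) (h.abs_sum_projError_le hq C hx))

/-- On the boundary |X| = 1, so subtracting the double normal component from the trace leaves the
trace over projected directions (`tensor_sum_normalProj`). Every slot of the leading part is then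
projected: this is where Π∇^{m+2}q enters the estimate. -/
lemma projField_bdry_sq_le (h : TubeBound Ω K ℓ) (hq : ContDiffOn ℝ (m + 2 : ℕ) q (closure Ω))
    (C : Fin m → Fin n) (hx : x ∈ frontier Ω) :
    ((∑ i, pd Ω i (projField Ω ℓ q C i) x)
      - ∑ i, nc Ω ℓ i x * ∑ l, nc Ω ℓ l x * pd Ω i (projField Ω ℓ q C l) x) ^ 2
      ≤ 2 * (n : ℝ) ^ 2 * projNormSq Ω ℓ (m + 2) q x
        + 2 * (n * projErrorConst n m K ℓ + n ^ 2 * projErrorConst n m K ℓ) ^ 2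
          * tensorNormSq (covDeriv Ω (m + 1) q x) := by
  have hxc := frontier_subset_closure hx
  set E := projErrorConst n m K ℓ with hE
  set N := tensorNormSq (covDeriv Ω (m + 1) q x) with hN
  set α := covDeriv Ω (m + 2) q x with hα
  set u : Fin m → Eu n := fun k => normalProj (normalExt Ω ℓ x) (eb (C k)) with hu
  have hpd : ∀ i l, pd Ω i (projField Ω ℓ q C l) x
      = α (Matrix.vecCons (eb i) (Matrix.vecCons (eb l) u)) + projError Ω ℓ q C i l x := by
    intro i l
    rw [projError]
    ring
  have htr := tensor_sum_normalProj α (h.sum_nc_sq hx) u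
  have e : (∑ i, pd Ω i (projField Ω ℓ q C i) x)
      - ∑ i, nc Ω ℓ i x * ∑ l, nc Ω ℓ l x * pd Ω i (projField Ω ℓ q C l) x
      = (∑ i, α (Matrix.vecCons (normalProj (normalExt Ω ℓ x) (eb i))
          (Matrix.vecCons (normalProj (normalExt Ω ℓ x) (eb i)) u)))
        + ((∑ i, projError Ω ℓ q C i i x)
          - ∑ i, nc Ω ℓ i x * ∑ l, nc Ω ℓ l x * projError Ω ℓ q C i l x) := by
    rw [htr]
    simp only [hpd, mul_add, Finset.sum_add_distrib]
    change _ = _ - ∑ i, nc Ω ℓ i x * ∑ l, nc Ω ℓ l x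
      * α (Matrix.vecCons (eb i) (Matrix.vecCons (eb l) u)) + _
    ring
  have hX := fun i => h.abs_nc_le i x
  have b1 : |∑ i, α (Matrix.vecCons (normalProj (normalExt Ω ℓ x) (eb i))
      (Matrix.vecCons (normalProj (normalExt Ω ℓ x) (eb i)) u))|
      ≤ n * √(projNormSq Ω ℓ (m + 2) q x) := by
    refine (Finset.abs_sum_le_sum_abs _ _).trans ?_
    refine sum_le_natCast_mul fun i => ?_
    have e2 : Matrix.vecCons (normalProj (normalExt Ω ℓ x) (eb i))
        (Matrix.vecCons (normalProj (normalExt Ω ℓ x) (eb i)) u)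
        = fun k => normalProj (normalExt Ω ℓ x)
          (eb ((Fin.cons i (Fin.cons i C : Fin (m + 1) → Fin n) : Fin (m + 2) → Fin n) k)) := by
      funext k
      refine Fin.cases (by simp) (fun k => ?_) k
      refine Fin.cases (by simp) (fun k => by simp [hu]) k
    rw [e2]
    exact abs_component_le_sqrt_projNormSq _
  have b2 : |∑ i, nc Ω ℓ i x * ∑ l, nc Ω ℓ l x * projError Ω ℓ q C i l x| ≤ n ^ 2 * E * √N := by
    have h1 : ∀ i, |∑ l, nc Ω ℓ l x * projError Ω ℓ q C i l x| ≤ n * (1 * (E * √N)) := fun i =>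
      abs_sum_mul_le hX zero_le_one fun l => h.abs_projError_le hq C i l hxc
    refine (abs_sum_mul_le hX zero_le_one h1).trans (le_of_eq ?_)
    ring
  refine sq_le_of_abs_le (c := n) (d := n * E + n ^ 2 * E) ?_ (tensorNormSq_nonneg _)
    (tensorNormSq_nonneg _) rfl
  rw [e]
  refine (abs_add_le _ _).trans (add_le_add b1 ((abs_sub _ _).trans ?_))
  have := h.abs_sum_projError_le hq C hxc
  linarith

/-- The constant in the recovery of a symmetric tensor. -/
def _root_.WeightedElliptic.recoveryFactor (n m : ℕ) : ℝ :=
  (n : ℝ) ^ (m + 2) * (recoveryConst n (m + 1) * ((n : ℝ) + 1) ^ (m + 2)) ^ 2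

/-- Recovery of all second derivatives of the projected fields. -/
lemma tensorNormSq_le_projField (h : TubeBound Ω K ℓ)
    (hq : ContDiffOn ℝ (m + 2 : ℕ) q (closure Ω)) (hx : x ∈ closure Ω) :
    tensorNormSq (covDeriv Ω (m + 2) q x)
      ≤ recoveryFactor n m * (n * (1 + projErrorConst n m K ℓ) + 1) ^ 2
        * ((∑ C : Fin m → Fin n, ∑ i, ∑ j, pd Ω i (projField Ω ℓ q C j) x ^ 2)
          + tensorNormSq (covDeriv Ω m (lap Ω q) x)
          + tensorNormSq (covDeriv Ω (m + 1) q x)) := by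
  set E := projErrorConst n m K ℓ with hE
  have hE0 : 0 ≤ E := h.projErrorConst_nonneg
  set N := tensorNormSq (covDeriv Ω (m + 1) q x) with hN
  have hN0 : 0 ≤ N := tensorNormSq_nonneg _
  set F := tensorNormSq (covDeriv Ω m (lap Ω q) x) with hF
  have hF0 : 0 ≤ F := tensorNormSq_nonneg _
  set Q := ∑ C : Fin m → Fin n, ∑ i, ∑ j, pd Ω i (projField Ω ℓ q C j) x ^ 2 with hQ
  have hQ0 : 0 ≤ Q := by positivity
  set S := Q + F + N with hS
  have hS0 : 0 ≤ S := by positivity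
  set c : ℝ := n * (1 + E) + 1 with hc
  have hQS : √Q ≤ √S := Real.sqrt_le_sqrt (by linarith)
  have hFS : √F ≤ √S := Real.sqrt_le_sqrt (by linarith)
  have hNS : √N ≤ √S := Real.sqrt_le_sqrt (by linarith)
  have hs0 := Real.sqrt_nonneg S
  have hpdQ : ∀ (C : Fin m → Fin n) i j, |pd Ω i (projField Ω ℓ q C j) x| ≤ √Q := by
    intro C i j
    refine Real.abs_le_sqrt ?_
    refine (Finset.single_le_sum (f := fun j => pd Ω i (projField Ω ℓ q C j) x ^ 2)
      (fun _ _ => sq_nonneg _) (Finset.mem_univ j)).trans ?_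
    refine (Finset.single_le_sum (f := fun i => ∑ j, pd Ω i (projField Ω ℓ q C j) x ^ 2)
      (fun _ _ => by positivity) (Finset.mem_univ i)).trans ?_
    exact Finset.single_le_sum (f := fun C : Fin m → Fin n =>
      ∑ i, ∑ j, pd Ω i (projField Ω ℓ q C j) x ^ 2) (fun _ _ => by positivity) (Finset.mem_univ C)
  have hn0 : (0 : ℝ) ≤ n := Nat.cast_nonneg n
  have hM : 0 ≤ c * √S := by positivity
  have hmain := (h.smooth.isSymmTensor_covDeriv (s := m + 1) hx
    (by exact_mod_cast hq)).tensorNormSq_le (h.norm_normalExt_le x) hM ?_ ?_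
  · refine hmain.trans (le_of_eq ?_)
    rw [recoveryFactor, mul_pow, mul_pow, mul_pow c, Real.sq_sqrt hS0]
    ring
  · intro i C'
    have e1 : (fun k => normalProj (normalExt Ω ℓ x) (eb (C' k)))
        = Matrix.vecCons (normalProj (normalExt Ω ℓ x) (eb (C' 0)))
          fun k : Fin m => normalProj (normalExt Ω ℓ x) (eb (C' k.succ)) :=
      (vecCons_self fun k => normalProj (normalExt Ω ℓ x) (eb (C' k))).symm
    set C : Fin m → Fin n := fun k => C' k.succ with hC
    -- A component with only the first slot free is a combination, through its second slot, of
    -- derivatives ∂_i of the projected fields, up to the projection error.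
    have e2 : covDeriv Ω (m + 2) q x (Matrix.vecCons (eb i)
        fun k => normalProj (normalExt Ω ℓ x) (eb (C' k)))
        = ∑ l, normalProj (normalExt Ω ℓ x) (eb (C' 0)) l
          * (pd Ω i (projField Ω ℓ q C l) x - projError Ω ℓ q C i l x) := by
      rw [e1]
      refine (tensor_cons_sum ((covDeriv Ω (m + 2) q x).curryLeft (eb i)) _ _).trans ?_
      refine Finset.sum_congr rfl fun l _ => ?_
      rw [projError, sub_sub_cancel]
      rfl
    rw [show covDeriv Ω (m + 1 + 1) q x = covDeriv Ω (m + 2) q x from rfl, e2]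
    refine (abs_sum_mul_le (fun l => h.abs_projEntry_le (C' 0) l x) zero_le_one
      (α := (1 + E) * √S) fun l => ?_).trans ?_
    · refine (abs_sub _ _).trans ?_
      have h1 := hpdQ C i l
      have h2 := h.abs_projError_le hq C i l hx
      have h3 := mul_le_mul_of_nonneg_left hNS hE0
      linarith
    · rw [hc]
      nlinarith
  · intro A
    rw [h.smooth.tensorTrace_covDeriv hx hq]
    refine (abs_basis_le_sqrt _ A).trans (hFS.trans ?_)
    refine le_mul_of_one_le_left hs0 ?_
    rw [hc]
    nlinarith

/-- Recovery of a derivative from the projected fields at the same order. -/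
lemma tensorNormSq_le_projField_self (h : TubeBound Ω K ℓ)
    (hq : ContDiffOn ℝ (m + 2 : ℕ) q (closure Ω)) (hx : x ∈ closure Ω) :
    tensorNormSq (covDeriv Ω (m + 2) q x)
      ≤ recoveryFactor n m * ((∑ C : Fin (m + 1) → Fin n, ∑ i, projField Ω ℓ q C i x ^ 2)
          + tensorNormSq (covDeriv Ω m (lap Ω q) x)) := by
  set F := tensorNormSq (covDeriv Ω m (lap Ω q) x) with hF
  have hF0 : 0 ≤ F := tensorNormSq_nonneg _
  set Q := ∑ C : Fin (m + 1) → Fin n, ∑ i, projField Ω ℓ q C i x ^ 2 with hQ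
  have hQ0 : 0 ≤ Q := by positivity
  have hmain := (h.smooth.isSymmTensor_covDeriv (s := m + 1) hx
    (by exact_mod_cast hq)).tensorNormSq_le (h.norm_normalExt_le x) (Real.sqrt_nonneg (Q + F)) ?_ ?_
  · refine hmain.trans (le_of_eq ?_)
    rw [recoveryFactor, mul_pow, mul_pow, Real.sq_sqrt (add_nonneg hQ0 hF0)]
    ring
  · intro i C
    refine (Real.abs_le_sqrt ?_).trans (Real.sqrt_le_sqrt (le_add_of_nonneg_right hF0))
    refine (Finset.single_le_sum (f := fun i => projField Ω ℓ q C i x ^ 2)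
      (fun _ _ => sq_nonneg _) (Finset.mem_univ i)).trans ?_
    exact Finset.single_le_sum (f := fun C : Fin (m + 1) → Fin n =>
      ∑ i, projField Ω ℓ q C i x ^ 2) (fun _ _ => by positivity) (Finset.mem_univ C)
  · intro A
    rw [h.smooth.tensorTrace_covDeriv hx hq]
    exact (abs_basis_le_sqrt _ A).trans (Real.sqrt_le_sqrt (le_add_of_nonneg_left hQ0))

/-- The tangential part of a projected field is bounded by the projected derivative. -/
lemma projField_tangential_le (h : TubeBound Ω K ℓ) (C : Fin m → Fin n) (hx : x ∈ frontier Ω) :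
    (∑ i, projField Ω ℓ q C i x ^ 2) - (∑ i, nc Ω ℓ i x * projField Ω ℓ q C i x) ^ 2
      ≤ n * projNormSq Ω ℓ (m + 1) q x := by
  set b := ∑ i, nc Ω ℓ i x * projField Ω ℓ q C i x with hb
  set u : Fin m → Eu n := fun k => normalProj (normalExt Ω ℓ x) (eb (C k)) with hu
  have hb' : b = covDeriv Ω (m + 1) q x (Matrix.vecCons (normalExt Ω ℓ x) u) :=
    (tensor_cons_sum _ _ _).symm
  have e1 : ∀ i, covDeriv Ω (m + 1) q x
      (Matrix.vecCons (normalProj (normalExt Ω ℓ x) (eb i)) u)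
      = projField Ω ℓ q C i x - nc Ω ℓ i x * b := by
    intro i
    rw [normalProj_apply, inner_eb, tensor_cons_sub_smul, ← hb']
    rfl
  have e2 : (∑ i, projField Ω ℓ q C i x ^ 2) - b ^ 2
      = ∑ i, (projField Ω ℓ q C i x - nc Ω ℓ i x * b) ^ 2 := by
    have e3 : ∀ i, (projField Ω ℓ q C i x - nc Ω ℓ i x * b) ^ 2 = projField Ω ℓ q C i x ^ 2
        - 2 * b * (nc Ω ℓ i x * projField Ω ℓ q C i x) + (nc Ω ℓ i x * nc Ω ℓ i x) * b ^ 2 := by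
      intro i
      ring
    rw [Finset.sum_congr rfl fun i _ => e3 i, Finset.sum_add_distrib, Finset.sum_sub_distrib,
      ← Finset.mul_sum, ← Finset.sum_mul, h.sum_nc_sq hx, ← hb]
    ring
  rw [e2]
  refine sum_le_natCast_mul fun i => ?_
  rw [← e1]
  have e4 : Matrix.vecCons (normalProj (normalExt Ω ℓ x) (eb i)) u
      = fun k => normalProj (normalExt Ω ℓ x)
        (eb ((Fin.cons i C : Fin (m + 1) → Fin n) k)) := by
    funext k
    refine Fin.cases (by simp) (fun k => by simp [hu]) k
  rw [e4]
  have h1 := abs_component_le_sqrt_projNormSq (Ω := Ω) (ℓ := ℓ) (q := q) (x := x)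
    (Fin.cons i C : Fin (m + 1) → Fin n)
  have h2 := pow_le_pow_left₀ (abs_nonneg _) h1 2
  rwa [sq_abs, Real.sq_sqrt (projNormSq_nonneg)] at h2

end TubeBound

end ProjectedBounds
/-! ### Weighted estimates with cutoffs -/

/-- The squared norm `|∇ˢ q|²`. -/
abbrev derivNormSq {n : ℕ} (Ω : Set (Eu n)) (s : ℕ) (q : Eu n → ℝ) (x : Eu n) : ℝ :=
  tensorNormSq (covDeriv Ω s q x)

/-- A common constant in the pointwise bounds for the projected fields. -/
def fieldConst (n m : ℕ) (K ℓ : ℝ) : ℝ :=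
  ((n : ℝ) ^ (m + 1)) ^ 2 + (2 * projErrorConst n m K ℓ) ^ 2 + 2 * ((n : ℝ) ^ m) ^ 2
    + 2 * (n * projErrorConst n m K ℓ) ^ 2 + 2 * (n : ℝ) ^ 2
    + 2 * (n * projErrorConst n m K ℓ + n ^ 2 * projErrorConst n m K ℓ) ^ 2

lemma fieldConst_nonneg (n m : ℕ) (K ℓ : ℝ) : 0 ≤ fieldConst n m K ℓ := by
  rw [fieldConst]; positivity

lemma add_mul_le_mul_add {c₁ c₂ Λ u v : ℝ} (h₁ : c₁ ≤ Λ) (h₂ : c₂ ≤ Λ) (hu : 0 ≤ u)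
    (hv : 0 ≤ v) : c₁ * u + c₂ * v ≤ Λ * (u + v) := by
  nlinarith [mul_le_mul_of_nonneg_right h₁ hu, mul_le_mul_of_nonneg_right h₂ hv]

section FieldConst

variable (n m : ℕ) (K ℓ : ℝ)

lemma le_fieldConst_size : ((n : ℝ) ^ (m + 1)) ^ 2 ≤ fieldConst n m K ℓ := by
  rw [fieldConst]
  have h1 : 0 ≤ (2 * projErrorConst n m K ℓ) ^ 2 + 2 * ((n : ℝ) ^ m) ^ 2
    + 2 * (n * projErrorConst n m K ℓ) ^ 2 + 2 * (n : ℝ) ^ 2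
    + 2 * (n * projErrorConst n m K ℓ + n ^ 2 * projErrorConst n m K ℓ) ^ 2 := by positivity
  linarith

lemma le_fieldConst_curl : (2 * projErrorConst n m K ℓ) ^ 2 ≤ fieldConst n m K ℓ := by
  rw [fieldConst]
  have h1 : 0 ≤ ((n : ℝ) ^ (m + 1)) ^ 2 + 2 * ((n : ℝ) ^ m) ^ 2
    + 2 * (n * projErrorConst n m K ℓ) ^ 2 + 2 * (n : ℝ) ^ 2
    + 2 * (n * projErrorConst n m K ℓ + n ^ 2 * projErrorConst n m K ℓ) ^ 2 := by positivity
  linarith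

lemma le_fieldConst_div : 2 * ((n : ℝ) ^ m) ^ 2 ≤ fieldConst n m K ℓ
    ∧ 2 * (n * projErrorConst n m K ℓ) ^ 2 ≤ fieldConst n m K ℓ := by
  rw [fieldConst]
  have h1 : 0 ≤ ((n : ℝ) ^ (m + 1)) ^ 2 + (2 * projErrorConst n m K ℓ) ^ 2 + 2 * (n : ℝ) ^ 2
    + 2 * (n * projErrorConst n m K ℓ + n ^ 2 * projErrorConst n m K ℓ) ^ 2 := by positivity
  have h2 : 0 ≤ 2 * ((n : ℝ) ^ m) ^ 2 := by positivity
  have h3 : 0 ≤ 2 * (n * projErrorConst n m K ℓ) ^ 2 := by positivity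
  constructor <;> linarith

lemma le_fieldConst_bdry : 2 * (n : ℝ) ^ 2 ≤ fieldConst n m K ℓ
    ∧ 2 * (n * projErrorConst n m K ℓ + n ^ 2 * projErrorConst n m K ℓ) ^ 2
      ≤ fieldConst n m K ℓ := by
  rw [fieldConst]
  have h1 : 0 ≤ ((n : ℝ) ^ (m + 1)) ^ 2 + (2 * projErrorConst n m K ℓ) ^ 2
    + 2 * ((n : ℝ) ^ m) ^ 2 + 2 * (n * projErrorConst n m K ℓ) ^ 2 := by positivity
  have h2 : 0 ≤ 2 * (n : ℝ) ^ 2 := by positivity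
  have h3 : 0 ≤ 2 * (n * projErrorConst n m K ℓ + n ^ 2 * projErrorConst n m K ℓ) ^ 2 := by
    positivity
  constructor <;> linarith

end FieldConst

namespace TubeBound

variable {n m : ℕ} {Ω : Set (Eu n)} {K ℓ B R : ℝ} {φ ψ η q : Eu n → ℝ}

lemma setIntegral_mul_le (h : TubeBound Ω K ℓ) {c d f : Eu n → ℝ} (hc : Continuous c)
    (hd : Continuous d) (hcR : ∀ x, R < ‖x‖ → c x = 0) (hdR : ∀ x, R < ‖x‖ → d x = 0)
    (hcd : ∀ x, c x ≤ d x) (hf : ContinuousOn f (closure Ω)) (hf0 : ∀ x, 0 ≤ f x) :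
    ∫ x in Ω, c x * f x ≤ ∫ x in Ω, d x * f x :=
  setIntegral_mono_on (h.integrableOn_mul hc hcR hf) (h.integrableOn_mul hd hdR hf)
    h.smooth.1.measurableSet fun x _ => mul_le_mul_of_nonneg_right (hcd x) (hf0 x)

lemma integral_bdry_mul_le (h : TubeBound Ω K ℓ) {c d f : Eu n → ℝ} (hc : Continuous c)
    (hd : Continuous d) (hcR : ∀ x, R < ‖x‖ → c x = 0) (hdR : ∀ x, R < ‖x‖ → d x = 0)
    (hcd : ∀ x, c x ≤ d x) (hf : ContinuousOn f (closure Ω)) (hf0 : ∀ x, 0 ≤ f x) :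
    ∫ x, c x * f x ∂(bdryMeasure Ω) ≤ ∫ x, d x * f x ∂(bdryMeasure Ω) :=
  setIntegral_mono_on (h.integrable_bdry_mul hc hcR hf) (h.integrable_bdry_mul hd hdR hf)
    isClosed_frontier.measurableSet fun x _ => mul_le_mul_of_nonneg_right (hcd x) (hf0 x)

lemma integral_mul_const_mul_add {μ : Measure (Eu n)} {c f g : Eu n → ℝ} (Λ : ℝ)
    (hf : Integrable (fun x => c x * f x) μ) (hg : Integrable (fun x => c x * g x) μ) :
    ∫ x, c x * (Λ * (f x + g x)) ∂μ = Λ * ((∫ x, c x * f x ∂μ) + ∫ x, c x * g x ∂μ) := by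
  rw [← integral_add hf hg, ← integral_const_mul]
  refine integral_congr_ae (Eventually.of_forall fun x => ?_)
  simp only
  ring

lemma integral_mul_const_mul {μ : Measure (Eu n)} {c f : Eu n → ℝ} (Λ : ℝ) :
    ∫ x, c x * (Λ * f x) ∂μ = Λ * ∫ x, c x * f x ∂μ := by
  rw [← integral_const_mul]
  refine integral_congr_ae (Eventually.of_forall fun x => ?_)
  simp only
  ring

/-- The weighted trace inequality for derivatives. -/
lemma trace_covDeriv (h : TubeBound Ω K ℓ) (hc : CutoffTriple φ ψ η B R) {s : ℕ}
    (hq : ContDiffOn ℝ (s + 1 : ℕ) q (closure Ω)) {ε : ℝ} (hε : 0 < ε) :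
    ∫ x, ψ x * derivNormSq Ω s q x ∂(bdryMeasure Ω)
      ≤ ε * (∫ x in Ω, φ x * derivNormSq Ω (s + 1) q x)
        + n * (B + normalDerivBound K ℓ + 1 / ε) * ∫ x in Ω, η x * derivNormSq Ω s q x := by
  have hu := h.smooth.uniqueDiffOn_closure
  have hcd : ∀ I : Fin s → Fin n,
      ContDiffOn ℝ 1 (fun x => covDeriv Ω s q x fun k => eb (I k)) (closure Ω) := fun I => by
    have := h.smooth.contDiffOn_covDeriv_apply (k := 1) (by rwa [add_comm]) fun k => eb (I k)
    exact_mod_cast this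
  have hφc := hc.contDiff_fst.continuous
  have hψc := hc.contDiff_snd.continuous
  have e1 : ∫ x, ψ x * derivNormSq Ω s q x ∂(bdryMeasure Ω)
      = ∑ I : Fin s → Fin n,
        ∫ x, ψ x * (covDeriv Ω s q x fun k => eb (I k)) ^ 2 ∂(bdryMeasure Ω) := by
    rw [← integral_finsetSum]
    · simp only [derivNormSq, tensorNormSq, Finset.mul_sum]
    · exact fun I _ => h.integrable_bdry_mul hψc hc.support_snd ((hcd I).continuousOn.pow 2)
  have e2 : ∫ x in Ω, η x * derivNormSq Ω s q x
      = ∑ I : Fin s → Fin n, ∫ x in Ω, η x * (covDeriv Ω s q x fun k => eb (I k)) ^ 2 := by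
    rw [← integral_finsetSum]
    · simp only [derivNormSq, tensorNormSq, Finset.mul_sum]
    · exact fun I _ => h.integrableOn_mul hc.continuous_trd hc.support
        ((hcd I).continuousOn.pow 2)
  have e3 : ∫ x in Ω, φ x * derivNormSq Ω (s + 1) q x
      = ∑ I : Fin s → Fin n, ∫ x in Ω, φ x
        * ∑ i, pd Ω i (fun x => covDeriv Ω s q x fun k => eb (I k)) x ^ 2 := by
    rw [← integral_finsetSum]
    · refine setIntegral_congr_fun h.smooth.1.measurableSet fun x hx => ?_
      simp only [derivNormSq, tensorNormSq_succ, Finset.mul_sum]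
      refine Finset.sum_congr rfl fun I _ => Finset.sum_congr rfl fun i _ => ?_
      rw [h.smooth.pd_covDeriv hq (subset_closure hx)]
    · exact fun I _ => h.integrableOn_mul hφc hc.support_fst
        (continuousOn_finsetSum _ fun i _ => (continuousOn_pd hu (hcd I)).pow 2)
  rw [e1, e2, e3, Finset.mul_sum, Finset.mul_sum, ← Finset.sum_add_distrib]
  exact Finset.sum_le_sum fun I _ => h.trace_estimate hc (hcd I) hε

/-- The div-curl estimate for one projected field. -/
lemma projField_estimate (h : TubeBound Ω K ℓ) (hn : 0 < n) (hc : CutoffTriple φ ψ η B R)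
    (hq : ContDiffOn ℝ (m + 3 : ℕ) q (closure Ω)) (C : Fin m → Fin n) {δ : ℝ} (hδ : 0 < δ) :
    ∫ x in Ω, φ x * ∑ i, ∑ j, pd Ω i (projField Ω ℓ q C j) x ^ 2
      ≤ 2 * fieldConst n m K ℓ * ((∫ x in Ω, φ x * derivNormSq Ω m (lap Ω q) x)
        + (1 + n ^ 2 * (1 + 2 * (n + 1) * B ^ 2)) * (∫ x in Ω, η x * derivNormSq Ω (m + 1) q x)
        + δ * (∫ x, φ x * projNormSq Ω ℓ (m + 2) q x ∂(bdryMeasure Ω))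
        + (δ + (2 * n ^ 3 * (B + 2 * normalDerivBound K ℓ) + n ^ 2 / δ))
          * ∫ x, ψ x * derivNormSq Ω (m + 1) q x ∂(bdryMeasure Ω)) := by
  set Λ := fieldConst n m K ℓ with hΛ
  have hΛ0 : 0 ≤ Λ := fieldConst_nonneg n m K ℓ
  have hφc := hc.contDiff_fst.continuous
  have hψc := hc.contDiff_snd.continuous
  have hq2 : ContDiffOn ℝ (m + 2 : ℕ) q (closure Ω) := hq.of_le (by norm_cast; omega)
  have hq1 : ContDiffOn ℝ (m + 1 : ℕ) q (closure Ω) := hq.of_le (by norm_cast; omega)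
  have cN := h.smooth.continuousOn_tensorNormSq hq1
  have cF := h.smooth.continuousOn_tensorNormSq (s := m) (h.smooth.contDiffOn_lap hq2)
  have cT := h.continuousOn_projNormSq hq2
  have main := h.divCurl_estimate hn hc (a := projField Ω ℓ q C)
    (N := fun x => Λ * derivNormSq Ω (m + 1) q x)
    (F := fun x => Λ * (derivNormSq Ω m (lap Ω q) x + derivNormSq Ω (m + 1) q x))
    (T := fun x => Λ * (projNormSq Ω ℓ (m + 2) q x + derivNormSq Ω (m + 1) q x))
    (fun i => by
      have := h.contDiffOn_projField (k := 2) (m := m) (q := q) (hq.of_le (by norm_cast; omega)) C i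
      exact_mod_cast this)
    (continuousOn_const.mul cN) (continuousOn_const.mul (cF.add cN))
    (continuousOn_const.mul (cT.add cN))
    (fun x _ i => (h.projField_sq_le C i x).trans
      (mul_le_mul_of_nonneg_right (le_fieldConst_size n m K ℓ) (tensorNormSq_nonneg _)))
    (fun x hx i j => (h.projField_curl_sq_le hq2 C i j hx).trans
      (mul_le_mul_of_nonneg_right (le_fieldConst_curl n m K ℓ) (tensorNormSq_nonneg _)))
    (fun x hx => (h.projField_div_sq_le hq2 C hx).trans (add_mul_le_mul_add
      (le_fieldConst_div n m K ℓ).1 (le_fieldConst_div n m K ℓ).2 (tensorNormSq_nonneg _)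
      (tensorNormSq_nonneg _)))
    (fun x hx => (h.projField_bdry_sq_le hq2 C hx).trans (add_mul_le_mul_add
      (le_fieldConst_bdry n m K ℓ).1 (le_fieldConst_bdry n m K ℓ).2 projNormSq_nonneg
      (tensorNormSq_nonneg _))) hδ
  rw [integral_mul_const_mul_add Λ (h.integrableOn_mul hφc hc.support_fst cF)
      (h.integrableOn_mul hφc hc.support_fst cN), integral_mul_const_mul,
    integral_mul_const_mul_add Λ (h.integrable_bdry_mul hφc hc.support_fst cT)
      (h.integrable_bdry_mul hφc hc.support_fst cN), integral_mul_const_mul] at main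
  have m1 := mul_le_mul_of_nonneg_left (h.setIntegral_mul_le hφc hc.continuous_trd hc.support_fst
    hc.support (fun x => (hc.fst_le x).trans (hc.snd_le x)) cN
    fun x => tensorNormSq_nonneg _) hΛ0
  have m2 := mul_le_mul_of_nonneg_left (h.integral_bdry_mul_le hφc hψc hc.support_fst
    hc.support_snd hc.fst_le cN fun x => tensorNormSq_nonneg _) (mul_nonneg hδ.le hΛ0)
  linarith

/-- Sum the div-curl estimates over the n^m index families and recover ∇^{m+2}q pointwise from the
fields, the derivatives of Δq and lower order. -/
lemma interior_estimate (h : TubeBound Ω K ℓ) (hn : 0 < n) (hc : CutoffTriple φ ψ η B R)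
    (hq : ContDiffOn ℝ (m + 3 : ℕ) q (closure Ω)) {δ : ℝ} (hδ : 0 < δ) :
    ∫ x in Ω, φ x * derivNormSq Ω (m + 2) q x
      ≤ recoveryFactor n m * (n * (1 + projErrorConst n m K ℓ) + 1) ^ 2
        * (n ^ m * (2 * fieldConst n m K ℓ * ((∫ x in Ω, φ x * derivNormSq Ω m (lap Ω q) x)
        + (1 + n ^ 2 * (1 + 2 * (n + 1) * B ^ 2)) * (∫ x in Ω, η x * derivNormSq Ω (m + 1) q x)
        + δ * (∫ x, φ x * projNormSq Ω ℓ (m + 2) q x ∂(bdryMeasure Ω))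
        + (δ + (2 * n ^ 3 * (B + 2 * normalDerivBound K ℓ) + n ^ 2 / δ))
          * ∫ x, ψ x * derivNormSq Ω (m + 1) q x ∂(bdryMeasure Ω)))
        + (∫ x in Ω, φ x * derivNormSq Ω m (lap Ω q) x)
        + ∫ x in Ω, η x * derivNormSq Ω (m + 1) q x) := by
  have hu := h.smooth.uniqueDiffOn_closure
  have hφc := hc.contDiff_fst.continuous
  have hq2 : ContDiffOn ℝ (m + 2 : ℕ) q (closure Ω) := hq.of_le (by norm_cast; omega)
  have hq1 : ContDiffOn ℝ (m + 1 : ℕ) q (closure Ω) := hq.of_le (by norm_cast; omega)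
  have cN := h.smooth.continuousOn_tensorNormSq hq1
  have cN2 := h.smooth.continuousOn_tensorNormSq hq2
  have cF := h.smooth.continuousOn_tensorNormSq (s := m) (h.smooth.contDiffOn_lap hq2)
  have cA : ∀ C : Fin m → Fin n, ContinuousOn
      (fun x => ∑ i, ∑ j, pd Ω i (projField Ω ℓ q C j) x ^ 2) (closure Ω) := fun C =>
    continuousOn_finsetSum _ fun i _ => continuousOn_finsetSum _ fun j _ =>
      (continuousOn_pd hu (by
        have := h.contDiffOn_projField (k := 1) (m := m) (q := q)
          (hq.of_le (by norm_cast; omega)) C j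
        exact_mod_cast this)).pow 2
  set c := recoveryFactor n m * (n * (1 + projErrorConst n m K ℓ) + 1) ^ 2 with hcdef
  have hc0 : 0 ≤ c := by rw [hcdef, recoveryFactor]; positivity
  have s1 := setIntegral_le_three (f := fun x => φ x * derivNormSq Ω (m + 2) q x)
    (g₁ := fun x => ∑ C : Fin m → Fin n, φ x * ∑ i, ∑ j, pd Ω i (projField Ω ℓ q C j) x ^ 2)
    (μ := volume) h.smooth.1.measurableSet (h.integrableOn_mul hφc hc.support_fst cN2)
    (integrable_finsetSum _ fun C _ => h.integrableOn_mul hφc hc.support_fst (cA C))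
    (h.integrableOn_mul hφc hc.support_fst cF) (h.integrableOn_mul hφc hc.support_fst cN)
    c c c fun x hx => by
      have := mul_le_mul_of_nonneg_left (h.tensorNormSq_le_projField hq2 (subset_closure hx))
        (hc.nonneg x)
      rw [← Finset.mul_sum]
      refine this.trans (le_of_eq ?_)
      rw [hcdef]
      ring
  rw [integral_finsetSum _ fun C _ => h.integrableOn_mul hφc hc.support_fst (cA C)] at s1
  have s2 := Finset.sum_le_sum fun C (_ : C ∈ (Finset.univ : Finset (Fin m → Fin n))) =>
    h.projField_estimate hn hc hq C hδ
  rw [Finset.sum_const, Finset.card_univ, Fintype.card_fun, Fintype.card_fin, Fintype.card_fin,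
    nsmul_eq_mul] at s2
  push_cast at s2
  have m1 := h.setIntegral_mul_le hφc hc.continuous_trd hc.support_fst
    hc.support (fun x => (hc.fst_le x).trans (hc.snd_le x)) cN fun x => tensorNormSq_nonneg _
  have m2 := mul_le_mul_of_nonneg_left (add_le_add (add_le_add_left s2
    (∫ x in Ω, φ x * derivNormSq Ω m (lap Ω q) x)) m1) hc0
  linarith

/-- Here x stands for the top order in the interior, y for one order less on the boundary, t for the
projected data, f for Δq and N for one order less in the interior. Insert the trace bound for y into
the bound for x: the coefficient c D c₂ ε ≤ 1/2 lets half of x be absorbed, which is legitimate as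
all quantities are finite reals. -/
lemma absorb_estimate {x y t f N c D c₁ c₂ c₄ δ δ' ε : ℝ} (hc : 0 ≤ c) (hD : 0 ≤ D)
    (hc₁ : 0 ≤ c₁) (hc₂ : 0 ≤ c₂) (hc₄ : 0 ≤ c₄) (hx : 0 ≤ x) (ht : 0 ≤ t) (hf : 0 ≤ f)
    (hN : 0 ≤ N) (hδ : 0 ≤ δ) (hδ' : c * D * δ' ≤ δ / 4) (hε : c * D * c₂ * ε ≤ 1 / 2) (hε' : ε ≤ 1 / 2)
    (h₁ : x ≤ c * (D * (f + c₁ * N + δ' * t + c₂ * y) + f + N)) (h₂ : y ≤ ε * x + c₄ * N) :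
    y + x ≤ δ * t + (3 * (c * D + c + (c * D * c₁ + c + c * D * c₂ * c₄)) + c₄) * (f + N) := by
  have hcD : 0 ≤ c * D := mul_nonneg hc hD
  have e1 := mul_le_mul_of_nonneg_left h₂ (mul_nonneg hcD hc₂)
  have e2 := mul_le_mul_of_nonneg_right hδ' ht
  have e3 := mul_le_mul_of_nonneg_right hε hx
  have e4 := mul_le_mul_of_nonneg_right hε' hx
  have p1 : 0 ≤ c * D * c₁ := mul_nonneg hcD hc₁
  have p2 : 0 ≤ c * D * c₂ * c₄ := mul_nonneg (mul_nonneg hcD hc₂) hc₄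
  have k1 : x / 2 ≤ δ / 4 * t + (c * D + c) * f + (c * D * c₁ + c + c * D * c₂ * c₄) * N := by
    linarith
  have k2 : y + x ≤ 3 * (x / 2) + c₄ * N := by linarith
  have k3 : 0 ≤ (c * D + c) * N := mul_nonneg (add_nonneg hcD hc) hN
  have k4 : 0 ≤ (c * D * c₁ + c + c * D * c₂ * c₄) * f :=
    mul_nonneg (by linarith) hf
  have k5 : 0 ≤ c₄ * f := mul_nonneg hc₄ hf
  have k6 : 0 ≤ δ * t := mul_nonneg hδ ht
  linarith

end TubeBound
-- Raising the order by one, with uniform constants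
section WeightedSteps

variable {n m : ℕ} {K ℓ B : ℝ}

/-- One step of the interior estimate, with constants independent of the domain, the cutoffs and
the function. -/
theorem exists_interior_step (hn : 0 < n) (m : ℕ) (hK : 0 ≤ K) (hℓ : 0 < ℓ) (hB : 0 ≤ B) {δ : ℝ}
    (hδ : 0 < δ) : ∃ C : ℝ, 0 ≤ C ∧ ∀ (Ω : Set (Eu n)), TubeBound Ω K ℓ →
      ∀ (φ ψ η : Eu n → ℝ) (R : ℝ), CutoffTriple φ ψ η B R →
      ∀ q : Eu n → ℝ, ContDiffOn ℝ (m + 3 : ℕ) q (closure Ω) →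
        (∫ x, ψ x * derivNormSq Ω (m + 1) q x ∂(bdryMeasure Ω))
            + ∫ x in Ω, φ x * derivNormSq Ω (m + 2) q x
          ≤ δ * (∫ x, φ x * projNormSq Ω ℓ (m + 2) q x ∂(bdryMeasure Ω))
            + C * ((∫ x in Ω, φ x * derivNormSq Ω m (lap Ω q) x)
              + ∫ x in Ω, η x * derivNormSq Ω (m + 1) q x) := by
  have hκ : 0 ≤ normalDerivBound K ℓ := by
    have := normalBumpBound_nonneg
    rw [normalDerivBound]; positivity
  set c := recoveryFactor n m * (n * (1 + projErrorConst n m K ℓ) + 1) ^ 2 with hc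
  have hc0 : 0 ≤ c := by rw [hc, recoveryFactor]; positivity
  set D : ℝ := n ^ m * (2 * fieldConst n m K ℓ) with hD
  have hD0 : 0 ≤ D := by have := fieldConst_nonneg n m K ℓ; rw [hD]; positivity
  have hcD : 0 ≤ c * D := mul_nonneg hc0 hD0
  set c₁ : ℝ := 1 + n ^ 2 * (1 + 2 * (n + 1) * B ^ 2) with hc₁
  have hc₁0 : 0 ≤ c₁ := by positivity
  -- The order of choices matters: δ' comes first, making the projected data small enough. The
  -- coefficient c₂ of the lower-order boundary term contains n²/δ', and only then is ε chosen.
  set δ' : ℝ := δ / (4 * (c * D + 1)) with hδ'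
  have hδ'0 : 0 < δ' := by positivity
  set c₂ : ℝ := δ' + (2 * n ^ 3 * (B + 2 * normalDerivBound K ℓ) + n ^ 2 / δ') with hc₂
  have hc₂0 : 0 ≤ c₂ := by positivity
  -- This parameter of the trace inequality gives both c D c₂ ε ≤ 1/2 and ε ≤ 1/2; the added 1 also
  -- covers a vanishing product.
  set ε : ℝ := 1 / (2 * (c * D * c₂ + 1)) with hε
  have hε0 : 0 < ε := by positivity
  set c₄ : ℝ := n * (B + normalDerivBound K ℓ + 1 / ε) with hc₄
  have hc₄0 : 0 ≤ c₄ := by positivity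
  refine ⟨3 * (c * D + c + (c * D * c₁ + c + c * D * c₂ * c₄)) + c₄, by positivity, ?_⟩
  intro Ω h φ ψ η R hcut q hq
  have hn0 : ∀ {μ : Measure (Eu n)} {u v : Eu n → ℝ}, (∀ x, 0 ≤ u x) → (∀ x, 0 ≤ v x) →
      0 ≤ ∫ x, u x * v x ∂μ := fun hu hv => integral_nonneg fun x => mul_nonneg (hu x) (hv x)
  refine TubeBound.absorb_estimate (δ' := δ') (ε := ε) hc0 hD0 hc₁0 hc₂0 hc₄0
    (hn0 hcut.nonneg fun x => tensorNormSq_nonneg _)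
    (hn0 hcut.nonneg fun x => projNormSq_nonneg) (hn0 hcut.nonneg fun x => tensorNormSq_nonneg _)
    (hn0 hcut.trd_nonneg fun x => tensorNormSq_nonneg _) hδ.le ?_ ?_ ?_ ?_ ?_
  · rw [hδ', mul_div_assoc', div_le_div_iff₀ (by positivity) (by norm_num)]
    nlinarith
  · rw [hε, mul_one_div, div_le_div_iff₀ (by positivity) (by norm_num)]
    nlinarith
  · rw [hε]
    refine one_div_le_one_div_of_le (by norm_num) ?_
    nlinarith [mul_nonneg hcD hc₂0]
  · refine (h.interior_estimate hn hcut hq hδ'0).trans (le_of_eq ?_)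
    rw [hD]
    ring
  · exact h.trace_covDeriv hcut (s := m + 1) (hq.of_le (by norm_cast; omega)) hε0

/-- The boundary estimate at top order, with constants independent of the domain, the cutoffs and
the function. -/
theorem exists_boundary_step (hn : 0 < n) (m : ℕ) (hK : 0 ≤ K) (hℓ : 0 < ℓ) (hB : 0 ≤ B) :
    ∃ C : ℝ, 0 ≤ C ∧ ∀ (Ω : Set (Eu n)), TubeBound Ω K ℓ →
      ∀ (φ ψ η : Eu n → ℝ) (R : ℝ), CutoffTriple φ ψ η B R →
      ∀ q : Eu n → ℝ, ContDiffOn ℝ (m + 3 : ℕ) q (closure Ω) →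
        ∫ x, φ x * derivNormSq Ω (m + 2) q x ∂(bdryMeasure Ω)
          ≤ C * ((∫ x, φ x * projNormSq Ω ℓ (m + 2) q x ∂(bdryMeasure Ω))
            + (∫ x in Ω, φ x * derivNormSq Ω (m + 1) (lap Ω q) x)
            + (∫ x in Ω, η x * derivNormSq Ω m (lap Ω q) x)
            + ∫ x in Ω, η x * derivNormSq Ω (m + 2) q x) := by
  have hκ : 0 ≤ normalDerivBound K ℓ := by
    have := normalBumpBound_nonneg
    rw [normalDerivBound]; positivity
  set c := recoveryFactor n m with hc
  have hc0 : 0 ≤ c := by rw [hc, recoveryFactor]; positivity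
  set Λ := fieldConst n (m + 1) K ℓ with hΛ
  have hΛ0 : 0 ≤ Λ := fieldConst_nonneg _ _ _ _
  set c₁ : ℝ := n ^ 2 * (3 * B + 3 * normalDerivBound K ℓ + 3) with hc₁
  have hc₁0 : 0 ≤ c₁ := by positivity
  -- The trace inequality is used with parameter 1: nothing has to be absorbed here, as all interior
  -- terms are allowed on the right.
  set c₄ : ℝ := n * (B + normalDerivBound K ℓ + 1 / 1) with hc₄
  have hc₄0 : 0 ≤ c₄ := by positivity
  set D : ℝ := n ^ (m + 1) with hD
  have hD0 : 0 ≤ D := by positivity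
  refine ⟨c * (D * (2 * n + Λ + Λ * (1 + c₁)) + 1 + c₄), by positivity, ?_⟩
  intro Ω h φ ψ η R hcut q hq
  have hu := h.smooth.uniqueDiffOn_closure
  have hφc := hcut.contDiff_fst.continuous
  have hψc := hcut.contDiff_snd.continuous
  have hn0 : ∀ {μ : Measure (Eu n)} {u v : Eu n → ℝ}, (∀ x, 0 ≤ u x) → (∀ x, 0 ≤ v x) →
      0 ≤ ∫ x, u x * v x ∂μ := fun hu hv => integral_nonneg fun x => mul_nonneg (hu x) (hv x)
  have hq2 : ContDiffOn ℝ (m + 2 : ℕ) q (closure Ω) := hq.of_le (by norm_cast; omega)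
  have hl1 : ContDiffOn ℝ (m + 1 : ℕ) (lap Ω q) (closure Ω) := h.smooth.contDiffOn_lap hq
  have cN := h.smooth.continuousOn_tensorNormSq hq2
  have cF1 := h.smooth.continuousOn_tensorNormSq hl1
  have cF := h.smooth.continuousOn_tensorNormSq (s := m) (h.smooth.contDiffOn_lap hq2)
  have cT := h.continuousOn_projNormSq hq2
  set t := ∫ x, φ x * projNormSq Ω ℓ (m + 2) q x ∂(bdryMeasure Ω) with ht
  set f₁ := ∫ x in Ω, φ x * derivNormSq Ω (m + 1) (lap Ω q) x with hf₁
  set f := ∫ x in Ω, η x * derivNormSq Ω m (lap Ω q) x with hf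
  set N := ∫ x in Ω, η x * derivNormSq Ω (m + 2) q x with hN
  have t0 : 0 ≤ t := hn0 hcut.nonneg fun x => projNormSq_nonneg
  have f10 : 0 ≤ f₁ := hn0 hcut.nonneg fun x => tensorNormSq_nonneg _
  have f0 : 0 ≤ f := hn0 hcut.trd_nonneg fun x => tensorNormSq_nonneg _
  have N0 : 0 ≤ N := hn0 hcut.trd_nonneg fun x => tensorNormSq_nonneg _
  have ha : ∀ (C : Fin (m + 1) → Fin n) i, ContDiffOn ℝ 1 (projField Ω ℓ q C i) (closure Ω) :=
    fun C i => by
      have := h.contDiffOn_projField (k := 1) (m := m + 1) (q := q)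
        (hq.of_le (by norm_cast; omega)) C i
      exact_mod_cast this
  have hfield : ∀ C : Fin (m + 1) → Fin n,
      ∫ x, φ x * ∑ i, projField Ω ℓ q C i x ^ 2 ∂(bdryMeasure Ω)
        ≤ 2 * n * t + Λ * f₁ + Λ * (1 + c₁) * N := by
    intro C
    have main := h.rellich_estimate hn hcut (ha C)
      (N := fun x => Λ * derivNormSq Ω (m + 2) q x)
      (F := fun x => Λ * (derivNormSq Ω (m + 1) (lap Ω q) x + derivNormSq Ω (m + 2) q x))
      (T := fun x => n * projNormSq Ω ℓ (m + 2) q x)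
      (continuousOn_const.mul cN) (continuousOn_const.mul (cF1.add cN))
      (continuousOn_const.mul cT)
      (fun x _ i => (h.projField_sq_le C i x).trans
        (mul_le_mul_of_nonneg_right (le_fieldConst_size n (m + 1) K ℓ) (tensorNormSq_nonneg _)))
      (fun x hx i j => (h.projField_curl_sq_le hq C i j hx).trans
        (mul_le_mul_of_nonneg_right (le_fieldConst_curl n (m + 1) K ℓ) (tensorNormSq_nonneg _)))
      (fun x hx => (h.projField_div_sq_le hq C hx).trans (add_mul_le_mul_add
        (le_fieldConst_div n (m + 1) K ℓ).1 (le_fieldConst_div n (m + 1) K ℓ).2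
        (tensorNormSq_nonneg _) (tensorNormSq_nonneg _)))
      (fun x hx => h.projField_tangential_le C hx)
    rw [TubeBound.integral_mul_const_mul_add Λ (h.integrableOn_mul hφc hcut.support_fst cF1)
        (h.integrableOn_mul hφc hcut.support_fst cN), TubeBound.integral_mul_const_mul,
      TubeBound.integral_mul_const_mul] at main
    have m1 := mul_le_mul_of_nonneg_left (h.setIntegral_mul_le hφc hcut.continuous_trd
      hcut.support_fst hcut.support (fun x => (hcut.fst_le x).trans (hcut.snd_le x)) cN
      fun x => tensorNormSq_nonneg _) hΛ0
    linarith
  -- Recovering ∇^{m+2}q on the boundary requires its trace ∇^m Δq there. The trace inequality for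
  -- this costs ∇^{m+1}Δq in the interior.
  have htrace : ∫ x, φ x * derivNormSq Ω m (lap Ω q) x ∂(bdryMeasure Ω) ≤ f₁ + c₄ * f := by
    refine (h.integral_bdry_mul_le hφc hψc hcut.support_fst hcut.support_snd hcut.fst_le cF
      fun x => tensorNormSq_nonneg _).trans ?_
    have := h.trace_covDeriv hcut hl1 one_pos
    rwa [one_mul] at this
  have cA : ∀ C : Fin (m + 1) → Fin n, ContinuousOn
      (fun x => ∑ i, projField Ω ℓ q C i x ^ 2) (closure Ω) := fun C =>
    continuousOn_finsetSum _ fun i _ => (ha C i).continuousOn.pow 2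
  have s1 := setIntegral_le_two (f := fun x => φ x * derivNormSq Ω (m + 2) q x)
    (g₁ := fun x => ∑ C : Fin (m + 1) → Fin n, φ x * ∑ i, projField Ω ℓ q C i x ^ 2)
    (μ := Measure.euclideanHausdorffMeasure (n - 1)) (s := frontier Ω)
    isClosed_frontier.measurableSet (h.integrable_bdry_mul hφc hcut.support_fst cN)
    (integrable_finsetSum _ fun C _ => h.integrable_bdry_mul hφc hcut.support_fst (cA C))
    (h.integrable_bdry_mul hφc hcut.support_fst cF) c c fun x hx => by
      have := mul_le_mul_of_nonneg_left
        (h.tensorNormSq_le_projField_self hq2 (frontier_subset_closure hx)) (hcut.nonneg x)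
      rw [← Finset.mul_sum]
      refine this.trans (le_of_eq ?_)
      ring
  rw [show (Measure.euclideanHausdorffMeasure (n - 1)).restrict (frontier Ω) = bdryMeasure Ω
    from rfl, integral_finsetSum _ fun C _ => h.integrable_bdry_mul hφc hcut.support_fst (cA C)] at s1
  have s2 := Finset.sum_le_sum fun C (_ : C ∈ (Finset.univ : Finset (Fin (m + 1) → Fin n))) =>
    hfield C
  rw [Finset.sum_const, Finset.card_univ, Fintype.card_fun, Fintype.card_fin, Fintype.card_fin,
    nsmul_eq_mul] at s2
  push_cast at s2
  have m2 := mul_le_mul_of_nonneg_left (add_le_add s2 htrace) hc0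
  have s3 : ∫ x, φ x * derivNormSq Ω (m + 2) q x ∂(bdryMeasure Ω)
      ≤ c * (D * (2 * n * t + Λ * f₁ + Λ * (1 + c₁) * N) + (f₁ + c₄ * f)) := by
    refine le_trans ?_ m2
    rw [mul_add]
    exact s1
  refine s3.trans ?_
  rw [mul_assoc c]
  refine mul_le_mul_of_nonneg_left ?_ hc0
  have hn' : (0 : ℝ) ≤ n := Nat.cast_nonneg n
  set S := t + f₁ + f + N with hS
  have S0 : 0 ≤ S := by positivity
  have j1 : D * (2 * n * t + Λ * f₁ + Λ * (1 + c₁) * N)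
      ≤ D * (2 * n * S + Λ * S + Λ * (1 + c₁) * S) := by
    gcongr <;> linarith
  have j2 : c₄ * f ≤ c₄ * S := by
    gcongr
    linarith
  have j3 : f₁ ≤ S := by linarith
  calc _ ≤ D * (2 * n * S + Λ * S + Λ * (1 + c₁) * S) + (S + c₄ * S) := by linarith
    _ = _ := by ring

end WeightedSteps
/-! ### Weighted cutoffs -/

section Cutoffs

variable {n : ℕ} {μ R : ℝ}

/-- A smooth cutoff, equal to one on the ball of radius `R` and supported in the ball of radius
`√2 R`. -/
def ballCutoff (R : ℝ) (x : Eu n) : ℝ := Real.smoothTransition (2 - ‖x‖ ^ 2 / R ^ 2)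

lemma contDiff_ballCutoff (R : ℝ) : ContDiff ℝ ∞ (ballCutoff (n := n) R) :=
  (Real.smoothTransition.contDiff (n := (⊤ : ℕ∞))).comp
    (contDiff_const.sub ((contDiff_norm_sq ℝ).div_const _))

lemma ballCutoff_nonneg (R : ℝ) (x : Eu n) : 0 ≤ ballCutoff R x := Real.smoothTransition.nonneg _

lemma ballCutoff_le_one (R : ℝ) (x : Eu n) : ballCutoff R x ≤ 1 := Real.smoothTransition.le_one _

lemma ballCutoff_eq_one (hR : 0 < R) {x : Eu n} (hx : ‖x‖ ^ 2 ≤ R ^ 2) : ballCutoff R x = 1 := by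
  refine Real.smoothTransition.one_of_one_le ?_
  have := (div_le_one (by positivity : 0 < R ^ 2)).2 hx
  linarith

lemma ballCutoff_eq_zero (hR : 0 < R) {x : Eu n} (hx : 2 * R ^ 2 ≤ ‖x‖ ^ 2) :
    ballCutoff R x = 0 := by
  refine Real.smoothTransition.zero_of_nonpos ?_
  have := (le_div_iff₀ (by positivity : 0 < R ^ 2)).2 hx
  linarith

lemma fderiv_ballCutoff (R : ℝ) (x : Eu n) (i : Fin n) :
    fderiv ℝ (ballCutoff R) x (eb i)
      = -(deriv Real.smoothTransition (2 - ‖x‖ ^ 2 / R ^ 2) * (2 * x i / R ^ 2)) := by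
  have h1 : HasFDerivAt (fun x : Eu n => 2 - ‖x‖ ^ 2 / R ^ 2)
      (-((R ^ 2)⁻¹ • (2 • innerSL ℝ x))) x := by
    have := ((hasStrictFDerivAt_norm_sq x).hasFDerivAt.mul_const ((R ^ 2)⁻¹)).const_sub 2
    simpa only [div_eq_mul_inv] using this
  have h2 : HasDerivAt Real.smoothTransition (deriv Real.smoothTransition (2 - ‖x‖ ^ 2 / R ^ 2))
      (2 - ‖x‖ ^ 2 / R ^ 2) :=
    ((Real.smoothTransition.contDiff (n := (⊤ : ℕ∞))).differentiable (by simp) _).hasDerivAt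
  have h3 : HasFDerivAt (ballCutoff R) _ x := h2.comp_hasFDerivAt x h1
  rw [h3.fderiv]
  have h4 : inner ℝ x (eb i) = x i := inner_eb x i
  simp only [smul_apply, neg_apply, smul_eq_mul, innerSL_apply_apply, h4, nsmul_eq_mul]
  push_cast
  ring

/-- The cutoff varies only where |x| ≤ √2 R, and there 2|x_i|/R² ≤ 4 as R ≥ 1. The bound is uniform
in R. -/
lemma abs_fderiv_ballCutoff_le {M : ℝ} (hM : ∀ s, |deriv Real.smoothTransition s| ≤ M)
    (hR : 1 ≤ R) (x : Eu n) (i : Fin n) : |fderiv ℝ (ballCutoff R) x (eb i)| ≤ 4 * M := by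
  have hM0 : 0 ≤ M := (abs_nonneg _).trans (hM 0)
  have hR0 : 0 < R := by linarith
  rw [fderiv_ballCutoff, abs_neg, abs_mul]
  rcases le_or_gt (‖x‖ ^ 2) (2 * R ^ 2) with hx | hx
  · have h1 : |2 * x i / R ^ 2| ≤ 4 := by
      rw [abs_div, abs_mul, abs_two, abs_of_pos (by positivity : 0 < R ^ 2),
        div_le_iff₀ (by positivity)]
      have h2 := abs_coord_le x i
      have h3 : ‖x‖ ≤ 2 * R := by nlinarith [norm_nonneg x]
      nlinarith
    calc _ ≤ M * 4 := mul_le_mul (hM _) h1 (abs_nonneg _) hM0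
      _ = _ := mul_comm _ _
  · have h1 : 2 - ‖x‖ ^ 2 / R ^ 2 < 0 := by
      have := (lt_div_iff₀ (by positivity : 0 < R ^ 2)).2 hx
      linarith
    rw [deriv_smoothTransition_of_lt h1]
    simp [hM0]

lemma fderiv_ballCutoff_eq_zero (hR : 0 < R) {x : Eu n} (hx : 2 * R ^ 2 < ‖x‖ ^ 2) (i : Fin n) :
    fderiv ℝ (ballCutoff R) x (eb i) = 0 := by
  have h1 : 2 - ‖x‖ ^ 2 / R ^ 2 < 0 := by
    have := (lt_div_iff₀ (by positivity : 0 < R ^ 2)).2 hx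
    linarith
  rw [fderiv_ballCutoff, deriv_smoothTransition_of_lt h1]
  simp

lemma weight_pos (μ : ℝ) (x : Eu n) : 0 < weight μ x := Real.rpow_pos_of_pos (by positivity) _

lemma contDiff_weight (μ : ℝ) : ContDiff ℝ ∞ (weight (n := n) μ) :=
  (contDiff_const.add (contDiff_norm_sq ℝ)).rpow_const_of_ne fun x => by positivity

/-- As 2|x_i| ≤ 1 + |x|², a derivative of the weight is at most μ times the weight. So the weight
can be treated as part of the cutoff, at the cost of a constant. -/
lemma abs_fderiv_weight_le (hμ : 0 ≤ μ) (x : Eu n) (i : Fin n) :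
    |fderiv ℝ (weight μ) x (eb i)| ≤ μ * weight μ x := by
  have h1 : HasFDerivAt (fun x : Eu n => 1 + ‖x‖ ^ 2) (2 • innerSL ℝ x) x :=
    (hasStrictFDerivAt_norm_sq x).hasFDerivAt.const_add 1
  have hpos : 0 < 1 + ‖x‖ ^ 2 := by positivity
  have h2 : HasFDerivAt (weight μ) _ x := h1.rpow_const (p := μ) (Or.inl hpos.ne')
  have h4 : inner ℝ x (eb i) = x i := inner_eb x i
  rw [h2.fderiv]
  simp only [smul_apply, smul_eq_mul, innerSL_apply_apply, h4, nsmul_eq_mul]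
  push_cast
  have h5 : |2 * x i| ≤ 1 + ‖x‖ ^ 2 := by
    rw [abs_mul, abs_two]
    nlinarith [abs_coord_le x i, sq_nonneg (‖x‖ - 1)]
  have h6 : weight μ x = (1 + ‖x‖ ^ 2) ^ (μ - 1) * (1 + ‖x‖ ^ 2) := by
    rw [weight, ← Real.rpow_add_one hpos.ne', sub_add_cancel]
  have h7 : 0 ≤ (1 + ‖x‖ ^ 2) ^ (μ - 1) := Real.rpow_nonneg hpos.le _
  rw [abs_mul, abs_mul, abs_of_nonneg hμ, abs_of_nonneg h7, h6, mul_assoc]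
  exact mul_le_mul_of_nonneg_left (mul_le_mul_of_nonneg_left h5 h7) hμ

/-- Cutoffs of the weight at every scale, with uniform bounds. -/
theorem exists_cutoffTriple (n : ℕ) (hμ : 0 ≤ μ) : ∃ B : ℝ, 0 ≤ B ∧ ∀ R : ℝ, 1 ≤ R →
    ∃ (φ ψ η : Eu n → ℝ) (R' : ℝ), CutoffTriple φ ψ η B R' ∧
      (∀ x, ‖x‖ ≤ R → φ x = weight μ x) ∧ ∀ x, η x ≤ weight μ x := by
  obtain ⟨M, hM0, hM⟩ := exists_abs_deriv_smoothTransition_le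
  refine ⟨μ + 8 * M, by positivity, fun R hR => ?_⟩
  have hR0 : 0 < R := by linarith
  have hχ := contDiff_ballCutoff (n := n) R
  have hw := contDiff_weight (n := n) μ
  have hw0 := fun x : Eu n => (weight_pos μ x).le
  have c0 := fun x : Eu n => ballCutoff_nonneg R x
  have c1 := fun x : Eu n => ballCutoff_le_one R x
  have hζ : ∀ x : Eu n, ‖x‖ ^ 2 ≤ 2 * R ^ 2 → ballCutoff (2 * R) x = 1 := fun x hx =>
    ballCutoff_eq_one (by positivity) (by nlinarith)
  have dw : ∀ x : Eu n, HasFDerivAt (weight μ) (fderiv ℝ (weight μ) x) x := fun x =>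
    (hw.differentiable (by simp) x).hasFDerivAt
  have dχ : ∀ x : Eu n, HasFDerivAt (ballCutoff R) (fderiv ℝ (ballCutoff R) x) x := fun x =>
    (hχ.differentiable (by simp) x).hasFDerivAt
  have eψ : ∀ (x : Eu n) i, fderiv ℝ (fun x => weight μ x * ballCutoff R x) x (eb i)
      = weight μ x * fderiv ℝ (ballCutoff R) x (eb i)
        + ballCutoff R x * fderiv ℝ (weight μ) x (eb i) := fun x i => by
    rw [((dw x).fun_mul (dχ x)).fderiv]
    simp
  have eφ : ∀ (x : Eu n) i,
      fderiv ℝ (fun x => weight μ x * ballCutoff R x * ballCutoff R x) x (eb i)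
      = weight μ x * ballCutoff R x * fderiv ℝ (ballCutoff R) x (eb i)
        + ballCutoff R x * (weight μ x * fderiv ℝ (ballCutoff R) x (eb i)
        + ballCutoff R x * fderiv ℝ (weight μ) x (eb i)) := fun x i => by
    rw [(((dw x).fun_mul (dχ x)).fun_mul (dχ x)).fderiv]
    simp only [add_apply, smul_apply, smul_eq_mul]
  -- φ = wχ², ψ = wχ and η = wζ, where ζ = 1 on the support of χ. The square in φ makes its
  -- derivative divisible by χ, hence bounded by ψ, and ψ² = φw = φη wherever χ ≠ 0. Since ζ
  -- vanishes for |x|² ≥ 8R², the radius 3R bounds the supports.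
  refine ⟨fun x => weight μ x * ballCutoff R x * ballCutoff R x,
    fun x => weight μ x * ballCutoff R x, fun x => weight μ x * ballCutoff (2 * R) x, 3 * R,
    ⟨(hw.mul hχ).mul hχ, hw.mul hχ, (hw.mul (contDiff_ballCutoff _)).continuous, fun x => ?_,
      fun x => ?_, fun x => ?_, fun x => ?_, fun x i => ?_, fun x i => ?_, by positivity,
      fun x hx => ?_⟩, fun x hx => ?_, fun x => ?_⟩
  · exact mul_nonneg (mul_nonneg (hw0 x) (c0 x)) (c0 x)
  · exact mul_le_of_le_one_right (mul_nonneg (hw0 x) (c0 x)) (c1 x)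
  · refine mul_le_mul_of_nonneg_left ?_ (hw0 x)
    rcases le_or_gt (‖x‖ ^ 2) (2 * R ^ 2) with hx | hx
    · rw [hζ x hx]; exact c1 x
    · rw [ballCutoff_eq_zero hR0 hx.le]; exact ballCutoff_nonneg _ _
  · rcases le_or_gt (‖x‖ ^ 2) (2 * R ^ 2) with hx | hx
    · simp only [hζ x hx]
      exact le_of_eq (by ring)
    · simp only [ballCutoff_eq_zero hR0 hx.le]
      exact le_of_eq (by ring)
  · rw [eφ]
    have h1 := abs_fderiv_ballCutoff_le hM hR x i
    have h2 := abs_fderiv_weight_le hμ x i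
    have hwc : 0 ≤ weight μ x * ballCutoff R x := mul_nonneg (hw0 x) (c0 x)
    have e : weight μ x * ballCutoff R x * fderiv ℝ (ballCutoff R) x (eb i)
        + ballCutoff R x * (weight μ x * fderiv ℝ (ballCutoff R) x (eb i)
        + ballCutoff R x * fderiv ℝ (weight μ) x (eb i))
        = 2 * (weight μ x * ballCutoff R x * fderiv ℝ (ballCutoff R) x (eb i))
          + ballCutoff R x * ballCutoff R x * fderiv ℝ (weight μ) x (eb i) := by ring
    rw [e]
    refine (abs_add_le _ _).trans ?_
    rw [abs_mul, abs_mul, abs_two, abs_of_nonneg hwc, abs_mul,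
      abs_of_nonneg (mul_nonneg (c0 x) (c0 x))]
    have h3 := mul_le_mul_of_nonneg_left h1 hwc
    have h4 : ballCutoff R x * ballCutoff R x * |fderiv ℝ (weight μ) x (eb i)|
        ≤ ballCutoff R x * 1 * (μ * weight μ x) :=
      mul_le_mul (mul_le_mul_of_nonneg_left (c1 x) (c0 x)) h2 (abs_nonneg _)
        (mul_nonneg (c0 x) zero_le_one)
    linarith
  · rw [eψ]
    rcases le_or_gt (‖x‖ ^ 2) (2 * R ^ 2) with hx | hx
    · rw [hζ x hx, mul_one]
      have h1 := mul_le_mul_of_nonneg_left (abs_fderiv_ballCutoff_le hM hR x i) (hw0 x)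
      have h2 := mul_le_mul (c1 x) (abs_fderiv_weight_le hμ x i) (abs_nonneg _) zero_le_one
      refine (abs_add_le _ _).trans ?_
      rw [abs_mul, abs_mul, abs_of_nonneg (hw0 x), abs_of_nonneg (c0 x)]
      have h3 : 0 ≤ M * weight μ x := mul_nonneg hM0 (hw0 x)
      linarith
    · rw [fderiv_ballCutoff_eq_zero hR0 hx, ballCutoff_eq_zero hR0 hx.le]
      simp only [mul_zero, zero_mul, add_zero, abs_zero]
      exact mul_nonneg (by positivity) (mul_nonneg (hw0 x) (ballCutoff_nonneg _ _))
  · rw [ballCutoff_eq_zero (by positivity), mul_zero]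
    nlinarith [norm_nonneg x]
  · have : ballCutoff R x = 1 :=
      ballCutoff_eq_one hR0 (pow_le_pow_left₀ (norm_nonneg _) hx 2)
    simp [this]
  · exact mul_le_of_le_one_right (hw0 x) (ballCutoff_le_one _ _)

end Cutoffs
/-! ### The estimates in weighted norms -/

/-- The radius 1/(2K'), with K' = max(K, 1), lies strictly below 1/K' ≤ l₀ and satisfies K'·ℓ = 1/2.
The maximum keeps the radius finite when K = 0. An empty boundary, where the geometric bound says
nothing about l₀, is treated apart. -/
lemma GeometryBound.tubeBound {n : ℕ} {Ω : Set (Eu n)} {K : ℝ≥0} (hΩ : HasSmoothBoundary Ω)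
    (h : GeometryBound Ω K) : TubeBound Ω (max (K : ℝ) 1) (1 / (2 * max (K : ℝ) 1)) := by
  set K' : ℝ := max (K : ℝ) 1 with hK'
  have h1 : 1 ≤ K' := le_max_right _ _
  have hK0 : 0 < K' := by linarith
  refine ⟨hΩ, by positivity, ?_, fun p hp => ?_, hK0.le, ?_⟩
  · rcases (frontier Ω).eq_empty_or_nonempty with he | ⟨p, hp⟩
    · intro z hz
      exact absurd hz.1 (by simp [he])
    have h2 : (injectivityRadius Ω)⁻¹ ≤ ENNReal.ofReal K' :=
      (le_add_self.trans (h p hp)).trans (by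
        rw [← ENNReal.ofReal_coe_nnreal]
        exact ENNReal.ofReal_le_ofReal (le_max_left _ _))
    have h3 : ENNReal.ofReal (1 / (2 * K')) < injectivityRadius Ω := by
      refine lt_of_lt_of_le ?_ (ENNReal.inv_le_iff_inv_le.1 h2)
      rw [← ENNReal.ofReal_inv_of_pos hK0, ENNReal.ofReal_lt_ofReal_iff (by positivity), one_div]
      exact inv_strictAnti₀ hK0 (by linarith)
    obtain ⟨l, hl, hlt⟩ := lt_sSup_iff.1 h3
    refine InjOn.mono ?_ hl
    intro z hz
    exact ⟨hz.1, (ENNReal.ofReal_le_ofReal hz.2.le).trans_lt hlt⟩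
  · have h2 : ENNReal.ofReal (secondFundamentalFormNorm Ω p) ≤ K := le_self_add.trans (h p hp)
    rw [← ENNReal.ofReal_coe_nnreal, ENNReal.ofReal_le_ofReal_iff K.coe_nonneg] at h2
    exact h2.trans (le_max_left _ _)
  · refine le_of_eq ?_
    field_simp

/-- The square of the norm of `L²_w(Ω)`. -/
def energyInterior {n s : ℕ} (μ : ℝ) (Ω : Set (Eu n)) (α : Eu n → Tensor n s) : ℝ≥0∞ :=
  ∫⁻ x in Ω, ENNReal.ofReal (tensorNormSq (α x) * weight μ x)

/-- The square of the norm of `L²_w(∂Ω)`. -/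
def energyBoundary {n s : ℕ} (μ : ℝ) (Ω : Set (Eu n)) (α : Eu n → Tensor n s) : ℝ≥0∞ :=
  ∫⁻ x, ENNReal.ofReal (tensorNormSq (α x) * weight μ x) ∂(bdryMeasure Ω)

section Limit

variable {n : ℕ} {μ R : ℝ} {ν ν' : Measure (Eu n)} {f φ η : Eu n → ℝ}

lemma lintegral_closedBall_le (hInt : Integrable (fun x => φ x * f x) ν) (hφ0 : ∀ x, 0 ≤ φ x)
    (hf0 : ∀ x, 0 ≤ f x) (hφ : ∀ x, ‖x‖ ≤ R → φ x = weight μ x) :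
    ∫⁻ x in Metric.closedBall 0 R, ENNReal.ofReal (f x * weight μ x) ∂ν
      ≤ ENNReal.ofReal (∫ x, φ x * f x ∂ν) := by
  rw [ofReal_integral_eq_lintegral_ofReal hInt
    (Eventually.of_forall fun x => mul_nonneg (hφ0 x) (hf0 x))]
  refine le_trans (le_of_eq ?_) (setLIntegral_le_lintegral (Metric.closedBall 0 R) _)
  refine setLIntegral_congr_fun Metric.isClosed_closedBall.measurableSet fun x hx => ?_
  rw [hφ x (by simpa using hx), mul_comm]

lemma ofReal_integral_le (hInt : Integrable (fun x => η x * f x) ν) (hη0 : ∀ x, 0 ≤ η x)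
    (hf0 : ∀ x, 0 ≤ f x) (hη : ∀ x, η x ≤ weight μ x) :
    ENNReal.ofReal (∫ x, η x * f x ∂ν) ≤ ∫⁻ x, ENNReal.ofReal (f x * weight μ x) ∂ν := by
  rw [ofReal_integral_eq_lintegral_ofReal hInt
    (Eventually.of_forall fun x => mul_nonneg (hη0 x) (hf0 x))]
  refine lintegral_mono fun x => ENNReal.ofReal_le_ofReal ?_
  rw [mul_comm]
  exact mul_le_mul_of_nonneg_left (hη x) (hf0 x)

/-- Exhaust the space by balls. The two integrals are taken together since the finite-radius
estimate bounds their sum, and suprema of monotone sequences add. -/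
lemma lintegral_add_le_of_closedBall {g g' : Eu n → ℝ≥0∞} {Y : ℝ≥0∞}
    (h : ∀ R : ℝ, 1 ≤ R → (∫⁻ x in Metric.closedBall 0 R, g x ∂ν)
      + ∫⁻ x in Metric.closedBall 0 R, g' x ∂ν' ≤ Y) :
    (∫⁻ x, g x ∂ν) + ∫⁻ x, g' x ∂ν' ≤ Y := by
  have hmono : Monotone fun k : ℕ => Metric.closedBall (0 : Eu n) (k + 1 : ℝ) := fun a b hab =>
    Metric.closedBall_subset_closedBall (by
      have : (a : ℝ) ≤ b := by exact_mod_cast hab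
      linarith)
  have huniv : ⋃ k : ℕ, Metric.closedBall (0 : Eu n) (k + 1 : ℝ) = univ := by
    refine eq_univ_of_forall fun x => ?_
    obtain ⟨k, hk⟩ := exists_nat_ge ‖x‖
    exact mem_iUnion.2 ⟨k, by rw [mem_closedBall_zero_iff]; linarith⟩
  have e : ∀ (ν : Measure (Eu n)) (g : Eu n → ℝ≥0∞), ∫⁻ x, g x ∂ν
      = ⨆ k : ℕ, ∫⁻ x in Metric.closedBall (0 : Eu n) (k + 1 : ℝ), g x ∂ν := fun ν g => by
    rw [← setLIntegral_iUnion_of_directed g (directed_of_isDirected_le hmono), huniv,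
      setLIntegral_univ]
  rw [e ν g, e ν' g', ENNReal.iSup_add_iSup_of_monotone]
  · exact iSup_le fun k => h _ (by
      have : (0 : ℝ) ≤ k := Nat.cast_nonneg k
      linarith)
  · exact fun a b hab => lintegral_mono_set (hmono hab)
  · exact fun a b hab => lintegral_mono_set (hmono hab)

lemma TubeBound.lintegral_projNormSq {Ω : Set (Eu n)} {K ℓ : ℝ} (h : TubeBound Ω K ℓ) (s : ℕ)
    (q : Eu n → ℝ) :
    ∫⁻ x, ENNReal.ofReal (projNormSq Ω ℓ s q x * weight μ x) ∂(bdryMeasure Ω)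
      = energyBoundary μ Ω fun x => tensorProj Ω x (covDeriv Ω s q x) := by
  refine setLIntegral_congr_fun isClosed_frontier.measurableSet fun x hx => ?_
  simp only
  rw [h.projNormSq_frontier hx]

end Limit

/-! ### Removing the cutoffs -/

section EnergySteps

variable {n : ℕ} {μ K ℓ : ℝ}

/-- The constant of `exists_interior_step` does not depend on the scale R of the cutoffs. On the
left they equal the weight on a ball of radius R and on the right they are at most the weight, so R
can tend to infinity with values in [0, ∞] on both sides. -/
theorem exists_interior_energy_step (hn : 0 < n) (hμ : 0 ≤ μ) (m : ℕ) (hK : 0 ≤ K) (hℓ : 0 < ℓ)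
    {δ : ℝ} (hδ : 0 < δ) : ∃ C : ℝ, ∀ (Ω : Set (Eu n)), TubeBound Ω K ℓ →
      ∀ q : Eu n → ℝ, ContDiffOn ℝ (m + 3 : ℕ) q (closure Ω) →
        energyBoundary μ Ω (covDeriv Ω (m + 1) q) + energyInterior μ Ω (covDeriv Ω (m + 2) q)
          ≤ ENNReal.ofReal δ
              * energyBoundary μ Ω (fun x => tensorProj Ω x (covDeriv Ω (m + 2) q x))
            + ENNReal.ofReal C * (energyInterior μ Ω (covDeriv Ω m (lap Ω q))
              + energyInterior μ Ω (covDeriv Ω (m + 1) q)) := by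
  obtain ⟨B, hB, hcut⟩ := exists_cutoffTriple n hμ
  obtain ⟨C, hC, hstep⟩ := exists_interior_step hn m hK hℓ hB hδ
  refine ⟨C, fun Ω h q hq => lintegral_add_le_of_closedBall fun R hR => ?_⟩
  obtain ⟨φ, ψ, η, R', hc, hφ, hη⟩ := hcut R hR
  have hφc := hc.contDiff_fst.continuous
  have hψc := hc.contDiff_snd.continuous
  have hq2 : ContDiffOn ℝ (m + 2 : ℕ) q (closure Ω) := hq.of_le (by norm_cast; omega)
  have hq1 : ContDiffOn ℝ (m + 1 : ℕ) q (closure Ω) := hq.of_le (by norm_cast; omega)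
  have cN := h.smooth.continuousOn_tensorNormSq hq1
  have cN2 := h.smooth.continuousOn_tensorNormSq hq2
  have cF := h.smooth.continuousOn_tensorNormSq (s := m) (h.smooth.contDiffOn_lap hq2)
  have cT := h.continuousOn_projNormSq hq2
  have hψη : ∀ x, ψ x ≤ weight μ x := fun x => (hc.snd_le x).trans (hη x)
  have hφη : ∀ x, φ x ≤ weight μ x := fun x => (hc.fst_le x).trans (hψη x)
  have hψR : ∀ x, ‖x‖ ≤ R → ψ x = weight μ x := fun x hx =>
    le_antisymm (hψη x) ((hφ x hx).symm.le.trans (hc.fst_le x))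
  have hn0 : ∀ {ν : Measure (Eu n)} {u v : Eu n → ℝ}, (∀ x, 0 ≤ u x) → (∀ x, 0 ≤ v x) →
      0 ≤ ∫ x, u x * v x ∂ν := fun hu hv => integral_nonneg fun x => mul_nonneg (hu x) (hv x)
  have l1 := lintegral_closedBall_le (h.integrable_bdry_mul hψc hc.support_snd cN) hc.snd_nonneg
    (fun x => tensorNormSq_nonneg _) hψR
  have l2 := lintegral_closedBall_le (h.integrableOn_mul hφc hc.support_fst cN2) hc.nonneg
    (fun x => tensorNormSq_nonneg _) hφ
  have u1 := ofReal_integral_le (h.integrable_bdry_mul hφc hc.support_fst cT) hc.nonneg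
    (fun x => projNormSq_nonneg) hφη
  have u2 := ofReal_integral_le (h.integrableOn_mul hφc hc.support_fst cF) hc.nonneg
    (fun x => tensorNormSq_nonneg _) hφη
  have u3 := ofReal_integral_le (h.integrableOn_mul hc.continuous_trd hc.support cN)
    hc.trd_nonneg (fun x => tensorNormSq_nonneg _) hη
  rw [h.lintegral_projNormSq] at u1
  refine (add_le_add l1 l2).trans ?_
  rw [← ENNReal.ofReal_add (hn0 hc.snd_nonneg fun x => tensorNormSq_nonneg _)
    (hn0 hc.nonneg fun x => tensorNormSq_nonneg _)]
  refine (ENNReal.ofReal_le_ofReal (hstep Ω h φ ψ η R' hc q hq)).trans ?_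
  refine ENNReal.ofReal_add_le.trans ?_
  rw [ENNReal.ofReal_mul hδ.le, ENNReal.ofReal_mul hC]
  refine add_le_add (by gcongr) ?_
  gcongr
  exact ENNReal.ofReal_add_le.trans (add_le_add u2 u3)

theorem exists_boundary_energy_step (hn : 0 < n) (hμ : 0 ≤ μ) (m : ℕ) (hK : 0 ≤ K) (hℓ : 0 < ℓ) :
    ∃ C : ℝ, ∀ (Ω : Set (Eu n)), TubeBound Ω K ℓ →
      ∀ q : Eu n → ℝ, ContDiffOn ℝ (m + 3 : ℕ) q (closure Ω) →
        energyBoundary μ Ω (covDeriv Ω (m + 2) q)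
          ≤ ENNReal.ofReal C
            * (energyBoundary μ Ω (fun x => tensorProj Ω x (covDeriv Ω (m + 2) q x))
              + energyInterior μ Ω (covDeriv Ω (m + 1) (lap Ω q))
              + energyInterior μ Ω (covDeriv Ω m (lap Ω q))
              + energyInterior μ Ω (covDeriv Ω (m + 2) q)) := by
  obtain ⟨B, hB, hcut⟩ := exists_cutoffTriple n hμ
  obtain ⟨C, hC, hstep⟩ := exists_boundary_step hn m hK hℓ hB
  refine ⟨C, fun Ω h q hq => ?_⟩
  -- Only one integral is needed here, so the second measure and integrand are zero.
  refine le_trans le_self_add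
    (lintegral_add_le_of_closedBall (ν := bdryMeasure Ω) (ν' := 0) (g' := fun _ => 0)
      fun R hR => ?_)
  rw [lintegral_zero, add_zero]
  obtain ⟨φ, ψ, η, R', hc, hφ, hη⟩ := hcut R hR
  have hφc := hc.contDiff_fst.continuous
  have hq2 : ContDiffOn ℝ (m + 2 : ℕ) q (closure Ω) := hq.of_le (by norm_cast; omega)
  have cN := h.smooth.continuousOn_tensorNormSq hq2
  have cF := h.smooth.continuousOn_tensorNormSq (s := m) (h.smooth.contDiffOn_lap hq2)
  have cF1 := h.smooth.continuousOn_tensorNormSq (s := m + 1) (h.smooth.contDiffOn_lap hq)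
  have cT := h.continuousOn_projNormSq hq2
  have hφη : ∀ x, φ x ≤ weight μ x := fun x =>
    (hc.fst_le x).trans ((hc.snd_le x).trans (hη x))
  have l1 := lintegral_closedBall_le (h.integrable_bdry_mul hφc hc.support_fst cN) hc.nonneg
    (fun x => tensorNormSq_nonneg _) hφ
  have u1 := ofReal_integral_le (h.integrable_bdry_mul hφc hc.support_fst cT) hc.nonneg
    (fun x => projNormSq_nonneg) hφη
  have u2 := ofReal_integral_le (h.integrableOn_mul hφc hc.support_fst cF1) hc.nonneg
    (fun x => tensorNormSq_nonneg _) hφη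
  have u3 := ofReal_integral_le (h.integrableOn_mul hc.continuous_trd hc.support cF)
    hc.trd_nonneg (fun x => tensorNormSq_nonneg _) hη
  have u4 := ofReal_integral_le (h.integrableOn_mul hc.continuous_trd hc.support cN)
    hc.trd_nonneg (fun x => tensorNormSq_nonneg _) hη
  rw [h.lintegral_projNormSq] at u1
  refine l1.trans ((ENNReal.ofReal_le_ofReal (hstep Ω h φ ψ η R' hc q hq)).trans ?_)
  rw [ENNReal.ofReal_mul hC]
  gcongr
  refine ENNReal.ofReal_add_le.trans (add_le_add ?_ u4)
  refine ENNReal.ofReal_add_le.trans (add_le_add ?_ u3)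
  exact ENNReal.ofReal_add_le.trans (add_le_add u1 u2)

end EnergySteps
-- Square roots and induction on the order
section NormEstimates

variable {n : ℕ} {μ K ℓ : ℝ}

lemma rpow_half_add_le (a b : ℝ≥0∞) :
    (a + b) ^ (1 / 2 : ℝ) ≤ a ^ (1 / 2 : ℝ) + b ^ (1 / 2 : ℝ) :=
  ENNReal.rpow_add_le_add_rpow a b (by norm_num) (by norm_num)

/-- The interior estimate, one order at a time. -/
theorem exists_interior_norm_step (hn : 0 < n) (hμ : 0 ≤ μ) (m : ℕ) (hK : 0 ≤ K) (hℓ : 0 < ℓ)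
    {δ : ℝ≥0} (hδ : 0 < δ) : ∃ C : ℝ≥0, ∀ (Ω : Set (Eu n)), TubeBound Ω K ℓ →
      ∀ q : Eu n → ℝ, ContDiffOn ℝ (m + 3 : ℕ) q (closure Ω) →
        normBoundary μ Ω (covDeriv Ω (m + 1) q) + normInterior μ Ω (covDeriv Ω (m + 2) q)
          ≤ δ * normProj μ Ω (m + 2) q + C * (normInterior μ Ω (covDeriv Ω m (lap Ω q))
            + normInterior μ Ω (covDeriv Ω (m + 1) q)) := by
  -- Each of the two norms on the left is bounded by the root of the whole energy bound. The energy
  -- parameter (δ/2)² gives δ/2 after the root, twice.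
  have hδ0 : (0 : ℝ) < (δ / 2) ^ 2 := by positivity
  obtain ⟨C, hC⟩ := exists_interior_energy_step hn hμ m hK hℓ hδ0
  refine ⟨2 * (C.toNNReal ^ (1 / 2 : ℝ)), fun Ω h q hq => ?_⟩
  have h1 := hC Ω h q hq
  set Y := ENNReal.ofReal (((δ : ℝ) / 2) ^ 2)
      * energyBoundary μ Ω (fun x => tensorProj Ω x (covDeriv Ω (m + 2) q x))
    + ENNReal.ofReal C * (energyInterior μ Ω (covDeriv Ω m (lap Ω q))
      + energyInterior μ Ω (covDeriv Ω (m + 1) q)) with hY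
  have b1 : normBoundary μ Ω (covDeriv Ω (m + 1) q) ≤ Y ^ (1 / 2 : ℝ) :=
    ENNReal.rpow_le_rpow (le_self_add.trans h1) (by norm_num)
  have b2 : normInterior μ Ω (covDeriv Ω (m + 2) q) ≤ Y ^ (1 / 2 : ℝ) :=
    ENNReal.rpow_le_rpow (le_add_self.trans h1) (by norm_num)
  have hroot : (ENNReal.ofReal (((δ : ℝ) / 2) ^ 2)) ^ (1 / 2 : ℝ) = ((δ / 2 : ℝ≥0) : ℝ≥0∞) := by
    have e : ENNReal.ofReal (((δ : ℝ) / 2) ^ 2) = ((δ / 2 : ℝ≥0) : ℝ≥0∞) ^ (2 : ℝ) := by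
      rw [ENNReal.rpow_two, ENNReal.ofReal_pow (by positivity), ← ENNReal.ofReal_coe_nnreal]
      push_cast
      rfl
    rw [e, ← ENNReal.rpow_mul]
    norm_num
  have hrootC : (ENNReal.ofReal C) ^ (1 / 2 : ℝ) = ((C.toNNReal ^ (1 / 2 : ℝ) : ℝ≥0) : ℝ≥0∞) :=
    (ENNReal.coe_rpow_of_nonneg _ (by norm_num)).symm
  have b3 : Y ^ (1 / 2 : ℝ) ≤ ((δ / 2 : ℝ≥0) : ℝ≥0∞) * normProj μ Ω (m + 2) q
      + ((C.toNNReal ^ (1 / 2 : ℝ) : ℝ≥0) : ℝ≥0∞)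
        * (normInterior μ Ω (covDeriv Ω m (lap Ω q))
          + normInterior μ Ω (covDeriv Ω (m + 1) q)) := by
    refine (rpow_half_add_le _ _).trans ?_
    rw [ENNReal.mul_rpow_of_nonneg _ _ (by norm_num), ENNReal.mul_rpow_of_nonneg _ _ (by norm_num),
      hroot, hrootC]
    gcongr
    · exact le_rfl
    · exact rpow_half_add_le _ _
  refine (add_le_add (b1.trans b3) (b2.trans b3)).trans (le_of_eq ?_)
  have hδ2 : (δ : ℝ≥0∞) = 2 * ((δ / 2 : ℝ≥0) : ℝ≥0∞) := by
    have : δ = 2 * (δ / 2) := by field_simp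
    conv_lhs => rw [this]
    push_cast
    rfl
  rw [hδ2]
  push_cast
  ring

/-- The boundary estimate at top order. -/
theorem exists_boundary_norm_step (hn : 0 < n) (hμ : 0 ≤ μ) (m : ℕ) (hK : 0 ≤ K) (hℓ : 0 < ℓ) :
    ∃ C : ℝ≥0, ∀ (Ω : Set (Eu n)), TubeBound Ω K ℓ →
      ∀ q : Eu n → ℝ, ContDiffOn ℝ (m + 3 : ℕ) q (closure Ω) →
        normBoundary μ Ω (covDeriv Ω (m + 2) q)
          ≤ C * (normProj μ Ω (m + 2) q + normInterior μ Ω (covDeriv Ω (m + 1) (lap Ω q))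
            + normInterior μ Ω (covDeriv Ω m (lap Ω q))
            + normInterior μ Ω (covDeriv Ω (m + 2) q)) := by
  obtain ⟨C, hC⟩ := exists_boundary_energy_step hn hμ m hK hℓ
  refine ⟨C.toNNReal ^ (1 / 2 : ℝ), fun Ω h q hq => ?_⟩
  have hrootC : (ENNReal.ofReal C) ^ (1 / 2 : ℝ) = ((C.toNNReal ^ (1 / 2 : ℝ) : ℝ≥0) : ℝ≥0∞) :=
    (ENNReal.coe_rpow_of_nonneg _ (by norm_num)).symm
  have h1 := ENNReal.rpow_le_rpow (hC Ω h q hq) (show (0 : ℝ) ≤ 1 / 2 by norm_num)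
  refine h1.trans ?_
  rw [ENNReal.mul_rpow_of_nonneg _ _ (by norm_num), hrootC]
  gcongr
  refine (rpow_half_add_le _ _).trans (add_le_add ?_ le_rfl)
  refine (rpow_half_add_le _ _).trans (add_le_add ?_ le_rfl)
  exact (rpow_half_add_le _ _).trans le_rfl

/-- The interior estimate in terms of the data and `∇ q`. -/
theorem exists_interior_norm_bound (hn : 0 < n) (hμ : 0 ≤ μ) (hK : 0 ≤ K) (hℓ : 0 < ℓ) (m : ℕ) :
    ∀ {δ : ℝ≥0}, 0 < δ → ∃ C : ℝ≥0, ∀ (Ω : Set (Eu n)), TubeBound Ω K ℓ →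
      ∀ q : Eu n → ℝ, ContDiffOn ℝ (m + 3 : ℕ) q (closure Ω) →
        normBoundary μ Ω (covDeriv Ω (m + 1) q) + normInterior μ Ω (covDeriv Ω (m + 2) q)
          ≤ δ * ∑ s ∈ Finset.range (m + 3), normProj μ Ω s q
            + C * (∑ s ∈ Finset.range (m + 1), normInterior μ Ω (covDeriv Ω s (lap Ω q))
              + normInterior μ Ω (covDeriv Ω 1 q)) := by
  induction m with
  | zero =>
    intro δ hδ
    obtain ⟨C, hC⟩ := exists_interior_norm_step hn hμ 0 hK hℓ hδ
    refine ⟨C, fun Ω h q hq => (hC Ω h q hq).trans ?_⟩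
    rw [Finset.sum_range_one]
    gcongr
    exact Finset.single_le_sum (f := fun s => normProj μ Ω s q) (fun _ _ => zero_le)
      (Finset.mem_range.2 (by norm_num))
  | succ m ih =>
    intro δ hδ
    obtain ⟨C, hC⟩ := exists_interior_norm_step hn hμ (m + 1) hK hℓ (half_pos hδ)
    -- The inductive bound for the order below is multiplied by C, so its projected terms must start
    -- with this smaller parameter to add up to δ; the 1 covers C = 0.
    have hδ' : 0 < δ / (2 * (C + 1)) := by positivity
    obtain ⟨C', hC'⟩ := ih hδ'
    refine ⟨C + C * C', fun Ω h q hq => (hC Ω h q hq).trans ?_⟩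
    have h1 := le_add_self.trans (hC' Ω h q (hq.of_le (by norm_cast; omega)))
    set P := ∑ s ∈ Finset.range (m + 1 + 3), normProj μ Ω s q with hP
    set S := ∑ s ∈ Finset.range (m + 1 + 1), normInterior μ Ω (covDeriv Ω s (lap Ω q)) with hS
    set I := normInterior μ Ω (covDeriv Ω 1 q) with hI
    have p1 : normProj μ Ω (m + 1 + 2) q ≤ P :=
      Finset.single_le_sum (f := fun s => normProj μ Ω s q) (fun _ _ => zero_le)
        (Finset.mem_range.2 (by omega))
    have p2 : ∑ s ∈ Finset.range (m + 3), normProj μ Ω s q ≤ P :=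
      Finset.sum_le_sum_of_subset (Finset.range_mono (by omega))
    have s1 : normInterior μ Ω (covDeriv Ω (m + 1) (lap Ω q)) ≤ S :=
      Finset.single_le_sum (f := fun s => normInterior μ Ω (covDeriv Ω s (lap Ω q)))
        (fun _ _ => zero_le) (Finset.mem_range.2 (by omega))
    have s2 : ∑ s ∈ Finset.range (m + 1), normInterior μ Ω (covDeriv Ω s (lap Ω q)) ≤ S :=
      Finset.sum_le_sum_of_subset (Finset.range_mono (by omega))
    have hcδ : (C : ℝ≥0∞) * ((δ / (2 * (C + 1)) : ℝ≥0) : ℝ≥0∞) ≤ ((δ / 2 : ℝ≥0) : ℝ≥0∞) := by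
      rw [← ENNReal.coe_mul, ENNReal.coe_le_coe, mul_div_assoc', div_le_div_iff₀ (by positivity)
        (by norm_num)]
      calc C * δ * 2 = δ * (2 * C) := by ring
        _ ≤ δ * (2 * (C + 1)) := by gcongr; exact le_self_add
    calc ((δ / 2 : ℝ≥0) : ℝ≥0∞) * normProj μ Ω (m + 1 + 2) q
          + C * (normInterior μ Ω (covDeriv Ω (m + 1) (lap Ω q))
            + normInterior μ Ω (covDeriv Ω (m + 1 + 1) q))
        ≤ ((δ / 2 : ℝ≥0) : ℝ≥0∞) * P + C * (S
            + (((δ / (2 * (C + 1)) : ℝ≥0) : ℝ≥0∞) * P + C' * (S + I))) := by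
          gcongr
          refine h1.trans ?_
          gcongr
      _ = ((δ / 2 : ℝ≥0) : ℝ≥0∞) * P + C * ((δ / (2 * (C + 1)) : ℝ≥0) : ℝ≥0∞) * P
          + (C * S + C * C' * (S + I)) := by ring
      _ ≤ ((δ / 2 : ℝ≥0) : ℝ≥0∞) * P + ((δ / 2 : ℝ≥0) : ℝ≥0∞) * P
          + (C * (S + I) + C * C' * (S + I)) := by
          gcongr
          exact le_self_add
      _ = (((δ / 2 + δ / 2 : ℝ≥0)) : ℝ≥0∞) * P + (C + C * C') * (S + I) := by
          push_cast
          ring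
      _ = δ * P + ((C + C * C' : ℝ≥0) : ℝ≥0∞) * (S + I) := by
          rw [add_halves]
          push_cast
          rfl

/-- The estimate for all derivatives of top order, up to the boundary. -/
theorem exists_top_norm_bound (hn : 0 < n) (hμ : 0 ≤ μ) (hK : 0 ≤ K) (hℓ : 0 < ℓ) (m : ℕ) :
    ∃ C : ℝ≥0, ∀ (Ω : Set (Eu n)), TubeBound Ω K ℓ →
      ∀ q : Eu n → ℝ, ContDiffOn ℝ (m + 3 : ℕ) q (closure Ω) →
        normBoundary μ Ω (covDeriv Ω (m + 2) q) + normInterior μ Ω (covDeriv Ω (m + 2) q)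
          ≤ C * (∑ s ∈ Finset.range (m + 3), normProj μ Ω s q
            + ∑ s ∈ Finset.range (m + 2), normInterior μ Ω (covDeriv Ω s (lap Ω q))
              + normInterior μ Ω (covDeriv Ω 1 q)) := by
  obtain ⟨C, hC⟩ := exists_boundary_norm_step hn hμ m hK hℓ
  -- Here the projected terms may carry any constant, so the parameter 1 suffices.
  obtain ⟨C', hC'⟩ := exists_interior_norm_bound hn hμ hK hℓ m one_pos
  refine ⟨3 * C + (C + 1) * (1 + C'), fun Ω h q hq => ?_⟩
  have h1 := hC Ω h q hq
  have h2 := le_add_self.trans (hC' Ω h q hq)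
  set P := ∑ s ∈ Finset.range (m + 3), normProj μ Ω s q with hP
  set S := ∑ s ∈ Finset.range (m + 2), normInterior μ Ω (covDeriv Ω s (lap Ω q)) with hS
  set I := normInterior μ Ω (covDeriv Ω 1 q) with hI
  set J := normInterior μ Ω (covDeriv Ω (m + 2) q) with hJ
  have p1 : normProj μ Ω (m + 2) q ≤ P + S + I :=
    (Finset.single_le_sum (f := fun s => normProj μ Ω s q) (fun _ _ => zero_le)
      (Finset.mem_range.2 (by omega))).trans (le_self_add.trans le_self_add)
  have s0 : S ≤ P + S + I := le_add_self.trans le_self_add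
  have s1 : ∀ k < m + 2, normInterior μ Ω (covDeriv Ω k (lap Ω q)) ≤ P + S + I := fun k hk =>
    (Finset.single_le_sum (f := fun s => normInterior μ Ω (covDeriv Ω s (lap Ω q)))
      (fun _ _ => zero_le) (Finset.mem_range.2 hk)).trans s0
  have s2 : ∑ s ∈ Finset.range (m + 1), normInterior μ Ω (covDeriv Ω s (lap Ω q)) ≤ S :=
    Finset.sum_le_sum_of_subset (Finset.range_mono (by omega))
  have j1 : J ≤ (1 + C') * (P + S + I) := by
    refine h2.trans ?_
    rw [ENNReal.coe_one, one_mul, add_mul, one_mul]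
    refine add_le_add (le_self_add.trans le_self_add) ?_
    gcongr
    exact s2.trans le_add_self
  calc _ ≤ C * ((P + S + I) + (P + S + I) + (P + S + I) + J) + J := by
        gcongr
        refine h1.trans ?_
        gcongr
        · exact s1 _ (by omega)
        · exact s1 _ (by omega)
    _ = 3 * C * (P + S + I) + (C + 1) * J := by ring
    _ ≤ 3 * C * (P + S + I) + (C + 1) * ((1 + C') * (P + S + I)) := by gcongr
    _ = _ := by
        push_cast
        ring

/-- There are no multi-indices of positive length over an empty index set. The estimates above
assume n > 0, and this disposes of the remaining dimension. -/
lemma norm_eq_zero_of_dim_zero (μ : ℝ) (Ω : Set (Eu 0)) {s : ℕ} (α : Eu 0 → Tensor 0 (s + 1)) :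
    normBoundary μ Ω α = 0 ∧ normInterior μ Ω α = 0 := by
  have h : ∀ x, tensorNormSq (α x) = 0 := fun x => by simp [tensorNormSq]
  constructor
  · simp [normBoundary, h]
  · simp [normInterior, h]

end NormEstimates

end WeightedElliptic

end

/-! ### The two estimates -/

theorem mainTheorem8 (n : ℕ) (μ : ℝ) (hμ : 2 ≤ μ) (K : NNReal) (r : ℕ) (hr : 2 ≤ r) :
    (∃ C : NNReal, ∀ Ω : Set (WeightedElliptic.Eu n),
      WeightedElliptic.HasSmoothBoundary Ω → WeightedElliptic.GeometryBound Ω K →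
      ∀ q : WeightedElliptic.Eu n → ℝ, ContDiffOn ℝ (r + 1 : ℕ) q (closure Ω) →
        WeightedElliptic.normBoundary μ Ω (WeightedElliptic.covDeriv Ω r q)
            + WeightedElliptic.normInterior μ Ω (WeightedElliptic.covDeriv Ω r q)
          ≤ (C : ENNReal) *
            (∑ s ∈ Finset.range (r + 1), WeightedElliptic.normProj μ Ω s q
              + ∑ s ∈ Finset.range r, WeightedElliptic.normInterior μ Ω
                  (WeightedElliptic.covDeriv Ω s (WeightedElliptic.lap Ω q))
              + WeightedElliptic.normInterior μ Ω (WeightedElliptic.covDeriv Ω 1 q))) ∧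
    (∀ δ : NNReal, 0 < δ → ∃ C : NNReal, ∀ Ω : Set (WeightedElliptic.Eu n),
      WeightedElliptic.HasSmoothBoundary Ω → WeightedElliptic.GeometryBound Ω K →
      ∀ q : WeightedElliptic.Eu n → ℝ, ContDiffOn ℝ (r + 1 : ℕ) q (closure Ω) →
        WeightedElliptic.normBoundary μ Ω (WeightedElliptic.covDeriv Ω (r - 1) q)
            + WeightedElliptic.normInterior μ Ω (WeightedElliptic.covDeriv Ω r q)
          ≤ (δ : ENNReal) * ∑ s ∈ Finset.range (r + 1), WeightedElliptic.normProj μ Ω s q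
            + (C : ENNReal) *
              (∑ s ∈ Finset.range (r - 1), WeightedElliptic.normInterior μ Ω
                  (WeightedElliptic.covDeriv Ω s (WeightedElliptic.lap Ω q))
                + WeightedElliptic.normInterior μ Ω (WeightedElliptic.covDeriv Ω 1 q))) := by
  obtain ⟨m, rfl⟩ : ∃ m, r = m + 2 := ⟨r - 2, by omega⟩
  have hμ0 : 0 ≤ μ := by linarith
  rcases Nat.eq_zero_or_pos n with rfl | hn
  · refine ⟨⟨0, fun Ω _ _ q _ => ?_⟩, fun δ _ => ⟨0, fun Ω _ _ q _ => ?_⟩⟩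
    · rw [(WeightedElliptic.norm_eq_zero_of_dim_zero μ Ω _).1,
        (WeightedElliptic.norm_eq_zero_of_dim_zero μ Ω _).2, add_zero]
      exact zero_le
    · rw [show m + 2 - 1 = m + 1 from rfl,
        (WeightedElliptic.norm_eq_zero_of_dim_zero μ Ω _).1,
        (WeightedElliptic.norm_eq_zero_of_dim_zero μ Ω _).2, add_zero]
      exact zero_le
  · have hK : (0 : ℝ) ≤ max (K : ℝ) 1 := le_max_of_le_right zero_le_one
    have hℓ : (0 : ℝ) < 1 / (2 * max (K : ℝ) 1) := by positivity
    refine ⟨?_, fun δ hδ => ?_⟩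
    · obtain ⟨C, hC⟩ := WeightedElliptic.exists_top_norm_bound hn hμ0 hK hℓ m
      exact ⟨C, fun Ω hΩ hG q hq => hC Ω (hG.tubeBound hΩ) q hq⟩
    · obtain ⟨C, hC⟩ := WeightedElliptic.exists_interior_norm_bound hn hμ0 hK hℓ m hδ
      exact ⟨C, fun Ω hΩ hG q hq => hC Ω (hG.tubeBound hΩ) q hq⟩
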